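/- Setting. Let $T,h_0\in(0,\infty)$, $H_T=[0,T]\times\mathbb R^d$, and let $\Lambda_1\subset\mathbb R^d\setminus\{0\}$ be finite. For $h\in(0,h_0]$ consider $$u(t,x)=g(x)+\int_0^t\big(L_hu(s,x)+f(s,x)\big)\,ds,\qquad (t,x)\in H_T,\tag{1}$$ $$L_h\varphi=\frac1h\sum_{\lambda\in\Lambda_1}q_\lambda\,\delta_{h,\lambda}\varphi+\sum_{\lambda\in\Lambda_1}p_\lambda\,\delta_{h,\lambda}\varphi-c\,\varphi,\qquad \delta_{h,\lambda}\varphi(x)=\frac{\varphi(x+h\lambda)-\varphi(x)}h,$$ with real Borel functions $q_\lambda\ge0$, $p_\lambda$, $c$, $f$ of $(t,x)\in H_T$ and $g$ of $x\in\mathbb R^d$. Derivatives $D^\alpha$ of these data and of solutions in $x$ are generalized derivatives, $|D^k\psi|^2=\sum_{|\alpha|=k}|D^\alpha\psi|^2$, and suprema of generalized derivatives over $H_T$ are over all $t\in[0,T]$ and essential in $x$. For an integer $m\ge0$, $\mathfrak B^m$ is the space of bounded Borel functions $\psi$ on $H_T$ that are continuous in $x$ for each $t$ and whose derivatives $D^\alpha\psi$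 in $x$, $|\alpha|\le m$, are bounded on $H_T$; $\|\psi\|_m^2=\sup_{H_T}\sum_{|\alpha|\le m}|D^\alpha\psi|^2$ (also used for functions independent of $t$). For a function $\psi_h$ of $h\in(0,h_0]$, $D_h^k\psi_h$ is its $k$-th derivative in $h$ (one-sided at $h_0$). Let $\tau_\lambda\ge0$ ($\lambda\in\Lambda_1$) and $\tau_0>0$. Put $|\Lambda_1|^2=\sum_{\lambda\in\Lambda_1}|\lambda|^2$, $\|\Lambda_1\|^2=\sum_{\lambda\in\Lambda_1}|\tau_\lambda\lambda|^2$. Let $\Lambda=\Lambda_1\cup\{\ell^1,\dots,\ell^d\}$, where the $\ell^i$ are distinct and not in $\Lambda_1$; set $T_{h,\lambda}\varphi(x)=\varphi(x+h\lambda)$, $\bar\delta_{h,\lambda}=\tau_\lambda h^{-1}(T_{h,\lambda}-1)$ for $\lambda\in\Lambda_1$, and $T_{h,\ell^i}=1$, $\bar\delta_{h,\ell^i}=\tau_0D_i$. For $\lambda=(\lambda^1,\lambda^2)\in\Lambda^2$ put $T_{h,\lambda}=T_{h,\lambda^1}T_{h,\lambda^2}$, $\bar\delta_{h,\lambda}=\bar\delta_{h,\lambda^1}\bar\delta_{h,\lambda^2}$.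 Put $\chi_{h,\lambda}=q_\lambda+hp_\lambda$ and, for $\mu\in\Lambda\cup\Lambda^2$, $$Q_{h,\mu}\varphi=\frac1h\sum_{\lambda\in\Lambda_1}(\bar\delta_{h,\mu}q_\lambda)\delta_{h,\lambda}\varphi,\qquad L^0_{h,\mu}\varphi=Q_{h,\mu}\varphi+\sum_{\lambda\in\Lambda_1}(\bar\delta_{h,\mu}p_\lambda)\delta_{h,\lambda}\varphi,$$ $$A_h(\varphi)=2\sum_{\lambda\in\Lambda}(\bar\delta_{h,\lambda}\varphi)\,L^0_{h,\lambda}T_{h,\lambda}\varphi,\qquad \mathcal Q_h(\varphi)=\sum_{\lambda\in\Lambda_1}\chi_{h,\lambda}(\delta_{h,\lambda}\varphi)^2 .$$ Let $\mathfrak K$ be the set of families $\mathcal K=\mathcal K(t)$, $t\in[0,T]$, of bounded linear operators on the space of bounded Borel functions on $\mathbb R^d$ that preserve nonnegativity and satisfy $\mathcal K1\le1$. Theorem. Let $m\ge2$ be an integer, $\delta\in(0,1]$, $K\ge1$, $c_0>0$, and let $M_0,\dots,M_m$ be constants. Assume: 1. $p_\lambda,q_\lambda,c,f,g\in\mathfrak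 B^m$ and $\sup_{H_T}\big(\sum_{\lambda\in\Lambda_1}(|D^kq_\lambda|^2+|D^kp_\lambda|^2)+|D^kc|^2\big)\le M_k^2$ for $k=0,\dots,m$; 2. $\chi_{h,\lambda}\ge0$ on $H_T$ for all $h\in(0,h_0]$, $\lambda\in\Lambda_1$; 3. $\sum_{\lambda\in\Lambda_1}\lambda q_\lambda=0$ on $H_T$; 4. $c\ge c_0$ on $H_T$; 5. for every $h\in(0,h_0]$ there is $\mathcal K_h\in\mathfrak K$ such that, for all smooth $\varphi$ bounded together with all derivatives, for all $t\in[0,T]$ and almost all $x$, $$mA_h(\varphi)\le(1-\delta)\sum_{\lambda\in\Lambda}\mathcal Q_h(\bar\delta_{h,\lambda}\varphi)+K\mathcal Q_h(\varphi)+2(1-\delta)c\,\mathcal K_h\Big(\sum_{\lambda\in\Lambda}|\bar\delta_{h,\lambda}\varphi|^2\Big);$$ 6. for every $h\in(0,h_0]$ and $n=1,\dots,m$ there are $\mathcal K_h,\mathcal K_h'\in\mathfrak K$ such that, for the same $\varphi$, $t$ and almost all $x$, $$n\sum_{\nu\in\Lambda}A_h(\bar\delta_{h,\nu}\varphi)+n(n-1)\sum_{\lambda\in\Lambda^2}(\bar\delta_{h,\lambda}\varphi)\,Q_{h,\lambda}T_{h,\lambda}\varphi\le(1-\delta)\sum_{\lambda\in\Lambda^2}\mathcal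 Q_h(\bar\delta_{h,\lambda}\varphi)+K\sum_{\lambda\in\Lambda}\mathcal Q_h(\bar\delta_{h,\lambda}\varphi)$$ $$\qquad+2(1-\delta)c\,\mathcal K_h\Big(\sum_{\lambda\in\Lambda^2}|\bar\delta_{h,\lambda}\varphi|^2\Big)+K\mathcal K_h'\Big(\sum_{\lambda\in\Lambda}|\bar\delta_{h,\lambda}\varphi|^2\Big).$$ Then for each $h\in(0,h_0]$ equation (1) has a unique bounded solution $u_h$ on $H_T$, and for all integers $k,r\ge0$ with $3k+r\le m$: for all $(t,x)\in H_T$ the function $h\mapsto u_h(t,x)$ is $k$ times continuously differentiable on $(0,h_0]$; for every $h\in(0,h_0]$ we have $D_h^ku_h\in\mathfrak B^r$; and $$|D^rD_h^ku_h|\le N(\|f\|_m+\|g\|_m)$$ for every $h\in(0,h_0]$, $t\in[0,T]$ and almost every $x\in\mathbb R^d$. In particular $u_h\in\mathfrak B^m$ and $\|u_h\|_m\le N(\|f\|_m+\|g\|_m)$ for every $h\in(0,h_0]$. Here $N$ depends only on $m,\delta,c_0,\tau_0,K,M_0,\dots,M_m,|\Lambda_1|,\|\Lambda_1\|$ (in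 particular not on $h$, $h_0$, $T$ or $d$). -/

import Mathlib

open Set MeasureTheory
open scoped ContDiff

noncomputable section

namespace FDScheme

/-- The Euclidean space `ℝ^d`. -/
abbrev E (d : ℕ) : Type := EuclideanSpace ℝ (Fin d)

/-! ### Classical and generalized partial derivatives -/

/-- The classical partial derivative `D_i φ`. -/
def partialDeriv {d : ℕ} (i : Fin d) (φ : E d → ℝ) : E d → ℝ :=
  fun x => fderiv ℝ φ x (EuclideanSpace.single i 1)

/-- The classical derivative `D^α φ = D_1^{α_1} ⋯ D_d^{α_d} φ` of a smooth function. -/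
def multiDeriv {d : ℕ} (α : Fin d → ℕ) (φ : E d → ℝ) : E d → ℝ :=
  (List.finRange d).foldr (fun i ψ => (partialDeriv i)^[α i] ψ) φ

/-- `v` is the generalized (distributional) derivative `D^α ψ` on `ℝ^d`. -/
def IsWeakDeriv {d : ℕ} (α : Fin d → ℕ) (ψ v : E d → ℝ) : Prop :=
  LocallyIntegrable ψ volume ∧ LocallyIntegrable v volume ∧
    ∀ φ : E d → ℝ, ContDiff ℝ ∞ φ → HasCompactSupport φ →
      ∫ x, ψ x * multiDeriv α φ x = (-1) ^ (∑ i, α i) * ∫ x, v x * φ x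

open Classical in
/-- The generalized derivative `D^α ψ` (unique up to null sets); `0` if there is none. -/
def weakDeriv {d : ℕ} (α : Fin d → ℕ) (ψ : E d → ℝ) : E d → ℝ :=
  if h : ∃ v, IsWeakDeriv α ψ v then h.choose else 0

/-- The multi-indices `α` with `|α| = k`. -/
def multiIndices (d k : ℕ) : Finset (Fin d → ℕ) :=
  Finset.piAntidiag Finset.univ k

/-- `|D^k ψ|² = ∑_{|α| = k} |D^α ψ|²`, with generalized derivatives. -/
def derivSq {d : ℕ} (k : ℕ) (ψ : E d → ℝ) (x : E d) : ℝ :=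
  ∑ α ∈ multiIndices d k, (weakDeriv α ψ x) ^ 2

/-! ### The spaces `𝔅^m` and their norms -/

/-- Borel measurability of `ψ` on `H_T = [0,T] × ℝ^d`. -/
def BorelOn {d : ℕ} (T : ℝ) (ψ : ℝ → E d → ℝ) : Prop :=
  Measurable fun z : Icc (0 : ℝ) T × E d => ψ (z.1 : ℝ) z.2

/-- The space `𝔅^m_T`: bounded Borel functions on `H_T`, continuous in `x`, whose generalized
derivatives in `x` up to order `m` are bounded on `H_T`. -/
structure MemB {d : ℕ} (T : ℝ) (m : ℕ) (ψ : ℝ → E d → ℝ) : Prop where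
  borel : BorelOn T ψ
  bounded : ∃ C : ℝ, ∀ t ∈ Icc 0 T, ∀ x, |ψ t x| ≤ C
  continuous : ∀ t ∈ Icc 0 T, Continuous (ψ t)
  derivs : ∃ C : ℝ, ∀ t ∈ Icc 0 T, ∀ α : Fin d → ℕ, ∑ i, α i ≤ m →
    ∃ v : E d → ℝ, IsWeakDeriv α (ψ t) v ∧ ∀ᵐ x, |v x| ≤ C

/-- The norm `‖ψ‖_m = (sup_{H_T} ∑_{|α| ≤ m} |D^α ψ|²)^{1/2}` of `ψ ∈ 𝔅^m_T`. The supremum is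
over all `t ∈ [0,T]` and, for given `t`, essential in `x`, generalized derivatives being defined
up to null sets only. -/
def normB {d : ℕ} (T : ℝ) (m : ℕ) (ψ : ℝ → E d → ℝ) : ℝ :=
  sInf {C : ℝ | 0 ≤ C ∧ ∀ t ∈ Icc 0 T, ∀ᵐ x,
    ∑ k ∈ Finset.range (m + 1), derivSq k (ψ t) x ≤ C ^ 2}

/-! ### Positive contractions on bounded Borel functions -/

/-- The bounded Borel functions on `ℝ^d`. -/
def BddBorel {d : ℕ} (ψ : E d → ℝ) : Prop :=
  Measurable ψ ∧ ∃ C : ℝ, ∀ x, |ψ x| ≤ C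

/-- The class `𝔎` of bounded linear operators on the space of bounded Borel functions which
preserve the cone of nonnegative functions and satisfy `𝒦 1 ≤ 1`. (Values of `𝒦` at functions
that are not bounded Borel are irrelevant.) -/
structure ClassK {d : ℕ} (𝒦 : (E d → ℝ) → (E d → ℝ)) : Prop where
  maps : ∀ ψ, BddBorel ψ → BddBorel (𝒦 ψ)
  add : ∀ ψ₁ ψ₂, BddBorel ψ₁ → BddBorel ψ₂ → 𝒦 (ψ₁ + ψ₂) = 𝒦 ψ₁ + 𝒦 ψ₂
  smul : ∀ (a : ℝ) (ψ), BddBorel ψ → 𝒦 (a • ψ) = a • 𝒦 ψ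
  bounded : ∃ B : ℝ, ∀ ψ (C : ℝ), BddBorel ψ → (∀ x, |ψ x| ≤ C) → ∀ x, |𝒦 ψ x| ≤ B * C
  nonneg : ∀ ψ, BddBorel ψ → (∀ x, 0 ≤ ψ x) → ∀ x, 0 ≤ 𝒦 ψ x
  one_le : ∀ x, 𝒦 (fun _ => 1) x ≤ 1

/-- Smooth functions on `ℝ^d` that are bounded together with all their derivatives. -/
def SmoothBdd {d : ℕ} (φ : E d → ℝ) : Prop :=
  ContDiff ℝ ∞ φ ∧ ∀ n : ℕ, ∃ C : ℝ, ∀ x, ‖iteratedFDeriv ℝ n φ x‖ ≤ C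

/-! ### The finite difference scheme -/

/-- The data of the scheme: the final time `T`, the largest mesh size `h₀`, the stencil `Λ₁`,
the coefficients `q_λ, p_λ, c`, the free terms `f, g`, and the weights `τ_λ`, `λ ∈ Λ₁`. Only the
values of the functions of `(t,x)` for `t ∈ [0,T]` matter. -/
structure Scheme (d : ℕ) where
  T : ℝ
  T_pos : 0 < T
  h₀ : ℝ
  h₀_pos : 0 < h₀
  Λ₁ : Finset (E d)
  zero_notMem : (0 : E d) ∉ Λ₁
  q : Λ₁ → ℝ → E d → ℝ
  p : Λ₁ → ℝ → E d → ℝ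
  c : ℝ → E d → ℝ
  f : ℝ → E d → ℝ
  g : E d → ℝ
  q_nonneg : ∀ l, ∀ t ∈ Icc 0 T, ∀ x, 0 ≤ q l t x
  τ : Λ₁ → ℝ
  τ_nonneg : ∀ l, 0 ≤ τ l

namespace Scheme

variable {d : ℕ} (S : Scheme d)

/-- `|Λ₁| = (∑ |λ|²)^{1/2}`. -/
def size : ℝ := Real.sqrt (∑ l : S.Λ₁, ‖(l : E d)‖ ^ 2)

/-- `‖Λ₁‖ = (∑ |τ_λ λ|²)^{1/2}`. -/
def weightedSize : ℝ := Real.sqrt (∑ l : S.Λ₁, ‖S.τ l • (l : E d)‖ ^ 2)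

/-- `δ_{h,λ} φ (x) = h⁻¹ (φ(x + hλ) - φ(x))`. -/
def del (h : ℝ) (l : S.Λ₁) (φ : E d → ℝ) : E d → ℝ :=
  fun x => h⁻¹ * (φ (x + h • (l : E d)) - φ x)

/-- `χ_{h,λ} = q_λ + h p_λ`. -/
def chi (h : ℝ) (l : S.Λ₁) (t : ℝ) (x : E d) : ℝ := S.q l t x + h * S.p l t x

/-- `L_h φ = h⁻¹ ∑ q_λ δ_{h,λ} φ + ∑ p_λ δ_{h,λ} φ - c φ`. -/
def L (h t : ℝ) (φ : E d → ℝ) (x : E d) : ℝ :=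
  h⁻¹ * ∑ l, S.q l t x * S.del h l φ x + ∑ l, S.p l t x * S.del h l φ x - S.c t x * φ x

/-- `w` is a bounded solution on `H_T` of `w(t,x) = g(x) + ∫₀ᵗ (L_h w + f)(s,x) ds`. -/
def IsBoundedSolution (h : ℝ) (w : ℝ → E d → ℝ) : Prop :=
  (∃ C : ℝ, ∀ t ∈ Icc 0 S.T, ∀ x, |w t x| ≤ C) ∧
    ∀ t ∈ Icc 0 S.T, ∀ x,
      IntervalIntegrable (fun s => S.L h s (w s) x + S.f s x) volume 0 t ∧
      w t x = S.g x + ∫ s in (0 : ℝ)..t, (S.L h s (w s) x + S.f s x)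

/-- The index set `Λ = Λ₁ ∪ Λ₂`; the vector `ℓ^i ∈ Λ₂` is the label `Sum.inr i`. -/
abbrev Idx : Type := S.Λ₁ ⊕ Fin d

/-- `T_{h,λ}`: the shift by `hλ` for `λ ∈ Λ₁`, the identity for `λ ∈ Λ₂`. -/
def shift (h : ℝ) : S.Idx → (E d → ℝ) → (E d → ℝ)
  | Sum.inl l, φ => fun x => φ (x + h • (l : E d))
  | Sum.inr _, φ => φ

/-- `δ̄_{h,λ}` on smooth functions: `τ_λ h⁻¹ (T_{h,λ} - 1)` for `λ ∈ Λ₁`, and `τ₀ D_i` for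
`λ = ℓ^i ∈ Λ₂`. -/
def dbar (τ₀ h : ℝ) : S.Idx → (E d → ℝ) → (E d → ℝ)
  | Sum.inl l, φ => fun x => S.τ l * h⁻¹ * (φ (x + h • (l : E d)) - φ x)
  | Sum.inr i, φ => fun x => τ₀ * partialDeriv i φ x

/-- `δ̄_{h,λ}` on the coefficients, with generalized derivatives in place of `D_i`. -/
def dbarW (τ₀ h : ℝ) : S.Idx → (E d → ℝ) → (E d → ℝ)
  | Sum.inl l, ψ => fun x => S.τ l * h⁻¹ * (ψ (x + h • (l : E d)) - ψ x)
  | Sum.inr i, ψ => fun x => τ₀ * weakDeriv (Pi.single i 1) ψ x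

/-- `L⁰_{h,μ} φ = h⁻¹ ∑ (δ̄_{h,μ} q_λ) δ_{h,λ} φ + ∑ (δ̄_{h,μ} p_λ) δ_{h,λ} φ`, `μ ∈ Λ`. -/
def L0 (τ₀ h t : ℝ) (μ : S.Idx) (φ : E d → ℝ) (x : E d) : ℝ :=
  h⁻¹ * ∑ l, S.dbarW τ₀ h μ (S.q l t) x * S.del h l φ x
    + ∑ l, S.dbarW τ₀ h μ (S.p l t) x * S.del h l φ x

/-- `Q_{h,μ} φ = h⁻¹ ∑ (δ̄_{h,μ} q_λ) δ_{h,λ} φ` for `μ = (μ¹, μ²) ∈ Λ²`. -/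
def Q2 (τ₀ h t : ℝ) (μ : S.Idx × S.Idx) (φ : E d → ℝ) (x : E d) : ℝ :=
  h⁻¹ * ∑ l, S.dbarW τ₀ h μ.1 (S.dbarW τ₀ h μ.2 (S.q l t)) x * S.del h l φ x

/-- `A_h(φ) = 2 ∑_{λ ∈ Λ} (δ̄_{h,λ} φ) L⁰_{h,λ} T_{h,λ} φ`. -/
def A (τ₀ h t : ℝ) (φ : E d → ℝ) (x : E d) : ℝ :=
  2 * ∑ l : S.Idx, S.dbar τ₀ h l φ x * S.L0 τ₀ h t l (S.shift h l φ) x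

/-- `𝒬_h(φ) = ∑_{λ ∈ Λ₁} χ_{h,λ} (δ_{h,λ} φ)²`. -/
def QQ (h t : ℝ) (φ : E d → ℝ) (x : E d) : ℝ :=
  ∑ l, S.chi h l t x * (S.del h l φ x) ^ 2

/-- `δ̄_{h,λ} φ = δ̄_{h,λ¹} δ̄_{h,λ²} φ` for `λ ∈ Λ²`. -/
def dbar2 (τ₀ h : ℝ) (l : S.Idx × S.Idx) (φ : E d → ℝ) : E d → ℝ :=
  S.dbar τ₀ h l.1 (S.dbar τ₀ h l.2 φ)

/-- `T_{h,λ} φ = T_{h,λ¹} T_{h,λ²} φ` for `λ ∈ Λ²`. -/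
def shift2 (h : ℝ) (l : S.Idx × S.Idx) (φ : E d → ℝ) : E d → ℝ :=
  S.shift h l.1 (S.shift h l.2 φ)

/-- `∑_{λ ∈ Λ} |δ̄_{h,λ} φ|²`. -/
def gradSq (τ₀ h : ℝ) (φ : E d → ℝ) : E d → ℝ :=
  fun x => ∑ l : S.Idx, (S.dbar τ₀ h l φ x) ^ 2

/-- `∑_{λ ∈ Λ²} |δ̄_{h,λ} φ|²`. -/
def hessSq (τ₀ h : ℝ) (φ : E d → ℝ) : E d → ℝ :=
  fun x => ∑ l : S.Idx × S.Idx, (S.dbar2 τ₀ h l φ x) ^ 2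

/-! ### The assumptions -/

/-- The data belong to `𝔅^m`, and
`sup_{H_T} (∑_λ (|D^k q_λ|² + |D^k p_λ|²) + |D^k c|²) ≤ M_k²` for `k = 0, …, m`. -/
structure SmoothData (m : ℕ) (M : Fin (m + 1) → ℝ) : Prop where
  q : ∀ l, MemB S.T m (S.q l)
  p : ∀ l, MemB S.T m (S.p l)
  c : MemB S.T m S.c
  f : MemB S.T m S.f
  g : MemB S.T m (fun _ => S.g)
  bound : ∀ k : Fin (m + 1), ∀ t ∈ Icc 0 S.T, ∀ᵐ x,
    (∑ l, (derivSq k (S.q l t) x + derivSq k (S.p l t) x)) + derivSq k (S.c t) x ≤ M k ^ 2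

/-- `χ_{h,λ} ≥ 0` on `H_T` for all `h ∈ (0,h₀]`. -/
def ChiNonneg : Prop :=
  ∀ h ∈ Ioc 0 S.h₀, ∀ l, ∀ t ∈ Icc 0 S.T, ∀ x, 0 ≤ S.chi h l t x

/-- `∑_{λ ∈ Λ₁} λ q_λ = 0` on `H_T`. -/
def Centered : Prop :=
  ∀ t ∈ Icc 0 S.T, ∀ x, ∑ l : S.Λ₁, S.q l t x • (l : E d) = 0

/-- `c ≥ c₀` on `H_T`. -/
def Killing (c₀ : ℝ) : Prop := ∀ t ∈ Icc 0 S.T, ∀ x, c₀ ≤ S.c t x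

/-- The first structural condition: for every `h` there are `𝒦_h(t) ∈ 𝔎` such that, for all
smooth `φ`,
`m A_h(φ) ≤ (1-δ) ∑_Λ 𝒬_h(δ̄_{h,λ} φ) + K 𝒬_h(φ) + 2(1-δ) c 𝒦_h(∑_Λ |δ̄_{h,λ} φ|²)`. -/
def StructI (m : ℕ) (δ τ₀ K : ℝ) : Prop :=
  ∀ h ∈ Ioc 0 S.h₀, ∃ 𝒦 : ℝ → (E d → ℝ) → (E d → ℝ),
    (∀ t ∈ Icc 0 S.T, ClassK (𝒦 t)) ∧
    ∀ φ : E d → ℝ, SmoothBdd φ → ∀ t ∈ Icc 0 S.T, ∀ᵐ x,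
      (m : ℝ) * S.A τ₀ h t φ x ≤
        (1 - δ) * ∑ l : S.Idx, S.QQ h t (S.dbar τ₀ h l φ) x
        + K * S.QQ h t φ x
        + 2 * (1 - δ) * S.c t x * 𝒦 t (S.gradSq τ₀ h φ) x

/-- The second structural condition: for every `h` and `n = 1, …, m` there are
`𝒦_h(t), 𝒦'_h(t) ∈ 𝔎` such that, for all smooth `φ`,
`n ∑_{ν ∈ Λ} A_h(δ̄_{h,ν} φ) + n(n-1) ∑_{λ ∈ Λ²} (δ̄_{h,λ} φ) Q_{h,λ} T_{h,λ} φ`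
`≤ (1-δ) ∑_{Λ²} 𝒬_h(δ̄_{h,λ} φ) + K ∑_Λ 𝒬_h(δ̄_{h,λ} φ)`
`+ 2(1-δ) c 𝒦_h(∑_{Λ²} |δ̄_{h,λ} φ|²) + K 𝒦'_h(∑_Λ |δ̄_{h,λ} φ|²)`. -/
def StructII (m : ℕ) (δ τ₀ K : ℝ) : Prop :=
  ∀ h ∈ Ioc 0 S.h₀, ∀ n ∈ Finset.Icc 1 m, ∃ 𝒦 𝒦' : ℝ → (E d → ℝ) → (E d → ℝ),
    (∀ t ∈ Icc 0 S.T, ClassK (𝒦 t)) ∧ (∀ t ∈ Icc 0 S.T, ClassK (𝒦' t)) ∧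
    ∀ φ : E d → ℝ, SmoothBdd φ → ∀ t ∈ Icc 0 S.T, ∀ᵐ x,
      (n : ℝ) * ∑ ν : S.Idx, S.A τ₀ h t (S.dbar τ₀ h ν φ) x
        + (n : ℝ) * ((n : ℝ) - 1) * ∑ l : S.Idx × S.Idx,
            S.dbar2 τ₀ h l φ x * S.Q2 τ₀ h t l (S.shift2 h l φ) x ≤
        (1 - δ) * ∑ l : S.Idx × S.Idx, S.QQ h t (S.dbar2 τ₀ h l φ) x
        + K * ∑ l : S.Idx, S.QQ h t (S.dbar τ₀ h l φ) x
        + 2 * (1 - δ) * S.c t x * 𝒦 t (S.hessSq τ₀ h φ) x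
        + K * 𝒦' t (S.gradSq τ₀ h φ) x

/-- `D_h^k u_h (t,x)`: the classical `k`-th derivative in `h ∈ (0,h₀]` (one-sided at `h₀`). -/
def Dh (k : ℕ) (u : ℝ → ℝ → E d → ℝ) (h t : ℝ) (x : E d) : ℝ :=
  iteratedDerivWithin k (fun η => u η t x) (Ioc 0 S.h₀) h

end Scheme

end FDScheme

end

noncomputable section

set_option linter.unusedSectionVars false

namespace FDScheme

/-! ### Directional derivatives -/

/-! The proof is Bernstein's method for the difference scheme, carried out for smooth data and
extended to general data by mollification.

For smooth data let `W_n` be the sum of `|δ̄_{h,λ} u|²` over all words `λ` of length `n` in `Λ`. The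
nonnegativity of `χ_{h,λ}` makes the second order part `Mop` of the scheme a positive combination of
differences, and `energy_identity` gives `2 φ L_h φ = Mop(φ²) - 𝒬_h(φ) - 2 c φ²`. When a word of
operators is applied to the equation, the Leibniz rule produces terms with one `δ̄` on the
coefficients, terms with two `δ̄` on `q`, and a remainder. By commutativity the first two groups sum
to multiples of the forms in the structural conditions (`lsum_firstTerms`, `lsum_secondTerms`). The
remainder is bounded by `W_j` with `j < n` (`remL_le`): centering turns `h⁻¹ δ_{h,λ}` into averaged
second derivatives, and all spatial derivatives are controlled by `W` because `τ₀ D_i` belongs to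
the family. All sums are estimated as Euclidean norms of families (`W_prod_le`), so neither `d` nor
the number of stencil points enters a constant.

The structural conditions leave `-δ 𝒬_h` at the top order, `K 𝒬_h` one order lower, and a supremum
of `W_n` with factor `2(1 - δ)c` against the damping `(2 - δ)c`. In `W_n + κ W_{n-1} + ⋯` with `κ =
K / δ` the terms `K 𝒬_h` cancel. The maximum principle then bounds `sup W_n` by `θ sup W_n + R D`
with `θ = 2(1 - δ)/(2 - δ) < 1`, where `D` bounds the data, and this is absorbed
(`le_of_self_improving`, `apriori_aux`).

For derivatives in `h` the mesh size becomes an extra coordinate `s`: the equations for all mesh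
sizes form one linear equation on `ℝ × ℝ^d`, solved by Picard iteration in classes of functions with
bounded derivatives. The `k`-th derivative in `s` solves the scheme with a free term made of lower
derivatives (`MeshSol.deriv`, `hFree_succ`). The difference quotients being integrals along
segments, one derivative in `s` costs at most three in `x`; this is the origin of `3k + r ≤ m`, and
induction on `k` gives `hD_bound`.

General data are mollified in `x`. The structural conditions are linear in the coefficients and hold
for every translate of the test function. Hence coefficients and test function may be evaluated at
different points, the coefficients averaged, and the operators `𝒦` replaced by suprema (`supI_mol`,
`supII_mol`). Mollified data in `𝔅^m` converge together with `m - 1` derivatives, and stability of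
the Picard solutions carries this over to the solutions (`exists_meshApprox`). The uniform bounds
pass to generalized derivatives of the limit (`weakDeriv_limit`), and uniqueness of bounded
solutions identifies the local families in `h` with the given one. -/

/-- The derivative in the direction `v`. -/
def dd {Z : Type*} [NormedAddCommGroup Z] [NormedSpace ℝ Z] (v : Z) (φ : Z → ℝ) : Z → ℝ :=
  fun x => fderiv ℝ φ x v

section dd

variable {Z : Type*} [NormedAddCommGroup Z] [NormedSpace ℝ Z]

theorem contDiff_dd {v : Z} {φ : Z → ℝ} (hφ : ContDiff ℝ ∞ φ) : ContDiff ℝ ∞ (dd v φ) :=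
  (hφ.fderiv_right (m := ∞) (by simp)).clm_apply contDiff_const

theorem dd_shift (v y : Z) (φ : Z → ℝ) : dd v (fun x => φ (x + y)) = fun x => dd v φ (x + y) := by
  funext x
  simp only [dd, fderiv_comp_add_right]

theorem dd_comm (v w : Z) {φ : Z → ℝ} (hφ : ContDiff ℝ 2 φ) : dd v (dd w φ) = dd w (dd v φ) := by
  funext x
  have h1 : DifferentiableAt ℝ (fderiv ℝ φ) x :=
    (hφ.fderiv_right (m := 1) (by norm_num)).differentiable (by norm_num) x
  have key : ∀ a b : Z, dd a (dd b φ) x = fderiv ℝ (fderiv ℝ φ) x a b := by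
    intro a b
    have : HasFDerivAt (dd b φ)
        ((ContinuousLinearMap.apply ℝ ℝ b).comp (fderiv ℝ (fderiv ℝ φ) x)) x :=
      (ContinuousLinearMap.apply ℝ ℝ b).hasFDerivAt.comp x h1.hasFDerivAt
    simp only [dd] at this ⊢
    rw [this.fderiv]
    rfl
  rw [key, key]
  have := (hφ.contDiffAt (x := x)).isSymmSndFDerivAt (by simp)
  exact this v w

theorem dd_add {v : Z} {φ ψ : Z → ℝ} (hφ : Differentiable ℝ φ) (hψ : Differentiable ℝ ψ) :
    dd v (fun x => φ x + ψ x) = fun x => dd v φ x + dd v ψ x := by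
  funext x
  simp only [dd]
  rw [fderiv_fun_add (hφ x) (hψ x)]
  rfl

theorem dd_sub {v : Z} {φ ψ : Z → ℝ} (hφ : Differentiable ℝ φ) (hψ : Differentiable ℝ ψ) :
    dd v (fun x => φ x - ψ x) = fun x => dd v φ x - dd v ψ x := by
  funext x
  simp only [dd]
  rw [fderiv_fun_sub (hφ x) (hψ x)]
  rfl

theorem dd_const_mul {v : Z} {φ : Z → ℝ} (a : ℝ) (hφ : Differentiable ℝ φ) :
    dd v (fun x => a * φ x) = fun x => a * dd v φ x := by
  funext x
  simp only [dd]
  rw [fderiv_const_mul (hφ x)]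
  rfl

theorem dd_mul {v : Z} {φ ψ : Z → ℝ} (hφ : Differentiable ℝ φ) (hψ : Differentiable ℝ ψ) :
    dd v (fun x => φ x * ψ x) = fun x => dd v φ x * ψ x + φ x * dd v ψ x := by
  funext x
  simp only [dd]
  rw [fderiv_fun_mul (hφ x) (hψ x)]
  simp
  ring

theorem dd_sum {v : Z} {ι : Type*} (s : Finset ι) {φ : ι → Z → ℝ}
    (hφ : ∀ i ∈ s, Differentiable ℝ (φ i)) :
    dd v (fun x => ∑ i ∈ s, φ i x) = fun x => ∑ i ∈ s, dd v (φ i) x := by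
  funext x
  simp only [dd]
  rw [fderiv_fun_sum (fun i hi => hφ i hi x)]
  simp

theorem contDiff_iterate_dd (v : Z) (j : ℕ) {φ : Z → ℝ} (hφ : ContDiff ℝ ∞ φ) :
    ContDiff ℝ ∞ ((dd v)^[j] φ) := by
  induction j generalizing φ with
  | zero => simpa using hφ
  | succ j ih => simpa using ih (contDiff_dd hφ)

end dd

theorem partialDeriv_eq_dd {d : ℕ} (i : Fin d) (φ : E d → ℝ) :
    partialDeriv i φ = dd (EuclideanSpace.single i 1) φ := rfl

theorem differentiable_of_smooth {Z : Type*} [NormedAddCommGroup Z] [NormedSpace ℝ Z] {φ : Z → ℝ}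
    (hφ : ContDiff ℝ ∞ φ) : Differentiable ℝ φ :=
  hφ.differentiable (by simp)

/-- A directional derivative in coordinates. -/
theorem dd_eq_sum {d : ℕ} (v : E d) (φ : E d → ℝ) (x : E d) :
    dd v φ x = ∑ i, v i * partialDeriv i φ x := by
  have hv : v = ∑ i, v i • EuclideanSpace.single i (1 : ℝ) := by
    have := (EuclideanSpace.basisFun (Fin d) ℝ).sum_repr v
    simpa using this.symm
  conv_lhs => rw [dd, hv]
  simp [partialDeriv]

/-! ### The operators `δ̄_{h,λ}`, words in them, and the functionals `W_n`. -/

namespace Scheme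

variable {d : ℕ} (S : Scheme d)

/-- The vector by which `T_{h,λ}` shifts. -/
def sv (h : ℝ) : S.Idx → E d
  | Sum.inl l => h • (l : E d)
  | Sum.inr _ => 0

theorem shift_eq (h : ℝ) (μ : S.Idx) (φ : E d → ℝ) :
    S.shift h μ φ = fun x => φ (x + S.sv h μ) := by
  cases μ <;> simp [shift, sv]

variable (τ₀ h : ℝ)

variable {S} in
theorem contDiff_dbar (μ : S.Idx) {φ : E d → ℝ} (hφ : ContDiff ℝ ∞ φ) :
    ContDiff ℝ ∞ (S.dbar τ₀ h μ φ) := by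
  cases μ with
  | inl l => exact contDiff_const.mul ((hφ.comp (contDiff_id.add contDiff_const)).sub hφ)
  | inr i => exact contDiff_const.mul (contDiff_dd hφ)

theorem dbar_shift (μ : S.Idx) (φ : E d → ℝ) (y : E d) :
    S.dbar τ₀ h μ (fun x => φ (x + y)) = fun x => S.dbar τ₀ h μ φ (x + y) := by
  cases μ with
  | inl l => funext x; simp only [dbar]; rw [add_right_comm]
  | inr i => funext x; simp only [dbar, partialDeriv_eq_dd, dd_shift]

theorem dbar_zero (μ : S.Idx) : S.dbar τ₀ h μ (fun _ => 0) = fun _ => 0 := by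
  cases μ <;> funext x <;> simp [dbar, partialDeriv]

theorem dbar_add (μ : S.Idx) {φ ψ : E d → ℝ} (hφ : Differentiable ℝ φ) (hψ : Differentiable ℝ ψ) :
    S.dbar τ₀ h μ (fun x => φ x + ψ x) = fun x => S.dbar τ₀ h μ φ x + S.dbar τ₀ h μ ψ x := by
  cases μ with
  | inl l => funext x; simp only [dbar]; ring
  | inr i => funext x; simp only [dbar, partialDeriv_eq_dd, dd_add hφ hψ]; ring

theorem dbar_sub (μ : S.Idx) {φ ψ : E d → ℝ} (hφ : Differentiable ℝ φ) (hψ : Differentiable ℝ ψ) :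
    S.dbar τ₀ h μ (fun x => φ x - ψ x) = fun x => S.dbar τ₀ h μ φ x - S.dbar τ₀ h μ ψ x := by
  cases μ with
  | inl l => funext x; simp only [dbar]; ring
  | inr i => funext x; simp only [dbar, partialDeriv_eq_dd, dd_sub hφ hψ]; ring

theorem dbar_const_mul (μ : S.Idx) (a : ℝ) {φ : E d → ℝ} (hφ : Differentiable ℝ φ) :
    S.dbar τ₀ h μ (fun x => a * φ x) = fun x => a * S.dbar τ₀ h μ φ x := by
  cases μ with
  | inl l => funext x; simp only [dbar]; ring
  | inr i => funext x; simp only [dbar, partialDeriv_eq_dd, dd_const_mul a hφ]; ring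

theorem dbar_sum (μ : S.Idx) {ι : Type*} (s : Finset ι) {φ : ι → E d → ℝ}
    (hφ : ∀ i ∈ s, Differentiable ℝ (φ i)) :
    S.dbar τ₀ h μ (fun x => ∑ i ∈ s, φ i x) = fun x => ∑ i ∈ s, S.dbar τ₀ h μ (φ i) x := by
  cases μ with
  | inl l => funext x; simp only [dbar]; rw [← Finset.sum_sub_distrib, Finset.mul_sum]
  | inr i => funext x; simp only [dbar, partialDeriv_eq_dd, dd_sum s hφ, Finset.mul_sum]

/-- The discrete Leibniz rule. -/
theorem dbar_mul (μ : S.Idx) {b φ : E d → ℝ} (hb : Differentiable ℝ b) (hφ : Differentiable ℝ φ) :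
    S.dbar τ₀ h μ (fun x => b x * φ x) =
      fun x => S.dbar τ₀ h μ b x * φ (x + S.sv h μ) + b x * S.dbar τ₀ h μ φ x := by
  cases μ with
  | inl l => funext x; simp only [dbar, sv]; ring
  | inr i => funext x; simp only [dbar, sv, partialDeriv_eq_dd, dd_mul hb hφ, add_zero]; ring

theorem dd_dbar (v : E d) (μ : S.Idx) {φ : E d → ℝ} (hφ : ContDiff ℝ ∞ φ) :
    dd v (S.dbar τ₀ h μ φ) = S.dbar τ₀ h μ (dd v φ) := by
  have hd := differentiable_of_smooth hφ
  cases μ with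
  | inl l =>
    have h1 : Differentiable ℝ (fun x => φ (x + h • (l : E d))) :=
      hd.comp (differentiable_id.add_const _)
    have e : S.dbar τ₀ h (Sum.inl l) φ =
      fun x => (S.τ l * h⁻¹) * (fun x => φ (x + h • (l : E d)) - φ x) x := rfl
    have h2 : Differentiable ℝ (fun x => φ (x + h • (l : E d)) - φ x) := h1.sub hd
    rw [e, dd_const_mul _ h2, dd_sub h1 hd, dd_shift]
    rfl
  | inr i =>
    have e : S.dbar τ₀ h (Sum.inr i) φ = fun x => τ₀ * dd (EuclideanSpace.single i 1) φ x := rfl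
    rw [e, dd_const_mul _ (differentiable_of_smooth (contDiff_dd hφ)),
      dd_comm _ _ (mod_cast contDiff_infty.1 hφ 2)]
    rfl

theorem dbar_comm (μ ν : S.Idx) {φ : E d → ℝ} (hφ : ContDiff ℝ ∞ φ) :
    S.dbar τ₀ h μ (S.dbar τ₀ h ν φ) = S.dbar τ₀ h ν (S.dbar τ₀ h μ φ) := by
  cases μ with
  | inl l =>
    have hd := differentiable_of_smooth hφ
    have h1 : Differentiable ℝ (fun x => φ (x + h • (l : E d))) :=
      hd.comp (differentiable_id.add_const _)
    have e : S.dbar τ₀ h (Sum.inl l) φ =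
      fun x => (S.τ l * h⁻¹) * (fun x => φ (x + h • (l : E d)) - φ x) x := rfl
    have h2 : Differentiable ℝ (fun x => φ (x + h • (l : E d)) - φ x) := h1.sub hd
    rw [e, dbar_const_mul _ _ _ _ _ h2, dbar_sub _ _ _ _ h1 hd, dbar_shift]
    rfl
  | inr i =>
    have e : ∀ ψ : E d → ℝ, S.dbar τ₀ h (Sum.inr i) ψ =
      fun x => τ₀ * dd (EuclideanSpace.single i 1) ψ x := fun _ => rfl
    rw [e, dd_dbar _ _ _ _ _ hφ, e,
      dbar_const_mul _ _ _ _ _ (differentiable_of_smooth (contDiff_dd hφ))]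

/-! ### Iterated difference-differential operators -/

/-- `δ̄_{h,λ}` for a finite list `λ` of indices. -/
def dl : List S.Idx → (E d → ℝ) → (E d → ℝ)
  | [], φ => φ
  | μ :: lam, φ => dl lam (S.dbar τ₀ h μ φ)

@[simp] theorem dl_nil (φ : E d → ℝ) : S.dl τ₀ h [] φ = φ := rfl

theorem dl_cons (μ : S.Idx) (lam : List S.Idx) (φ : E d → ℝ) :
    S.dl τ₀ h (μ :: lam) φ = S.dl τ₀ h lam (S.dbar τ₀ h μ φ) := rfl

variable {S} in
theorem contDiff_dl (lam : List S.Idx) {φ : E d → ℝ} (hφ : ContDiff ℝ ∞ φ) :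
    ContDiff ℝ ∞ (S.dl τ₀ h lam φ) := by
  induction lam generalizing φ with
  | nil => exact hφ
  | cons μ lam ih => exact ih (contDiff_dbar τ₀ h μ hφ)

theorem dl_dbar (lam : List S.Idx) (μ : S.Idx) {φ : E d → ℝ} (hφ : ContDiff ℝ ∞ φ) :
    S.dl τ₀ h lam (S.dbar τ₀ h μ φ) = S.dbar τ₀ h μ (S.dl τ₀ h lam φ) := by
  induction lam generalizing φ with
  | nil => rfl
  | cons ν lam ih =>
    rw [dl_cons, dl_cons, S.dbar_comm τ₀ h ν μ hφ, ih (contDiff_dbar τ₀ h ν hφ)]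

theorem dl_add (lam : List S.Idx) {φ ψ : E d → ℝ} (hφ : ContDiff ℝ ∞ φ) (hψ : ContDiff ℝ ∞ ψ) :
    S.dl τ₀ h lam (fun x => φ x + ψ x) = fun x => S.dl τ₀ h lam φ x + S.dl τ₀ h lam ψ x := by
  induction lam generalizing φ ψ with
  | nil => rfl
  | cons ν lam ih =>
    rw [dl_cons, dl_cons, dl_cons, S.dbar_add τ₀ h ν (differentiable_of_smooth hφ)
      (differentiable_of_smooth hψ), ih (contDiff_dbar τ₀ h ν hφ) (contDiff_dbar τ₀ h ν hψ)]

theorem dl_sub (lam : List S.Idx) {φ ψ : E d → ℝ} (hφ : ContDiff ℝ ∞ φ) (hψ : ContDiff ℝ ∞ ψ) :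
    S.dl τ₀ h lam (fun x => φ x - ψ x) = fun x => S.dl τ₀ h lam φ x - S.dl τ₀ h lam ψ x := by
  induction lam generalizing φ ψ with
  | nil => rfl
  | cons ν lam ih =>
    rw [dl_cons, dl_cons, dl_cons, S.dbar_sub τ₀ h ν (differentiable_of_smooth hφ)
      (differentiable_of_smooth hψ), ih (contDiff_dbar τ₀ h ν hφ) (contDiff_dbar τ₀ h ν hψ)]

/-! ### Sums over lists of given length -/

/-- The sum of `F` over the lists of length `n`. -/
def lsum {I : Type*} [Fintype I] (n : ℕ) (F : List I → ℝ) : ℝ :=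
  ∑ lam : Fin n → I, F (List.ofFn lam)

theorem lsum_zero {I : Type*} [Fintype I] (F : List I → ℝ) : lsum 0 F = F [] := by
  simp [lsum]

theorem lsum_succ {I : Type*} [Fintype I] (n : ℕ) (F : List I → ℝ) :
    lsum (n + 1) F = ∑ μ, lsum n (fun lam => F (μ :: lam)) := by
  unfold lsum
  rw [← Fintype.sum_prod_type']
  symm
  refine Fintype.sum_equiv (Fin.consEquiv (fun _ => I)) _ _ (fun p => ?_)
  simp [Fin.consEquiv, List.ofFn_succ]

theorem lsum_add {I : Type*} [Fintype I] (n : ℕ) (F G : List I → ℝ) :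
    lsum n (fun l => F l + G l) = lsum n F + lsum n G := Finset.sum_add_distrib

theorem lsum_sub {I : Type*} [Fintype I] (n : ℕ) (F G : List I → ℝ) :
    lsum n (fun l => F l - G l) = lsum n F - lsum n G := Finset.sum_sub_distrib _ _

theorem lsum_mul_left {I : Type*} [Fintype I] (n : ℕ) (a : ℝ) (F : List I → ℝ) :
    lsum n (fun l => a * F l) = a * lsum n F := (Finset.mul_sum _ _ _).symm

theorem lsum_mono {I : Type*} [Fintype I] (n : ℕ) {F G : List I → ℝ} (hFG : ∀ l, F l ≤ G l) :
    lsum n F ≤ lsum n G := Finset.sum_le_sum fun _ _ => hFG _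

theorem lsum_nonneg {I : Type*} [Fintype I] (n : ℕ) {F : List I → ℝ} (hF : ∀ l, 0 ≤ F l) :
    0 ≤ lsum n F := Finset.sum_nonneg fun _ _ => hF _

theorem lsum_comm {I ι : Type*} [Fintype I] (s : Finset ι) (n : ℕ) (F : ι → List I → ℝ) :
    lsum n (fun l => ∑ i ∈ s, F i l) = ∑ i ∈ s, lsum n (F i) := Finset.sum_comm

/-! ### The quadratic functionals `W_n` -/

/-- `W_n φ = ∑_{λ ∈ Λ^n} |δ̄_{h,λ} φ|²`. -/
def W (n : ℕ) (φ : E d → ℝ) (x : E d) : ℝ := lsum n (fun lam => (S.dl τ₀ h lam φ x) ^ 2)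

theorem W_zero (φ : E d → ℝ) (x : E d) : S.W τ₀ h 0 φ x = (φ x) ^ 2 := by simp [W, lsum_zero]

theorem W_succ (n : ℕ) (φ : E d → ℝ) (x : E d) :
    S.W τ₀ h (n + 1) φ x = ∑ μ, S.W τ₀ h n (S.dbar τ₀ h μ φ) x := by
  simp only [W, lsum_succ, dl_cons]

theorem W_nonneg (n : ℕ) (φ : E d → ℝ) (x : E d) : 0 ≤ S.W τ₀ h n φ x :=
  lsum_nonneg _ fun _ => sq_nonneg _

theorem W_add_le (n : ℕ) {φ ψ : E d → ℝ} (hφ : ContDiff ℝ ∞ φ) (hψ : ContDiff ℝ ∞ ψ) (x : E d) :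
    S.W τ₀ h n (fun x => φ x + ψ x) x ≤ 2 * S.W τ₀ h n φ x + 2 * S.W τ₀ h n ψ x := by
  simp only [W, ← lsum_mul_left, ← lsum_add, S.dl_add τ₀ h _ hφ hψ]
  exact lsum_mono _ fun l => by nlinarith [sq_nonneg (S.dl τ₀ h l φ x - S.dl τ₀ h l ψ x)]

/-- Since `τ₀ D_i` belongs to the family `Λ`, the whole gradient is part of `W_1`. Cauchy–Schwarz
then controls every directional derivative with no dependence on `d`. -/
theorem dd_sq_le (hτ₀ : 0 < τ₀) (v : E d) (φ : E d → ℝ) (x : E d) :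
    (dd v φ x) ^ 2 ≤ (‖v‖ / τ₀) ^ 2 * S.W τ₀ h 1 φ x := by
  rw [dd_eq_sum]
  have h1 := Finset.sum_mul_sq_le_sq_mul_sq Finset.univ (fun i => v i)
    (fun i => partialDeriv i φ x)
  have h2 : ∑ i, (v i) ^ 2 = ‖v‖ ^ 2 := by
    rw [EuclideanSpace.norm_sq_eq]; simp
  have h3 : τ₀ ^ 2 * ∑ i, (partialDeriv i φ x) ^ 2 ≤ S.W τ₀ h 1 φ x := by
    rw [W_succ, Fintype.sum_sum_type, Finset.mul_sum]
    have : 0 ≤ ∑ l : S.Λ₁, S.W τ₀ h 0 (S.dbar τ₀ h (Sum.inl l) φ) x :=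
      Finset.sum_nonneg fun _ _ => S.W_nonneg _ _ _ _ _
    refine le_trans (le_of_eq ?_) (le_add_of_nonneg_left this)
    refine Finset.sum_congr rfl fun i _ => ?_
    rw [W_zero]; simp only [dbar]; ring
  rw [h2] at h1
  refine h1.trans ?_
  rw [div_pow, div_mul_eq_mul_div, le_div_iff₀ (by positivity), mul_assoc]
  exact mul_le_mul_of_nonneg_left (by linarith) (by positivity)

theorem W_dd_le (hτ₀ : 0 < τ₀) (v : E d) (n : ℕ) {φ : E d → ℝ} (hφ : ContDiff ℝ ∞ φ) (x : E d) :
    S.W τ₀ h n (dd v φ) x ≤ (‖v‖ / τ₀) ^ 2 * S.W τ₀ h (n + 1) φ x := by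
  induction n generalizing φ with
  | zero => rw [W_zero]; exact S.dd_sq_le τ₀ h hτ₀ v φ x
  | succ n ih =>
    rw [W_succ, W_succ, Finset.mul_sum]
    refine Finset.sum_le_sum fun μ _ => ?_
    rw [← S.dd_dbar τ₀ h v μ hφ]
    exact ih (contDiff_dbar τ₀ h μ hφ)

theorem W_iterate_dd_le (hτ₀ : 0 < τ₀) (v : E d) (n j : ℕ) {φ : E d → ℝ} (hφ : ContDiff ℝ ∞ φ)
    (x : E d) :
    S.W τ₀ h n ((dd v)^[j] φ) x ≤ (‖v‖ / τ₀) ^ (2 * j) * S.W τ₀ h (n + j) φ x := by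
  induction j generalizing φ with
  | zero => simp
  | succ j ih =>
    rw [Function.iterate_succ_apply]
    refine (ih (contDiff_dd hφ)).trans ?_
    have := S.W_dd_le τ₀ h hτ₀ v (n + j) hφ x
    refine (mul_le_mul_of_nonneg_left this (by positivity)).trans (le_of_eq ?_)
    rw [← add_assoc]; ring

/-- The norm of a sum of products: the bound behind all estimates of commutators. -/
theorem W_prod_le {K₁ K₂ ι : Type} [Fintype K₁] [Fintype K₂] [Fintype ι] (n : ℕ)
    {b : K₁ → ι → E d → ℝ} {φ : K₂ → ι → E d → ℝ} (y : K₁ → E d)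
    (hb : ∀ k i, ContDiff ℝ ∞ (b k i)) (hφ : ∀ k i, ContDiff ℝ ∞ (φ k i)) {B Φ : ℝ}
    (hB : ∀ s ≤ n, ∀ x, ∑ k, ∑ i, S.W τ₀ h s (b k i) x ≤ B)
    (hΦ : ∀ s ≤ n, ∀ x, ∑ k, ∑ i, S.W τ₀ h s (φ k i) x ≤ Φ) (x : E d) :
    ∑ k₁, ∑ k₂, S.W τ₀ h n (fun x => ∑ i, b k₁ i x * φ k₂ i (x + y k₁)) x ≤ 4 ^ n * B * Φ := by
  induction n generalizing K₁ K₂ with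
  | zero =>
    have hB0 : 0 ≤ B := le_trans (Finset.sum_nonneg fun _ _ => Finset.sum_nonneg fun _ _ =>
      S.W_nonneg _ _ _ _ _) (hB 0 le_rfl x)
    have hB1 : ∀ x, ∑ k, ∑ i, (b k i x) ^ 2 ≤ B := fun x => by simpa [W_zero] using hB 0 le_rfl x
    have hΦ1 : ∀ x, ∑ k, ∑ i, (φ k i x) ^ 2 ≤ Φ := fun x => by simpa [W_zero] using hΦ 0 le_rfl x
    have hΦ0 : 0 ≤ Φ := le_trans (Finset.sum_nonneg fun _ _ => Finset.sum_nonneg fun _ _ =>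
      sq_nonneg _) (hΦ1 x)
    simp only [W_zero, pow_zero, one_mul]
    calc ∑ k₁, ∑ k₂, (∑ i, b k₁ i x * φ k₂ i (x + y k₁)) ^ 2
        ≤ ∑ k₁, ∑ k₂, (∑ i, (b k₁ i x) ^ 2) * ∑ i, (φ k₂ i (x + y k₁)) ^ 2 :=
          Finset.sum_le_sum fun _ _ => Finset.sum_le_sum fun _ _ =>
            Finset.sum_mul_sq_le_sq_mul_sq _ _ _
      _ = ∑ k₁, (∑ i, (b k₁ i x) ^ 2) * ∑ k₂, ∑ i, (φ k₂ i (x + y k₁)) ^ 2 := by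
          simp only [Finset.mul_sum]
      _ ≤ ∑ k₁, (∑ i, (b k₁ i x) ^ 2) * Φ :=
          Finset.sum_le_sum fun k _ => mul_le_mul_of_nonneg_left (hΦ1 _)
            (Finset.sum_nonneg fun _ _ => sq_nonneg _)
      _ = (∑ k₁, (∑ i, (b k₁ i x) ^ 2)) * Φ := by rw [Finset.sum_mul]
      _ ≤ B * Φ := mul_le_mul_of_nonneg_right (hB1 x) hΦ0
  | succ n ih =>
    have hsh : ∀ k₂ i (z : E d), ContDiff ℝ ∞ (fun x => φ k₂ i (x + z)) := fun k₂ i z =>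
      (hφ k₂ i).comp (contDiff_id.add contDiff_const)
    have e : ∀ k₁ k₂ μ, S.dbar τ₀ h μ (fun x => ∑ i, b k₁ i x * φ k₂ i (x + y k₁)) =
        fun x => (∑ i, S.dbar τ₀ h μ (b k₁ i) x * φ k₂ i (x + (S.sv h μ + y k₁))) +
          ∑ i, b k₁ i x * S.dbar τ₀ h μ (φ k₂ i) (x + y k₁) := by
      intro k₁ k₂ μ
      rw [S.dbar_sum τ₀ h μ _ (fun i _ => differentiable_of_smooth ((hb k₁ i).mul (hsh _ _ _)))]
      funext x
      rw [← Finset.sum_add_distrib]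
      refine Finset.sum_congr rfl fun i _ => ?_
      rw [S.dbar_mul τ₀ h μ (differentiable_of_smooth (hb k₁ i))
        (differentiable_of_smooth (hsh k₂ i _)), S.dbar_shift]
      simp only [add_assoc]
    -- The operator falls on one of the two factors, and the index family of that factor is enlarged
    -- by the index of the operator. No count of `Λ` is lost; each step costs only a factor 4. The
    -- shift produced by the Leibniz rule is absorbed in `y`.
    have h1 := ih (K₁ := K₁ × S.Idx) (K₂ := K₂) (b := fun k i => S.dbar τ₀ h k.2 (b k.1 i))
      (φ := φ) (fun k => S.sv h k.2 + y k.1) (fun k i => contDiff_dbar τ₀ h _ (hb k.1 i)) hφ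
      (fun s hs x => by
        rw [Fintype.sum_prod_type]
        refine le_trans (le_of_eq ?_) (hB (s + 1) (by omega) x)
        refine Finset.sum_congr rfl fun k _ => ?_
        rw [Finset.sum_comm]
        simp only [W_succ])
      (fun s hs => hΦ s (by omega))
    have h2 := ih (K₁ := K₁) (K₂ := K₂ × S.Idx) (b := b)
      (φ := fun k i => S.dbar τ₀ h k.2 (φ k.1 i)) y hb
      (fun k i => contDiff_dbar τ₀ h _ (hφ k.1 i)) (fun s hs => hB s (by omega))
      (fun s hs x => by
        rw [Fintype.sum_prod_type]
        refine le_trans (le_of_eq ?_) (hΦ (s + 1) (by omega) x)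
        refine Finset.sum_congr rfl fun k _ => ?_
        rw [Finset.sum_comm]
        simp only [W_succ])
    simp only [W_succ, e]
    have h3 : ∀ k₁ k₂ μ, S.W τ₀ h n (fun x =>
        (∑ i, S.dbar τ₀ h μ (b k₁ i) x * φ k₂ i (x + (S.sv h μ + y k₁))) +
          ∑ i, b k₁ i x * S.dbar τ₀ h μ (φ k₂ i) (x + y k₁)) x ≤
        2 * S.W τ₀ h n (fun x =>
          ∑ i, S.dbar τ₀ h μ (b k₁ i) x * φ k₂ i (x + (S.sv h μ + y k₁))) x +
        2 * S.W τ₀ h n (fun x => ∑ i, b k₁ i x * S.dbar τ₀ h μ (φ k₂ i) (x + y k₁)) x := by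
      intro k₁ k₂ μ
      refine S.W_add_le τ₀ h n ?_ ?_ x
      · exact ContDiff.sum fun i _ => (contDiff_dbar τ₀ h _ (hb k₁ i)).mul (hsh _ _ _)
      · exact ContDiff.sum fun i _ => (hb k₁ i).mul
          ((contDiff_dbar τ₀ h _ (hφ k₂ i)).comp (contDiff_id.add contDiff_const))
    refine (Finset.sum_le_sum fun k₁ _ => Finset.sum_le_sum fun k₂ _ =>
      Finset.sum_le_sum fun μ _ => h3 k₁ k₂ μ).trans ?_
    simp only [Finset.sum_add_distrib, ← Finset.mul_sum]
    simp only [Fintype.sum_prod_type] at h1 h2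
    have h4 : ∑ k₁, ∑ k₂, ∑ μ, S.W τ₀ h n (fun x =>
          ∑ i, S.dbar τ₀ h μ (b k₁ i) x * φ k₂ i (x + (S.sv h μ + y k₁))) x =
        ∑ k₁, ∑ μ, ∑ k₂, S.W τ₀ h n (fun x =>
          ∑ i, S.dbar τ₀ h μ (b k₁ i) x * φ k₂ i (x + (S.sv h μ + y k₁))) x :=
      Finset.sum_congr rfl fun _ _ => Finset.sum_comm
    rw [h4]
    calc _ ≤ 2 * (4 ^ n * B * Φ) + 2 * (4 ^ n * B * Φ) := by gcongr
      _ = _ := by ring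

end Scheme

end FDScheme

namespace FDScheme

/-! ### Integrals depending smoothly on a parameter -/

section Param

variable {X V : Type} [NormedAddCommGroup X] [NormedSpace ℝ X] [FiniteDimensional ℝ X]
  [NormedAddCommGroup V] [NormedSpace ℝ V]

theorem hasFDerivAt_param_integral {F : X × ℝ → V} (hF : ContDiff ℝ 1 F) (z : X) :
    HasFDerivAt (fun z => ∫ θ in (0 : ℝ)..1, F (z, θ))
      (∫ θ in (0 : ℝ)..1, (fderiv ℝ F (z, θ)).comp (ContinuousLinearMap.inl ℝ X ℝ)) z := by
  have : ProperSpace X := FiniteDimensional.proper ℝ X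
  have hc : Continuous fun p : X × ℝ => (fderiv ℝ F p).comp (ContinuousLinearMap.inl ℝ X ℝ) :=
    (hF.continuous_fderiv (by norm_num)).clm_comp continuous_const
  obtain ⟨C, hC⟩ := ((isCompact_closedBall z 1).prod (isCompact_Icc (a := (0 : ℝ)) (b := 1))).exists_bound_of_continuousOn hc.continuousOn
  refine intervalIntegral.hasFDerivAt_integral_of_dominated_of_fderiv_le
    (F := fun z θ => F (z, θ)) (bound := fun _ => C)
    (F' := fun z θ => (fderiv ℝ F (z, θ)).comp (ContinuousLinearMap.inl ℝ X ℝ))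
    (Metric.closedBall_mem_nhds z one_pos) ?_ ?_ ?_ ?_ ?_ ?_
  · exact Filter.Eventually.of_forall fun y =>
      (hF.continuous.comp (Continuous.prodMk_right y)).aestronglyMeasurable
  · exact (hF.continuous.comp (Continuous.prodMk_right z)).intervalIntegrable _ _
  · exact (hc.comp (Continuous.prodMk_right z)).aestronglyMeasurable
  · refine Filter.Eventually.of_forall fun θ hθ y hy => hC (y, θ) ⟨hy, ?_⟩
    rw [uIoc_of_le zero_le_one] at hθ
    exact ⟨hθ.1.le, hθ.2⟩
  · exact intervalIntegrable_const
  · refine Filter.Eventually.of_forall fun θ _ y _ => ?_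
    exact (hF.differentiable (by norm_num) (y, θ)).hasFDerivAt.comp y
      (hasFDerivAt_prodMk_left y θ)

/-- The target space varies in the induction because the derivative of the integrand takes values in
a space of linear maps. -/
theorem contDiff_param_integral_nat (n : ℕ) : ∀ {V : Type} [NormedAddCommGroup V] [NormedSpace ℝ V]
    [CompleteSpace V] {F : X × ℝ → V}, ContDiff ℝ n F →
    ContDiff ℝ n (fun z => ∫ θ in (0 : ℝ)..1, F (z, θ)) := by
  induction n with
  | zero =>
    intro V _ _ _ F hF
    rw [Nat.cast_zero, contDiff_zero] at hF ⊢
    exact intervalIntegral.continuous_parametric_intervalIntegral_of_continuous' (f := fun z θ => F (z, θ)) hF 0 1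
  | succ n ih =>
    intro V _ _ _ F hF
    have h1 : ContDiff ℝ 1 F := hF.of_le (by norm_cast; omega)
    have h2 := fun z => hasFDerivAt_param_integral h1 z
    push_cast
    rw [contDiff_succ_iff_fderiv]
    refine ⟨fun z => (h2 z).differentiableAt, by simp, ?_⟩
    have e : fderiv ℝ (fun z => ∫ θ in (0 : ℝ)..1, F (z, θ)) = fun z => ∫ θ in (0 : ℝ)..1,
      (fun p => (fderiv ℝ F p).comp (ContinuousLinearMap.inl ℝ X ℝ)) (z, θ) :=
      funext fun z => (h2 z).fderiv
    rw [e]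
    refine ih (V := X →L[ℝ] V)
      (F := fun p => (fderiv ℝ F p).comp (ContinuousLinearMap.inl ℝ X ℝ)) ?_
    exact (hF.fderiv_right (m := n) (by push_cast; exact le_rfl)).clm_comp contDiff_const

theorem contDiff_param_integral [CompleteSpace V] {F : X × ℝ → V} (hF : ContDiff ℝ ∞ F) :
    ContDiff ℝ ∞ (fun z => ∫ θ in (0 : ℝ)..1, F (z, θ)) :=
  contDiff_infty.2 fun n => contDiff_param_integral_nat n (V := V) (contDiff_infty.1 hF n)

theorem dd_param_integral {F : X × ℝ → ℝ} (hF : ContDiff ℝ ∞ F) (v z : X) :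
    dd v (fun z => ∫ θ in (0 : ℝ)..1, F (z, θ)) z =
      ∫ θ in (0 : ℝ)..1, dd v (fun z => F (z, θ)) z := by
  have h1 : ContDiff ℝ 1 F := mod_cast contDiff_infty.1 hF 1
  have hc : Continuous fun p : X × ℝ => (fderiv ℝ F p).comp (ContinuousLinearMap.inl ℝ X ℝ) :=
    (h1.continuous_fderiv (by norm_num)).clm_comp continuous_const
  unfold dd
  have hi : IntervalIntegrable (fun θ : ℝ => (fderiv ℝ F (z, θ)).comp
      (ContinuousLinearMap.inl ℝ X ℝ)) volume 0 1 :=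
    (hc.comp (Continuous.prodMk_right z)).intervalIntegrable _ _
  rw [(hasFDerivAt_param_integral h1 z).fderiv, ContinuousLinearMap.intervalIntegral_apply hi]
  refine intervalIntegral.integral_congr fun θ _ => ?_
  have := (h1.differentiable (by norm_num) (z, θ)).hasFDerivAt.comp z
      (hasFDerivAt_prodMk_left (𝕜 := ℝ) z θ)
  exact congrArg (fun L => L v) this.fderiv.symm

end Param

/-- A weighted mean does not increase the Euclidean norm of a finite family. -/
theorem sum_sq_integral_le {κ : Type*} [Fintype κ] {w : ℝ → ℝ} {ψ : κ → ℝ → ℝ} {C : ℝ}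
    (hw : Continuous w) (hψ : ∀ k, Continuous (ψ k)) (hw1 : ∀ θ ∈ Icc (0 : ℝ) 1, |w θ| ≤ 1)
    (hC : ∀ θ ∈ Icc (0 : ℝ) 1, ∑ k, (ψ k θ) ^ 2 ≤ C) :
    ∑ k, (∫ θ in (0 : ℝ)..1, w θ * ψ k θ) ^ 2 ≤ C := by
  set a : κ → ℝ := fun k => ∫ θ in (0 : ℝ)..1, w θ * ψ k θ with ha
  set A := ∑ k, (a k) ^ 2 with hA
  have hA0 : 0 ≤ A := Finset.sum_nonneg fun _ _ => sq_nonneg _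
  have hC0 : 0 ≤ C := le_trans (Finset.sum_nonneg fun _ _ => sq_nonneg _) (hC 0 (by simp))
  -- Duality: the vector of means is tested against itself, so that Cauchy–Schwarz inside the
  -- integral gives `A² ≤ A C`.
  have e : A = ∫ θ in (0 : ℝ)..1, w θ * ∑ k, a k * ψ k θ := by
    have : ∀ θ, w θ * ∑ k, a k * ψ k θ = ∑ k, a k * (w θ * ψ k θ) := fun θ => by
      rw [Finset.mul_sum]; exact Finset.sum_congr rfl fun _ _ => by ring
    simp_rw [this]
    rw [intervalIntegral.integral_finsetSum]
    · simp_rw [intervalIntegral.integral_const_mul, hA, sq]; rfl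
    · intro k _
      exact (continuous_const.mul (hw.mul (hψ k))).intervalIntegrable _ _
  have hb : ‖∫ θ in (0 : ℝ)..1, w θ * ∑ k, a k * ψ k θ‖ ≤ Real.sqrt (A * C) * |1 - 0| := by
    refine intervalIntegral.norm_integral_le_of_norm_le_const fun θ hθ => ?_
    rw [uIoc_of_le zero_le_one] at hθ
    have hθ' : θ ∈ Icc (0 : ℝ) 1 := ⟨hθ.1.le, hθ.2⟩
    rw [Real.norm_eq_abs, abs_mul]
    refine (mul_le_of_le_one_left (abs_nonneg _) (hw1 θ hθ')).trans ?_
    refine Real.abs_le_sqrt ((Finset.sum_mul_sq_le_sq_mul_sq _ _ _).trans ?_)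
    exact mul_le_mul_of_nonneg_left (hC θ hθ') hA0
  rw [← e, Real.norm_eq_abs, abs_of_nonneg hA0] at hb
  have h2 : A ^ 2 ≤ A * C := by
    have := pow_le_pow_left₀ hA0 hb 2
    simpa [Real.sq_sqrt (mul_nonneg hA0 hC0)] using this
  by_contra hlt
  push Not at hlt
  nlinarith

/-! ### Averaged directional derivatives -/

/-- The mean of `D_l^j φ` over the segment from `x` to `x + hl` with weight `w`. -/
def Jop {d : ℕ} (w : ℝ → ℝ) (l : E d) (j : ℕ) (h : ℝ) (φ : E d → ℝ) (x : E d) : ℝ :=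
  ∫ θ in (0 : ℝ)..1, w θ * ((dd l)^[j] φ) (x + (θ * h) • l)

section Jop

variable {d : ℕ} {w : ℝ → ℝ} (l : E d) (j : ℕ) (h : ℝ)

theorem contDiff_Jop_integrand (hw : ContDiff ℝ ∞ w) {φ : E d → ℝ} (hφ : ContDiff ℝ ∞ φ) :
    ContDiff ℝ ∞ (fun p : E d × ℝ => w p.2 * ((dd l)^[j] φ) (p.1 + (p.2 * h) • l)) :=
  (hw.comp contDiff_snd).mul ((contDiff_iterate_dd l j hφ).comp
    (contDiff_fst.add ((contDiff_snd.mul contDiff_const).smul contDiff_const)))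

theorem contDiff_Jop (hw : ContDiff ℝ ∞ w) {φ : E d → ℝ} (hφ : ContDiff ℝ ∞ φ) :
    ContDiff ℝ ∞ (Jop w l j h φ) :=
  contDiff_param_integral (contDiff_Jop_integrand l j h hw hφ)

theorem continuous_Jop_integrand {φ : E d → ℝ} (hφ : ContDiff ℝ ∞ φ)
    (x : E d) : Continuous fun θ : ℝ => ((dd l)^[j] φ) (x + (θ * h) • l) :=
  (contDiff_iterate_dd l j hφ).continuous.comp (by fun_prop)

theorem iterate_dd_comm (v : E d) {φ : E d → ℝ} (hφ : ContDiff ℝ ∞ φ) :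
    (dd l)^[j] (dd v φ) = dd v ((dd l)^[j] φ) := by
  induction j generalizing φ with
  | zero => rfl
  | succ j ih =>
    rw [Function.iterate_succ_apply, Function.iterate_succ_apply,
      dd_comm l v (mod_cast contDiff_infty.1 hφ 2), ih (contDiff_dd hφ)]

theorem iterate_dd_shift (φ : E d → ℝ) (y : E d) :
    (dd l)^[j] (fun x => φ (x + y)) = fun x => (dd l)^[j] φ (x + y) := by
  induction j generalizing φ with
  | zero => rfl
  | succ j ih => rw [Function.iterate_succ_apply, dd_shift, ih, Function.iterate_succ_apply]

theorem Jop_shift (φ : E d → ℝ) (y : E d) :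
    Jop w l j h (fun x => φ (x + y)) = fun x => Jop w l j h φ (x + y) := by
  funext x
  simp only [Jop, iterate_dd_shift]
  simp only [add_right_comm]

theorem dd_Jop (hw : ContDiff ℝ ∞ w) (v : E d) {φ : E d → ℝ} (hφ : ContDiff ℝ ∞ φ) :
    dd v (Jop w l j h φ) = Jop w l j h (dd v φ) := by
  funext x
  refine (dd_param_integral (contDiff_Jop_integrand l j h hw hφ) v x).trans ?_
  unfold Jop
  refine intervalIntegral.integral_congr fun θ _ => ?_
  have hd := differentiable_of_smooth (contDiff_iterate_dd l j hφ)
  have hd' : Differentiable ℝ (fun z => ((dd l)^[j] φ) (z + (θ * h) • l)) :=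
    hd.comp (differentiable_id.add_const _)
  simp only [dd_const_mul _ hd', dd_shift, iterate_dd_comm l j v hφ]

end Jop

/-! ### Averaged derivatives in the functionals `W`, and Taylor formulas for difference quotients.
-/

namespace Scheme

variable {d : ℕ} (S : Scheme d) (τ₀ h : ℝ)

section Jop

variable {w : ℝ → ℝ} (l : E d) (j : ℕ) (η : ℝ)

theorem iterate_dd_dbar (μ : S.Idx) {φ : E d → ℝ} (hφ : ContDiff ℝ ∞ φ) :
    (dd l)^[j] (S.dbar τ₀ h μ φ) = S.dbar τ₀ h μ ((dd l)^[j] φ) := by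
  induction j generalizing φ with
  | zero => rfl
  | succ j ih =>
    rw [Function.iterate_succ_apply, Function.iterate_succ_apply, S.dd_dbar τ₀ h l μ hφ,
      ih (contDiff_dd hφ)]

theorem dbar_Jop (hw : ContDiff ℝ ∞ w) (μ : S.Idx) {φ : E d → ℝ} (hφ : ContDiff ℝ ∞ φ) :
    S.dbar τ₀ h μ (Jop w l j η φ) = Jop w l j η (S.dbar τ₀ h μ φ) := by
  cases μ with
  | inl l' =>
    funext x
    have e := congrFun (Jop_shift (w := w) l j η φ (h • (l' : E d))) x
    have hc : ∀ φ : E d → ℝ, ContDiff ℝ ∞ φ →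
        Continuous fun θ : ℝ => w θ * ((dd l)^[j] φ) (x + (θ * η) • l) := fun φ hφ =>
      hw.continuous.mul (continuous_Jop_integrand l j η hφ x)
    have hs : ContDiff ℝ ∞ fun x => φ (x + h • (l' : E d)) :=
      hφ.comp (contDiff_id.add contDiff_const)
    simp only [dbar]
    rw [← e]
    unfold Jop
    rw [← intervalIntegral.integral_sub ((hc _ hs).intervalIntegrable _ _)
      ((hc _ hφ).intervalIntegrable _ _), ← intervalIntegral.integral_const_mul]
    refine intervalIntegral.integral_congr fun θ _ => ?_
    have e2 := S.iterate_dd_dbar τ₀ h l j (Sum.inl l') hφ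
    have e3 : S.dbar τ₀ h (Sum.inl l') φ =
      fun x => S.τ l' * h⁻¹ * (φ (x + h • (l' : E d)) - φ x) := rfl
    simp only [← e3, e2, iterate_dd_shift]
    simp only [dbar]
    ring
  | inr i =>
    have e : ∀ ψ : E d → ℝ, S.dbar τ₀ h (Sum.inr i) ψ =
      fun x => τ₀ * dd (EuclideanSpace.single i 1) ψ x := fun _ => rfl
    rw [e, e, dd_Jop l j η hw _ hφ]
    funext x
    unfold Jop
    rw [← intervalIntegral.integral_const_mul]
    refine intervalIntegral.integral_congr fun θ _ => ?_
    have e2 : (dd l)^[j] (S.dbar τ₀ h (Sum.inr i) φ) = S.dbar τ₀ h (Sum.inr i) ((dd l)^[j] φ) :=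
      S.iterate_dd_dbar τ₀ h l j _ hφ
    rw [e, e] at e2
    simp only [e2, iterate_dd_comm l j _ hφ]
    ring

theorem dl_Jop (hw : ContDiff ℝ ∞ w) (lam : List S.Idx) {φ : E d → ℝ} (hφ : ContDiff ℝ ∞ φ) :
    S.dl τ₀ h lam (Jop w l j η φ) = Jop w l j η (S.dl τ₀ h lam φ) := by
  induction lam generalizing φ with
  | nil => rfl
  | cons μ lam ih =>
    rw [dl_cons, dl_cons, S.dbar_Jop τ₀ h l j η hw μ hφ, ih (contDiff_dbar τ₀ h μ hφ)]

theorem iterate_dd_dl (lam : List S.Idx) {φ : E d → ℝ} (hφ : ContDiff ℝ ∞ φ) :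
    (dd l)^[j] (S.dl τ₀ h lam φ) = S.dl τ₀ h lam ((dd l)^[j] φ) := by
  induction lam generalizing φ with
  | nil => rfl
  | cons μ lam ih =>
    rw [dl_cons, dl_cons, ih (contDiff_dbar τ₀ h μ hφ), S.iterate_dd_dbar τ₀ h l j μ hφ]

/-- Averaging commutes with every `δ̄` and does not increase Euclidean norms (`sum_sq_integral_le`).
Each of the `j` derivatives along `l` costs one order of `W` and a factor `(‖l‖ / τ₀)²`. -/
theorem W_Jop_le (hτ₀ : 0 < τ₀) (hw : ContDiff ℝ ∞ w) (hw1 : ∀ θ ∈ Icc (0 : ℝ) 1, |w θ| ≤ 1)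
    {κ : Type*} [Fintype κ] {φ : κ → E d → ℝ} (hφ : ∀ k, ContDiff ℝ ∞ (φ k)) (n : ℕ) {Φ : ℝ}
    (hΦ : ∀ x, ∑ k, S.W τ₀ h (n + j) (φ k) x ≤ Φ) (x : E d) :
    ∑ k, S.W τ₀ h n (Jop w l j η (φ k)) x ≤ (‖l‖ / τ₀) ^ (2 * j) * Φ := by
  unfold W lsum
  rw [← Fintype.sum_prod_type']
  simp only [fun lam k => S.dl_Jop τ₀ h l j η hw lam (hφ k)]
  refine sum_sq_integral_le hw.continuous (fun k => continuous_Jop_integrand l j η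
    (contDiff_dl τ₀ h _ (hφ k.1)) x) hw1 fun θ _ => ?_
  rw [Fintype.sum_prod_type]
  simp only [fun lam k => S.iterate_dd_dl τ₀ h l j lam (hφ k)]
  refine le_trans (Finset.sum_le_sum fun k _ => S.W_iterate_dd_le τ₀ h hτ₀ l n j (hφ k) _) ?_
  rw [← Finset.mul_sum]
  exact mul_le_mul_of_nonneg_left (hΦ _) (by positivity)

end Jop

theorem sum_norm_sq : ∑ l : S.Λ₁, ‖(l : E d)‖ ^ 2 = S.size ^ 2 :=
  (Real.sq_sqrt (Finset.sum_nonneg fun _ _ => sq_nonneg _)).symm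

theorem norm_le_size (l : S.Λ₁) : ‖(l : E d)‖ ≤ S.size := by
  refine Real.le_sqrt_of_sq_le ?_
  exact Finset.single_le_sum (f := fun l : S.Λ₁ => ‖(l : E d)‖ ^ 2) (fun _ _ => sq_nonneg _)
    (Finset.mem_univ l)

/-- One factor `‖l‖²` is summed and the others are bounded by `S.size`, so the number of stencil
points does not enter. -/
theorem sum_norm_pow_le (j : ℕ) (hj : 1 ≤ j) :
    ∑ l : S.Λ₁, (‖(l : E d)‖ / τ₀) ^ (2 * j) ≤ (S.size / τ₀) ^ (2 * j) := by
  simp only [div_pow]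
  rw [← Finset.sum_div]
  refine div_le_div_of_nonneg_right ?_ (by rw [pow_mul]; positivity)
  obtain ⟨i, rfl⟩ : ∃ i, j = i + 1 := ⟨j - 1, by omega⟩
  have e : ∀ a : ℝ, a ^ (2 * (i + 1)) = a ^ (2 * i) * a ^ 2 := fun a => by ring
  simp only [e]
  rw [← sum_norm_sq, Finset.mul_sum]
  exact Finset.sum_le_sum fun l _ => mul_le_mul_of_nonneg_right
    (pow_le_pow_left₀ (norm_nonneg _) (S.norm_le_size l) _) (sq_nonneg _)

/-- The averaged derivatives along all vectors of the stencil. -/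
theorem sum_W_Jop_le (hτ₀ : 0 < τ₀) {w : ℝ → ℝ} (hw : ContDiff ℝ ∞ w)
    (hw1 : ∀ θ ∈ Icc (0 : ℝ) 1, |w θ| ≤ 1) (j : ℕ) (hj : 1 ≤ j) (η : ℝ)
    {κ : Type*} [Fintype κ] {φ : κ → E d → ℝ} (hφ : ∀ k, ContDiff ℝ ∞ (φ k)) (n : ℕ) {Φ : ℝ}
    (hΦ : ∀ x, ∑ k, S.W τ₀ h (n + j) (φ k) x ≤ Φ) (x : E d) :
    ∑ k, ∑ l : S.Λ₁, S.W τ₀ h n (Jop w (l : E d) j η (φ k)) x ≤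
      (S.size / τ₀) ^ (2 * j) * Φ := by
  have hΦ0 : 0 ≤ Φ := le_trans (Finset.sum_nonneg fun _ _ => S.W_nonneg _ _ _ _ _) (hΦ x)
  rw [Finset.sum_comm]
  refine (Finset.sum_le_sum (s := Finset.univ) fun (l : S.Λ₁) _ =>
    S.W_Jop_le τ₀ h (l : E d) j η hτ₀ hw hw1 hφ n hΦ x).trans ?_
  rw [← Finset.sum_mul]
  exact mul_le_mul_of_nonneg_right (S.sum_norm_pow_le τ₀ j hj) hΦ0

/-- The fundamental theorem of calculus along the segment from `x` to `x + h l`. -/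
theorem del_eq_Jop {h : ℝ} (hh : h ≠ 0) (l : S.Λ₁) {φ : E d → ℝ} (hφ : ContDiff ℝ ∞ φ) (x : E d) :
    S.del h l φ x = Jop (fun _ => 1) (l : E d) 1 h φ x := by
  have hd : ∀ θ : ℝ, HasDerivAt (fun θ : ℝ => h⁻¹ * φ (x + (θ * h) • (l : E d)))
      (dd (l : E d) φ (x + (θ * h) • (l : E d))) θ := by
    intro θ
    have h1 : HasDerivAt (fun θ : ℝ => x + (θ * h) • (l : E d)) ((1 * h) • (l : E d)) θ :=
      (((hasDerivAt_id θ).mul_const h).smul_const (l : E d)).const_add x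
    have h2 := ((differentiable_of_smooth hφ _).hasFDerivAt.comp_hasDerivAt θ h1).const_mul h⁻¹
    convert! h2 using 1
    simp [dd, hh]
  have := intervalIntegral.integral_eq_sub_of_hasDerivAt (a := 0) (b := 1) (fun θ _ => hd θ)
    ((continuous_Jop_integrand (l : E d) 1 h hφ x).intervalIntegrable _ _)
  simp only [Jop, one_mul, Function.iterate_one]
  rw [this]
  simp [del]
  ring

/-- Taylor's formula with integral remainder. The singular first order term is isolated because it
cancels against centered coefficients. -/
theorem second_diff_eq_Jop {h : ℝ} (hh : h ≠ 0) (l : S.Λ₁) {φ : E d → ℝ} (hφ : ContDiff ℝ ∞ φ)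
    (x : E d) : h⁻¹ * S.del h l φ x =
      h⁻¹ * dd (l : E d) φ x + Jop (fun θ => 1 - θ) (l : E d) 2 h φ x := by
  have hd : ∀ {φ : E d → ℝ} (_ : ContDiff ℝ ∞ φ) (θ : ℝ),
      HasDerivAt (fun θ : ℝ => h⁻¹ * φ (x + (θ * h) • (l : E d)))
      (dd (l : E d) φ (x + (θ * h) • (l : E d))) θ := by
    intro φ hφ θ
    have h1 : HasDerivAt (fun θ : ℝ => x + (θ * h) • (l : E d)) ((1 * h) • (l : E d)) θ :=
      (((hasDerivAt_id θ).mul_const h).smul_const (l : E d)).const_add x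
    have h2 := ((differentiable_of_smooth hφ _).hasFDerivAt.comp_hasDerivAt θ h1).const_mul h⁻¹
    convert! h2 using 1
    simp [dd, hh]
  have hd2 : ∀ θ : ℝ, HasDerivAt (fun θ : ℝ => (1 - θ) *
      (h⁻¹ * dd (l : E d) φ (x + (θ * h) • (l : E d))) +
      h⁻¹ * (h⁻¹ * φ (x + (θ * h) • (l : E d))))
      ((1 - θ) * ((dd (l : E d))^[2] φ) (x + (θ * h) • (l : E d))) θ := by
    intro θ
    have := (((hasDerivAt_id θ).const_sub 1).mul (hd (contDiff_dd (v := (l : E d)) hφ) θ)).add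
      ((hd hφ θ).const_mul h⁻¹)
    convert! this using 1
    simp
  have := intervalIntegral.integral_eq_sub_of_hasDerivAt (a := 0) (b := 1) (fun θ _ => hd2 θ)
    (((continuous_const.sub continuous_id).mul (continuous_Jop_integrand (l : E d)
      2 h hφ x)).intervalIntegrable _ _)
  simp only [Jop]
  rw [this]
  simp [del]
  ring

/-- Second difference quotients with centered coefficients are bounded by second derivatives. -/
theorem centered_eq_Jop {h : ℝ} (hh : h ≠ 0) {a : S.Λ₁ → ℝ} (ha : ∑ l, a l • (l : E d) = 0)
    {φ : E d → ℝ} (hφ : ContDiff ℝ ∞ φ) (x : E d) :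
    h⁻¹ * ∑ l, a l * S.del h l φ x =
      ∑ l, a l * Jop (fun θ => 1 - θ) (l : E d) 2 h φ x := by
  -- The sum is the differential of `φ` applied to the vanishing vector `∑ a_l l`.
  have h0 : ∑ l, a l * dd (l : E d) φ x = 0 := by
    have := congrArg (fderiv ℝ φ x) ha
    simpa [dd] using this
  have : h⁻¹ * ∑ l, a l * S.del h l φ x = h⁻¹ * ∑ l, a l * dd (l : E d) φ x +
      ∑ l, a l * Jop (fun θ => 1 - θ) (l : E d) 2 h φ x := by
    rw [Finset.mul_sum, Finset.mul_sum, ← Finset.sum_add_distrib]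
    refine Finset.sum_congr rfl fun l _ => ?_
    rw [mul_left_comm, S.second_diff_eq_Jop hh l hφ]
    ring
  rw [this, h0, mul_zero, zero_add]

end Scheme

end FDScheme

namespace FDScheme

namespace Scheme

variable {d : ℕ} (S : Scheme d) (τ₀ h : ℝ)

/-! ### Difference operators with smooth coefficients -/

/-- `h⁻¹ ∑ q_λ δ_{h,λ}`. -/
def Qop (q : S.Λ₁ → E d → ℝ) (φ : E d → ℝ) (x : E d) : ℝ := h⁻¹ * ∑ l, q l x * S.del h l φ x

/-- `∑ p_λ δ_{h,λ}`. -/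
def Pop (p : S.Λ₁ → E d → ℝ) (φ : E d → ℝ) (x : E d) : ℝ := ∑ l, p l x * S.del h l φ x

/-- The operator `L_h` with given coefficients. -/
def Lop (q p : S.Λ₁ → E d → ℝ) (c : E d → ℝ) (φ : E d → ℝ) (x : E d) : ℝ :=
  S.Qop h q φ x + S.Pop h p φ x - c x * φ x

/-- The coefficients `δ̄_{h,μ} q_λ`. -/
def cf (μ : S.Idx) (q : S.Λ₁ → E d → ℝ) : S.Λ₁ → E d → ℝ := fun l => S.dbar τ₀ h μ (q l)

theorem contDiff_shift {φ : E d → ℝ} (hφ : ContDiff ℝ ∞ φ) (y : E d) :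
    ContDiff ℝ ∞ (fun x => φ (x + y)) := hφ.comp (contDiff_id.add contDiff_const)

variable {S} in
theorem contDiff_del (l : S.Λ₁) {φ : E d → ℝ} (hφ : ContDiff ℝ ∞ φ) :
    ContDiff ℝ ∞ (S.del h l φ) :=
  contDiff_const.mul ((contDiff_shift hφ _).sub hφ)

variable {S} in
theorem contDiff_Qop {q : S.Λ₁ → E d → ℝ} (hq : ∀ l, ContDiff ℝ ∞ (q l)) {φ : E d → ℝ}
    (hφ : ContDiff ℝ ∞ φ) : ContDiff ℝ ∞ (S.Qop h q φ) :=
  contDiff_const.mul (ContDiff.sum fun l _ => (hq l).mul (contDiff_del h l hφ))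

variable {S} in
theorem contDiff_Pop {q : S.Λ₁ → E d → ℝ} (hq : ∀ l, ContDiff ℝ ∞ (q l)) {φ : E d → ℝ}
    (hφ : ContDiff ℝ ∞ φ) : ContDiff ℝ ∞ (S.Pop h q φ) :=
  ContDiff.sum fun l _ => (hq l).mul (contDiff_del h l hφ)

variable {S} in
theorem contDiff_Lop {q p : S.Λ₁ → E d → ℝ} {c : E d → ℝ} (hq : ∀ l, ContDiff ℝ ∞ (q l))
    (hp : ∀ l, ContDiff ℝ ∞ (p l)) (hc : ContDiff ℝ ∞ c) {φ : E d → ℝ}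
    (hφ : ContDiff ℝ ∞ φ) : ContDiff ℝ ∞ (S.Lop h q p c φ) :=
  ((contDiff_Qop h hq hφ).add (contDiff_Pop h hp hφ)).sub (hc.mul hφ)

theorem del_shift (l : S.Λ₁) (φ : E d → ℝ) (y x : E d) :
    S.del h l (fun x => φ (x + y)) x = S.del h l φ (x + y) := by
  simp only [del]; rw [add_right_comm]

theorem dbar_del (l : S.Λ₁) (μ : S.Idx) {φ : E d → ℝ} (hφ : ContDiff ℝ ∞ φ) :
    S.dbar τ₀ h μ (S.del h l φ) = S.del h l (S.dbar τ₀ h μ φ) := by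
  have h1 : Differentiable ℝ (fun x => φ (x + h • (l : E d)) - φ x) :=
    differentiable_of_smooth ((contDiff_shift hφ _).sub hφ)
  unfold del
  rw [S.dbar_const_mul τ₀ h μ _ h1, S.dbar_sub τ₀ h μ (differentiable_of_smooth
    (contDiff_shift hφ _)) (differentiable_of_smooth hφ), S.dbar_shift]

theorem dbar_Pop (μ : S.Idx) {q : S.Λ₁ → E d → ℝ} (hq : ∀ l, ContDiff ℝ ∞ (q l)) {φ : E d → ℝ}
    (hφ : ContDiff ℝ ∞ φ) : S.dbar τ₀ h μ (S.Pop h q φ) = fun x =>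
      S.Pop h (S.cf τ₀ h μ q) (fun x => φ (x + S.sv h μ)) x +
      S.Pop h q (S.dbar τ₀ h μ φ) x := by
  unfold Pop
  rw [S.dbar_sum τ₀ h μ _ fun l _ => differentiable_of_smooth ((hq l).mul (contDiff_del h l hφ))]
  funext x
  rw [← Finset.sum_add_distrib]
  refine Finset.sum_congr rfl fun l _ => ?_
  rw [S.dbar_mul τ₀ h μ (differentiable_of_smooth (hq l))
    (differentiable_of_smooth (contDiff_del h l hφ)), S.dbar_del τ₀ h l μ hφ, del_shift]
  rfl

theorem Qop_eq_Pop (q : S.Λ₁ → E d → ℝ) (φ : E d → ℝ) :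
    S.Qop h q φ = fun x => h⁻¹ * S.Pop h q φ x := rfl

theorem dbar_Qop (μ : S.Idx) {q : S.Λ₁ → E d → ℝ} (hq : ∀ l, ContDiff ℝ ∞ (q l)) {φ : E d → ℝ}
    (hφ : ContDiff ℝ ∞ φ) : S.dbar τ₀ h μ (S.Qop h q φ) = fun x =>
      S.Qop h (S.cf τ₀ h μ q) (fun x => φ (x + S.sv h μ)) x +
      S.Qop h q (S.dbar τ₀ h μ φ) x := by
  rw [Qop_eq_Pop, S.dbar_const_mul τ₀ h μ _ (differentiable_of_smooth (contDiff_Pop h hq hφ)),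
    S.dbar_Pop τ₀ h μ hq hφ]
  funext x
  simp only [Qop_eq_Pop]
  ring

variable {S} in
theorem contDiff_cf (μ : S.Idx) {q : S.Λ₁ → E d → ℝ} (hq : ∀ l, ContDiff ℝ ∞ (q l)) (l : S.Λ₁) :
    ContDiff ℝ ∞ (S.cf τ₀ h μ q l) := contDiff_dbar τ₀ h μ (hq l)

/-- Centering is, in each coordinate, a linear relation with constant factors between the
coefficients, so `δ̄` preserves it. This keeps the factor `h⁻¹` harmless in all commutators. -/
theorem cf_centered (μ : S.Idx) {q : S.Λ₁ → E d → ℝ} (hq : ∀ l, ContDiff ℝ ∞ (q l))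
    (hcen : ∀ x, ∑ l, q l x • (l : E d) = 0) (x : E d) :
    ∑ l, S.cf τ₀ h μ q l x • (l : E d) = 0 := by
  ext j
  have e : (fun x => ∑ l : S.Λ₁, (l : E d) j * q l x) = fun _ => 0 := by
    funext x
    have := congrArg (fun v : E d => v j) (hcen x)
    simpa [mul_comm] using this
  have := S.dbar_sum τ₀ h μ Finset.univ (φ := fun (l : S.Λ₁) x => (l : E d) j * q l x)
    fun l _ => (differentiable_of_smooth (hq l)).const_mul _
  rw [e, dbar_zero] at this
  have := congrFun this x
  simp only [S.dbar_const_mul τ₀ h μ _ (differentiable_of_smooth (hq _))] at this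
  simp only [cf, WithLp.ofLp_sum, WithLp.ofLp_smul, Finset.sum_apply, Pi.smul_apply, smul_eq_mul]
  exact (Finset.sum_congr rfl fun l _ => mul_comm _ _).trans this.symm

/-! ### The expansion of `δ̄_{h,λ} L_h` -/

section Expansion

variable (q p : S.Λ₁ → E d → ℝ) (c : E d → ℝ)

/-- The operator `L⁰_{h,μ}`. -/
def Dop (μ : S.Idx) (φ : E d → ℝ) (x : E d) : ℝ :=
  S.Qop h (S.cf τ₀ h μ q) φ x + S.Pop h (S.cf τ₀ h μ p) φ x

/-- The terms of `δ̄_{h,λ} L_h φ` with one `δ̄` on the coefficients. -/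
def firstTerms : List S.Idx → (E d → ℝ) → E d → ℝ
  | [], _ => fun _ => 0
  | μ :: lam, φ => fun x => S.Dop τ₀ h q p μ (fun x => S.dl τ₀ h lam φ (x + S.sv h μ)) x +
      firstTerms lam (S.dbar τ₀ h μ φ) x

/-- The terms of `δ̄_{h,λ} (L⁰_{h,μ} T_{h,μ} φ)` with one more `δ̄` on the coefficients `q`. -/
def crossTerms (μ : S.Idx) : List S.Idx → (E d → ℝ) → E d → ℝ
  | [], _ => fun _ => 0
  | ν :: lam, φ => fun x => S.Qop h (S.cf τ₀ h ν (S.cf τ₀ h μ q))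
        (fun x => S.dl τ₀ h lam φ (x + (S.sv h μ + S.sv h ν))) x +
      crossTerms μ lam (S.dbar τ₀ h ν φ) x

/-- The terms of `δ̄_{h,λ} L_h φ` with two `δ̄` on the coefficients `q`. -/
def secondTerms : List S.Idx → (E d → ℝ) → E d → ℝ
  | [], _ => fun _ => 0
  | μ :: lam, φ => fun x => S.crossTerms τ₀ h q μ lam φ x + secondTerms lam (S.dbar τ₀ h μ φ) x

/-- The commutator of `δ̄_{h,λ}` with a difference operator. -/
def remQ (b : S.Λ₁ → E d → ℝ) (y : E d) (lam : List S.Idx) (φ : E d → ℝ) (x : E d) : ℝ :=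
  S.dl τ₀ h lam (S.Qop h b (fun x => φ (x + y))) x -
    S.Qop h b (fun x => S.dl τ₀ h lam φ (x + y)) x

/-- The remainder in the expansion of `δ̄_{h,λ} (L⁰_{h,μ} T_{h,μ} φ)`. -/
def remD (μ : S.Idx) (lam : List S.Idx) (φ : E d → ℝ) (x : E d) : ℝ :=
  S.dl τ₀ h lam (S.Dop τ₀ h q p μ (fun x => φ (x + S.sv h μ))) x -
    S.Dop τ₀ h q p μ (fun x => S.dl τ₀ h lam φ (x + S.sv h μ)) x - S.crossTerms τ₀ h q μ lam φ x

/-- The remainder in the expansion of `δ̄_{h,λ} L_h φ`. -/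
def remL (lam : List S.Idx) (φ : E d → ℝ) (x : E d) : ℝ :=
  S.dl τ₀ h lam (S.Lop h q p c φ) x - S.Lop h q p c (S.dl τ₀ h lam φ) x -
    S.firstTerms τ₀ h q p lam φ x - S.secondTerms τ₀ h q lam φ x

variable {q p c} (hq : ∀ l, ContDiff ℝ ∞ (q l)) (hp : ∀ l, ContDiff ℝ ∞ (p l))
  (hc : ContDiff ℝ ∞ c)

include hq in
theorem remQ_cons (y : E d) (ν : S.Idx) (lam : List S.Idx) {φ : E d → ℝ} (hφ : ContDiff ℝ ∞ φ)
    (x : E d) : S.remQ τ₀ h q y (ν :: lam) φ x = S.remQ τ₀ h q y lam (S.dbar τ₀ h ν φ) x +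
      S.dl τ₀ h lam (S.Qop h (S.cf τ₀ h ν q) (fun x => φ (x + (S.sv h ν + y)))) x := by
  have hd := contDiff_dbar τ₀ h ν hφ
  have h1 : ContDiff ℝ ∞ (S.Qop h q fun x => S.dbar τ₀ h ν φ (x + y)) :=
    contDiff_Qop h hq (contDiff_shift hd y)
  have h2 : ContDiff ℝ ∞ (S.Qop h (S.cf τ₀ h ν q) (fun x => φ (x + (S.sv h ν + y)))) :=
    contDiff_Qop h (contDiff_cf τ₀ h ν hq) (contDiff_shift hφ _)
  unfold remQ
  rw [dl_cons, dl_cons, S.dbar_Qop τ₀ h ν hq (contDiff_shift hφ y), S.dbar_shift]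
  simp only [add_assoc]
  rw [S.dl_add τ₀ h lam h2 h1]
  ring

include hq hp in
theorem dbar_Dop (μ ν : S.Idx) {φ : E d → ℝ} (hφ : ContDiff ℝ ∞ φ) :
    S.dbar τ₀ h ν (S.Dop τ₀ h q p μ φ) = fun x =>
      S.Dop τ₀ h q p μ (S.dbar τ₀ h ν φ) x +
      (S.Qop h (S.cf τ₀ h ν (S.cf τ₀ h μ q)) (fun x => φ (x + S.sv h ν)) x +
      S.Pop h (S.cf τ₀ h ν (S.cf τ₀ h μ p)) (fun x => φ (x + S.sv h ν)) x) := by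
  have hq' := contDiff_cf τ₀ h μ hq
  have hp' := contDiff_cf τ₀ h μ hp
  unfold Dop
  rw [S.dbar_add τ₀ h ν (differentiable_of_smooth (contDiff_Qop h hq' hφ))
    (differentiable_of_smooth (contDiff_Pop h hp' hφ)), S.dbar_Qop τ₀ h ν hq' hφ,
    S.dbar_Pop τ₀ h ν hp' hφ]
  funext x
  ring

include hq hp in
theorem contDiff_Dop (μ : S.Idx) {φ : E d → ℝ} (hφ : ContDiff ℝ ∞ φ) :
    ContDiff ℝ ∞ (S.Dop τ₀ h q p μ φ) :=
  (contDiff_Qop h (contDiff_cf τ₀ h μ hq) hφ).add (contDiff_Pop h (contDiff_cf τ₀ h μ hp) hφ)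

include hq hp in
theorem remD_cons (μ ν : S.Idx) (lam : List S.Idx) {φ : E d → ℝ} (hφ : ContDiff ℝ ∞ φ)
    (x : E d) : S.remD τ₀ h q p μ (ν :: lam) φ x = S.remD τ₀ h q p μ lam (S.dbar τ₀ h ν φ) x +
      S.remQ τ₀ h (S.cf τ₀ h ν (S.cf τ₀ h μ q)) (S.sv h μ + S.sv h ν) lam φ x +
      S.dl τ₀ h lam (S.Pop h (S.cf τ₀ h ν (S.cf τ₀ h μ p))
        (fun x => φ (x + (S.sv h μ + S.sv h ν)))) x := by
  have hd := contDiff_dbar τ₀ h ν hφ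
  have hq' := contDiff_cf τ₀ h ν (contDiff_cf τ₀ h μ hq)
  have hp' := contDiff_cf τ₀ h ν (contDiff_cf τ₀ h μ hp)
  have hs := contDiff_shift hφ (S.sv h μ + S.sv h ν)
  unfold remD remQ
  rw [dl_cons, dl_cons, S.dbar_Dop τ₀ h hq hp μ ν (contDiff_shift hφ _), S.dbar_shift,
    crossTerms]
  simp only [add_assoc, add_comm (S.sv h ν) (S.sv h μ)]
  rw [S.dl_add τ₀ h lam (S.contDiff_Dop τ₀ h hq hp μ (contDiff_shift hd _))
      ((contDiff_Qop h hq' hs).add (contDiff_Pop h hp' hs)),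
    S.dl_add τ₀ h lam (contDiff_Qop h hq' hs) (contDiff_Pop h hp' hs)]
  ring

include hq hp hc in
theorem dbar_Lop (μ : S.Idx) {φ : E d → ℝ} (hφ : ContDiff ℝ ∞ φ) :
    S.dbar τ₀ h μ (S.Lop h q p c φ) = fun x =>
      (S.Lop h q p c (S.dbar τ₀ h μ φ) x + S.Dop τ₀ h q p μ (fun x => φ (x + S.sv h μ)) x) -
      S.dbar τ₀ h μ c x * φ (x + S.sv h μ) := by
  unfold Lop Dop
  rw [S.dbar_sub τ₀ h μ (differentiable_of_smooth ((contDiff_Qop h hq hφ).add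
      (contDiff_Pop h hp hφ))) (differentiable_of_smooth (hc.mul hφ)),
    S.dbar_add τ₀ h μ (differentiable_of_smooth (contDiff_Qop h hq hφ))
      (differentiable_of_smooth (contDiff_Pop h hp hφ)), S.dbar_Qop τ₀ h μ hq hφ,
    S.dbar_Pop τ₀ h μ hp hφ, S.dbar_mul τ₀ h μ (differentiable_of_smooth hc)
      (differentiable_of_smooth hφ)]
  funext x
  ring

-- Peeling off the first operator leaves the same remainder for `δ̄ φ`, the remainder of the term in
-- which it fell on `q` or `p`, and the term in which it fell on `c`. The recursion in `cL` mirrors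
-- this.
include hq hp hc in
theorem remL_cons (μ : S.Idx) (lam : List S.Idx) {φ : E d → ℝ} (hφ : ContDiff ℝ ∞ φ)
    (x : E d) : S.remL τ₀ h q p c (μ :: lam) φ x = S.remL τ₀ h q p c lam (S.dbar τ₀ h μ φ) x +
      S.remD τ₀ h q p μ lam φ x -
      S.dl τ₀ h lam (fun x => S.dbar τ₀ h μ c x * φ (x + S.sv h μ)) x := by
  have hd := contDiff_dbar τ₀ h μ hφ
  have h1 := contDiff_Lop h hq hp hc hd
  have h2 := S.contDiff_Dop τ₀ h hq hp μ (contDiff_shift hφ (S.sv h μ))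
  unfold remL remD
  rw [dl_cons, dl_cons, S.dbar_Lop τ₀ h hq hp hc μ hφ, firstTerms, secondTerms,
    S.dl_sub τ₀ h lam (h1.add h2) ((contDiff_dbar τ₀ h μ hc).mul (contDiff_shift hφ _)),
    S.dl_add τ₀ h lam h1 h2]
  ring

end Expansion

/-! ### Bounds for the remainders -/

theorem abs_one_sub_le {θ : ℝ} (hθ : θ ∈ Icc (0 : ℝ) 1) : |1 - θ| ≤ 1 := by
  rw [abs_le]; constructor <;> linarith [hθ.1, hθ.2]

section Bounds

variable {τ₀ h} (hτ₀ : 0 < τ₀) (hh : h ≠ 0) {K₁ K₂ : Type} [Fintype K₁] [Fintype K₂]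

include hτ₀ hh

/-- Centering turns `h⁻¹ δ_{h,λ}` into averages of second derivatives, so the operator costs two
orders of `W`, uniformly in `h`. -/
theorem W_Qop_le (n : ℕ) {b : K₁ → S.Λ₁ → E d → ℝ} (y : K₁ → E d) {φ : K₂ → E d → ℝ}
    (hb : ∀ k l, ContDiff ℝ ∞ (b k l)) (hφ : ∀ k, ContDiff ℝ ∞ (φ k)) {B Φ : ℝ}
    (hcen : ∀ k x, ∑ l, b k l x • (l : E d) = 0)
    (hB : ∀ s ≤ n, ∀ x, ∑ k, ∑ l, S.W τ₀ h s (b k l) x ≤ B)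
    (hΦ : ∀ j ≤ n + 2, ∀ x, ∑ k, S.W τ₀ h j (φ k) x ≤ Φ) (x : E d) :
    ∑ k₁, ∑ k₂, S.W τ₀ h n (S.Qop h (b k₁) (fun x => φ k₂ (x + y k₁))) x ≤
      4 ^ n * B * ((S.size / τ₀) ^ 4 * Φ) := by
  have hw : ContDiff ℝ ∞ fun θ : ℝ => 1 - θ := contDiff_const.sub contDiff_id
  have e : ∀ k₁ k₂, S.Qop h (b k₁) (fun x => φ k₂ (x + y k₁)) = fun x =>
      ∑ l, b k₁ l x * Jop (fun θ => 1 - θ) (l : E d) 2 h (φ k₂) (x + y k₁) := by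
    intro k₁ k₂
    funext x
    unfold Qop
    rw [S.centered_eq_Jop hh (hcen k₁ x) (contDiff_shift (hφ k₂) _)]
    simp only [Jop_shift]
  simp only [e]
  refine S.W_prod_le τ₀ h n (φ := fun k (l : S.Λ₁) => Jop (fun θ => 1 - θ) (l : E d) 2 h (φ k)) y hb
    (fun k l => contDiff_Jop _ _ _ hw (hφ k)) hB (fun s hs x => ?_) x
  exact S.sum_W_Jop_le τ₀ h hτ₀ hw (fun θ hθ => abs_one_sub_le hθ) 2 (by norm_num) h hφ s
    (fun x => hΦ (s + 2) (by omega) x) x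

/-- Here the quotients are averages of first derivatives: the cost is one order, and no centering is
needed. -/
theorem W_Pop_le (n : ℕ) {b : K₁ → S.Λ₁ → E d → ℝ} (y : K₁ → E d) {φ : K₂ → E d → ℝ}
    (hb : ∀ k l, ContDiff ℝ ∞ (b k l)) (hφ : ∀ k, ContDiff ℝ ∞ (φ k)) {B Φ : ℝ}
    (hB : ∀ s ≤ n, ∀ x, ∑ k, ∑ l, S.W τ₀ h s (b k l) x ≤ B)
    (hΦ : ∀ j ≤ n + 1, ∀ x, ∑ k, S.W τ₀ h j (φ k) x ≤ Φ) (x : E d) :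
    ∑ k₁, ∑ k₂, S.W τ₀ h n (S.Pop h (b k₁) (fun x => φ k₂ (x + y k₁))) x ≤
      4 ^ n * B * ((S.size / τ₀) ^ 2 * Φ) := by
  have hw : ContDiff ℝ ∞ fun _ : ℝ => (1 : ℝ) := contDiff_const
  have e : ∀ k₁ k₂, S.Pop h (b k₁) (fun x => φ k₂ (x + y k₁)) = fun x =>
      ∑ l, b k₁ l x * Jop (fun _ => 1) (l : E d) 1 h (φ k₂) (x + y k₁) := by
    intro k₁ k₂
    funext x
    unfold Pop
    refine Finset.sum_congr rfl fun l _ => ?_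
    rw [S.del_eq_Jop hh l (contDiff_shift (hφ k₂) _), Jop_shift]
  simp only [e]
  refine S.W_prod_le τ₀ h n (φ := fun k (l : S.Λ₁) => Jop (fun _ => 1) (l : E d) 1 h (φ k)) y hb
    (fun k l => contDiff_Jop _ _ _ hw (hφ k)) hB (fun s hs x => ?_) x
  exact S.sum_W_Jop_le τ₀ h hτ₀ hw (fun θ hθ => by simp) 1 le_rfl h hφ s
    (fun x => hΦ (s + 1) (by omega) x) x

omit hτ₀ hh in
theorem sum_W_succ {K ι : Type} [Fintype K] [Fintype ι] (n : ℕ) (b : K → ι → E d → ℝ) (x : E d) :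
    ∑ k : K × S.Idx, ∑ i, S.W τ₀ h n (S.dbar τ₀ h k.2 (b k.1 i)) x =
      ∑ k, ∑ i, S.W τ₀ h (n + 1) (b k i) x := by
  rw [Fintype.sum_prod_type]
  refine Finset.sum_congr rfl fun k _ => ?_
  rw [Finset.sum_comm]
  simp only [W_succ]

omit hτ₀ hh in
theorem sum_W_succ' {K : Type} [Fintype K] (n : ℕ) (b : K → E d → ℝ) (x : E d) :
    ∑ k : K × S.Idx, S.W τ₀ h n (S.dbar τ₀ h k.2 (b k.1)) x = ∑ k, S.W τ₀ h (n + 1) (b k) x := by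
  rw [Fintype.sum_prod_type]
  simp only [W_succ]

end Bounds

/-- The constant in the bound of `remQ`. -/
def cQ (α : ℝ) : ℕ → ℝ
  | 0 => 0
  | n + 1 => 2 * cQ α n + 2 * (4 ^ n * α ^ 4)

/-- The constant in the bound of `remD`. -/
def cD (α : ℝ) : ℕ → ℝ
  | 0 => 0
  | n + 1 => 3 * cD α n + 3 * cQ α n + 3 * (4 ^ n * α ^ 2)

/-- The constant in the bound of `remL`. -/
def cL (α : ℝ) : ℕ → ℝ
  | 0 => 0
  | n + 1 => 3 * cL α n + 3 * cD α n + 3 * 4 ^ n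

theorem sq_add3_le (a b c : ℝ) : (a + b + c) ^ 2 ≤ 3 * a ^ 2 + 3 * b ^ 2 + 3 * c ^ 2 := by
  nlinarith [sq_nonneg (a - b), sq_nonneg (a - c), sq_nonneg (b - c)]

section Bounds

variable {τ₀ h} (hτ₀ : 0 < τ₀) (hh : h ≠ 0) {K₁ K₂ : Type} [Fintype K₁] [Fintype K₂]

include hτ₀ hh

/-- In the commutator at least one of the `n` operators falls on the coefficients. At most `n - 1`
remain for `φ`, and the difference operator adds two, which gives the orders up to `n + 1`. -/
theorem remQ_le (n : ℕ) {b : K₁ → S.Λ₁ → E d → ℝ} (y : K₁ → E d) {φ : K₂ → E d → ℝ}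
    (hb : ∀ k l, ContDiff ℝ ∞ (b k l)) (hφ : ∀ k, ContDiff ℝ ∞ (φ k)) {B Φ : ℝ}
    (hcen : ∀ k x, ∑ l, b k l x • (l : E d) = 0)
    (hB : ∀ s ≤ n, ∀ x, ∑ k, ∑ l, S.W τ₀ h s (b k l) x ≤ B)
    (hΦ : ∀ j ≤ n + 1, ∀ x, ∑ k, S.W τ₀ h j (φ k) x ≤ Φ) (x : E d) :
    ∑ k₁, ∑ k₂, lsum n (fun lam => (S.remQ τ₀ h (b k₁) (y k₁) lam (φ k₂) x) ^ 2) ≤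
      cQ (S.size / τ₀) n * B * Φ := by
  induction n generalizing K₁ K₂ with
  | zero => simp [lsum_zero, remQ, cQ]
  | succ n ih =>
    simp only [lsum_succ]
    have key : ∀ k₁ k₂ ν, lsum n (fun lam => (S.remQ τ₀ h (b k₁) (y k₁) (ν :: lam) (φ k₂) x) ^ 2) ≤
        2 * lsum n (fun lam => (S.remQ τ₀ h (b k₁) (y k₁) lam (S.dbar τ₀ h ν (φ k₂)) x) ^ 2) +
        2 * S.W τ₀ h n (S.Qop h (S.cf τ₀ h ν (b k₁))
          (fun x => φ k₂ (x + (S.sv h ν + y k₁)))) x := by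
      intro k₁ k₂ ν
      simp only [W, ← lsum_mul_left, ← lsum_add]
      refine lsum_mono n fun lam => ?_
      rw [S.remQ_cons τ₀ h (hb k₁) (y k₁) ν lam (hφ k₂)]
      exact add_sq_le.trans (le_of_eq (by ring))
    refine (Finset.sum_le_sum fun k₁ _ => Finset.sum_le_sum fun k₂ _ =>
      Finset.sum_le_sum fun ν _ => key k₁ k₂ ν).trans ?_
    simp only [Finset.sum_add_distrib, ← Finset.mul_sum]
    have h1 := ih (K₁ := K₁) (K₂ := K₂ × S.Idx) y (φ := fun k => S.dbar τ₀ h k.2 (φ k.1)) hb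
      (fun k => contDiff_dbar τ₀ h _ (hφ k.1)) hcen (fun s hs => hB s (by omega))
      (fun j hj x => by rw [sum_W_succ']; exact hΦ (j + 1) (by omega) x)
    have h2 := S.W_Qop_le hτ₀ hh n (K₁ := K₁ × S.Idx) (b := fun k => S.cf τ₀ h k.2 (b k.1))
      (fun k => S.sv h k.2 + y k.1) (fun k => contDiff_cf τ₀ h _ (hb k.1)) hφ
      (fun k x => S.cf_centered τ₀ h _ (hb k.1) (hcen k.1) x)
      (fun s hs x => by simp only [cf]; rw [sum_W_succ]; exact hB (s + 1) (by omega) x)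
      (fun j hj x => hΦ j (by omega) x) x
    simp only [Fintype.sum_prod_type] at h1 h2
    rw [Finset.sum_congr rfl fun k₁ _ => Finset.sum_comm] at h2
    calc _ ≤ 2 * (cQ (S.size / τ₀) n * B * Φ) + 2 * (4 ^ n * B * ((S.size / τ₀) ^ 4 * Φ)) := by
          gcongr
      _ = _ := by rw [cQ]; ring

variable {q p : S.Λ₁ → E d → ℝ} {c : E d → ℝ}
  (hq : ∀ l, ContDiff ℝ ∞ (q l)) (hp : ∀ l, ContDiff ℝ ∞ (p l))
  (hc : ContDiff ℝ ∞ c) (hcen : ∀ x, ∑ l, q l x • (l : E d) = 0)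

include hq hp hcen

/-- After the subtraction at least two of the `n` operators sit on `q`, or at least one on `p`. The
orders left for `φ` are at most `n - 2 + 2` and `n - 1 + 1`. -/
theorem remD_le (n : ℕ) {φ : K₂ → E d → ℝ} (hφ : ∀ k, ContDiff ℝ ∞ (φ k)) {B Φ : ℝ}
    (hBq : ∀ s ≤ n + 1, ∀ x, ∑ l, S.W τ₀ h s (q l) x ≤ B)
    (hBp : ∀ s ≤ n + 1, ∀ x, ∑ l, S.W τ₀ h s (p l) x ≤ B)
    (hΦ : ∀ j ≤ n, ∀ x, ∑ k, S.W τ₀ h j (φ k) x ≤ Φ) (x : E d) :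
    ∑ μ, ∑ k₂, lsum n (fun lam => (S.remD τ₀ h q p μ lam (φ k₂) x) ^ 2) ≤
      cD (S.size / τ₀) n * B * Φ := by
  induction n generalizing K₂ with
  | zero => simp [lsum_zero, remD, crossTerms, cD]
  | succ n ih =>
    simp only [lsum_succ]
    have key : ∀ μ k₂ ν, lsum n (fun lam => (S.remD τ₀ h q p μ (ν :: lam) (φ k₂) x) ^ 2) ≤
        3 * lsum n (fun lam => (S.remD τ₀ h q p μ lam (S.dbar τ₀ h ν (φ k₂)) x) ^ 2) +
        3 * lsum n (fun lam => (S.remQ τ₀ h (S.cf τ₀ h ν (S.cf τ₀ h μ q))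
          (S.sv h μ + S.sv h ν) lam (φ k₂) x) ^ 2) +
        3 * S.W τ₀ h n (S.Pop h (S.cf τ₀ h ν (S.cf τ₀ h μ p))
          (fun x => φ k₂ (x + (S.sv h μ + S.sv h ν)))) x := by
      intro μ k₂ ν
      simp only [W, ← lsum_mul_left, ← lsum_add]
      refine lsum_mono n fun lam => ?_
      rw [S.remD_cons τ₀ h hq hp μ ν lam (hφ k₂)]
      exact sq_add3_le _ _ _
    refine (Finset.sum_le_sum fun k₁ _ => Finset.sum_le_sum fun k₂ _ =>
      Finset.sum_le_sum fun ν _ => key k₁ k₂ ν).trans ?_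
    simp only [Finset.sum_add_distrib, ← Finset.mul_sum]
    -- Summing over the two indices that sit on the coefficients turns `W_s` of the differenced
    -- coefficients into `W_{s+2}` of the coefficients themselves.
    have hBB : ∀ {r : S.Λ₁ → E d → ℝ}, (∀ s ≤ n + 1 + 1, ∀ x, ∑ l, S.W τ₀ h s (r l) x ≤ B) →
        ∀ s ≤ n, ∀ x, ∑ k : S.Idx × S.Idx, ∑ l,
          S.W τ₀ h s (S.cf τ₀ h k.2 (S.cf τ₀ h k.1 r) l) x ≤ B := by
      intro r hr s hs x
      have e1 := S.sum_W_succ (τ₀ := τ₀) (h := h) s (fun μ : S.Idx => S.cf τ₀ h μ r) x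
      have e2 := S.sum_W_succ (τ₀ := τ₀) (h := h) (s + 1) (fun _ : Unit => r) x
      simp only [Fintype.sum_prod_type, Finset.univ_unique, Finset.sum_singleton] at e1 e2
      simp only [Fintype.sum_prod_type]
      exact (le_of_eq (e1.trans e2)).trans (hr (s + 1 + 1) (by omega) x)
    have h1 := ih (K₂ := K₂ × S.Idx) (φ := fun k => S.dbar τ₀ h k.2 (φ k.1))
      (fun k => contDiff_dbar τ₀ h _ (hφ k.1)) (fun s hs => hBq s (by omega))
      (fun s hs => hBp s (by omega))
      (fun j hj x => by rw [sum_W_succ']; exact hΦ (j + 1) (by omega) x)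
    have h2 := S.remQ_le hτ₀ hh n (K₁ := S.Idx × S.Idx)
      (b := fun k => S.cf τ₀ h k.2 (S.cf τ₀ h k.1 q))
      (fun k => S.sv h k.1 + S.sv h k.2)
      (fun k => contDiff_cf τ₀ h _ (contDiff_cf τ₀ h _ hq)) hφ
      (fun k x => S.cf_centered τ₀ h _ (contDiff_cf τ₀ h _ hq)
        (S.cf_centered τ₀ h _ hq hcen) x)
      (hBB hBq) hΦ x
    have h3 := S.W_Pop_le hτ₀ hh n (K₁ := S.Idx × S.Idx)
      (b := fun k => S.cf τ₀ h k.2 (S.cf τ₀ h k.1 p))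
      (fun k => S.sv h k.1 + S.sv h k.2)
      (fun k => contDiff_cf τ₀ h _ (contDiff_cf τ₀ h _ hp)) hφ (hBB hBp) hΦ x
    simp only [Fintype.sum_prod_type] at h1 h2 h3
    rw [Finset.sum_congr rfl fun k₁ _ => Finset.sum_comm] at h2 h3
    calc _ ≤ 3 * (cD (S.size / τ₀) n * B * Φ) + 3 * (cQ (S.size / τ₀) n * B * Φ) +
          3 * (4 ^ n * B * ((S.size / τ₀) ^ 2 * Φ)) := by gcongr
      _ = _ := by rw [cD]; ring

include hc

/-- What is left has at least three operators on `q`, two on `p`, or one on `c`. In each case at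
most `n - 1` orders fall on `φ`, strictly fewer than the length of the word; this is what permits an
induction on the order. -/
theorem remL_le (n : ℕ) {φ : K₂ → E d → ℝ} (hφ : ∀ k, ContDiff ℝ ∞ (φ k)) {B Φ : ℝ}
    (hBq : ∀ s ≤ n, ∀ x, ∑ l, S.W τ₀ h s (q l) x ≤ B)
    (hBp : ∀ s ≤ n, ∀ x, ∑ l, S.W τ₀ h s (p l) x ≤ B)
    (hBc : ∀ s ≤ n, ∀ x, S.W τ₀ h s c x ≤ B)
    (hΦ : ∀ j < n, ∀ x, ∑ k, S.W τ₀ h j (φ k) x ≤ Φ) (x : E d) :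
    ∑ k₂, lsum n (fun lam => (S.remL τ₀ h q p c lam (φ k₂) x) ^ 2) ≤
      cL (S.size / τ₀) n * B * Φ := by
  induction n generalizing K₂ with
  | zero => simp [lsum_zero, remL, firstTerms, secondTerms, cL]
  | succ n ih =>
    simp only [lsum_succ]
    have key : ∀ k₂ μ, lsum n (fun lam => (S.remL τ₀ h q p c (μ :: lam) (φ k₂) x) ^ 2) ≤
        3 * lsum n (fun lam => (S.remL τ₀ h q p c lam (S.dbar τ₀ h μ (φ k₂)) x) ^ 2) +
        3 * lsum n (fun lam => (S.remD τ₀ h q p μ lam (φ k₂) x) ^ 2) +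
        3 * S.W τ₀ h n (fun x => S.dbar τ₀ h μ c x * φ k₂ (x + S.sv h μ)) x := by
      intro k₂ μ
      simp only [W, ← lsum_mul_left, ← lsum_add]
      refine lsum_mono n fun lam => ?_
      rw [S.remL_cons τ₀ h hq hp hc μ lam (hφ k₂), sub_eq_add_neg]
      exact (sq_add3_le _ _ _).trans (by rw [neg_sq])
    refine (Finset.sum_le_sum fun k₂ _ =>
      Finset.sum_le_sum fun μ _ => key k₂ μ).trans ?_
    simp only [Finset.sum_add_distrib, ← Finset.mul_sum]
    have h1 := ih (K₂ := K₂ × S.Idx) (φ := fun k => S.dbar τ₀ h k.2 (φ k.1))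
      (fun k => contDiff_dbar τ₀ h _ (hφ k.1)) (fun s hs => hBq s (by omega))
      (fun s hs => hBp s (by omega)) (fun s hs => hBc s (by omega))
      (fun j hj x => by rw [sum_W_succ']; exact hΦ (j + 1) (by omega) x)
    have h2 := S.remD_le hτ₀ hh hq hp hcen n hφ hBq hBp (fun j hj => hΦ j (by omega)) x
    have h3 := S.W_prod_le τ₀ h n (K₁ := S.Idx) (K₂ := K₂) (ι := Unit)
      (b := fun μ _ => S.dbar τ₀ h μ c) (φ := fun k _ => φ k) (fun μ => S.sv h μ)
      (fun μ _ => contDiff_dbar τ₀ h μ hc) (fun k _ => hφ k) (B := B) (Φ := Φ)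
      (fun s hs x => by
        simp only [Finset.univ_unique, Finset.sum_singleton, ← W_succ]
        exact hBc (s + 1) (by omega) x)
      (fun s hs x => by
        simp only [Finset.univ_unique, Finset.sum_singleton]
        exact hΦ s (by omega) x) x
    simp only [Fintype.sum_prod_type] at h1
    simp only [Finset.univ_unique, Finset.sum_singleton] at h3
    rw [Finset.sum_comm] at h2 h3
    calc _ ≤ 3 * (cL (S.size / τ₀) n * B * Φ) + 3 * (cD (S.size / τ₀) n * B * Φ) +
          3 * (4 ^ n * B * Φ) := by gcongr
      _ = _ := by rw [cL]; ring

end Bounds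

end Scheme

end FDScheme

namespace FDScheme

/-! ### Smooth functions bounded with all derivatives -/

section SmoothBdd

variable {d : ℕ} {φ ψ : E d → ℝ}

theorem SmoothBdd.shift (hφ : SmoothBdd φ) (y : E d) : SmoothBdd (fun x => φ (x + y)) := by
  refine ⟨hφ.1.comp (contDiff_id.add contDiff_const), fun n => ?_⟩
  obtain ⟨C, hC⟩ := hφ.2 n
  exact ⟨C, fun x => by rw [iteratedFDeriv_comp_add_right]; exact hC _⟩

theorem SmoothBdd.sub (hφ : SmoothBdd φ) (hψ : SmoothBdd ψ) :
    SmoothBdd (fun x => φ x - ψ x) := by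
  refine ⟨hφ.1.sub hψ.1, fun n => ?_⟩
  obtain ⟨C, hC⟩ := hφ.2 n
  obtain ⟨C', hC'⟩ := hψ.2 n
  refine ⟨C + C', fun x => ?_⟩
  have := iteratedFDeriv_sub_apply (i := n) (x := x)
    ((contDiff_infty.1 hφ.1 n).contDiffAt (x := x)) ((contDiff_infty.1 hψ.1 n).contDiffAt)
  have e : (fun x => φ x - ψ x) = φ - ψ := rfl
  rw [e, this]
  exact (norm_sub_le _ _).trans (add_le_add (hC x) (hC' x))

theorem SmoothBdd.const_mul (hφ : SmoothBdd φ) (a : ℝ) : SmoothBdd (fun x => a * φ x) := by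
  refine ⟨contDiff_const.mul hφ.1, fun n => ?_⟩
  obtain ⟨C, hC⟩ := hφ.2 n
  refine ⟨|a| * C, fun x => ?_⟩
  have := iteratedFDeriv_const_smul_apply (i := n) (x := x) (a := a)
    ((contDiff_infty.1 hφ.1 n).contDiffAt (x := x))
  have e : (fun x => a * φ x) = a • φ := rfl
  rw [e, this, norm_smul, Real.norm_eq_abs]
  exact mul_le_mul_of_nonneg_left (hC x) (abs_nonneg _)

theorem SmoothBdd.dd (hφ : SmoothBdd φ) (v : E d) : SmoothBdd (dd v φ) := by
  refine ⟨contDiff_dd hφ.1, fun n => ?_⟩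
  obtain ⟨C, hC⟩ := hφ.2 (n + 1)
  refine ⟨‖ContinuousLinearMap.apply ℝ ℝ v‖ * C, fun x => ?_⟩
  have h1 : ContDiff ℝ n (fderiv ℝ φ) := (hφ.1.fderiv_right (m := ∞) (by simp)).of_le
    (mod_cast le_top)
  have := (ContinuousLinearMap.apply ℝ ℝ v).norm_iteratedFDeriv_comp_left
    (h1.contDiffAt (x := x)) le_rfl
  refine this.trans (mul_le_mul_of_nonneg_left ?_ (norm_nonneg _))
  rw [norm_iteratedFDeriv_fderiv]
  exact hC x

theorem SmoothBdd.bounded (hφ : SmoothBdd φ) : ∃ C, ∀ x, |φ x| ≤ C := by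
  obtain ⟨C, hC⟩ := hφ.2 0
  exact ⟨C, fun x => by simpa using hC x⟩

end SmoothBdd

namespace Scheme

variable {d : ℕ} (S : Scheme d) (τ₀ h : ℝ)

theorem smoothBdd_dbar (μ : S.Idx) {φ : E d → ℝ} (hφ : SmoothBdd φ) :
    SmoothBdd (S.dbar τ₀ h μ φ) := by
  cases μ with
  | inl l => exact ((hφ.shift _).sub hφ).const_mul _
  | inr i => exact (hφ.dd _).const_mul _

theorem smoothBdd_dl (lam : List S.Idx) {φ : E d → ℝ} (hφ : SmoothBdd φ) :
    SmoothBdd (S.dl τ₀ h lam φ) := by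
  induction lam generalizing φ with
  | nil => exact hφ
  | cons μ lam ih => exact ih (S.smoothBdd_dbar τ₀ h μ hφ)

/-! ### The structural conditions with suprema in place of positive operators -/

variable (q p : S.Λ₁ → E d → ℝ) (c : E d → ℝ)

/-- `𝒬_h` with given coefficients. -/
def QQop (φ : E d → ℝ) (x : E d) : ℝ := ∑ l, (q l x + h * p l x) * (S.del h l φ x) ^ 2

/-- `A_h` with given smooth coefficients. -/
def Aop (φ : E d → ℝ) (x : E d) : ℝ :=
  2 * ∑ μ, S.dbar τ₀ h μ φ x * S.Dop τ₀ h q p μ (fun x => φ (x + S.sv h μ)) x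

/-- `∑_{λ ∈ Λ²} (δ̄_{h,λ} φ) Q_{h,λ} T_{h,λ} φ` with given smooth coefficients. -/
def Bop (φ : E d → ℝ) (x : E d) : ℝ :=
  ∑ μ, ∑ ν, S.dbar τ₀ h ν (S.dbar τ₀ h μ φ) x * S.Qop h (S.cf τ₀ h ν (S.cf τ₀ h μ q))
    (fun x => φ (x + (S.sv h μ + S.sv h ν))) x

/-- The first structural condition with a supremum. -/
def SupI (m : ℕ) (δ K : ℝ) : Prop :=
  ∀ φ : E d → ℝ, SmoothBdd φ → ∀ G : ℝ, (∀ x, S.W τ₀ h 1 φ x ≤ G) → ∀ x,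
    (m : ℝ) * S.Aop τ₀ h q p φ x ≤
      (1 - δ) * lsum 1 (fun lam => S.QQop h q p (S.dl τ₀ h lam φ) x) + K * S.QQop h q p φ x +
      2 * (1 - δ) * c x * G

/-- The second structural condition with suprema, for finite families. -/
def SupII (n : ℕ) (δ K : ℝ) : Prop :=
  ∀ (κ : Type) [Fintype κ] (φ : κ → E d → ℝ), (∀ k, SmoothBdd (φ k)) → ∀ G₁ G₂ : ℝ,
    (∀ x, ∑ k, S.W τ₀ h 1 (φ k) x ≤ G₁) → (∀ x, ∑ k, S.W τ₀ h 2 (φ k) x ≤ G₂) → ∀ x,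
    ∑ k, ((n : ℝ) * ∑ ν, S.Aop τ₀ h q p (S.dbar τ₀ h ν (φ k)) x +
        (n : ℝ) * ((n : ℝ) - 1) * S.Bop τ₀ h q (φ k) x) ≤
      ∑ k, ((1 - δ) * lsum 2 (fun lam => S.QQop h q p (S.dl τ₀ h lam (φ k)) x) +
        K * lsum 1 (fun lam => S.QQop h q p (S.dl τ₀ h lam (φ k)) x)) +
      2 * (1 - δ) * c x * G₂ + K * G₁

/-! ### The quadratic form of the expansion -/

theorem lsum_dl_add (X : (E d → ℝ) → ℝ) (n j : ℕ) (φ : E d → ℝ) :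
    lsum n (fun lam => lsum j (fun lam' => X (S.dl τ₀ h lam' (S.dl τ₀ h lam φ)))) =
      lsum (n + j) (fun lam => X (S.dl τ₀ h lam φ)) := by
  induction n generalizing φ with
  | zero => simp [lsum_zero]
  | succ n ih =>
    rw [lsum_succ, Nat.succ_add, Nat.succ_eq_add_one, lsum_succ]
    exact Finset.sum_congr rfl fun μ _ => ih (S.dbar τ₀ h μ φ)

theorem lsum_W (n j : ℕ) (φ : E d → ℝ) (x : E d) :
    lsum n (fun lam => S.W τ₀ h j (S.dl τ₀ h lam φ) x) = S.W τ₀ h (n + j) φ x :=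
  S.lsum_dl_add τ₀ h (fun ψ => (ψ x) ^ 2) n j φ

/-- The operator that hits the coefficients may stand at any of `n + 1` positions of the word, and
by commutativity every position contributes the same sum. The half compensates the factor 2 in
`A_h`. -/
theorem lsum_firstTerms (n : ℕ) {φ : E d → ℝ} (hφ : ContDiff ℝ ∞ φ) (x : E d) :
    lsum (n + 1) (fun lam => S.dl τ₀ h lam φ x * S.firstTerms τ₀ h q p lam φ x) =
      ((n : ℝ) + 1) / 2 * lsum n (fun lam => S.Aop τ₀ h q p (S.dl τ₀ h lam φ) x) := by
  induction n generalizing φ with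
  | zero =>
    rw [lsum_succ]
    simp only [lsum_zero, dl_cons, dl_nil, firstTerms, Aop, Finset.mul_sum]
    refine Finset.sum_congr rfl fun μ _ => ?_
    push_cast
    ring
  | succ n ih =>
    rw [lsum_succ]
    simp only [firstTerms, mul_add, lsum_add, dl_cons, Finset.sum_add_distrib]
    rw [Finset.sum_congr rfl fun μ _ => ih (contDiff_dbar τ₀ h μ hφ), ← Finset.mul_sum,
      ← lsum_comm]
    have e : lsum (n + 1) (fun lam => S.Aop τ₀ h q p (S.dl τ₀ h lam φ) x) =
        ∑ μ, lsum n (fun lam => S.Aop τ₀ h q p (S.dl τ₀ h lam (S.dbar τ₀ h μ φ)) x) := by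
      rw [lsum_succ]; rfl
    rw [← e]
    have e2 : lsum (n + 1) (fun lam => ∑ μ, S.dl τ₀ h lam (S.dbar τ₀ h μ φ) x *
          S.Dop τ₀ h q p μ (fun x => S.dl τ₀ h lam φ (x + S.sv h μ)) x) =
        lsum (n + 1) (fun lam => 1 / 2 * S.Aop τ₀ h q p (S.dl τ₀ h lam φ) x) := by
      congr 1
      funext lam
      simp only [Aop, S.dl_dbar τ₀ h lam _ hφ]
      ring
    rw [e2, lsum_mul_left]
    push_cast
    ring

/-- One of the two operators on `q` is the distinguished `μ`; the other stands at any of the `n + 1`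
positions of the word, with equal contributions. -/
theorem lsum_crossTerms (n : ℕ) {φ : E d → ℝ} (hφ : ContDiff ℝ ∞ φ) (x : E d) :
    ∑ μ, lsum (n + 1) (fun lam => S.dl τ₀ h lam (S.dbar τ₀ h μ φ) x *
        S.crossTerms τ₀ h q μ lam φ x) =
      ((n : ℝ) + 1) * lsum n (fun lam => S.Bop τ₀ h q (S.dl τ₀ h lam φ) x) := by
  induction n generalizing φ with
  | zero =>
    simp only [lsum_succ, lsum_zero, dl_cons, dl_nil, crossTerms, Bop]
    push_cast
    simp
  | succ n ih =>
    simp only [fun (F : List S.Idx → ℝ) => lsum_succ (n + 1) F, crossTerms, mul_add, lsum_add,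
      dl_cons, Finset.sum_add_distrib]
    have e1 : ∑ μ, ∑ ν, lsum (n + 1) (fun lam => S.dl τ₀ h lam (S.dbar τ₀ h ν (S.dbar τ₀ h μ φ)) x *
          S.crossTerms τ₀ h q μ lam (S.dbar τ₀ h ν φ) x) =
        ∑ ν, ((n : ℝ) + 1) * lsum n (fun lam =>
          S.Bop τ₀ h q (S.dl τ₀ h lam (S.dbar τ₀ h ν φ)) x) := by
      rw [Finset.sum_comm]
      refine Finset.sum_congr rfl fun ν _ => ?_
      rw [← ih (contDiff_dbar τ₀ h ν hφ)]
      simp only [S.dbar_comm τ₀ h ν _ hφ]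
    have e3 : lsum (n + 1) (fun lam => S.Bop τ₀ h q (S.dl τ₀ h lam φ) x) =
        ∑ μ, lsum n (fun lam => S.Bop τ₀ h q (S.dl τ₀ h lam (S.dbar τ₀ h μ φ)) x) := by
      rw [lsum_succ]; rfl
    have e2 : ∑ μ, ∑ ν, lsum (n + 1) (fun lam => S.dl τ₀ h lam (S.dbar τ₀ h ν (S.dbar τ₀ h μ φ)) x *
          S.Qop h (S.cf τ₀ h ν (S.cf τ₀ h μ q))
            (fun x => S.dl τ₀ h lam φ (x + (S.sv h μ + S.sv h ν))) x) =
        lsum (n + 1) (fun lam => S.Bop τ₀ h q (S.dl τ₀ h lam φ) x) := by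
      simp only [← lsum_comm, Bop]
      congr 1
      funext lam
      simp only [S.dl_dbar τ₀ h lam _ hφ, S.dl_dbar τ₀ h lam _ (contDiff_dbar τ₀ h _ hφ)]
    rw [e1, ← Finset.mul_sum, ← e3, e2]
    push_cast
    ring

/-- The factor is the number of pairs of positions in a word of length `n + 2`. Doubled, it is `n(n
- 1)` of the second structural condition with `n + 2` for `n`. -/
theorem lsum_secondTerms (n : ℕ) {φ : E d → ℝ} (hφ : ContDiff ℝ ∞ φ) (x : E d) :
    lsum (n + 2) (fun lam => S.dl τ₀ h lam φ x * S.secondTerms τ₀ h q lam φ x) =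
      ((n : ℝ) + 2) * ((n : ℝ) + 1) / 2 *
        lsum n (fun lam => S.Bop τ₀ h q (S.dl τ₀ h lam φ) x) := by
  induction n generalizing φ with
  | zero =>
    have := S.lsum_crossTerms τ₀ h q 0 hφ x
    simp only [lsum_zero, dl_nil] at this ⊢
    rw [lsum_succ]
    simp only [secondTerms, mul_add, lsum_add, dl_cons, Finset.sum_add_distrib]
    rw [this]
    simp only [lsum_succ, lsum_zero, secondTerms, crossTerms]
    push_cast
    simp
  | succ n ih =>
    rw [lsum_succ]
    simp only [secondTerms, mul_add, lsum_add, dl_cons, Finset.sum_add_distrib]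
    have e3 : lsum (n + 1) (fun lam => S.Bop τ₀ h q (S.dl τ₀ h lam φ) x) =
        ∑ μ, lsum n (fun lam => S.Bop τ₀ h q (S.dl τ₀ h lam (S.dbar τ₀ h μ φ)) x) := by
      rw [lsum_succ]; rfl
    rw [S.lsum_crossTerms τ₀ h q (n + 1) hφ x,
      Finset.sum_congr rfl fun μ _ => ih (contDiff_dbar τ₀ h μ hφ), ← Finset.mul_sum, ← e3]
    push_cast
    ring

/-! ### The Bernstein inequality -/

/-- The second order part of `L_h`. -/
def Mop (ψ : E d → ℝ) (x : E d) : ℝ :=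
  ∑ l : S.Λ₁, h⁻¹ * h⁻¹ * (q l x + h * p l x) * (ψ (x + h • (l : E d)) - ψ x)

variable {q p c h}

/-- This is `2a(b - a) = b² - a² - (b - a)²` at every stencil point, with the first and second order
parts merged into the single weight `h⁻² χ_{h,λ}`. -/
theorem energy_identity (hh : h ≠ 0) (φ : E d → ℝ) (x : E d) :
    2 * (φ x * S.Lop h q p c φ x) =
      S.Mop h q p (fun x => (φ x) ^ 2) x - S.QQop h q p φ x - 2 * c x * (φ x) ^ 2 := by
  have e : S.Lop h q p c φ x = ∑ l : S.Λ₁, h⁻¹ * h⁻¹ * (q l x + h * p l x) *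
      (φ (x + h • (l : E d)) - φ x) - c x * φ x := by
    simp only [Lop, Qop, Pop, Finset.mul_sum, ← Finset.sum_add_distrib, del]
    congr 1
    refine Finset.sum_congr rfl fun l _ => ?_
    field_simp
  rw [e]
  have e2 : S.Mop h q p (fun x => (φ x) ^ 2) x - S.QQop h q p φ x =
      2 * φ x * ∑ l : S.Λ₁, h⁻¹ * h⁻¹ * (q l x + h * p l x) * (φ (x + h • (l : E d)) - φ x) := by
    simp only [Mop, QQop, del]
    rw [← Finset.sum_sub_distrib, Finset.mul_sum]
    exact Finset.sum_congr rfl fun l _ => by ring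
  rw [e2]
  ring

theorem lsum_Mop (n : ℕ) (F : List S.Idx → E d → ℝ) (x : E d) :
    lsum n (fun lam => S.Mop h q p (F lam) x) = S.Mop h q p (fun x => lsum n fun lam => F lam x) x := by
  simp only [Mop]
  rw [lsum_comm]
  refine Finset.sum_congr rfl fun l _ => ?_
  rw [lsum_mul_left, lsum_sub]

variable {S τ₀} {m : ℕ} {δ K : ℝ}

theorem QQop_nonneg (hχ : ∀ l x, 0 ≤ q l x + h * p l x) (φ : E d → ℝ) (x : E d) :
    0 ≤ S.QQop h q p φ x :=
  Finset.sum_nonneg fun l _ => mul_nonneg (hχ l x) (sq_nonneg _)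

/-- For words of length one only `A_h(φ)` occurs and the first condition applies. Longer words are
covered by the second condition, used for the family of all shorter words applied to `φ`. -/
theorem structural_le (hδ1 : δ ≤ 1) (hK : 0 ≤ K) (hχ : ∀ l x, 0 ≤ q l x + h * p l x)
    (hc : ∀ x, 0 ≤ c x) (hI : S.SupI τ₀ h q p c m δ K)
    (hII : ∀ n ∈ Finset.Icc 1 m, S.SupII τ₀ h q p c n δ K) (n : ℕ) (hn : n + 1 ≤ m)
    {φ : E d → ℝ} (hφ : SmoothBdd φ) {Ω Φ : ℝ} (hΩ : ∀ x, S.W τ₀ h (n + 1) φ x ≤ Ω)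
    (hΦ : ∀ j ≤ n, ∀ x, S.W τ₀ h j φ x ≤ Φ) (x : E d) :
    2 * lsum (n + 1) (fun lam => S.dl τ₀ h lam φ x * (S.firstTerms τ₀ h q p lam φ x +
        S.secondTerms τ₀ h q lam φ x)) ≤
      (1 - δ) * lsum (n + 1) (fun lam => S.QQop h q p (S.dl τ₀ h lam φ) x) +
      K * lsum n (fun lam => S.QQop h q p (S.dl τ₀ h lam φ) x) + 2 * (1 - δ) * c x * Ω + K * Φ := by
  have hΩ0 : 0 ≤ Ω := (S.W_nonneg _ _ _ _ _).trans (hΩ x)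
  have hΦ0 : 0 ≤ Φ := (S.W_nonneg _ _ _ _ _).trans (hΦ 0 (Nat.zero_le _) x)
  simp only [mul_add, lsum_add]
  rw [S.lsum_firstTerms τ₀ h q p n hφ.1]
  rcases n with _ | n
  · have e : lsum (0 + 1) (fun lam => S.dl τ₀ h lam φ x * S.secondTerms τ₀ h q lam φ x) = 0 := by
      simp [lsum_succ, lsum_zero, secondTerms, crossTerms]
    rw [e]
    simp only [lsum_zero, dl_nil]
    have h1 := hI φ hφ Ω hΩ x
    set R := (1 - δ) * lsum 1 (fun lam => S.QQop h q p (S.dl τ₀ h lam φ) x) +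
      K * S.QQop h q p φ x + 2 * (1 - δ) * c x * Ω with hR
    have hR0 : 0 ≤ R := by
      have := mul_nonneg (sub_nonneg.2 hδ1) (lsum_nonneg 1 fun lam =>
        QQop_nonneg hχ (S.dl τ₀ h lam φ) x)
      have h2 := mul_nonneg hK (QQop_nonneg hχ φ x)
      have h3 := mul_nonneg (mul_nonneg (mul_nonneg zero_le_two (sub_nonneg.2 hδ1)) (hc x)) hΩ0
      positivity
    -- The condition bounds `m A_h`; as `m ≥ 1` and `R ≥ 0`, it bounds `A_h` whatever its sign.
    have hA : S.Aop τ₀ h q p φ x ≤ R := by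
      have hm1 : (1 : ℝ) ≤ m := by exact_mod_cast (by omega : 1 ≤ m)
      rcases le_total (S.Aop τ₀ h q p φ x) 0 with hA | hA
      · exact hA.trans hR0
      · nlinarith
    have := mul_nonneg hK hΦ0
    push_cast
    rw [zero_add]
    linarith
  · rw [S.lsum_secondTerms τ₀ h q n hφ.1]
    -- The family consists of the words of length `n` applied to `φ`, so that its summed `W_1` and
    -- `W_2` are `W_{n+1}` and `W_{n+2}` of `φ`.
    have h1 := hII (n + 2) (Finset.mem_Icc.2 ⟨by omega, by omega⟩) (Fin n → S.Idx)
      (fun k => S.dl τ₀ h (List.ofFn k) φ) (fun k => S.smoothBdd_dl τ₀ h _ hφ) Φ Ω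
      (fun x => by
        have := S.lsum_W τ₀ h n 1 φ x
        exact (le_of_eq this).trans (hΦ (n + 1) le_rfl x))
      (fun x => by
        have := S.lsum_W τ₀ h n 2 φ x
        exact (le_of_eq this).trans (hΩ x)) x
    have e2 := S.lsum_dl_add τ₀ h (fun ψ => S.QQop h q p ψ x) n 2 φ
    have e1 := S.lsum_dl_add τ₀ h (fun ψ => S.QQop h q p ψ x) n 1 φ
    have e0 := S.lsum_dl_add τ₀ h (fun ψ => S.Aop τ₀ h q p ψ x) n 1 φ
    simp only [Finset.sum_add_distrib, ← Finset.mul_sum] at h1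
    have f0 : ∑ k : Fin n → S.Idx, ∑ ν, S.Aop τ₀ h q p (S.dbar τ₀ h ν
        (S.dl τ₀ h (List.ofFn k) φ)) x = lsum (n + 1) (fun lam =>
        S.Aop τ₀ h q p (S.dl τ₀ h lam φ) x) := by
      rw [← e0]
      simp only [lsum_succ 0, lsum_zero, dl_cons, dl_nil]
      rfl
    rw [f0] at h1
    unfold lsum at e1 e2 h1 ⊢
    rw [e1, e2] at h1
    push_cast at h1 ⊢
    linarith

theorem two_mul_add_le {v r f a : ℝ} (ha : 0 < a) :
    2 * (v * (r + f)) ≤ a * v ^ 2 + 2 / a * (r ^ 2 + f ^ 2) := by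
  have h1 : 0 ≤ (a * v - (r + f)) ^ 2 / a := by positivity
  have h2 : (a * v - (r + f)) ^ 2 / a = a * v ^ 2 - 2 * (v * (r + f)) + (r + f) ^ 2 / a := by
    field_simp; ring
  have h3 : (r + f) ^ 2 / a ≤ 2 / a * (r ^ 2 + f ^ 2) := by
    rw [div_mul_eq_mul_div]
    exact div_le_div_of_nonneg_right (by nlinarith [sq_nonneg (r - f)]) ha.le
  linarith

/-- The differential inequality for `W_n`, `n ≥ 1`. -/
theorem bernstein_succ {c₀ B : ℝ} (hτ₀ : 0 < τ₀) (hh : h ≠ 0) (hδ : 0 < δ)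
    (hδ1 : δ ≤ 1) (hK : 0 ≤ K) (hc₀ : 0 < c₀)
    (hq : ∀ l, ContDiff ℝ ∞ (q l)) (hp : ∀ l, ContDiff ℝ ∞ (p l)) (hc : ContDiff ℝ ∞ c)
    (hχ : ∀ l x, 0 ≤ q l x + h * p l x) (hcc : ∀ x, c₀ ≤ c x)
    (hcen : ∀ x, ∑ l, q l x • (l : E d) = 0)
    (hBq : ∀ s ≤ m, ∀ x, ∑ l, S.W τ₀ h s (q l) x ≤ B)
    (hBp : ∀ s ≤ m, ∀ x, ∑ l, S.W τ₀ h s (p l) x ≤ B)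
    (hBc : ∀ s ≤ m, ∀ x, S.W τ₀ h s c x ≤ B)
    (hI : S.SupI τ₀ h q p c m δ K)
    (hII : ∀ n ∈ Finset.Icc 1 m, S.SupII τ₀ h q p c n δ K) (n : ℕ) (hn : n + 1 ≤ m)
    {φ : E d → ℝ} (hφ : SmoothBdd φ) {f : E d → ℝ} (hf : ContDiff ℝ ∞ f) {Ω Φ F : ℝ}
    (hΩ : ∀ x, S.W τ₀ h (n + 1) φ x ≤ Ω)
    (hΦ : ∀ j ≤ n, ∀ x, S.W τ₀ h j φ x ≤ Φ) (hF : ∀ x, S.W τ₀ h (n + 1) f x ≤ F) (x : E d) :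
    2 * lsum (n + 1) (fun lam => S.dl τ₀ h lam φ x *
        S.dl τ₀ h lam (fun x => S.Lop h q p c φ x + f x) x) ≤
      S.Mop h q p (S.W τ₀ h (n + 1) φ) x - (2 - δ) * c x * S.W τ₀ h (n + 1) φ x -
      δ * lsum (n + 1) (fun lam => S.QQop h q p (S.dl τ₀ h lam φ) x) +
      K * lsum n (fun lam => S.QQop h q p (S.dl τ₀ h lam φ) x) + 2 * (1 - δ) * c x * Ω +
      (K * Φ + 2 / (δ * c₀) * (cL (S.size / τ₀) (n + 1) * B * Φ + F)) := by
  have h1 := structural_le hδ1 hK hχ (fun x => hc₀.le.trans (hcc x)) hI hII n hn hφ hΩ hΦ x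
  have h2 := S.remL_le hτ₀ hh (K₂ := Unit) hq hp hc hcen (n + 1) (φ := fun _ => φ)
    (fun _ => hφ.1) (fun s hs => hBq s (by omega)) (fun s hs => hBp s (by omega))
    (fun s hs => hBc s (by omega)) (Φ := Φ)
    (fun j hj x => by simpa using hΦ j (by omega) x) x
  simp only [Finset.univ_unique, Finset.sum_singleton] at h2
  have e1 : ∀ lam, S.dl τ₀ h lam (fun x => S.Lop h q p c φ x + f x) x =
      S.Lop h q p c (S.dl τ₀ h lam φ) x + (S.firstTerms τ₀ h q p lam φ x +
        S.secondTerms τ₀ h q lam φ x) + (S.remL τ₀ h q p c lam φ x + S.dl τ₀ h lam f x) := by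
    intro lam
    rw [S.dl_add τ₀ h lam (contDiff_Lop h hq hp hc hφ.1) hf]
    simp only [remL]
    ring
  have e2 : lsum (n + 1) (fun lam => S.dl τ₀ h lam φ x *
        S.dl τ₀ h lam (fun x => S.Lop h q p c φ x + f x) x) =
      lsum (n + 1) (fun lam => S.dl τ₀ h lam φ x * S.Lop h q p c (S.dl τ₀ h lam φ) x) +
      lsum (n + 1) (fun lam => S.dl τ₀ h lam φ x * (S.firstTerms τ₀ h q p lam φ x +
        S.secondTerms τ₀ h q lam φ x)) +
      lsum (n + 1) (fun lam => S.dl τ₀ h lam φ x *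
        (S.remL τ₀ h q p c lam φ x + S.dl τ₀ h lam f x)) := by
    simp only [e1, ← lsum_add, mul_add]
  have e3 : 2 * lsum (n + 1) (fun lam => S.dl τ₀ h lam φ x *
        S.Lop h q p c (S.dl τ₀ h lam φ) x) = S.Mop h q p (S.W τ₀ h (n + 1) φ) x -
        lsum (n + 1) (fun lam => S.QQop h q p (S.dl τ₀ h lam φ) x) -
        2 * c x * S.W τ₀ h (n + 1) φ x := by
    rw [← lsum_mul_left]
    simp only [S.energy_identity hh, lsum_sub, lsum_mul_left, lsum_Mop]
    rfl
  have hδc : 0 < δ * c₀ := mul_pos hδ hc₀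
  -- Young's inequality with weight `δ c₀`: a part `δ c` of the damping `2 c` pays for the remainder
  -- and the free term, and `(2 - δ) c` is kept.
  have h3 : 2 * lsum (n + 1) (fun lam => S.dl τ₀ h lam φ x *
        (S.remL τ₀ h q p c lam φ x + S.dl τ₀ h lam f x)) ≤ δ * c₀ * S.W τ₀ h (n + 1) φ x +
      2 / (δ * c₀) * (lsum (n + 1) (fun lam => (S.remL τ₀ h q p c lam φ x) ^ 2) +
        S.W τ₀ h (n + 1) f x) := by
    simp only [W, ← lsum_add, ← lsum_mul_left]
    exact lsum_mono _ fun lam => two_mul_add_le hδc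
  have h4 : δ * c₀ * S.W τ₀ h (n + 1) φ x ≤ δ * c x * S.W τ₀ h (n + 1) φ x :=
    mul_le_mul_of_nonneg_right (mul_le_mul_of_nonneg_left (hcc x) hδ.le) (S.W_nonneg _ _ _ _ _)
  have h5 : 2 / (δ * c₀) * (lsum (n + 1) (fun lam => (S.remL τ₀ h q p c lam φ x) ^ 2) +
        S.W τ₀ h (n + 1) f x) ≤ 2 / (δ * c₀) * (cL (S.size / τ₀) (n + 1) * B * Φ + F) :=
    mul_le_mul_of_nonneg_left (add_le_add h2 (hF x)) (by positivity)
  rw [e2, mul_add, mul_add, e3]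
  linarith

/-- The differential inequality for `W_0`. -/
theorem bernstein_zero {c₀ : ℝ} (hh : h ≠ 0) (hδ : 0 < δ) (hc₀ : 0 < c₀)
    (hcc : ∀ x, c₀ ≤ c x) (hδ1 : δ ≤ 1)
    (hχ : ∀ l x, 0 ≤ q l x + h * p l x)
    {φ : E d → ℝ} {f : E d → ℝ} {F : ℝ}
    (hF : ∀ x, S.W τ₀ h 0 f x ≤ F) (x : E d) :
    2 * lsum 0 (fun lam => S.dl τ₀ h lam φ x *
        S.dl τ₀ h lam (fun x => S.Lop h q p c φ x + f x) x) ≤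
      S.Mop h q p (S.W τ₀ h 0 φ) x - (2 - δ) * c x * S.W τ₀ h 0 φ x -
      δ * lsum 0 (fun lam => S.QQop h q p (S.dl τ₀ h lam φ) x) + 2 / (δ * c₀) * F := by
  have hδc : 0 < δ * c₀ := mul_pos hδ hc₀
  have e : S.W τ₀ h 0 φ = fun x => (φ x) ^ 2 := funext fun x => S.W_zero _ _ _ _
  have hF' := hF x
  rw [W_zero] at hF'
  simp only [lsum_zero, dl_nil, e]
  have h1 := S.energy_identity (q := q) (p := p) (c := c) hh φ x
  have h2 := two_mul_add_le (v := φ x) (r := 0) (f := f x) hδc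
  have h4 : δ * c₀ * (φ x) ^ 2 ≤ δ * c x * (φ x) ^ 2 :=
    mul_le_mul_of_nonneg_right (mul_le_mul_of_nonneg_left (hcc x) hδ.le) (sq_nonneg _)
  have h5 : 2 / (δ * c₀) * (0 ^ 2 + (f x) ^ 2) ≤ 2 / (δ * c₀) * F :=
    mul_le_mul_of_nonneg_left (by linarith) (by positivity)
  have h6 := mul_nonneg (sub_nonneg.2 hδ1) (QQop_nonneg (S := S) hχ φ x)
  rw [mul_add, mul_add, h1]
  rw [zero_add] at h2
  linarith

end Scheme

end FDScheme

namespace FDScheme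

/-! ### A chain rule and a maximum principle for integral equations in time -/

/-- The data are only measurable in time, so `v` is absolutely continuous rather than
differentiable, and the product rule is used in its integrated form. -/
theorem sq_eq_integral {v F : ℝ → ℝ} {v₀ t : ℝ} (ht : 0 ≤ t)
    (hF : IntervalIntegrable F volume 0 t)
    (hv : ∀ s ∈ Icc 0 t, v s = v₀ + ∫ r in (0 : ℝ)..s, F r) :
    IntervalIntegrable (fun s => 2 * (v s * F s)) volume 0 t ∧
      (v t) ^ 2 = v₀ ^ 2 + ∫ s in (0 : ℝ)..t, 2 * (v s * F s) := by
  set a : ℝ → ℝ := fun s => v₀ + ∫ r in (0 : ℝ)..s, F r with ha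
  have hI : AbsolutelyContinuousOnInterval (fun s => ∫ r in (0 : ℝ)..s, F r) 0 t :=
    hF.absolutelyContinuousOnInterval_intervalIntegral (by simp [ht])
  have hac : AbsolutelyContinuousOnInterval a 0 t := by
    have hc : AbsolutelyContinuousOnInterval (fun _ : ℝ => v₀) 0 t :=
      ((LipschitzWith.const v₀).lipschitzOnWith).absolutelyContinuousOnInterval
    exact hc.add hI
  have hva : ∀ s ∈ Icc 0 t, v s = a s := hv
  have hae : ∀ᵐ s, s ∈ uIcc 0 t → HasDerivAt a (F s) s := by
    filter_upwards [hF.ae_hasDerivAt_integral] with s hs hst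
    exact (hs hst 0 (by simp)).const_add v₀
  have h1 := hac.integral_deriv_mul_eq_sub hac
  have h2 : ∫ s in (0 : ℝ)..t, deriv a s * a s + a s * deriv a s =
      ∫ s in (0 : ℝ)..t, 2 * (v s * F s) := by
    refine intervalIntegral.integral_congr_ae ?_
    filter_upwards [hae] with s hs hst
    have hs' := uIoc_subset_uIcc hst
    rw [(hs hs').deriv, hva s (by rwa [uIcc_of_le ht] at hs')]
    ring
  constructor
  · have h3 : IntervalIntegrable (fun s => a s * F s) volume 0 t :=
      hF.continuousOn_mul hac.continuousOn
    refine (h3.const_mul 2).congr ?_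
    intro s hs
    simp only
    rw [hva s (by rw [uIoc_of_le ht] at hs; exact ⟨hs.1.le, hs.2⟩)]
  · rw [h2] at h1
    rw [h1, hva t ⟨ht, le_rfl⟩]
    simp [ha]
    ring

/-- No maximum has to be attained. The excess `Y - k` is bounded by its own time integral taken at
shifted points, and iteration gives `C' (A' t)^n / n!`, which tends to zero. The size of the rates
`b` therefore does not affect the conclusion. -/
theorem maximum_principle {X ι : Type*} [Fintype ι] {T C A k : ℝ} {Y F : ℝ → X → ℝ} {Y₀ : X → ℝ}
    {σ : ι → X → X} {b : ι → ℝ → X → ℝ} {γ : ℝ → X → ℝ}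
    (hF : ∀ t ∈ Icc 0 T, ∀ x, IntervalIntegrable (fun s => F s x) volume 0 t)
    (hY : ∀ t ∈ Icc 0 T, ∀ x, Y t x = Y₀ x + ∫ s in (0 : ℝ)..t, F s x)
    (hC : ∀ t ∈ Icc 0 T, ∀ x, Y t x ≤ C) (hA : 0 ≤ A)
    (hb0 : ∀ i, ∀ t ∈ Icc 0 T, ∀ x, 0 ≤ b i t x) (hbA : ∀ i, ∀ t ∈ Icc 0 T, ∀ x, b i t x ≤ A)
    (hγ : ∀ t ∈ Icc 0 T, ∀ x, 0 ≤ γ t x)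
    (hle : ∀ t ∈ Icc 0 T, ∀ x, F t x ≤
      (∑ i, b i t x * (Y t (σ i x) - Y t x)) - γ t x * (Y t x - k))
    (hk : ∀ x, Y₀ x ≤ k) : ∀ t ∈ Icc 0 T, ∀ x, Y t x ≤ k := by
  set A' : ℝ := Fintype.card ι * A with hA'
  have hA'0 : 0 ≤ A' := by positivity
  set C' : ℝ := max 0 (C - k) with hC'
  have hC'0 : 0 ≤ C' := le_max_left _ _
  have main : ∀ n : ℕ, ∀ t ∈ Icc 0 T, ∀ x, Y t x - k ≤ C' * A' ^ n * t ^ n / n.factorial := by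
    intro n
    induction n with
    | zero =>
      intro t ht x
      have := hC t ht x
      simp only [pow_zero, mul_one, Nat.factorial_zero, Nat.cast_one, div_one]
      exact le_max_of_le_right (by linarith)
    | succ n ih =>
      intro t ht x
      have ht0 := ht.1
      rcases le_or_gt (Y t x - k) 0 with h0 | h0
      · exact h0.trans (by positivity)
      have hcont : ContinuousOn (fun s => Y s x) (Icc 0 t) := by
        have h1 : ContinuousOn (fun s => Y₀ x + ∫ r in (0 : ℝ)..s, F r x) (Icc 0 t) := by
          have := intervalIntegral.continuousOn_primitive_interval' (hF t ht x) (a := 0) (by simp)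
          rw [uIcc_of_le ht0] at this
          exact continuousOn_const.add this
        exact h1.congr fun s hs => hY s ⟨hs.1, hs.2.trans ht.2⟩ x
      set Z := {s ∈ Icc 0 t | Y s x ≤ k} with hZ
      have hZc : IsClosed Z := by
        have := hcont.preimage_isClosed_of_isClosed isClosed_Icc (isClosed_Iic (a := k))
        exact this
      have hZ0 : (0 : ℝ) ∈ Z := by
        refine ⟨⟨le_rfl, ht0⟩, ?_⟩
        rw [hY 0 ⟨le_rfl, ht0.trans ht.2⟩]
        simpa using hk x
      have hZb : BddAbove Z := ⟨t, fun s hs => hs.1.2⟩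
      -- The last time up to `t` at which `Y ≤ k`. After it the damping term has a favourable sign,
      -- and `Y(σ_i x) - Y(x)` is at most the excess over `k` at `σ_i x`, which the previous iterate
      -- bounds.
      set t₀ := sSup Z with ht₀
      have hmem : t₀ ∈ Z := hZc.csSup_mem ⟨0, hZ0⟩ hZb
      have hpos : ∀ s, t₀ < s → s ≤ t → k < Y s x := by
        intro s hs hst
        by_contra hcon
        push Not at hcon
        exact absurd (le_csSup hZb (show s ∈ Z from ⟨⟨hmem.1.1.trans hs.le, hst⟩, hcon⟩))
          (not_le.2 hs)
      have hT0 : t₀ ∈ Icc 0 T := ⟨hmem.1.1, hmem.1.2.trans ht.2⟩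
      have i1 := hF t ht x
      have i0 := hF t₀ hT0 x
      have e : Y t x = Y t₀ x + ∫ s in t₀..t, F s x := by
        rw [hY t ht, hY t₀ hT0, add_assoc, intervalIntegral.integral_add_adjacent_intervals i0
          (i0.symm.trans i1)]
      have hint : ∫ s in t₀..t, F s x ≤
          ∫ s in t₀..t, A' * (C' * A' ^ n * s ^ n / n.factorial) := by
        refine intervalIntegral.integral_mono_on_of_le_Ioo hmem.1.2 (i0.symm.trans i1)
          (Continuous.intervalIntegrable (by fun_prop) _ _) fun s hs => ?_
        have hsT : s ∈ Icc 0 T := ⟨hmem.1.1.trans hs.1.le, hs.2.le.trans ht.2⟩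
        have hp := hpos s hs.1 hs.2.le
        refine (hle s hsT x).trans ?_
        have h1 : 0 ≤ γ s x * (Y s x - k) := mul_nonneg (hγ s hsT x) (by linarith)
        have hr : 0 ≤ C' * A' ^ n * s ^ n / n.factorial := by
          have := hsT.1
          positivity
        have h2 : ∑ i, b i s x * (Y s (σ i x) - Y s x) ≤
            ∑ _i : ι, A * (C' * A' ^ n * s ^ n / n.factorial) := by
          refine Finset.sum_le_sum fun i _ => ?_
          have h3 : Y s (σ i x) - Y s x ≤ C' * A' ^ n * s ^ n / n.factorial := by
            have := ih s hsT (σ i x)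
            linarith
          exact (mul_le_mul_of_nonneg_left h3 (hb0 i s hsT x)).trans
            (mul_le_mul_of_nonneg_right (hbA i s hsT x) hr)
        rw [Finset.sum_const, Finset.card_univ, nsmul_eq_mul, ← mul_assoc] at h2
        linarith
      have hint2 : ∫ s in t₀..t, A' * (C' * A' ^ n * s ^ n / n.factorial) ≤
          C' * A' ^ (n + 1) * t ^ (n + 1) / (n + 1).factorial := by
        have e2 : ∀ s : ℝ, A' * (C' * A' ^ n * s ^ n / n.factorial) =
            (C' * A' ^ (n + 1) / n.factorial) * s ^ n := fun s => by ring
        simp_rw [e2]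
        rw [intervalIntegral.integral_const_mul, integral_pow, Nat.factorial_succ]
        have h3 : t ^ (n + 1) - t₀ ^ (n + 1) ≤ t ^ (n + 1) :=
          sub_le_self _ (pow_nonneg hmem.1.1 _)
        calc C' * A' ^ (n + 1) / n.factorial * ((t ^ (n + 1) - t₀ ^ (n + 1)) / (n + 1))
            ≤ C' * A' ^ (n + 1) / n.factorial * (t ^ (n + 1) / (n + 1)) := by gcongr
          _ = _ := by push_cast; field_simp
      have := hmem.2
      linarith
  intro t ht x
  have hlim : Filter.Tendsto (fun n : ℕ => C' * A' ^ n * t ^ n / n.factorial) Filter.atTop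
      (nhds 0) := by
    have := (FloorSemiring.tendsto_pow_div_factorial_atTop (A' * t)).const_mul C'
    simp only [mul_zero] at this
    refine this.congr fun n => ?_
    rw [mul_pow]
    ring
  have := ge_of_tendsto' hlim (fun n => main n t ht x)
  linarith

/-- If every bound `Ω` of a bounded function improves to `θ Ω + b`, then `b / (1 - θ)` is a
bound. -/
theorem le_of_self_improving {ι : Type*} [Nonempty ι] {w : ι → ℝ} {θ b C : ℝ} (hθ : θ < 1)
    (hC : ∀ i, w i ≤ C) (h : ∀ Ω, (∀ i, w i ≤ Ω) → ∀ i, w i ≤ θ * Ω + b) (i : ι) :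
    w i ≤ b / (1 - θ) := by
  have hb : BddAbove (range w) := ⟨C, by rintro _ ⟨i, rfl⟩; exact hC i⟩
  have h1 := h (⨆ i, w i) (fun i => le_ciSup hb i)
  have h2 : (⨆ i, w i) ≤ θ * (⨆ i, w i) + b := ciSup_le h1
  refine (le_ciSup hb i).trans ?_
  rw [le_div_iff₀ (by linarith)]
  linarith

/-! ### The a priori estimate for smooth data. -/

namespace Scheme

variable {d : ℕ} (S : Scheme d) (τ₀ h : ℝ)

/-- Smooth coefficients satisfying the structural conditions with suprema, with bounds that do
not depend on the mesh size. -/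
structure SmoothCoef (m : ℕ) (δ K c₀ B : ℝ) (q p : S.Λ₁ → E d → ℝ) (c : E d → ℝ) : Prop where
  q_smooth : ∀ l, ContDiff ℝ ∞ (q l)
  p_smooth : ∀ l, ContDiff ℝ ∞ (p l)
  c_smooth : ContDiff ℝ ∞ c
  chi : ∀ l x, 0 ≤ q l x + h * p l x
  killing : ∀ x, c₀ ≤ c x
  centered : ∀ x, ∑ l, q l x • (l : E d) = 0
  q_le : ∀ s ≤ m, ∀ x, ∑ l, S.W τ₀ h s (q l) x ≤ B
  p_le : ∀ s ≤ m, ∀ x, ∑ l, S.W τ₀ h s (p l) x ≤ B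
  c_le : ∀ s ≤ m, ∀ x, S.W τ₀ h s c x ≤ B
  supI : S.SupI τ₀ h q p c m δ K
  supII : ∀ n ∈ Finset.Icc 1 m, S.SupII τ₀ h q p c n δ K

/-- A solution, smooth in `x`, of the scheme with smooth data. -/
structure SmoothSol (q p : S.Λ₁ → ℝ → E d → ℝ) (c f : ℝ → E d → ℝ) (g : E d → ℝ)
    (u : ℝ → E d → ℝ) : Prop where
  f_smooth : ∀ t ∈ Icc 0 S.T, ContDiff ℝ ∞ (f t)
  smooth : ∀ t ∈ Icc 0 S.T, SmoothBdd (u t)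
  bounded : ∀ n, ∃ C, ∀ t ∈ Icc 0 S.T, ∀ x, S.W τ₀ h n (u t) x ≤ C
  integrable : ∀ lam, ∀ t ∈ Icc 0 S.T, ∀ x, IntervalIntegrable (fun s => S.dl τ₀ h lam
    (fun x => S.Lop h (fun l => q l s) (fun l => p l s) (c s) (u s) x + f s x) x) volume 0 t
  eqn : ∀ lam, ∀ t ∈ Icc 0 S.T, ∀ x, S.dl τ₀ h lam (u t) x = S.dl τ₀ h lam g x +
    ∫ s in (0 : ℝ)..t, S.dl τ₀ h lam
      (fun x => S.Lop h (fun l => q l s) (fun l => p l s) (c s) (u s) x + f s x) x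

/-- `W_n + κ W_{n-1} + ⋯ + κ^n W_0`. -/
def Ysum (κ : ℝ) : ℕ → (E d → ℝ) → E d → ℝ
  | 0, φ => S.W τ₀ h 0 φ
  | n + 1, φ => fun x => S.W τ₀ h (n + 1) φ x + κ * Ysum κ n φ x

/-- The time derivative of `W_n + κ W_{n-1} + ⋯ + κ^n W_0` along `φ' = ψ`. -/
def dYsum (κ : ℝ) : ℕ → (E d → ℝ) → (E d → ℝ) → E d → ℝ
  | 0, φ, ψ => fun x => 2 * lsum 0 (fun lam => S.dl τ₀ h lam φ x * S.dl τ₀ h lam ψ x)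
  | n + 1, φ, ψ => fun x => 2 * lsum (n + 1) (fun lam => S.dl τ₀ h lam φ x * S.dl τ₀ h lam ψ x) +
      κ * dYsum κ n φ ψ x

variable {S τ₀ h} {m : ℕ} {δ K c₀ B : ℝ} {q p : S.Λ₁ → ℝ → E d → ℝ} {c f : ℝ → E d → ℝ}
  {g : E d → ℝ} {u : ℝ → E d → ℝ}

theorem SmoothSol.W_eq (hu : S.SmoothSol τ₀ h q p c f g u) (n : ℕ) {t : ℝ} (ht : t ∈ Icc 0 S.T)
    (x : E d) :
    IntervalIntegrable (fun s => 2 * lsum n (fun lam => S.dl τ₀ h lam (u s) x * S.dl τ₀ h lam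
      (fun x => S.Lop h (fun l => q l s) (fun l => p l s) (c s) (u s) x + f s x) x)) volume 0 t ∧
    S.W τ₀ h n (u t) x = S.W τ₀ h n g x + ∫ s in (0 : ℝ)..t, 2 * lsum n (fun lam =>
      S.dl τ₀ h lam (u s) x * S.dl τ₀ h lam
      (fun x => S.Lop h (fun l => q l s) (fun l => p l s) (c s) (u s) x + f s x) x) := by
  have key := fun lam => sq_eq_integral (v := fun t => S.dl τ₀ h lam (u t) x) ht.1
    (hu.integrable lam t ht x) (fun s hs => hu.eqn lam s ⟨hs.1, hs.2.trans ht.2⟩ x)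
  simp only [← lsum_mul_left]
  constructor
  · unfold lsum
    have := IntervalIntegrable.sum Finset.univ
      fun (lam : Fin n → S.Idx) _ => (key (List.ofFn lam)).1
    convert! this using 1
    funext s
    simp
  · unfold W lsum
    rw [intervalIntegral.integral_finsetSum fun lam _ => (key _).1, ← Finset.sum_add_distrib]
    exact Finset.sum_congr rfl fun lam _ => (key _).2

theorem SmoothSol.Ysum_eq (hu : S.SmoothSol τ₀ h q p c f g u) (κ : ℝ) (n : ℕ) {t : ℝ}
    (ht : t ∈ Icc 0 S.T) (x : E d) :
    IntervalIntegrable (fun s => S.dYsum τ₀ h κ n (u s)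
      (fun x => S.Lop h (fun l => q l s) (fun l => p l s) (c s) (u s) x + f s x) x) volume 0 t ∧
    S.Ysum τ₀ h κ n (u t) x = S.Ysum τ₀ h κ n g x + ∫ s in (0 : ℝ)..t, S.dYsum τ₀ h κ n (u s)
      (fun x => S.Lop h (fun l => q l s) (fun l => p l s) (c s) (u s) x + f s x) x := by
  induction n with
  | zero => exact hu.W_eq 0 ht x
  | succ n ih =>
    obtain ⟨i1, e1⟩ := hu.W_eq (n + 1) ht x
    refine ⟨i1.add (ih.1.const_mul κ), ?_⟩
    simp only [Ysum, dYsum]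
    rw [intervalIntegral.integral_add i1 (ih.1.const_mul κ),
      intervalIntegral.integral_const_mul κ, e1, ih.2]
    ring

theorem Ysum_nonneg {κ : ℝ} (hκ : 0 ≤ κ) (n : ℕ) (φ : E d → ℝ) (x : E d) :
    0 ≤ S.Ysum τ₀ h κ n φ x := by
  induction n with
  | zero => exact S.W_nonneg _ _ _ _ _
  | succ n ih => exact add_nonneg (S.W_nonneg _ _ _ _ _) (mul_nonneg hκ ih)

theorem W_le_Ysum {κ : ℝ} (hκ : 0 ≤ κ) (n : ℕ) (φ : E d → ℝ) (x : E d) :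
    S.W τ₀ h n φ x ≤ S.Ysum τ₀ h κ n φ x := by
  cases n with
  | zero => exact le_rfl
  | succ n => exact le_add_of_nonneg_right (mul_nonneg hκ (Ysum_nonneg hκ n φ x))

theorem Ysum_le {κ : ℝ} (hκ : 0 ≤ κ) (n : ℕ) {φ : E d → ℝ} {D : ℝ} {x : E d}
    (hD : ∀ j ≤ n, S.W τ₀ h j φ x ≤ D) :
    S.Ysum τ₀ h κ n φ x ≤ (∑ j ∈ Finset.range (n + 1), κ ^ j) * D := by
  induction n with
  | zero => simpa [Ysum] using hD 0 le_rfl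
  | succ n ih =>
    have h1 := mul_le_mul_of_nonneg_left (ih fun j hj => hD j (by omega)) hκ
    have h2 := hD (n + 1) le_rfl
    rw [Finset.sum_range_succ']
    simp only [Ysum, pow_succ, ← Finset.sum_mul]
    linarith

theorem Mop_add_mul (q p : S.Λ₁ → E d → ℝ) (φ ψ : E d → ℝ) (κ : ℝ) (x : E d) :
    S.Mop h q p (fun x => φ x + κ * ψ x) x = S.Mop h q p φ x + κ * S.Mop h q p ψ x := by
  simp only [Mop, Finset.mul_sum, ← Finset.sum_add_distrib]
  exact Finset.sum_congr rfl fun l _ => by ring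

theorem SmoothCoef.q_abs_le {q p : S.Λ₁ → E d → ℝ} {c : E d → ℝ}
    (H : S.SmoothCoef τ₀ h m δ K c₀ B q p c) (l : S.Λ₁) (x : E d) :
    |q l x| ≤ 1 + B ∧ |p l x| ≤ 1 + B := by
  have h1 := H.q_le 0 (Nat.zero_le _) x
  have h2 := H.p_le 0 (Nat.zero_le _) x
  simp only [W_zero] at h1 h2
  have h3 := (Finset.single_le_sum (f := fun l => (q l x) ^ 2) (fun _ _ => sq_nonneg _)
    (Finset.mem_univ l)).trans h1
  have h4 := (Finset.single_le_sum (f := fun l => (p l x) ^ 2) (fun _ _ => sq_nonneg _)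
    (Finset.mem_univ l)).trans h2
  constructor <;> rw [abs_le] <;> constructor <;> nlinarith

/-- The maximum principle for `Ysum`. -/
theorem SmoothSol.Ysum_le_of (hu : S.SmoothSol τ₀ h q p c f g u) (hc₀ : 0 < c₀) (hδ1 : δ ≤ 1)
    (H : ∀ t ∈ Icc 0 S.T, S.SmoothCoef τ₀ h m δ K c₀ B (fun l => q l t) (fun l => p l t) (c t))
    {κ : ℝ} (hκ : 0 ≤ κ) (n : ℕ) {k : ℝ}
    (hle : ∀ t ∈ Icc 0 S.T, ∀ x, S.dYsum τ₀ h κ n (u t)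
      (fun x => S.Lop h (fun l => q l t) (fun l => p l t) (c t) (u t) x + f t x) x ≤
      S.Mop h (fun l => q l t) (fun l => p l t) (S.Ysum τ₀ h κ n (u t)) x -
        (2 - δ) * c t x * (S.Ysum τ₀ h κ n (u t) x - k))
    (hk : ∀ x, S.Ysum τ₀ h κ n g x ≤ k) : ∀ t ∈ Icc 0 S.T, ∀ x, S.Ysum τ₀ h κ n (u t) x ≤ k := by
  have hbd : ∀ n, ∃ C, ∀ t ∈ Icc 0 S.T, ∀ x, S.Ysum τ₀ h κ n (u t) x ≤ C := by
    intro n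
    induction n with
    | zero => exact hu.bounded 0
    | succ n ih =>
      obtain ⟨C, hC⟩ := ih
      obtain ⟨C', hC'⟩ := hu.bounded (n + 1)
      exact ⟨C' + κ * C, fun t ht x => add_le_add (hC' t ht x)
        (mul_le_mul_of_nonneg_left (hC t ht x) hκ)⟩
  obtain ⟨C, hC⟩ := hbd n
  have hB0 : 0 ≤ 1 + B := by
    have h0 : (0 : ℝ) ∈ Icc 0 S.T := ⟨le_rfl, S.T_pos.le⟩
    have := ((S.W_nonneg τ₀ h 0 (c 0) 0).trans ((H 0 h0).c_le 0 (Nat.zero_le _) 0))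
    linarith
  -- This bound on the rates degenerates as the mesh size tends to zero, but it does not enter the
  -- conclusion.
  refine maximum_principle (A := |h⁻¹ * h⁻¹| * ((1 + B) + |h| * (1 + B)))
    (σ := fun (l : S.Λ₁) x => x + h • (l : E d))
    (b := fun l t x => h⁻¹ * h⁻¹ * (q l t x + h * p l t x)) (γ := fun t x => (2 - δ) * c t x)
    (fun t ht x => (hu.Ysum_eq κ n ht x).1) (fun t ht x => (hu.Ysum_eq κ n ht x).2) hC
    (by positivity) ?_ ?_ ?_ hle hk
  · intro l t ht x
    exact mul_nonneg (mul_self_nonneg _) ((H t ht).chi l x)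
  · intro l t ht x
    refine (le_abs_self _).trans ?_
    rw [abs_mul]
    refine mul_le_mul_of_nonneg_left ((abs_add_le _ _).trans ?_) (abs_nonneg _)
    rw [abs_mul]
    have := (H t ht).q_abs_le l x
    exact add_le_add this.1 (mul_le_mul_of_nonneg_left this.2 (abs_nonneg _))
  · intro t ht x
    exact mul_nonneg (by linarith) (hc₀.le.trans ((H t ht).killing x))

/-- The basic estimate: bounds for `W_n` uniform in the mesh size. -/
theorem apriori_aux (m : ℕ) {δ K c₀ τ₀ B : ℝ} (α : ℝ) (hδ : 0 < δ) (hδ1 : δ ≤ 1) (hK : 0 ≤ K)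
    (hc₀ : 0 < c₀) (hτ₀ : 0 < τ₀) (n : ℕ) (hn : n ≤ m) : ∃ N P₁ P₂ : ℝ, 0 ≤ N ∧
    0 ≤ P₁ ∧ 0 ≤ P₂ ∧ ∀ (d : ℕ) (S : Scheme d) (h : ℝ) (q p : S.Λ₁ → ℝ → E d → ℝ)
      (c f : ℝ → E d → ℝ) (g : E d → ℝ) (u : ℝ → E d → ℝ) (D : ℝ), S.size / τ₀ = α → h ≠ 0 →
      0 ≤ D → (∀ t ∈ Icc 0 S.T,
        S.SmoothCoef τ₀ h m δ K c₀ B (fun l => q l t) (fun l => p l t) (c t)) →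
      S.SmoothSol τ₀ h q p c f g u →
      (∀ j ≤ n, ∀ t ∈ Icc 0 S.T, ∀ x, S.W τ₀ h j (f t) x ≤ D) →
      (∀ j ≤ n, ∀ x, S.W τ₀ h j g x ≤ D) →
      (∀ j ≤ n, ∀ t ∈ Icc 0 S.T, ∀ x, S.W τ₀ h j (u t) x ≤ N * D) ∧
      ∀ t ∈ Icc 0 S.T, ∀ x, S.dYsum τ₀ h (K / δ) n (u t)
        (fun x => S.Lop h (fun l => q l t) (fun l => p l t) (c t) (u t) x + f t x) x ≤
        S.Mop h (fun l => q l t) (fun l => p l t) (S.Ysum τ₀ h (K / δ) n (u t)) x -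
        (2 - δ) * c t x * S.Ysum τ₀ h (K / δ) n (u t) x -
        δ * lsum n (fun lam => S.QQop h (fun l => q l t) (fun l => p l t)
          (S.dl τ₀ h lam (u t)) x) + (c t x * P₁ + P₂) * D := by
  have hκ : 0 ≤ K / δ := by positivity
  have h2δ : 0 < 2 - δ := by linarith
  induction n with
  | zero =>
    set P := 2 / (δ * c₀) with hP
    have hP0 : 0 ≤ P := by positivity
    -- The `1` covers the initial value, and the quotient makes the damping at this level outweigh
    -- the free term `P D`.
    refine ⟨1 + P / ((2 - δ) * c₀), 0, P, by positivity, le_rfl, hP0, ?_⟩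
    intro d S h q p c f g u D hα hh hD H hu hf hg
    have key : ∀ t ∈ Icc 0 S.T, ∀ x, S.dYsum τ₀ h (K / δ) 0 (u t)
        (fun x => S.Lop h (fun l => q l t) (fun l => p l t) (c t) (u t) x + f t x) x ≤
        S.Mop h (fun l => q l t) (fun l => p l t) (S.Ysum τ₀ h (K / δ) 0 (u t)) x -
        (2 - δ) * c t x * S.Ysum τ₀ h (K / δ) 0 (u t) x -
        δ * lsum 0 (fun lam => S.QQop h (fun l => q l t) (fun l => p l t)
          (S.dl τ₀ h lam (u t)) x) + (c t x * 0 + P) * D := by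
      intro t ht x
      have := bernstein_zero (S := S) (τ₀ := τ₀) (φ := u t) hh hδ hc₀ (H t ht).killing hδ1
        (H t ht).chi (hf 0 le_rfl t ht) x
      simp only [dYsum, Ysum]
      rw [mul_zero, zero_add]
      exact this
    refine ⟨?_, key⟩
    intro j hj t ht x
    obtain rfl : j = 0 := by omega
    refine hu.Ysum_le_of (κ := K / δ) hc₀ hδ1 H hκ 0 (fun t ht x => (key t ht x).trans ?_)
      (fun x => (hg 0 le_rfl x).trans ?_) t ht x
    · have h1 : 0 ≤ lsum 0 (fun lam => S.QQop h (fun l => q l t) (fun l => p l t)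
          (S.dl τ₀ h lam (u t)) x) := lsum_nonneg _ fun _ => QQop_nonneg (H t ht).chi _ _
      have h2 : P * D ≤ (2 - δ) * c t x * ((1 + P / ((2 - δ) * c₀)) * D) := by
        have h3 : P ≤ (2 - δ) * c₀ * (1 + P / ((2 - δ) * c₀)) := by
          rw [mul_add, mul_div_cancel₀ _ (by positivity)]
          nlinarith
        have h4 := (H t ht).killing x
        have h5 : (2 - δ) * c₀ * (1 + P / ((2 - δ) * c₀)) ≤
            (2 - δ) * c t x * (1 + P / ((2 - δ) * c₀)) := by gcongr
        nlinarith
      nlinarith [mul_nonneg hδ.le h1]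
    · have : 0 ≤ P / ((2 - δ) * c₀) := by positivity
      nlinarith
  | succ n ih =>
    obtain ⟨N, P₁, P₂, hN, hP₁, hP₂, ih⟩ := ih (by omega)
    -- With this weight the term `K ∑ 𝒬_h` produced at order `n + 1` cancels `κ` times the term `-δ
    -- ∑ 𝒬_h` available at order `n`. For this reason the induction also carries the differential
    -- inequality, not only the bound.
    set κ := K / δ with hκd
    set Z := ∑ j ∈ Finset.range (n + 1 + 1), κ ^ j with hZ
    have hZ0 : 0 ≤ Z := Finset.sum_nonneg fun _ _ => pow_nonneg hκ _
    set e := |K * N + 2 / (δ * c₀) * (cL α (n + 1) * B * N + 1)| with he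
    have he0 : 0 ≤ e := abs_nonneg _
    -- The first two summands let `(2 - δ) c R` dominate the lower order terms, those with a factor
    -- `c` and those without; `Z` covers the initial value.
    set R := κ * P₁ / (2 - δ) + (e + κ * P₂) / ((2 - δ) * c₀) + Z with hR
    have hR0 : 0 ≤ R := by positivity
    -- The ratio of the supremum term `2(1 - δ) c Ω` to the damping `(2 - δ) c`; it is below one
    -- precisely because `δ > 0`.
    set θ := 2 * (1 - δ) / (2 - δ) with hθ
    have hθ0 : 0 ≤ θ := div_nonneg (by linarith) h2δ.le
    have hθ1 : θ < 1 := by rw [hθ, div_lt_one h2δ]; linarith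
    set N' := R / (1 - θ) with hN'
    have hN'0 : 0 ≤ N' := div_nonneg hR0 (by linarith)
    refine ⟨max N N', 2 * (1 - δ) * N' + κ * P₁, e + κ * P₂, le_max_of_le_left hN, ?_,
      by positivity, ?_⟩
    · have : 0 ≤ 1 - δ := by linarith
      positivity
    intro d S h q p c f g u D hα hh hD H hu hf hg
    obtain ⟨ih1, ih2⟩ := ih d S h q p c f g u D hα hh hD H hu (fun j hj => hf j (by omega))
      (fun j hj => hg j (by omega))
    have key : ∀ Ω, (∀ t ∈ Icc 0 S.T, ∀ x, S.W τ₀ h (n + 1) (u t) x ≤ Ω) → ∀ t ∈ Icc 0 S.T, ∀ x,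
        S.dYsum τ₀ h κ (n + 1) (u t)
        (fun x => S.Lop h (fun l => q l t) (fun l => p l t) (c t) (u t) x + f t x) x ≤
        S.Mop h (fun l => q l t) (fun l => p l t) (S.Ysum τ₀ h κ (n + 1) (u t)) x -
        (2 - δ) * c t x * S.Ysum τ₀ h κ (n + 1) (u t) x -
        δ * lsum (n + 1) (fun lam => S.QQop h (fun l => q l t) (fun l => p l t)
          (S.dl τ₀ h lam (u t)) x) + 2 * (1 - δ) * c t x * Ω +
          (c t x * (κ * P₁) + (e + κ * P₂)) * D := by
      intro Ω hΩ t ht x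
      have hH := H t ht
      have h1 := bernstein_succ hτ₀ hh hδ hδ1 hK hc₀ hH.q_smooth hH.p_smooth hH.c_smooth hH.chi
        hH.killing hH.centered hH.q_le hH.p_le hH.c_le hH.supI hH.supII n hn (hu.smooth t ht)
        (hu.f_smooth t ht) (hΩ t ht) (Φ := N * D) (fun j hj => ih1 j hj t ht)
        (hf (n + 1) le_rfl t ht) x
      have h2 := ih2 t ht x
      have h3 : K * (N * D) + 2 / (δ * c₀) * (cL (S.size / τ₀) (n + 1) * B * (N * D) + D) ≤
          e * D := by
        rw [hα]
        refine le_trans (le_of_eq ?_) (mul_le_mul_of_nonneg_right (le_abs_self _) hD)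
        ring
      simp only [dYsum, Ysum]
      rw [Mop_add_mul]
      have h4 := mul_le_mul_of_nonneg_left h2 hκ
      have h5 : κ * δ = K := by rw [hκd]; field_simp
      have h6 : κ * (δ * lsum n (fun lam => S.QQop h (fun l => q l t) (fun l => p l t)
          (S.dl τ₀ h lam (u t)) x)) = K * lsum n (fun lam => S.QQop h (fun l => q l t)
          (fun l => p l t) (S.dl τ₀ h lam (u t)) x) := by rw [← mul_assoc, h5]
      linarith
    have hW : ∀ t ∈ Icc 0 S.T, ∀ x, S.W τ₀ h (n + 1) (u t) x ≤ N' * D := by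
      have : Nonempty (Icc 0 S.T × E d) := ⟨⟨⟨0, le_rfl, S.T_pos.le⟩, 0⟩⟩
      obtain ⟨C, hC⟩ := hu.bounded (n + 1)
      have := le_of_self_improving (ι := Icc 0 S.T × E d)
        (w := fun z => S.W τ₀ h (n + 1) (u z.1) z.2) (θ := θ) (b := R * D) (C := C) hθ1
        (fun z => hC z.1 z.1.2 z.2) ?_
      · intro t ht x
        refine (this (⟨t, ht⟩, x)).trans (le_of_eq ?_)
        rw [hN']; ring
      · intro Ω hΩ z
        have hΩ' : ∀ t ∈ Icc 0 S.T, ∀ x, S.W τ₀ h (n + 1) (u t) x ≤ Ω :=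
          fun t ht x => hΩ (⟨t, ht⟩, x)
        have hΩ0 : 0 ≤ Ω := (S.W_nonneg _ _ _ _ _).trans (hΩ z)
        -- The maximum principle at the level `θ Ω + R D`. A bound `Ω` thus improves to this level,
        -- and `N' = R / (1 - θ)` comes from the fixed point of the improvement.
        refine (W_le_Ysum hκ _ _ _).trans (hu.Ysum_le_of (κ := κ) hc₀ hδ1 H hκ (n + 1)
          (fun t ht x => (key Ω hΩ' t ht x).trans ?_) (fun x => (Ysum_le hκ (n + 1)
          (fun j hj => hg j hj x)).trans ?_) z.1 z.1.2 z.2)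
        · have h1 : 0 ≤ lsum (n + 1) (fun lam => S.QQop h (fun l => q l t) (fun l => p l t)
            (S.dl τ₀ h lam (u t)) x) := lsum_nonneg _ fun _ => QQop_nonneg (H t ht).chi _ _
          have h4 := (H t ht).killing x
          have hct : 0 < c t x := hc₀.trans_le h4
          have h2 : (2 - δ) * c t x * (θ * Ω) = 2 * (1 - δ) * c t x * Ω := by
            rw [hθ]; field_simp
          have h3 : c t x * (κ * P₁) + (e + κ * P₂) ≤ (2 - δ) * c t x * R := by
            have h5 : (2 - δ) * c t x * R = c t x * (κ * P₁) +
                (e + κ * P₂) * (c t x / c₀) + (2 - δ) * c t x * Z := by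
              rw [hR]; field_simp
            have h6 : 1 ≤ c t x / c₀ := by rw [le_div_iff₀ hc₀]; linarith
            have h7 : 0 ≤ (2 - δ) * c t x * Z := by positivity
            have h8 : 0 ≤ e + κ * P₂ := by positivity
            nlinarith
          have h9 := mul_le_mul_of_nonneg_right h3 hD
          nlinarith [mul_nonneg hδ.le h1]
        · have h1 : Z * D ≤ R * D := by
            refine mul_le_mul_of_nonneg_right ?_ hD
            rw [hR]
            have : 0 ≤ κ * P₁ / (2 - δ) + (e + κ * P₂) / ((2 - δ) * c₀) := by positivity
            linarith
          have := mul_nonneg hθ0 hΩ0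
          linarith
    refine ⟨?_, ?_⟩
    · intro j hj t ht x
      rcases Nat.lt_or_ge j (n + 1) with hlt | hge
      · exact (ih1 j (by omega) t ht x).trans
          (mul_le_mul_of_nonneg_right (le_max_left _ _) hD)
      · obtain rfl : j = n + 1 := by omega
        exact (hW t ht x).trans (mul_le_mul_of_nonneg_right (le_max_right _ _) hD)
    · intro t ht x
      refine (key (N' * D) hW t ht x).trans (le_of_eq ?_)
      ring

end Scheme

end FDScheme

namespace FDScheme

/-! ### Functions with bounded derivatives, measurable in time -/

/-- The point of `[0,T]` closest to `t`. -/
def cl (T t : ℝ) : ℝ := max 0 (min T t)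

theorem cl_nonneg (T t : ℝ) : 0 ≤ cl T t := le_max_left _ _

theorem cl_le {T : ℝ} (hT : 0 ≤ T) (t : ℝ) : cl T t ≤ T := max_le hT (min_le_left _ _)

theorem cl_mem {T : ℝ} (hT : 0 ≤ T) (t : ℝ) : cl T t ∈ Icc 0 T := ⟨cl_nonneg T t, cl_le hT t⟩

theorem cl_of_mem {T t : ℝ} (ht : t ∈ Icc 0 T) : cl T t = t := by
  rw [cl, min_eq_right ht.2, max_eq_right ht.1]

theorem measurable_cl (T : ℝ) : Measurable (cl T) :=
  measurable_const.max (measurable_const.min measurable_id)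

variable {Z : Type} [NormedAddCommGroup Z] [NormedSpace ℝ Z] [FiniteDimensional ℝ Z]
  [MeasurableSpace Z] [BorelSpace Z] {J : Type} [Fintype J] (e : Module.Basis J ℝ Z)

/-- Measurable functions of `(t,z)`, continuous in `z` and bounded by `C e^{rt}`. -/
def NN0 (T r C : ℝ) (F : ℝ → Z → ℝ) : Prop :=
  Measurable (Function.uncurry F) ∧ (∀ t, Continuous (F t)) ∧
    ∀ t z, |F t z| ≤ C * Real.exp (r * cl T t)

/-- Functions whose derivatives in `z` up to order `n` satisfy `NN0`. -/
def NN (T r : ℝ) : ℕ → ℝ → (ℝ → Z → ℝ) → Prop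
  | 0, C, F => NN0 T r C F
  | n + 1, C, F => NN0 T r C F ∧ (∀ t, Differentiable ℝ (F t)) ∧
      ∀ j, NN T r n C (fun t => dd (e j) (F t))

section NN

variable {e} {T r C C' : ℝ} {n : ℕ} {F G : ℝ → Z → ℝ}

theorem NN.nn0 (hF : NN e T r n C F) : NN0 T r C F := by
  cases n with
  | zero => exact hF
  | succ n => exact hF.1

theorem NN.nonneg (hF : NN e T r n C F) : 0 ≤ C := by
  have := (abs_nonneg _).trans (hF.nn0.2.2 0 0)
  exact nonneg_of_mul_nonneg_left this (Real.exp_pos _)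

theorem NN.mono (hF : NN e T r n C F) (hC : C ≤ C') : NN e T r n C' F := by
  have h0 : ∀ F : ℝ → Z → ℝ, NN0 T r C F → NN0 T r C' F := fun F h =>
    ⟨h.1, h.2.1, fun t z => (h.2.2 t z).trans (by gcongr)⟩
  induction n generalizing F with
  | zero => exact h0 F hF
  | succ n ih => exact ⟨h0 F hF.1, hF.2.1, fun j => ih (hF.2.2 j)⟩

theorem NN.pred (hF : NN e T r (n + 1) C F) : NN e T r n C F := by
  induction n generalizing F with
  | zero => exact hF.1
  | succ n ih => exact ⟨hF.1, hF.2.1, fun j => ih (hF.2.2 j)⟩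

theorem NN.weight {r' : ℝ} (hF : NN e T r n C F) (hr : r ≤ r') : NN e T r' n C F := by
  have hC := hF.nonneg
  have h0 : ∀ F : ℝ → Z → ℝ, NN0 T r C F → NN0 T r' C F := fun F h =>
    ⟨h.1, h.2.1, fun t z => (h.2.2 t z).trans (by have := cl_nonneg T t; gcongr)⟩
  induction n generalizing F with
  | zero => exact h0 F hF
  | succ n ih => exact ⟨h0 F hF.1, hF.2.1, fun j => ih (hF.2.2 j)⟩

theorem NN.unweight (hT : 0 ≤ T) (hr : 0 ≤ r) (hF : NN e T r n C F) :
    NN e T 0 n (C * Real.exp (r * T)) F := by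
  have hC := hF.nonneg
  have h0 : ∀ F : ℝ → Z → ℝ, NN0 T r C F → NN0 T 0 (C * Real.exp (r * T)) F := fun F h =>
    ⟨h.1, h.2.1, fun t z => (h.2.2 t z).trans (by
      have := cl_le hT t
      rw [zero_mul, Real.exp_zero, mul_one]; gcongr)⟩
  induction n generalizing F with
  | zero => exact h0 F hF
  | succ n ih => exact ⟨h0 F hF.1, hF.2.1, fun j => ih (hF.2.2 j)⟩

theorem NN.add (hF : NN e T r n C F) (hG : NN e T r n C' G) :
    NN e T r n (C + C') (fun t z => F t z + G t z) := by
  have h0 : ∀ F G : ℝ → Z → ℝ, NN0 T r C F → NN0 T r C' G →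
      NN0 T r (C + C') (fun t z => F t z + G t z) := fun F G h h' =>
    ⟨h.1.add h'.1, fun t => (h.2.1 t).add (h'.2.1 t), fun t z => by
      rw [add_mul]; exact (abs_add_le _ _).trans (add_le_add (h.2.2 t z) (h'.2.2 t z))⟩
  induction n generalizing F G with
  | zero => exact h0 F G hF hG
  | succ n ih =>
    refine ⟨h0 F G hF.1 hG.1, fun t => (hF.2.1 t).add (hG.2.1 t), fun j => ?_⟩
    simp only [dd_add (hF.2.1 _) (hG.2.1 _)]
    exact ih (hF.2.2 j) (hG.2.2 j)

theorem NN.const_mul (a : ℝ) (hF : NN e T r n C F) :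
    NN e T r n (|a| * C) (fun t z => a * F t z) := by
  have h0 : ∀ F : ℝ → Z → ℝ, NN0 T r C F → NN0 T r (|a| * C) (fun t z => a * F t z) := fun F h =>
    ⟨measurable_const.mul h.1, fun t => continuous_const.mul (h.2.1 t), fun t z => by
      rw [abs_mul, mul_assoc]; exact mul_le_mul_of_nonneg_left (h.2.2 t z) (abs_nonneg _)⟩
  induction n generalizing F with
  | zero => exact h0 F hF
  | succ n ih =>
    refine ⟨h0 F hF.1, fun t => (hF.2.1 t).const_mul a, fun j => ?_⟩
    simp only [dd_const_mul a (hF.2.1 _)]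
    exact ih (hF.2.2 j)

theorem NN.sub (hF : NN e T r n C F) (hG : NN e T r n C' G) :
    NN e T r n (C + C') (fun t z => F t z - G t z) := by
  have := hF.add (hG.const_mul (-1))
  simpa [sub_eq_add_neg] using this

theorem NN.const (a : ℝ) : NN e T r n (|a| * Real.exp (|r| * |T|)) (fun _ _ => a) := by
  have h0 : ∀ a : ℝ, NN0 T r (|a| * Real.exp (|r| * |T|)) (fun _ (_ : Z) => a) := fun a =>
    ⟨measurable_const, fun _ => continuous_const, fun t z => by
      rw [mul_assoc, ← Real.exp_add]
      refine le_mul_of_one_le_right (abs_nonneg _) (Real.one_le_exp ?_)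
      have h1 : cl T t ≤ |T| := max_le (abs_nonneg _) ((min_le_left _ _).trans (le_abs_self _))
      have h2 := cl_nonneg T t
      have h3 : |r * cl T t| ≤ |r| * |T| := by
        rw [abs_mul, abs_of_nonneg h2]; gcongr
      linarith [neg_abs_le (r * cl T t)]⟩
  induction n generalizing a with
  | zero => exact h0 a
  | succ n ih =>
    refine ⟨h0 a, fun _ => differentiable_const a, fun j => ?_⟩
    have : (fun _ : ℝ => dd (e j) (fun _ : Z => a)) = fun _ _ => (0 : ℝ) := by
      funext t z; simp [dd]
    rw [this]
    have := ih 0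
    exact this.mono (by rw [abs_zero, zero_mul]; positivity)

theorem NN.sum {ι : Type*} (s : Finset ι) {F : ι → ℝ → Z → ℝ} {C : ι → ℝ}
    (hF : ∀ i ∈ s, NN e T r n (C i) (F i)) :
    NN e T r n (∑ i ∈ s, C i) (fun t z => ∑ i ∈ s, F i t z) := by
  classical
  induction s using Finset.induction_on with
  | empty => simpa using NN.const (e := e) (T := T) (r := r) (n := n) 0
  | insert i s hi ih =>
    simp only [Finset.sum_insert hi]
    exact (hF i (Finset.mem_insert_self i s)).add
      (ih fun j hj => hF j (Finset.mem_insert_of_mem hj))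

/-- Only one factor carries the exponential weight: the coefficients are unweighted and the unknown
is weighted. -/
theorem NN.mul (hF : NN e T 0 n C F) (hG : NN e T r n C' G) :
    NN e T r n (2 ^ n * (C * C')) (fun t z => F t z * G t z) := by
  have hC := hF.nonneg
  have hC' := hG.nonneg
  have h0 : ∀ F G : ℝ → Z → ℝ, NN0 T 0 C F → NN0 T r C' G →
      NN0 T r (C * C') (fun t z => F t z * G t z) := fun F G h h' =>
    ⟨h.1.mul h'.1, fun t => (h.2.1 t).mul (h'.2.1 t), fun t z => by
      have h1 := h.2.2 t z
      rw [zero_mul, Real.exp_zero, mul_one] at h1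
      rw [abs_mul, mul_assoc]
      exact mul_le_mul h1 (h'.2.2 t z) (abs_nonneg _) hC⟩
  induction n generalizing F G with
  | zero =>
    have h1 := h0 F G hF hG
    rw [← one_mul (C * C')] at h1
    exact h1
  | succ n ih =>
    refine ⟨?_, fun t => (hF.2.1 t).mul (hG.2.1 t), fun j => ?_⟩
    · have := NN.mono (e := e) (n := 0) (h0 F G hF.1 hG.1)
        (C' := 2 ^ (n + 1) * (C * C'))
        (le_mul_of_one_le_left (mul_nonneg hC hC') (one_le_pow₀ (by norm_num)))
      exact this
    · simp only [dd_mul (hF.2.1 _) (hG.2.1 _)]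
      have := (ih (hF.2.2 j) hG.pred).add (ih hF.pred (hG.2.2 j))
      exact this.mono (by rw [pow_succ]; linarith)

/-- The coordinate functionals of a basis. -/
def crd (e : Module.Basis J ℝ Z) (j : J) : Z →L[ℝ] ℝ := LinearMap.toContinuousLinearMap (e.coord j)

theorem clm_eq_sum_crd (e : Module.Basis J ℝ Z) (L : Z →L[ℝ] ℝ) :
    L = ∑ j, (L (e j)) • crd e j := by
  ext z
  have h1 := congrArg L (e.sum_repr z)
  rw [map_sum] at h1
  rw [← h1]
  simp [crd, mul_comm]

theorem fderiv_eq_sum (e : Module.Basis J ℝ Z) (φ : Z → ℝ) (z : Z) :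
    fderiv ℝ φ z = ∑ j, (dd (e j) φ z) • crd e j := clm_eq_sum_crd e _

/-- The gain `1 / r` comes from `∫₀ᵗ e^{rs} ds ≤ e^{rt} / r`. It makes the Picard map a contraction
on all of `[0,T]` when `r` is large. -/
theorem NN0.integral (hr : 0 < r) (hF : NN0 T r C F) :
    NN0 T r (C / r) (fun t z => ∫ s in (0 : ℝ)..cl T t, F s z) := by
  have hC : 0 ≤ C := NN.nonneg (e := Module.finBasis ℝ Z) (n := 0) hF
  have hmeas : ∀ z, Measurable fun s => F s z := fun z => hF.1.comp measurable_prodMk_right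
  refine ⟨?_, fun t => ?_, fun t z => ?_⟩
  · have h1 : ∀ t z, ∫ s in (0 : ℝ)..cl T t, F s z =
        ∫ s, (fun p : (ℝ × Z) × ℝ => (Ioc (0 : ℝ) (cl T p.1.1)).indicator
          (fun s => F s p.1.2) p.2) ((t, z), s) := by
      intro t z
      rw [intervalIntegral.integral_of_le (cl_nonneg T t),
        ← integral_indicator measurableSet_Ioc]
    have h2 : Measurable (fun p : (ℝ × Z) × ℝ => (Ioc (0 : ℝ) (cl T p.1.1)).indicator
          (fun s => F s p.1.2) p.2) := by
      have : (fun p : (ℝ × Z) × ℝ => (Ioc (0 : ℝ) (cl T p.1.1)).indicator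
          (fun s => F s p.1.2) p.2) = {p : (ℝ × Z) × ℝ | 0 < p.2 ∧ p.2 ≤ cl T p.1.1}.indicator
          (fun p => F p.2 p.1.2) := by
        funext p
        simp only [indicator, mem_Ioc, mem_ofPred_eq]
      rw [this]
      refine Measurable.indicator (hF.1.comp (measurable_snd.prodMk
        (measurable_snd.comp measurable_fst))) ?_
      exact (measurableSet_lt measurable_const measurable_snd).inter
        (measurableSet_le measurable_snd
          ((measurable_cl T).comp (measurable_fst.comp measurable_fst)))
    have h3 := (h2.stronglyMeasurable.integral_prod_right' (ν := volume)).measurable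
    have h4 : Function.uncurry (fun t z => ∫ s in (0 : ℝ)..cl T t, F s z) = _ :=
      funext fun p => h1 p.1 p.2
    rw [h4]
    exact h3
  · refine intervalIntegral.continuous_of_dominated_interval
      (bound := fun s => C * Real.exp (|r| * |T|)) (fun z => (hmeas z).aestronglyMeasurable)
      (fun z => Filter.Eventually.of_forall fun s _ => ?_) intervalIntegrable_const
      (Filter.Eventually.of_forall fun s _ => hF.2.1 s)
    refine (hF.2.2 s z).trans ?_
    have h1 : cl T s ≤ |T| := max_le (abs_nonneg _) ((min_le_left _ _).trans (le_abs_self _))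
    have h2 := cl_nonneg T s
    have h3 := le_abs_self r
    gcongr
  · have h0 := cl_nonneg T t
    have hb : ∀ s ∈ Ioc 0 (cl T t), ‖F s z‖ ≤ C * Real.exp (r * s) := by
      intro s hs
      have := hF.2.2 s z
      rwa [cl_of_mem ⟨hs.1.le, hs.2.trans (by
        by_contra hcon
        push Not at hcon
        rw [cl] at hs hcon
        rcases le_total 0 (min T t) with h | h
        · rw [max_eq_right h] at hcon
          exact absurd (min_le_left T t) (not_le.2 hcon)
        · rw [max_eq_left h] at hs
          exact absurd hs.1 (not_lt.2 hs.2))⟩] at this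
    have h1 := intervalIntegral.norm_integral_le_of_norm_le h0
      (Filter.Eventually.of_forall fun s hs => hb s hs)
      (Continuous.intervalIntegrable (by fun_prop) _ _ :
        IntervalIntegrable (fun s => C * Real.exp (r * s)) volume 0 (cl T t))
    refine h1.trans ?_
    rw [intervalIntegral.integral_const_mul, intervalIntegral.integral_comp_mul_left _ hr.ne',
      integral_exp, mul_zero, Real.exp_zero, smul_eq_mul, div_mul_eq_mul_div, mul_comm r⁻¹,
      ← mul_assoc, ← div_eq_mul_inv]
    gcongr
    linarith

/-- Differentiation under the integral. Measurability in time and boundedness of the full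
differential are recovered from the basis directions through `fderiv_eq_sum`. -/
theorem dd_integral (hF : NN e T r (n + 1) C F) (j : J) (t : ℝ) :
    Differentiable ℝ (fun z => ∫ s in (0 : ℝ)..cl T t, F s z) ∧
    dd (e j) (fun z => ∫ s in (0 : ℝ)..cl T t, F s z) =
      fun z => ∫ s in (0 : ℝ)..cl T t, dd (e j) (F s) z := by
  have hC := hF.nonneg
  have hmeas : ∀ z, Measurable fun s => F s z := fun z => hF.1.1.comp measurable_prodMk_right
  have hmeas' : ∀ j z, Measurable fun s => dd (e j) (F s) z := fun j z =>
    (hF.2.2 j).nn0.1.comp measurable_prodMk_right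
  have hexp : ∀ s, Real.exp (r * cl T s) ≤ Real.exp (|r| * |T|) := by
    intro s
    have h1 : cl T s ≤ |T| := max_le (abs_nonneg _) ((min_le_left _ _).trans (le_abs_self _))
    have h2 := cl_nonneg T s
    have h3 := le_abs_self r
    gcongr
  have hbd : ∀ j s z, |dd (e j) (F s) z| ≤ C * Real.exp (|r| * |T|) := fun j s z =>
    ((hF.2.2 j).nn0.2.2 s z).trans (mul_le_mul_of_nonneg_left (hexp s) hC)
  have hfm : ∀ z, StronglyMeasurable fun s => fderiv ℝ (F s) z := by
    intro z
    simp only [fderiv_eq_sum e]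
    exact Finset.stronglyMeasurable_fun_sum _ fun j _ =>
      (hmeas' j z).stronglyMeasurable.smul_const _
  have hfb : ∀ s z, ‖fderiv ℝ (F s) z‖ ≤ ∑ j, C * Real.exp (|r| * |T|) * ‖crd e j‖ := by
    intro s z
    rw [fderiv_eq_sum e]
    refine (norm_sum_le _ _).trans (Finset.sum_le_sum fun j _ => ?_)
    rw [norm_smul]
    exact mul_le_mul_of_nonneg_right (hbd j s z) (norm_nonneg _)
  have hint : ∀ z, IntervalIntegrable (fun s => F s z) volume 0 (cl T t) := by
    intro z
    refine (intervalIntegrable_const (c := C * Real.exp (|r| * |T|))).mono_fun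
      (hmeas z).aestronglyMeasurable (Filter.Eventually.of_forall fun s => ?_)
    change ‖F s z‖ ≤ ‖_‖
    rw [Real.norm_eq_abs, Real.norm_eq_abs]
    exact ((hF.1.2.2 s z).trans (mul_le_mul_of_nonneg_left (hexp s) hC)).trans (le_abs_self _)
  have key : ∀ z, HasFDerivAt (fun z => ∫ s in (0 : ℝ)..cl T t, F s z)
      (∫ s in (0 : ℝ)..cl T t, fderiv ℝ (F s) z) z := by
    intro z
    exact intervalIntegral.hasFDerivAt_integral_of_dominated_of_fderiv_le
      (F := fun z s => F s z) (F' := fun z s => fderiv ℝ (F s) z)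
      (bound := fun _ => ∑ j, C * Real.exp (|r| * |T|) * ‖crd e j‖) Filter.univ_mem
      (Filter.Eventually.of_forall fun y => (hmeas y).aestronglyMeasurable) (hint z)
      (hfm z).aestronglyMeasurable
      (Filter.Eventually.of_forall fun s _ y _ => hfb s y) intervalIntegrable_const
      (Filter.Eventually.of_forall fun s _ y _ => (hF.2.1 s y).hasFDerivAt)
  refine ⟨fun z => (key z).differentiableAt, funext fun z => ?_⟩
  unfold dd
  rw [(key z).fderiv]
  have hfi : IntervalIntegrable (fun s => fderiv ℝ (F s) z) volume 0 (cl T t) := by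
    refine (intervalIntegrable_const (c := ∑ j, C * Real.exp (|r| * |T|) * ‖crd e j‖)).mono_fun
      (hfm z).aestronglyMeasurable (Filter.Eventually.of_forall fun s => ?_)
    exact (hfb s z).trans (le_abs_self _)
  rw [ContinuousLinearMap.intervalIntegral_apply hfi]

theorem NN.integral (hr : 0 < r) (hF : NN e T r n C F) :
    NN e T r n (C / r) (fun t z => ∫ s in (0 : ℝ)..cl T t, F s z) := by
  induction n generalizing F with
  | zero => exact NN0.integral hr hF
  | succ n ih =>
    refine ⟨NN0.integral hr hF.1, fun t => ?_, fun j => ?_⟩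
    -- An empty basis offers no direction in which to apply `dd_integral`; the space is then a
    -- single point.
    · rcases isEmpty_or_nonempty J with hJ | ⟨⟨j⟩⟩
      · have : Subsingleton Z := by
          refine ⟨fun a b => ?_⟩
          rw [← e.sum_repr a, ← e.sum_repr b]
          simp
        have hc : (fun z => ∫ s in (0 : ℝ)..cl T t, F s z) =
            fun _ => ∫ s in (0 : ℝ)..cl T t, F s 0 := by
          funext z; rw [Subsingleton.elim z 0]
        change Differentiable ℝ (fun z => ∫ s in (0 : ℝ)..cl T t, F s z)
        rw [hc]
        exact differentiable_const _
      · exact (dd_integral hF j t).1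
    · simp only [(dd_integral hF j _).2]
      exact ih (hF.2.2 j)

/-- A uniform limit of functions in the class. -/
theorem NN.limit {F : ℕ → ℝ → Z → ℝ} {ε : ℕ → ℝ} (hF : ∀ i, NN e T r n C (F i))
    (hε : Filter.Tendsto ε Filter.atTop (nhds 0))
    (hFε : ∀ i k, i ≤ k → NN e T r n (ε i) (fun t z => F i t z - F k t z)) :
    ∃ G : ℝ → Z → ℝ, (∀ t z, Filter.Tendsto (fun i => F i t z) Filter.atTop (nhds (G t z))) ∧
      NN e T r n C G ∧ ∀ i, NN e T r n (ε i) (fun t z => F i t z - G t z) := by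
  have h0 : ∀ F : ℕ → ℝ → Z → ℝ, (∀ i, NN0 T r C (F i)) →
      (∀ i k, i ≤ k → NN0 T r (ε i) (fun t z => F i t z - F k t z)) →
      ∃ G : ℝ → Z → ℝ, (∀ t z, Filter.Tendsto (fun i => F i t z) Filter.atTop (nhds (G t z))) ∧
      (∀ t, TendstoUniformly (fun i z => F i t z) (G t) Filter.atTop) ∧
      NN0 T r C G ∧ ∀ i, NN0 T r (ε i) (fun t z => F i t z - G t z) := by
    intro F hF hFε
    have hcau : ∀ t z, CauchySeq fun i => F i t z := by
      intro t z
      refine cauchySeq_of_le_tendsto_0' (fun i => ε i * Real.exp (r * cl T t)) (fun i k hik => ?_) ?_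
      · rw [Real.dist_eq]; exact (hFε i k hik).2.2 t z
      · simpa using hε.mul_const (Real.exp (r * cl T t))
    choose G hG using fun t z => cauchySeq_tendsto_of_complete (hcau t z)
    have hd : ∀ i t z, |F i t z - G t z| ≤ ε i * Real.exp (r * cl T t) := by
      intro i t z
      have h1 : Filter.Tendsto (fun k => |F i t z - F k t z|) Filter.atTop
          (nhds |F i t z - G t z|) := ((hG t z).const_sub _).abs
      refine le_of_tendsto h1 ?_
      filter_upwards [Filter.eventually_ge_atTop i] with k hk
      exact (hFε i k hk).2.2 t z
    have hu : ∀ t, TendstoUniformly (fun i z => F i t z) (G t) Filter.atTop := by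
      intro t
      rw [Metric.tendstoUniformly_iff]
      intro η hη
      have h1 : Filter.Tendsto (fun i => ε i * Real.exp (r * cl T t)) Filter.atTop (nhds 0) := by
        simpa using hε.mul_const (Real.exp (r * cl T t))
      filter_upwards [h1.eventually_lt_const hη] with i hi z
      rw [dist_comm, Real.dist_eq]
      exact (hd i t z).trans_lt hi
    have hGm : Measurable (Function.uncurry G) := measurable_of_tendsto_metrizable
      (fun i => (hF i).1) (tendsto_pi_nhds.2 fun p => hG p.1 p.2)
    have hGc : ∀ t, Continuous (G t) := fun t =>
      (hu t).continuous (Filter.Frequently.of_forall fun i => (hF i).2.1 t)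
    refine ⟨G, hG, hu, ⟨hGm, hGc, fun t z => ?_⟩, fun i => ⟨(hF i).1.sub hGm,
      fun t => ((hF i).2.1 t).sub (hGc t), hd i⟩⟩
    exact le_of_tendsto' (hG t z).abs fun i => (hF i).2.2 t z
  induction n generalizing F with
  | zero =>
    obtain ⟨G, h1, _, h2, h3⟩ := h0 F hF hFε
    exact ⟨G, h1, h2, h3⟩
  | succ n ih =>
    obtain ⟨G, h1, hu, h2, h3⟩ := h0 F (fun i => (hF i).1) (fun i k hik => (hFε i k hik).1)
    have h4 := fun j => ih (F := fun i t => dd (e j) (F i t)) (fun i => (hF i).2.2 j)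
      (fun i k hik => by
        have := (hFε i k hik).2.2 j
        simpa only [dd_sub ((hF i).2.1 _) ((hF k).2.1 _)] using this)
    choose D hD1 hD2 hD3 using h4
    -- The induction hypothesis gives uniform limits of the directional derivatives. They assemble
    -- to a uniform limit of differentials, which is the differential of `G`.
    have hfd : ∀ t z, HasFDerivAt (G t) (∑ j, (D j t z) • crd e j) z := by
      intro t z
      refine hasFDerivAt_of_tendstoUniformly (l := Filter.atTop) (f := fun i => F i t)
        (f' := fun i z => fderiv ℝ (F i t) z) (g' := fun z => ∑ j, (D j t z) • crd e j) ?_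
        (fun i z => ((hF i).2.1 t z).hasFDerivAt) (fun z => h1 t z) z
      rw [Metric.tendstoUniformly_iff]
      intro η hη
      set b := ∑ j, Real.exp (r * cl T t) * ‖crd e j‖
      have h1 : Filter.Tendsto (fun i => ε i * b) Filter.atTop (nhds 0) := by
        simpa using hε.mul_const b
      filter_upwards [h1.eventually_lt_const hη] with i hi z
      rw [dist_comm, dist_eq_norm, fderiv_eq_sum e, ← Finset.sum_sub_distrib]
      refine ((norm_sum_le _ _).trans (Finset.sum_le_sum fun j _ => ?_)).trans_lt
        ((Finset.mul_sum _ _ _).symm.trans_lt hi)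
      rw [← sub_smul, norm_smul, ← mul_assoc]
      exact mul_le_mul_of_nonneg_right ((hD3 j i).nn0.2.2 t z) (norm_nonneg _)
    have hdd : ∀ j t, dd (e j) (G t) = D j t := by
      intro j t
      funext z
      classical
      simp [dd, (hfd t z).fderiv, crd, Finsupp.single_apply]
    have hdf : ∀ t, Differentiable ℝ (G t) := fun t z => (hfd t z).differentiableAt
    refine ⟨G, h1, ⟨h2, hdf, fun j => ?_⟩, fun i => ⟨h3 i, fun t => ((hF i).2.1 t).sub (hdf t),
      fun j => ?_⟩⟩
    · simp only [hdd]; exact hD2 j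
    · simp only [dd_sub ((hF i).2.1 _) (hdf _), hdd]
      exact hD3 j i

end NN

/-! ### Linear equations with shifts -/

/-- The operator `F ↦ ∑ b_i (F ∘ σ_i)`. -/
def shiftOp {ι : Type} [Fintype ι] (b : ι → ℝ → Z → ℝ) (σ : ι → Z → Z) (F : ℝ → Z → ℝ) :
    ℝ → Z → ℝ := fun t z => ∑ i, b i t z * F t (σ i z)

section Equation

variable {ι : Type} [Fintype ι] {e} {T r C B κ : ℝ} {n : ℕ} {F G : ℝ → Z → ℝ}
  {b : ι → ℝ → Z → ℝ} {σ : ι → Z → Z}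

/-- Composition with the maps `σ_i` preserves the classes. -/
def CompBound (e : Module.Basis J ℝ Z) (T : ℝ) (n : ℕ) (σ : ι → Z → Z) (κ : ℝ) : Prop :=
  ∀ i (r C : ℝ) (F : ℝ → Z → ℝ), NN e T r n C F → NN e T r n (κ * C) (fun t z => F t (σ i z))

theorem NN.shiftOp (hσ : CompBound e T n σ κ) (hb : ∀ i, NN e T 0 n B (b i))
    (hF : NN e T r n C F) :
    NN e T r n (Fintype.card ι * (2 ^ n * (B * κ)) * C) (shiftOp b σ F) := by
  have := NN.sum Finset.univ fun i (_ : i ∈ Finset.univ) => (hb i).mul (hσ i r C F hF)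
  refine NN.mono this (le_of_eq ?_)
  rw [Finset.sum_const, Finset.card_univ, nsmul_eq_mul]
  ring

theorem NN0.intervalIntegrable (hF : NN0 T r C F) (z : Z) (s t : ℝ) :
    IntervalIntegrable (fun s => F s z) volume s t := by
  have hC : 0 ≤ C := nonneg_of_mul_nonneg_left ((abs_nonneg _).trans (hF.2.2 0 0)) (Real.exp_pos _)
  refine (intervalIntegrable_const (c := C * Real.exp (|r| * |T|))).mono_fun
    (hF.1.comp measurable_prodMk_right).aestronglyMeasurable
    (Filter.Eventually.of_forall fun s => ?_)
  change ‖F s z‖ ≤ ‖_‖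
  rw [Real.norm_eq_abs, Real.norm_eq_abs]
  refine ((hF.2.2 s z).trans (mul_le_mul_of_nonneg_left ?_ hC)).trans (le_abs_self _)
  have h1 : cl T s ≤ |T| := max_le (abs_nonneg _) ((min_le_left _ _).trans (le_abs_self _))
  have h2 := cl_nonneg T s
  have h3 := le_abs_self r
  gcongr

/-- Solvability of `U = H + ∫ ∑ b_i (U ∘ σ_i)` in the classes. -/
theorem exists_solution (hσ : CompBound e T n σ κ)
    (hb : ∀ i, NN e T 0 n B (b i)) (hr : 0 < r)
    (hr2 : 2 * (Fintype.card ι * (2 ^ n * (B * κ))) ≤ r) {H : ℝ → Z → ℝ} (hH : NN e T r n C H) :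
    ∃ U, NN e T r n (2 * C) U ∧
      ∀ t z, U t z = H t z + ∫ s in (0 : ℝ)..cl T t, shiftOp b σ U s z := by
  set A := Fintype.card ι * (2 ^ n * (B * κ)) with hA
  have hC := hH.nonneg
  set Φ : (ℝ → Z → ℝ) → (ℝ → Z → ℝ) :=
    fun F t z => ∫ s in (0 : ℝ)..cl T t, shiftOp b σ F s z with hΦ
  -- The choice `r ≥ 2A` makes the integral operator a contraction with factor `1/2`, simultaneously
  -- in all derivatives up to order `n`.
  have hΦ1 : ∀ {F : ℝ → Z → ℝ} {C : ℝ}, NN e T r n C F → NN e T r n (1 / 2 * C) (Φ F) := by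
    intro F C hF
    refine ((hF.shiftOp hσ hb).integral hr).mono ?_
    have := hF.nonneg
    rw [div_le_iff₀ hr]
    nlinarith
  have hΦsub : ∀ {F G : ℝ → Z → ℝ} {C C' : ℝ}, NN e T r n C F → NN e T r n C' G → ∀ t z,
      Φ F t z - Φ G t z = Φ (fun t z => F t z - G t z) t z := by
    intro F G C C' hF hG t z
    simp only [hΦ]
    rw [← intervalIntegral.integral_sub ((hF.shiftOp hσ hb).nn0.intervalIntegrable z _ _)
      ((hG.shiftOp hσ hb).nn0.intervalIntegrable z _ _)]
    refine intervalIntegral.integral_congr fun s _ => ?_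
    simp only [shiftOp, ← Finset.sum_sub_distrib]
    exact Finset.sum_congr rfl fun i _ => by ring
  let U : ℕ → ℝ → Z → ℝ := fun k => Nat.rec H (fun _ F t z => H t z + Φ F t z) k
  have hU0 : U 0 = H := rfl
  have hU1 : ∀ k, U (k + 1) = fun t z => H t z + Φ (U k) t z := fun k => rfl
  have hUb : ∀ k, NN e T r n (2 * C) (U k) := by
    intro k
    induction k with
    | zero => rw [hU0]; exact hH.mono (by linarith)
    | succ k ih => rw [hU1]; exact (hH.add (hΦ1 ih)).mono (by linarith)
  have hUd : ∀ k, NN e T r n ((1 / 2) ^ k * C) (fun t z => U k t z - U (k + 1) t z) := by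
    intro k
    induction k with
    | zero =>
      have := (hΦ1 hH).const_mul (-1)
      rw [hU1]
      simp only [hU0]
      have e1 : (fun t z => H t z - (H t z + Φ H t z)) = fun t z => -1 * Φ H t z := by
        funext t z; ring
      rw [e1]
      exact this.mono (by rw [abs_neg, abs_one]; linarith)
    | succ k ih =>
      have := hΦ1 ih
      have e1 : (fun t z => U (k + 1) t z - U (k + 1 + 1) t z) =
          Φ (fun t z => U k t z - U (k + 1) t z) := by
        funext t z
        rw [← hΦsub (hUb k) (hUb (k + 1)), hU1, hU1 (k + 1)]
        ring
      rw [e1]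
      exact this.mono (by rw [pow_succ]; linarith)
  -- The exact partial sum of the geometric series of successive differences.
  have hUd2 : ∀ i k, NN e T r n ((2 - 2 * (1 / 2) ^ k) * ((1 / 2) ^ i * C))
      (fun t z => U i t z - U (i + k) t z) := by
    intro i k
    induction k with
    | zero =>
      have e1 : (fun t z => U i t z - U (i + 0) t z) = fun _ _ => (0 : ℝ) := by
        funext t z; simp
      rw [e1]
      exact (NN.const 0).mono (by simp)
    | succ k ih =>
      have := ih.add (hUd (i + k))
      have e1 : (fun t z => U i t z - U (i + (k + 1)) t z) =
          fun t z => (U i t z - U (i + k) t z) + (U (i + k) t z - U (i + k + 1) t z) := by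
        funext t z; rw [← add_assoc]; ring
      rw [e1]
      refine this.mono (le_of_eq ?_)
      rw [pow_succ, pow_add]
      ring
  have hlim : Filter.Tendsto (fun i : ℕ => 2 * ((1 / 2 : ℝ) ^ i * C)) Filter.atTop (nhds 0) := by
    have := ((tendsto_pow_atTop_nhds_zero_of_lt_one (r := (1 / 2 : ℝ)) (by norm_num)
      (by norm_num)).mul_const C).const_mul 2
    simpa using this
  obtain ⟨V, hV1, hV2, hV3⟩ := NN.limit hUb hlim (fun i k hik => by
    obtain ⟨l, rfl⟩ := Nat.exists_eq_add_of_le hik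
    refine (hUd2 i l).mono ?_
    have : 0 ≤ (1 / 2 : ℝ) ^ l := by positivity
    have : 0 ≤ (1 / 2 : ℝ) ^ i * C := by positivity
    gcongr
    linarith)
  refine ⟨V, hV2, fun t z => ?_⟩
  have h1 : Filter.Tendsto (fun k => U (k + 1) t z) Filter.atTop (nhds (V t z)) :=
    (hV1 t z).comp (Filter.tendsto_add_atTop_nat 1)
  have h2 : Filter.Tendsto (fun k => H t z + Φ (U k) t z) Filter.atTop
      (nhds (H t z + Φ V t z)) := by
    refine Filter.Tendsto.const_add _ ?_
    rw [tendsto_iff_dist_tendsto_zero]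
    refine squeeze_zero (fun _ => dist_nonneg) (g := fun k =>
      1 / 2 * (2 * ((1 / 2 : ℝ) ^ k * C)) * Real.exp (r * cl T t)) (fun k => ?_) ?_
    · rw [Real.dist_eq, hΦsub (hUb k) hV2]
      exact (hΦ1 (hV3 k)).nn0.2.2 t z
    · have h2 := (hlim.const_mul (1 / 2)).mul_const (Real.exp (r * cl T t))
      rw [mul_zero, zero_mul] at h2
      exact h2
  exact tendsto_nhds_unique h1 h2

end Equation

/-- A bounded function dominated by its own time integral vanishes. -/
theorem eq_zero_of_integral_eq {X : Type*} {ι : Type*} [Fintype ι] {T A C : ℝ} {w : ℝ → X → ℝ}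
    {b : ι → ℝ → X → ℝ} {σ : ι → X → X} (hA : 0 ≤ A)
    (hC : ∀ t ∈ Icc 0 T, ∀ x, |w t x| ≤ C) (hb : ∀ i, ∀ t ∈ Icc 0 T, ∀ x, |b i t x| ≤ A)
    (hw : ∀ t ∈ Icc 0 T, ∀ x, w t x = ∫ s in (0 : ℝ)..t, ∑ i, b i s x * w s (σ i x)) :
    ∀ t ∈ Icc 0 T, ∀ x, w t x = 0 := by
  set A' : ℝ := Fintype.card ι * A with hA'
  have hA'0 : 0 ≤ A' := by positivity
  have main : ∀ n : ℕ, ∀ t ∈ Icc 0 T, ∀ x, |w t x| ≤ C * A' ^ n * t ^ n / n.factorial := by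
    intro n
    induction n with
    | zero =>
      intro t ht x
      simpa using hC t ht x
    | succ n ih =>
      intro t ht x
      have ht0 := ht.1
      rw [hw t ht]
      have h1 := intervalIntegral.norm_integral_le_of_norm_le ht0 (g := fun s =>
        A' * (C * A' ^ n * s ^ n / n.factorial)) (f := fun s => ∑ i, b i s x * w s (σ i x))
        (μ := volume) (Filter.Eventually.of_forall fun s hs => ?_)
        (Continuous.intervalIntegrable (by fun_prop) _ _)
      · refine h1.trans (le_of_eq ?_)
        have e2 : ∀ s : ℝ, A' * (C * A' ^ n * s ^ n / n.factorial) =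
            (C * A' ^ (n + 1) / n.factorial) * s ^ n := fun s => by ring
        simp_rw [e2]
        rw [intervalIntegral.integral_const_mul, integral_pow, Nat.factorial_succ]
        push_cast
        field_simp
        simp
      · have hsT : s ∈ Icc 0 T := ⟨hs.1.le, hs.2.trans ht.2⟩
        refine (norm_sum_le _ _).trans ?_
        have : ∑ i, ‖b i s x * w s (σ i x)‖ ≤ ∑ _i : ι, A * (C * A' ^ n * s ^ n / n.factorial) := by
          refine Finset.sum_le_sum fun i _ => ?_
          rw [norm_mul]
          exact mul_le_mul (hb i s hsT x) (ih s hsT _) (norm_nonneg _) hA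
        rw [Finset.sum_const, Finset.card_univ, nsmul_eq_mul, ← mul_assoc] at this
        exact this
  intro t ht x
  have hlim : Filter.Tendsto (fun n : ℕ => C * A' ^ n * t ^ n / n.factorial) Filter.atTop
      (nhds 0) := by
    have := (FloorSemiring.tendsto_pow_div_factorial_atTop (A' * t)).const_mul C
    simp only [mul_zero] at this
    refine this.congr fun n => ?_
    rw [mul_pow]
    ring
  have := ge_of_tendsto' hlim (fun n => main n t ht x)
  exact abs_nonpos_iff.1 this

end FDScheme

namespace FDScheme

/-! ### Smooth functions, measurable in time -/

section SM

variable {Z : Type} [NormedAddCommGroup Z] [NormedSpace ℝ Z] [FiniteDimensional ℝ Z]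
  [MeasurableSpace Z] [BorelSpace Z] {J : Type} [Fintype J] {e : Module.Basis J ℝ Z} {T : ℝ}
  {F G : ℝ → Z → ℝ}

/-- Functions bounded together with all their derivatives in `z`. -/
def SM (e : Module.Basis J ℝ Z) (T : ℝ) (F : ℝ → Z → ℝ) : Prop := ∀ n, ∃ C, NN e T 0 n C F

theorem SM.add (hF : SM e T F) (hG : SM e T G) : SM e T (fun t z => F t z + G t z) := fun n => by
  obtain ⟨C, hC⟩ := hF n
  obtain ⟨C', hC'⟩ := hG n
  exact ⟨_, hC.add hC'⟩

theorem SM.sub (hF : SM e T F) (hG : SM e T G) : SM e T (fun t z => F t z - G t z) := fun n => by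
  obtain ⟨C, hC⟩ := hF n
  obtain ⟨C', hC'⟩ := hG n
  exact ⟨_, hC.sub hC'⟩

theorem SM.mul (hF : SM e T F) (hG : SM e T G) : SM e T (fun t z => F t z * G t z) := fun n => by
  obtain ⟨C, hC⟩ := hF n
  obtain ⟨C', hC'⟩ := hG n
  exact ⟨_, hC.mul hC'⟩

theorem SM.const (a : ℝ) : SM e T (fun _ _ => a) := fun _ => ⟨_, NN.const a⟩

theorem SM.const_mul (a : ℝ) (hF : SM e T F) : SM e T (fun t z => a * F t z) :=
  (SM.const a).mul hF

theorem SM.sum {ι : Type*} (s : Finset ι) {F : ι → ℝ → Z → ℝ} (hF : ∀ i, SM e T (F i)) :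
    SM e T (fun t z => ∑ i ∈ s, F i t z) := fun n => by
  choose C hC using fun i => hF i n
  exact ⟨_, NN.sum s fun i _ => hC i⟩

theorem SM.dd (hF : SM e T F) (j : J) : SM e T (fun t => dd (e j) (F t)) := fun n => by
  obtain ⟨C, hC⟩ := hF (n + 1)
  exact ⟨C, hC.2.2 j⟩

theorem SM.iterate_dd (hF : SM e T F) (j : J) (k : ℕ) :
    SM e T (fun t => (FDScheme.dd (e j))^[k] (F t)) := by
  induction k generalizing F with
  | zero => exact hF
  | succ k ih => exact ih (hF.dd j)

theorem NN.integral_of_nonneg (hT : 0 ≤ T) {n : ℕ} {C : ℝ} (hF : NN e T 0 n C F) :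
    NN e T 0 n (C * Real.exp T) (fun t z => ∫ s in (0 : ℝ)..cl T t, F s z) := by
  have := ((hF.weight zero_le_one).integral one_pos).unweight hT zero_le_one
  simpa using this

theorem SM.integral (hT : 0 ≤ T) (hF : SM e T F) :
    SM e T (fun t z => ∫ s in (0 : ℝ)..cl T t, F s z) := fun n => by
  obtain ⟨C, hC⟩ := hF n
  exact ⟨_, hC.integral_of_nonneg hT⟩

theorem NN.contDiff {n : ℕ} {r C : ℝ} (hF : NN e T r n C F) (t : ℝ) : ContDiff ℝ n (F t) := by
  induction n generalizing F with
  | zero => exact contDiff_zero.2 (hF.nn0.2.1 t)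
  | succ n ih =>
    have : ((n + 1 : ℕ) : WithTop ℕ∞) = (n : WithTop ℕ∞) + 1 := by push_cast; rfl
    rw [this, contDiff_succ_iff_fderiv]
    refine ⟨hF.2.1 t, by simp, ?_⟩
    have h1 : fderiv ℝ (F t) = fun z => ∑ j, (FDScheme.dd (e j) (F t) z) • crd e j :=
      funext (fderiv_eq_sum e _)
    rw [h1]
    exact ContDiff.sum fun j _ => (ih (hF.2.2 j)).smul contDiff_const

theorem SM.contDiff (hF : SM e T F) (t : ℝ) : ContDiff ℝ ∞ (F t) :=
  contDiff_infty.2 fun n => by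
    obtain ⟨C, hC⟩ := hF n
    exact hC.contDiff t

/-- The classes only speak of basis directions. Expanding the differential in coordinate functionals
converts such bounds into bounds on the full iterated derivatives. -/
theorem SM.norm_iteratedFDeriv_le (hF : SM e T F) (n : ℕ) :
    ∃ C, ∀ t z, ‖iteratedFDeriv ℝ n (F t) z‖ ≤ C := by
  induction n generalizing F with
  | zero =>
    obtain ⟨C, hC⟩ := hF 0
    refine ⟨C, fun t z => ?_⟩
    have := hC.2.2 t z
    rw [zero_mul, Real.exp_zero, mul_one] at this
    rwa [norm_iteratedFDeriv_zero]
  | succ n ih =>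
    choose C hC using fun j => ih (hF.dd j)
    refine ⟨∑ j, ‖ContinuousLinearMap.smulRight (1 : ℝ →L[ℝ] ℝ) (crd e j)‖ * C j, fun t z => ?_⟩
    rw [← norm_iteratedFDeriv_fderiv]
    have h1 : fderiv ℝ (F t) = ∑ j, fun z =>
        (ContinuousLinearMap.smulRight (1 : ℝ →L[ℝ] ℝ) (crd e j)) (FDScheme.dd (e j) (F t) z) := by
      funext z
      rw [fderiv_eq_sum e, Finset.sum_apply]
      simp
    have hs : ∀ j, ContDiff ℝ n (FDScheme.dd (e j) (F t)) := fun j =>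
      contDiff_infty.1 ((hF.dd j).contDiff t) n
    rw [h1, iteratedFDeriv_sum_apply (f := fun j z => (ContinuousLinearMap.smulRight
      (1 : ℝ →L[ℝ] ℝ) (crd e j)) (FDScheme.dd (e j) (F t) z)) fun j _ => ((ContinuousLinearMap.smulRight (1 : ℝ →L[ℝ] ℝ)
      (crd e j)).contDiff.comp (hs j)).contDiffAt]
    refine (norm_sum_le _ _).trans (Finset.sum_le_sum fun j _ => ?_)
    refine (ContinuousLinearMap.norm_iteratedFDeriv_comp_left
      (ContinuousLinearMap.smulRight (1 : ℝ →L[ℝ] ℝ) (crd e j)) (f := FDScheme.dd (e j) (F t))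
      (hs j).contDiffAt le_rfl).trans ?_
    exact mul_le_mul_of_nonneg_left (hC j t z) (norm_nonneg _)

theorem NN.shift {n : ℕ} {r C : ℝ} (hF : NN e T r n C F) (y : Z) :
    NN e T r n C (fun t z => F t (z + y)) := by
  have h0 : ∀ F : ℝ → Z → ℝ, NN0 T r C F → NN0 T r C (fun t z => F t (z + y)) := fun F h =>
    ⟨h.1.comp (measurable_fst.prodMk (measurable_snd.add_const y)),
      fun t => (h.2.1 t).comp (continuous_id.add continuous_const), fun t z => h.2.2 t _⟩
  induction n generalizing F with
  | zero => exact h0 F hF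
  | succ n ih =>
    refine ⟨h0 F hF.1, fun t => (hF.2.1 t).comp (differentiable_id.add_const y), fun j => ?_⟩
    simp only [dd_shift]
    exact ih (hF.2.2 j)

theorem SM.shift (hF : SM e T F) (y : Z) : SM e T (fun t z => F t (z + y)) := fun n => by
  obtain ⟨C, hC⟩ := hF n
  exact ⟨C, hC.shift y⟩

/-- Composition with smooth maps preserves the classes. -/
theorem exists_compBound {ι : Type} [Fintype ι] {σ : ι → Z → Z} {a : ι → J → J → Z → ℝ}
    (hσ : ∀ i, Differentiable ℝ (σ i))
    (hd : ∀ i j z, fderiv ℝ (σ i) z (e j) = ∑ k, a i j k z • e k)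
    (ha : ∀ i j k, SM e T (fun _ => a i j k)) (n : ℕ) : ∃ κ, 0 ≤ κ ∧ CompBound e T n σ κ := by
  have h0 : ∀ i (r C : ℝ) (F : ℝ → Z → ℝ), NN0 T r C F → NN0 T r C (fun t z => F t (σ i z)) :=
    fun i r C F h => ⟨h.1.comp (measurable_fst.prodMk
      ((hσ i).continuous.measurable.comp measurable_snd)),
      fun t => (h.2.1 t).comp (hσ i).continuous, fun t z => h.2.2 t _⟩
  induction n with
  | zero => exact ⟨1, zero_le_one, fun i r C F hF => by rw [one_mul]; exact h0 i r C F hF⟩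
  | succ n ih =>
    obtain ⟨κ, hκ, hcomp⟩ := ih
    choose A hA using fun i j k => ha i j k n
    have hA0 : ∀ i j k, 0 ≤ A i j k := fun i j k => (hA i j k).nonneg
    have hnn : ∀ i j k, 0 ≤ 2 ^ n * (A i j k * κ) := fun i j k =>
      mul_nonneg (by positivity) (mul_nonneg (hA0 i j k) hκ)
    refine ⟨1 + ∑ i, ∑ j, ∑ k, 2 ^ n * (A i j k * κ), ?_, fun i r C F hF => ?_⟩
    · exact add_nonneg zero_le_one (Finset.sum_nonneg fun i _ => Finset.sum_nonneg fun j _ =>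
        Finset.sum_nonneg fun k _ => hnn i j k)
    have hC := hF.nonneg
    have hle : ∀ j, ∑ k, 2 ^ n * (A i j k * κ) ≤ ∑ i, ∑ j, ∑ k, 2 ^ n * (A i j k * κ) := by
      intro j
      refine (Finset.single_le_sum (f := fun j => ∑ k, 2 ^ n * (A i j k * κ))
        (fun j _ => Finset.sum_nonneg fun k _ => hnn i j k) (Finset.mem_univ j)).trans ?_
      exact Finset.single_le_sum (f := fun i => ∑ j, ∑ k, 2 ^ n * (A i j k * κ))
        (fun i _ => Finset.sum_nonneg fun j _ => Finset.sum_nonneg fun k _ => hnn i j k)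
        (Finset.mem_univ i)
    have hs0 : 0 ≤ ∑ i, ∑ j, ∑ k, 2 ^ n * (A i j k * κ) :=
      Finset.sum_nonneg fun i _ => Finset.sum_nonneg fun j _ =>
        Finset.sum_nonneg fun k _ => hnn i j k
    refine ⟨?_, fun t => (hF.2.1 t).comp (hσ i), fun j => ?_⟩
    · have := h0 i r C F hF.1
      exact NN.mono (e := e) (n := 0) this (le_mul_of_one_le_left hC (by linarith))
    -- Chain rule: a derivative of the composition is a combination of composed derivatives with the
    -- entries of the Jacobian as coefficients, so the lower order bound applies.
    · have h1 : (fun t => FDScheme.dd (e j) (fun z => F t (σ i z))) =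
          fun t z => ∑ k, a i j k z * FDScheme.dd (e k) (F t) (σ i z) := by
        funext t z
        unfold FDScheme.dd
        have := fderiv_comp z ((hF.2.1 t) (σ i z)) (hσ i z)
        have h2 : (fun z => F t (σ i z)) = F t ∘ σ i := rfl
        rw [h2, this, ContinuousLinearMap.comp_apply, hd, map_sum]
        simp
      rw [h1]
      refine (NN.sum Finset.univ fun k _ => (hA i j k).mul
        (hcomp i r C _ (hF.2.2 k))).mono ?_
      have h3 : ∑ k, 2 ^ n * (A i j k * (κ * C)) = (∑ k, 2 ^ n * (A i j k * κ)) * C := by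
        rw [Finset.sum_mul]; exact Finset.sum_congr rfl fun k _ => by ring
      rw [h3]
      exact mul_le_mul_of_nonneg_right (by linarith [hle j]) hC

theorem cl_cl (hT : 0 ≤ T) (t : ℝ) : cl T (cl T t) = cl T t := cl_of_mem (cl_mem hT t)

section Equation

variable {ι : Type} [Fintype ι] {σ : ι → Z → Z} {b : ι → ℝ → Z → ℝ} {H U V : ℝ → Z → ℝ}

/-- Uniqueness for `U = H + ∫ ∑ b_i (U ∘ σ_i)`. -/
theorem solution_unique (hT : 0 ≤ T) {B r C r' C' : ℝ} (hb : ∀ i, NN0 T 0 B (b i))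
    (hH : ∀ t z, H (cl T t) z = H t z)
    (hU0 : NN0 T r C U) (hV0 : NN0 T r' C' V)
    (hU : ∀ t z, U t z = H t z + ∫ s in (0 : ℝ)..cl T t, shiftOp b σ U s z)
    (hV : ∀ t z, V t z = H t z + ∫ s in (0 : ℝ)..cl T t, shiftOp b σ V s z) :
    ∀ t z, U t z = V t z := by
  have hbd : ∀ {r C : ℝ} {U : ℝ → Z → ℝ}, NN0 T r C U → ∃ A, 0 ≤ A ∧ ∀ t z, |U t z| ≤ A := by
    intro r C U hU
    have hC : 0 ≤ C := nonneg_of_mul_nonneg_left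
      ((abs_nonneg _).trans (hU.2.2 0 0)) (Real.exp_pos _)
    refine ⟨C * Real.exp (|r| * |T|), by positivity, fun t z => (hU.2.2 t z).trans ?_⟩
    have h1 : cl T t ≤ |T| := max_le (abs_nonneg _) ((min_le_left _ _).trans (le_abs_self _))
    have h2 := cl_nonneg T t
    have h3 := le_abs_self r
    gcongr
  obtain ⟨A, hA0, hA⟩ := hbd hU0
  obtain ⟨A', hA'0, hA'⟩ := hbd hV0
  choose D hD0 hD using fun i => hbd (hb i)
  have hint : ∀ {U : ℝ → Z → ℝ} {A : ℝ}, Measurable (Function.uncurry U) → (∀ t z, |U t z| ≤ A) →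
      ∀ z a b', IntervalIntegrable (fun s => shiftOp b σ U s z) volume a b' := by
    intro U A hm hA z a b'
    unfold shiftOp
    have hf : ∀ i, IntervalIntegrable (fun s => b i s z * U s (σ i z)) volume a b' := by
      intro i
      refine (intervalIntegrable_const (c := D i * A)).mono_fun
        (((hb i).1.comp measurable_prodMk_right).mul
          (hm.comp measurable_prodMk_right)).aestronglyMeasurable
        (Filter.Eventually.of_forall fun s => ?_)
      change ‖b i s z * U s (σ i z)‖ ≤ ‖D i * A‖
      rw [norm_mul]
      exact (mul_le_mul (hD i s z) (hA s _) (abs_nonneg _) (hD0 i)).trans (le_abs_self _)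
    have := IntervalIntegrable.sum Finset.univ (fun i (_ : i ∈ Finset.univ) => hf i)
    refine this.congr (fun s _ => ?_)
    simp
  have hzero := eq_zero_of_integral_eq (T := T) (A := ∑ i, D i) (C := A + A')
    (w := fun t z => U t z - V t z) (b := b) (σ := σ) (Finset.sum_nonneg fun i _ => hD0 i)
    (fun t _ z => (abs_sub _ _).trans (add_le_add (hA t z) (hA' t z)))
    (fun i t _ z => (hD i t z).trans (Finset.single_le_sum (fun i _ => hD0 i) (Finset.mem_univ i)))
    (fun t ht z => by
      have h1 := hU t z
      have h2 := hV t z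
      rw [cl_of_mem ht] at h1 h2
      change U t z - V t z = _
      rw [h1, h2, add_sub_add_left_eq_sub,
        ← intervalIntegral.integral_sub (hint hU0.1 hA z _ _) (hint hV0.1 hA' z _ _)]
      refine intervalIntegral.integral_congr fun s _ => ?_
      simp only [shiftOp, ← Finset.sum_sub_distrib, mul_sub])
  intro t z
  -- Solutions depend on `t` only through `cl T t`, which extends the equality from `[0,T]` to all
  -- times.
  have h3 : ∀ W : ℝ → Z → ℝ, (∀ t z, W t z = H t z + ∫ s in (0 : ℝ)..cl T t, shiftOp b σ W s z) →
      W (cl T t) z = W t z := by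
    intro W hW
    rw [hW t z, hW (cl T t) z, hH, cl_cl hT]
  rw [← h3 U hU, ← h3 V hV]
  exact sub_eq_zero.1 (hzero _ (cl_mem hT t) z)

/-- Solvability in the classes, without weights. -/
theorem exists_solution_unweighted (hT : 0 ≤ T) {n : ℕ} {κ : ℝ} (hσ : CompBound e T n σ κ)
    (B : ℝ) : ∃ N, ∀ (b : ι → ℝ → Z → ℝ) (H : ℝ → Z → ℝ) (C : ℝ), (∀ i, NN e T 0 n B (b i)) →
      NN e T 0 n C H → ∃ U, NN e T 0 n (N * C) U ∧
      ∀ t z, U t z = H t z + ∫ s in (0 : ℝ)..cl T t, shiftOp b σ U s z := by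
  set r := |2 * (Fintype.card ι * (2 ^ n * (B * κ)))| + 1 with hr
  have hr0 : 0 < r := by positivity
  refine ⟨2 * Real.exp (r * T), fun b H C hb hH => ?_⟩
  obtain ⟨U, hU1, hU2⟩ := exists_solution hσ hb hr0 ((le_abs_self _).trans (by linarith))
    (hH.weight hr0.le)
  exact ⟨U, (hU1.unweight hT hr0.le).mono (by linarith), hU2⟩

/-- The contraction weight depends on the order of differentiation, so a solution is built for each
order separately. Uniqueness at order zero shows that they are one function. -/
theorem exists_smooth_solution (hT : 0 ≤ T) (hσ : ∀ n, ∃ κ, 0 ≤ κ ∧ CompBound e T n σ κ)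
    (hb : ∀ i, SM e T (b i)) (hH : SM e T H)
    (hHcl : ∀ t z, H (cl T t) z = H t z) : ∃ U, SM e T U ∧
      ∀ t z, U t z = H t z + ∫ s in (0 : ℝ)..cl T t, shiftOp b σ U s z := by
  have key : ∀ n, ∃ U C, NN e T 0 n C U ∧
      ∀ t z, U t z = H t z + ∫ s in (0 : ℝ)..cl T t, shiftOp b σ U s z := by
    intro n
    obtain ⟨κ, hκ, hc⟩ := hσ n
    choose B hB using fun i => hb i n
    obtain ⟨C, hC⟩ := hH n
    obtain ⟨N, hN⟩ := exists_solution_unweighted hT hc (∑ i, B i)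
    obtain ⟨U, h1, h2⟩ := hN b H C (fun i => (hB i).mono
      (Finset.single_le_sum (fun i _ => (hB i).nonneg) (Finset.mem_univ i))) hC
    exact ⟨U, _, h1, h2⟩
  choose U C hU hE using key
  refine ⟨U 0, fun n => ⟨C n, ?_⟩, hE 0⟩
  have heq : U n = U 0 := by
    choose B hB using fun i => hb i 0
    funext t z
    exact solution_unique hT (fun i => ((hB i).mono
      (Finset.single_le_sum (fun i _ => (hB i).nonneg) (Finset.mem_univ i))).nn0) hHcl
      (hU n).nn0 (hU 0).nn0 (hE n) (hE 0) t z
  rw [← heq]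
  exact hU n

/-- Dependence of the solution on the coefficients and the free term. -/
theorem solution_stability (hT : 0 ≤ T) {n : ℕ} {κ : ℝ} (hσ : CompBound e T n σ κ)
    (B C : ℝ) :
    ∃ N, ∀ (b b' : ι → ℝ → Z → ℝ) (H H' U U' : ℝ → Z → ℝ) (ε : ℝ), (∀ i, NN e T 0 n B (b i)) →
      (∀ i, NN e T 0 n B (b' i)) → (∀ i, NN e T 0 n ε (fun t z => b' i t z - b i t z)) →
      NN e T 0 n ε (fun t z => H' t z - H t z) → (∀ t z, H (cl T t) z = H t z) →
      (∀ t z, H' (cl T t) z = H' t z) → NN e T 0 n C U → NN e T 0 n C U' →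
      (∀ t z, U t z = H t z + ∫ s in (0 : ℝ)..cl T t, shiftOp b σ U s z) →
      (∀ t z, U' t z = H' t z + ∫ s in (0 : ℝ)..cl T t, shiftOp b' σ U' s z) →
      NN e T 0 n (N * ε) (fun t z => U' t z - U t z) := by
  obtain ⟨N, hN⟩ := exists_solution_unweighted hT hσ B
  refine ⟨N * (1 + Fintype.card ι * (2 ^ n * κ) * C * Real.exp T), ?_⟩
  intro b b' H H' U U' ε hb hb' hbε hHε hHcl hH'cl hU hU' hUe hU'e
  -- The difference `U' - U` solves the equation with coefficients `b` and this free term, which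
  -- collects the differences of the data and is of size `ε`.
  set Y : ℝ → Z → ℝ := fun t z => (H' t z - H t z) +
    ∫ s in (0 : ℝ)..cl T t, shiftOp (fun i t z => b' i t z - b i t z) σ U' s z with hY
  have hYn := hHε.add ((hU'.shiftOp hσ hbε).integral_of_nonneg hT)
  have hint : ∀ z t, IntervalIntegrable (fun s => shiftOp b σ (fun t z => U' t z - U t z) s z)
      volume 0 t := fun z t => ((hU'.sub hU).shiftOp hσ hb).nn0.intervalIntegrable z _ _
  obtain ⟨V, hV, hVe⟩ := hN b Y _ hb hYn
  have hYcl : ∀ t z, Y (cl T t) z = Y t z := fun t z => by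
    simp only [hY, hHcl, hH'cl, cl_cl hT]
  have hWe : ∀ t z, U' t z - U t z = Y t z +
      ∫ s in (0 : ℝ)..cl T t, shiftOp b σ (fun t z => U' t z - U t z) s z := by
    intro t z
    rw [hUe, hU'e, hY, add_assoc,
      ← intervalIntegral.integral_add
        ((hU'.shiftOp hσ hbε).nn0.intervalIntegrable z _ _) (hint z _),
      add_sub_add_comm, ← intervalIntegral.integral_sub
        ((hU'.shiftOp hσ hb').nn0.intervalIntegrable z _ _)
        ((hU.shiftOp hσ hb).nn0.intervalIntegrable z _ _)]
    congr 1
    refine intervalIntegral.integral_congr fun s _ => ?_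
    simp only [shiftOp, ← Finset.sum_sub_distrib, ← Finset.sum_add_distrib]
    exact Finset.sum_congr rfl fun i _ => by ring
  have heq : (fun t z => U' t z - U t z) = V := by
    funext t z
    exact solution_unique hT (fun i => (hb i).nn0) hYcl (hU'.sub hU).nn0 hV.nn0 hWe hVe t z
  rw [heq]
  refine hV.mono (le_of_eq ?_)
  ring

end Equation

end SM

end FDScheme

namespace FDScheme

/-! ### The classes on `ℝ^d` and on `ℝ × ℝ^d` -/

/-- The standard basis of `ℝ^d`. -/
def eE (d : ℕ) : Module.Basis (Fin d) ℝ (E d) := (EuclideanSpace.basisFun (Fin d) ℝ).toBasis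

theorem eE_apply {d : ℕ} (i : Fin d) : eE d i = EuclideanSpace.single i 1 := by simp [eE]

/-- The standard basis of `ℝ × ℝ^d`. -/
def eZ (d : ℕ) : Module.Basis (Unit ⊕ Fin d) ℝ (ℝ × E d) := (Module.Basis.singleton Unit ℝ).prod (eE d)

theorem eZ_inl {d : ℕ} : eZ d (Sum.inl ()) = (1, 0) := by
  simp [eZ, Module.Basis.prod_apply]

theorem eZ_inr {d : ℕ} (i : Fin d) : eZ d (Sum.inr i) = (0, eE d i) := by
  simp [eZ, Module.Basis.prod_apply]

section Lift

variable {d n : ℕ} {T r C : ℝ}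

theorem dd_lift {φ : E d → ℝ} (hφ : Differentiable ℝ φ) (v : ℝ × E d) :
    dd v (fun z : ℝ × E d => φ z.2) = fun z => dd v.2 φ z.2 := by
  funext z
  have h := (hφ z.2).hasFDerivAt.comp z (hasFDerivAt_snd (𝕜 := ℝ) (E := ℝ) (F := E d) (p := z))
  have h2 : (φ ∘ Prod.snd : ℝ × E d → ℝ) = fun z => φ z.2 := rfl
  rw [h2] at h
  simp [dd, h.fderiv]

theorem dd_slice {φ : ℝ × E d → ℝ} (hφ : Differentiable ℝ φ) (v : E d) (s : ℝ) :
    dd v (fun x => φ (s, x)) = fun x => dd ((0 : ℝ), v) φ (s, x) := by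
  funext x
  have h := (hφ (s, x)).hasFDerivAt.comp x (hasFDerivAt_prodMk_right (𝕜 := ℝ) s x)
  have h2 : (φ ∘ fun x => (s, x)) = fun x => φ (s, x) := rfl
  rw [h2] at h
  simp [dd, h.fderiv]

theorem NN.lift {F : ℝ → E d → ℝ} (hF : NN (eE d) T r n C F) :
    NN (eZ d) T r n C (fun t z => F t z.2) := by
  have h0 : ∀ F : ℝ → E d → ℝ, NN0 T r C F → NN0 T r C (fun t (z : ℝ × E d) => F t z.2) :=
    fun F h => ⟨h.1.comp (measurable_fst.prodMk (measurable_snd.comp measurable_snd)),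
      fun t => (h.2.1 t).comp continuous_snd, fun t z => h.2.2 t _⟩
  induction n generalizing F with
  | zero => exact h0 F hF
  | succ n ih =>
    refine ⟨h0 F hF.1, fun t => (hF.2.1 t).comp differentiable_snd, fun j => ?_⟩
    simp only [dd_lift (hF.2.1 _)]
    rcases j with j | i
    · rw [eZ_inl]
      have h1 : (fun t (z : ℝ × E d) => dd (0 : E d) (F t) z.2) = fun _ _ => (0 : ℝ) := by
        funext t z; simp [dd]
      rw [h1]
      refine (NN.const 0).mono ?_
      have := hF.nonneg
      simpa using this
    · rw [eZ_inr]
      exact ih (hF.2.2 i)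

theorem NN.slice {F : ℝ → ℝ × E d → ℝ} (hF : NN (eZ d) T r n C F) (s : ℝ) :
    NN (eE d) T r n C (fun t x => F t (s, x)) := by
  have h0 : ∀ F : ℝ → ℝ × E d → ℝ, NN0 T r C F → NN0 T r C (fun t (x : E d) => F t (s, x)) :=
    fun F h => ⟨h.1.comp (measurable_fst.prodMk (measurable_const.prodMk measurable_snd)),
      fun t => (h.2.1 t).comp (by fun_prop), fun t z => h.2.2 t _⟩
  induction n generalizing F with
  | zero => exact h0 F hF
  | succ n ih =>
    refine ⟨h0 F hF.1, fun t => (hF.2.1 t).comp (by fun_prop), fun i => ?_⟩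
    simp only [dd_slice (hF.2.1 _)]
    have := hF.2.2 (Sum.inr i)
    rw [eZ_inr] at this
    exact ih this

theorem SM.lift {F : ℝ → E d → ℝ} (hF : SM (eE d) T F) : SM (eZ d) T (fun t z => F t z.2) :=
  fun n => by
    obtain ⟨C, hC⟩ := hF n
    exact ⟨C, hC.lift⟩

theorem SM.slice {F : ℝ → ℝ × E d → ℝ} (hF : SM (eZ d) T F) (s : ℝ) :
    SM (eE d) T (fun t x => F t (s, x)) := fun n => by
  obtain ⟨C, hC⟩ := hF n
  exact ⟨C, hC.slice s⟩

theorem SM.smoothBdd {F : ℝ → E d → ℝ} (hF : SM (eE d) T F) (t : ℝ) : SmoothBdd (F t) :=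
  ⟨hF.contDiff t, fun n => by
    obtain ⟨C, hC⟩ := hF.norm_iteratedFDeriv_le n
    exact ⟨C, hC t⟩⟩

theorem SM.bounded {F : ℝ → E d → ℝ} (hF : SM (eE d) T F) : ∃ C, ∀ t x, |F t x| ≤ C := by
  obtain ⟨C, hC⟩ := hF 0
  refine ⟨C, fun t x => ?_⟩
  have := hC.2.2 t x
  rwa [zero_mul, Real.exp_zero, mul_one] at this

/-- Functions of the first variable which are constant outside a compact set. -/
theorem sm_of_compactSupport {a : ℝ → ℝ} (ha : ContDiff ℝ ∞ a) {c : ℝ}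
    (hc : HasCompactSupport fun s => a s - c) :
    SM (eZ d) T (fun _ z => a z.1) := by
  intro n
  have h0 : ∀ {a : ℝ → ℝ} {c : ℝ}, ContDiff ℝ ∞ a → HasCompactSupport (fun s => a s - c) →
      ∃ C, 0 ≤ C ∧ NN0 T 0 C (fun _ (z : ℝ × E d) => a z.1) := by
    intro a c ha hc
    obtain ⟨C, hC⟩ := hc.exists_bound_of_continuous (ha.continuous.sub continuous_const)
    have hC0 : 0 ≤ C := (norm_nonneg _).trans (hC 0)
    refine ⟨C + |c|, by positivity, ?_, fun t => ha.continuous.comp continuous_fst, fun t z => ?_⟩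
    · exact ha.continuous.measurable.comp (measurable_fst.comp measurable_snd)
    · rw [zero_mul, Real.exp_zero, mul_one]
      have h1 := hC z.1
      rw [Real.norm_eq_abs] at h1
      calc |a z.1| = |(a z.1 - c) + c| := by ring_nf
        _ ≤ _ := (abs_add_le _ _).trans (by gcongr)
  induction n generalizing a c with
  | zero =>
    obtain ⟨C, _, h⟩ := h0 ha hc
    exact ⟨C, h⟩
  | succ n ih =>
    obtain ⟨C, hC0, h⟩ := h0 ha hc
    have hda : ContDiff ℝ ∞ (deriv a) := (contDiff_infty_iff_deriv.1 ha).2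
    have hdc : HasCompactSupport (fun s => deriv a s - 0) := by
      have h1 : (fun s => deriv a s - 0) = deriv (fun s => a s - c) := by
        funext s; simp
      rw [h1]
      exact hc.deriv
    obtain ⟨C', h'⟩ := ih hda hdc
    have hd : Differentiable ℝ a := ha.differentiable (by simp)
    have hdd : ∀ v : ℝ × E d, dd v (fun z : ℝ × E d => a z.1) = fun z => v.1 * deriv a z.1 := by
      intro v
      funext z
      have h := (hd z.1).hasFDerivAt.comp z (hasFDerivAt_fst (𝕜 := ℝ) (E := ℝ) (F := E d) (p := z))
      have h2 : (a ∘ Prod.fst : ℝ × E d → ℝ) = fun z => a z.1 := rfl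
      rw [h2] at h
      simp [dd, h.fderiv]
    have hC'0 := h'.nonneg
    refine ⟨C + C', ?_, fun t => hd.comp differentiable_fst, fun j => ?_⟩
    · exact NN.mono (e := eZ d) (n := 0) h (by linarith)
    · simp only [hdd]
      rcases j with j | i
      · rw [eZ_inl]
        simp only [one_mul]
        exact h'.mono (by linarith)
      · rw [eZ_inr]
        simp only [zero_mul]
        refine (NN.const 0).mono ?_
        simp only [abs_zero, zero_mul]
        linarith

end Lift

/-! ### The difference operators on the smooth classes. -/

namespace Scheme

variable {d : ℕ} {S : Scheme d} {τ₀ h T : ℝ}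

theorem _root_.FDScheme.SM.dbar {F : ℝ → E d → ℝ} (hF : SM (eE d) T F) (μ : S.Idx) :
    SM (eE d) T (fun t => S.dbar τ₀ h μ (F t)) := by
  rcases μ with l | i
  · exact ((hF.shift _).sub hF).const_mul _
  · have := (hF.dd i).const_mul τ₀
    simp only [eE_apply] at this
    exact this

theorem _root_.FDScheme.SM.dl {F : ℝ → E d → ℝ} (hF : SM (eE d) T F) (lam : List S.Idx) :
    SM (eE d) T (fun t => S.dl τ₀ h lam (F t)) := by
  induction lam generalizing F with
  | nil => exact hF
  | cons μ lam ih => exact ih (hF.dbar μ)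

theorem _root_.FDScheme.SM.W_le {F : ℝ → E d → ℝ} (hF : SM (eE d) T F) (n : ℕ) :
    ∃ C, ∀ t x, S.W τ₀ h n (F t) x ≤ C := by
  choose C hC using fun lam : List S.Idx => (hF.dl (τ₀ := τ₀) (h := h) lam).bounded
  refine ⟨lsum n fun lam => C lam ^ 2, fun t x => lsum_mono n fun lam => ?_⟩
  exact sq_le_sq' (neg_le_of_abs_le (hC lam t x)) (le_of_abs_le (hC lam t x))

theorem _root_.FDScheme.SM.intervalIntegrable {F : ℝ → E d → ℝ} (hF : SM (eE d) T F) (x : E d) (a b : ℝ) :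
    IntervalIntegrable (fun s => F s x) volume a b := by
  obtain ⟨C, hC⟩ := hF 0
  exact hC.nn0.intervalIntegrable x a b

/-- Differences pass through the time integral by linearity, partial derivatives by `dd_integral`.
-/
theorem dl_integral {F : ℝ → E d → ℝ} (hF : SM (eE d) T F) (lam : List S.Idx) (t : ℝ) :
    S.dl τ₀ h lam (fun x => ∫ s in (0 : ℝ)..cl T t, F s x) =
      fun x => ∫ s in (0 : ℝ)..cl T t, S.dl τ₀ h lam (F s) x := by
  induction lam generalizing F with
  | nil => rfl
  | cons μ lam ih =>
    have h1 : S.dbar τ₀ h μ (fun x => ∫ s in (0 : ℝ)..cl T t, F s x) =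
        fun x => ∫ s in (0 : ℝ)..cl T t, S.dbar τ₀ h μ (F s) x := by
      rcases μ with l | i
      · funext x
        simp only [dbar]
        rw [intervalIntegral.integral_const_mul, intervalIntegral.integral_sub
          (hF.intervalIntegrable _ _ _) (hF.intervalIntegrable _ _ _)]
      · funext x
        simp only [dbar]
        rw [intervalIntegral.integral_const_mul]
        obtain ⟨C, hC⟩ := hF 1
        have := (dd_integral hC i t).2
        rw [eE_apply] at this
        rw [partialDeriv_eq_dd, this]
        rfl
    rw [dl_cons, h1, ih (hF.dbar μ)]
    rfl

theorem sm_del {F : ℝ → E d → ℝ} (hF : SM (eE d) T F) (l : S.Λ₁) :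
    SM (eE d) T (fun t => S.del h l (F t)) := ((hF.shift _).sub hF).const_mul _

theorem sm_Lop {q p : S.Λ₁ → ℝ → E d → ℝ} {c F : ℝ → E d → ℝ} (hq : ∀ l, SM (eE d) T (q l))
    (hp : ∀ l, SM (eE d) T (p l)) (hc : SM (eE d) T c) (hF : SM (eE d) T F) :
    SM (eE d) T (fun t => S.Lop h (fun l => q l t) (fun l => p l t) (c t) (F t)) :=
  (((SM.sum Finset.univ fun l => (hq l).mul (sm_del hF l)).const_mul _).add
    (SM.sum Finset.univ fun l => (hp l).mul (sm_del hF l))).sub (hc.mul hF)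

theorem smoothSol_of_SM {q p : S.Λ₁ → ℝ → E d → ℝ} {c f u : ℝ → E d → ℝ} {g : E d → ℝ}
    (hq : ∀ l, SM (eE d) S.T (q l)) (hp : ∀ l, SM (eE d) S.T (p l)) (hc : SM (eE d) S.T c)
    (hf : SM (eE d) S.T f) (hg : ContDiff ℝ ∞ g) (hu : SM (eE d) S.T u)
    (heq : ∀ t ∈ Icc 0 S.T, ∀ x, u t x = g x + ∫ s in (0 : ℝ)..t,
      (S.Lop h (fun l => q l s) (fun l => p l s) (c s) (u s) x + f s x)) :
    S.SmoothSol τ₀ h q p c f g u := by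
  have hT := S.T_pos.le
  have hF := (sm_Lop (h := h) hq hp hc hu).add hf
  refine ⟨fun t _ => hf.contDiff t, fun t _ => hu.smoothBdd t, fun n => ?_,
    fun lam t _ x => (hF.dl lam).intervalIntegrable x _ _, fun lam t ht x => ?_⟩
  · obtain ⟨C, hC⟩ := hu.W_le (S := S) (τ₀ := τ₀) (h := h) n
    exact ⟨C, fun t _ => hC t⟩
  · have h1 : u t = fun x => g x + ∫ s in (0 : ℝ)..cl S.T t,
        (S.Lop h (fun l => q l s) (fun l => p l s) (c s) (u s) x + f s x) := by
      funext x; rw [cl_of_mem ht]; exact heq t ht x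
    rw [h1, S.dl_add _ _ _ hg ((hF.integral hT).contDiff t), dl_integral hF, cl_of_mem ht]

end Scheme

end FDScheme

namespace FDScheme

/-! ### The mesh size as an additional variable -/

/-- A cut-off of the identity, bent to the constant `h₀` far away. It stays positive, so `1 / ρ` is
smooth on the whole line, and it is the identity on both sides of `h₀`, so derivatives at the
endpoint `h₀` may be taken two-sided. -/
theorem exists_mesh {h₀ h₁ : ℝ} (h₁pos : 0 < h₁) (h₁lt : h₁ < h₀) : ∃ ρ : ℝ → ℝ,
    ContDiff ℝ ∞ ρ ∧ HasCompactSupport (fun s => ρ s - h₀) ∧ (∀ s, 0 < ρ s) ∧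
    ∀ s ∈ Ioo h₁ (2 * h₀ - h₁), ρ s = s := by
  let f : ContDiffBump h₀ := ⟨h₀ - h₁, h₀ - h₁ / 2, by linarith, by linarith⟩
  have hf : ContDiff ℝ ∞ fun s => f s := f.contDiff
  refine ⟨fun s => h₀ + f s * (s - h₀), ?_, ?_, fun s => ?_, fun s hs => ?_⟩
  · exact contDiff_const.add (hf.mul (contDiff_id.sub contDiff_const))
  · have h1 : (fun s => h₀ + f s * (s - h₀) - h₀) = fun s => f s * (s - h₀) := by funext s; ring
    rw [h1]
    exact f.hasCompactSupport.mul_right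
  · rcases lt_or_ge |s - h₀| (h₀ - h₁ / 2) with h | h
    · have h1 : |f s * (s - h₀)| ≤ |s - h₀| := by
        rw [abs_mul, abs_of_nonneg f.nonneg]
        exact mul_le_of_le_one_left (abs_nonneg _) f.le_one
      have := neg_abs_le (f s * (s - h₀))
      linarith
    · have h1 : f s = 0 := f.zero_of_le_dist (by rw [Real.dist_eq]; exact h)
      simp only [h1]; linarith
  · have h1 : f s = 1 := f.one_of_mem_closedBall (by
      rw [Metric.mem_closedBall, Real.dist_eq, abs_le]
      exact ⟨by linarith [hs.1], by linarith [hs.2]⟩)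
    simp only [h1]; ring

theorem iterate_dd_dd_comm {Z : Type*} [NormedAddCommGroup Z] [NormedSpace ℝ Z] (v w : Z) (j : ℕ)
    {φ : Z → ℝ} (hφ : ContDiff ℝ ∞ φ) : (dd w)^[j] (dd v φ) = dd v ((dd w)^[j] φ) := by
  induction j generalizing φ with
  | zero => rfl
  | succ j ih =>
    rw [Function.iterate_succ_apply, Function.iterate_succ_apply,
      dd_comm w v (mod_cast contDiff_infty.1 hφ 2), ih (contDiff_dd hφ)]

theorem iterate_dd_add {Z : Type*} [NormedAddCommGroup Z] [NormedSpace ℝ Z] (v : Z) (k : ℕ)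
    {φ ψ : Z → ℝ} (hφ : ContDiff ℝ ∞ φ) (hψ : ContDiff ℝ ∞ ψ) :
    (dd v)^[k] (fun z => φ z + ψ z) = fun z => (dd v)^[k] φ z + (dd v)^[k] ψ z := by
  induction k generalizing φ ψ with
  | zero => rfl
  | succ k ih =>
    rw [Function.iterate_succ_apply, dd_add (differentiable_of_smooth hφ)
      (differentiable_of_smooth hψ), ih (contDiff_dd hφ) (contDiff_dd hψ)]
    rfl

theorem iterate_dd_sum {Z : Type*} [NormedAddCommGroup Z] [NormedSpace ℝ Z] (v : Z) (k : ℕ)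
    {ι : Type*} (s : Finset ι) {φ : ι → Z → ℝ} (hφ : ∀ i, ContDiff ℝ ∞ (φ i)) :
    (dd v)^[k] (fun z => ∑ i ∈ s, φ i z) = fun z => ∑ i ∈ s, (dd v)^[k] (φ i) z := by
  induction k generalizing φ with
  | zero => rfl
  | succ k ih =>
    rw [Function.iterate_succ_apply, dd_sum s fun i _ => differentiable_of_smooth (hφ i),
      ih fun i => contDiff_dd (hφ i)]
    rfl

/-- Locality of differentiation: where `ρ` is the identity nearby, the cut-off can be forgotten
before differentiating. -/
theorem iterate_dd_eventuallyEq {Z : Type*} [NormedAddCommGroup Z] [NormedSpace ℝ Z] (v : Z) (k : ℕ)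
    {φ ψ : Z → ℝ} {z : Z} (h : φ =ᶠ[nhds z] ψ) : (dd v)^[k] φ =ᶠ[nhds z] (dd v)^[k] ψ := by
  induction k generalizing φ ψ with
  | zero => exact h
  | succ k ih =>
    exact ih ((h.fderiv (𝕜 := ℝ)).mono fun y hy => congrArg (fun L => L v) hy)

section Mesh

variable {d : ℕ}

/-- The direction of the mesh size. -/
abbrev es (d : ℕ) : ℝ × E d := (1, 0)

theorem iterate_dd_lift {φ : E d → ℝ} (hφ : ContDiff ℝ ∞ φ) (k : ℕ) :
    (dd (es d))^[k + 1] (fun z : ℝ × E d => φ z.2) = fun _ => 0 := by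
  have h0 : dd (es d) (fun z : ℝ × E d => φ z.2) = fun _ => 0 := by
    rw [dd_lift (differentiable_of_smooth hφ)]
    funext z; simp [dd]
  rw [Function.iterate_succ_apply, h0]
  clear h0 hφ
  induction k with
  | zero => rfl
  | succ k ih =>
    rw [Function.iterate_succ_apply]
    have h1 : dd (es d) (fun _ : ℝ × E d => (0 : ℝ)) = fun _ => 0 := by funext z; simp [dd]
    rw [h1, ih]

theorem iterate_dd_lift_mul {b : E d → ℝ} {Φ : ℝ × E d → ℝ} (hb : ContDiff ℝ ∞ b)
    (hΦ : ContDiff ℝ ∞ Φ) (k : ℕ) :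
    (dd (es d))^[k] (fun z => b z.2 * Φ z) = fun z => b z.2 * (dd (es d))^[k] Φ z := by
  induction k generalizing Φ with
  | zero => rfl
  | succ k ih =>
    have h1 : dd (es d) (fun z => b z.2 * Φ z) = fun z => b z.2 * dd (es d) Φ z := by
      have hb' : Differentiable ℝ (fun z : ℝ × E d => b z.2) :=
        (differentiable_of_smooth hb).comp differentiable_snd
      rw [dd_mul hb' (differentiable_of_smooth hΦ)]
      have := iterate_dd_lift hb 0
      simp only [zero_add, Function.iterate_one] at this
      rw [this]
      funext z; ring
    rw [Function.iterate_succ_apply, h1, ih (contDiff_dd hΦ)]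
    rfl

theorem iterate_dd_slice {Φ : ℝ × E d → ℝ} (hΦ : ContDiff ℝ ∞ Φ) (l : E d) (j : ℕ) (s : ℝ) :
    (dd l)^[j] (fun x => Φ (s, x)) = fun x => (dd ((0 : ℝ), l))^[j] Φ (s, x) := by
  induction j generalizing Φ with
  | zero => rfl
  | succ j ih =>
    rw [Function.iterate_succ_apply, dd_slice (differentiable_of_smooth hΦ), ih (contDiff_dd hΦ)]
    rfl

/-- The mean of `D_l^j Φ` over the segment from `(s,x)` to `(s,x+sl)`, as a function of `(s,x)`. -/
def JZ (w : ℝ → ℝ) (l : E d) (j : ℕ) (Φ : ℝ × E d → ℝ) (z : ℝ × E d) : ℝ :=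
  ∫ θ in (0 : ℝ)..1, w θ * ((dd ((0 : ℝ), l))^[j] Φ) (z.1, z.2 + (θ * z.1) • l)

variable {w : ℝ → ℝ} {Φ : ℝ × E d → ℝ}

theorem JZ_eq_Jop (hΦ : ContDiff ℝ ∞ Φ) (l : E d) (j : ℕ) (s : ℝ) (x : E d) :
    JZ w l j Φ (s, x) = Jop w l j s (fun x => Φ (s, x)) x := by
  simp only [JZ, Jop, iterate_dd_slice hΦ]

theorem contDiff_JZ_integrand (hw : ContDiff ℝ ∞ w) (hΦ : ContDiff ℝ ∞ Φ) (l : E d) (j : ℕ) :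
    ContDiff ℝ ∞ (fun p : (ℝ × E d) × ℝ =>
      w p.2 * ((dd ((0 : ℝ), l))^[j] Φ) (p.1.1, p.1.2 + (p.2 * p.1.1) • l)) :=
  (hw.comp contDiff_snd).mul ((contDiff_iterate_dd _ j hΦ).comp
    ((contDiff_fst.comp contDiff_fst).prodMk ((contDiff_snd.comp contDiff_fst).add
      ((contDiff_snd.mul (contDiff_fst.comp contDiff_fst)).smul contDiff_const))))

theorem contDiff_JZ (hw : ContDiff ℝ ∞ w) (hΦ : ContDiff ℝ ∞ Φ) (l : E d) (j : ℕ) :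
    ContDiff ℝ ∞ (JZ w l j Φ) :=
  contDiff_param_integral (contDiff_JZ_integrand hw hΦ l j)

theorem dd_segment (hΦ : Differentiable ℝ Φ) (l : E d) (θ : ℝ) (z : ℝ × E d) :
    dd (es d) (fun z : ℝ × E d => Φ (z.1, z.2 + (θ * z.1) • l)) z =
      dd (es d) Φ (z.1, z.2 + (θ * z.1) • l) +
        θ * dd ((0 : ℝ), l) Φ (z.1, z.2 + (θ * z.1) • l) := by
  have h1 : HasFDerivAt (fun z : ℝ × E d => (z.1, z.2 + (θ * z.1) • l))
      ((ContinuousLinearMap.fst ℝ ℝ (E d)).prod (ContinuousLinearMap.snd ℝ ℝ (E d) +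
        (θ • ContinuousLinearMap.fst ℝ ℝ (E d)).smulRight l)) z :=
    hasFDerivAt_fst.prodMk (hasFDerivAt_snd.add ((hasFDerivAt_fst.const_mul θ).smul_const l))
  have h := (hΦ (z.1, z.2 + (θ * z.1) • l)).hasFDerivAt.comp z h1
  have h2 : (Φ ∘ fun z : ℝ × E d => (z.1, z.2 + (θ * z.1) • l)) =
    fun z => Φ (z.1, z.2 + (θ * z.1) • l) := rfl
  rw [h2] at h
  unfold dd
  rw [h.fderiv, ContinuousLinearMap.comp_apply]
  have h3 : ((ContinuousLinearMap.fst ℝ ℝ (E d)).prod (ContinuousLinearMap.snd ℝ ℝ (E d) +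
        (θ • ContinuousLinearMap.fst ℝ ℝ (E d)).smulRight l)) (es d) =
      es d + θ • ((0 : ℝ), l) := by simp
  rw [h3, map_add, map_smul, smul_eq_mul]

/-- A derivative in the mesh size falls on `Φ` itself or, through the moving point `x + θ s l`,
produces one more derivative along `l` and a factor `θ` in the weight. Since `0 ≤ θ ≤ 1`, the weight
does not grow. -/
theorem dd_JZ (hw : ContDiff ℝ ∞ w) (hΦ : ContDiff ℝ ∞ Φ) (l : E d) (j : ℕ) :
    dd (es d) (JZ w l j Φ) =
      fun z => JZ w l j (dd (es d) Φ) z + JZ (fun θ => θ * w θ) l (j + 1) Φ z := by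
  funext z
  have h1 := dd_param_integral (contDiff_JZ_integrand hw hΦ l j) (es d) z
  have h2 : JZ w l j Φ = fun z => ∫ θ in (0 : ℝ)..1, (fun p : (ℝ × E d) × ℝ =>
      w p.2 * ((dd ((0 : ℝ), l))^[j] Φ) (p.1.1, p.1.2 + (p.2 * p.1.1) • l)) (z, θ) := rfl
  rw [h2, h1]
  have hs := contDiff_iterate_dd ((0 : ℝ), l) j hΦ
  have h3 : ∀ θ : ℝ, dd (es d) (fun z : ℝ × E d =>
      w θ * ((dd ((0 : ℝ), l))^[j] Φ) (z.1, z.2 + (θ * z.1) • l)) z =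
      w θ * ((dd ((0 : ℝ), l))^[j] (dd (es d) Φ)) (z.1, z.2 + (θ * z.1) • l) +
      θ * w θ * ((dd ((0 : ℝ), l))^[j + 1] Φ) (z.1, z.2 + (θ * z.1) • l) := by
    intro θ
    have hd : Differentiable ℝ (fun z : ℝ × E d =>
        ((dd ((0 : ℝ), l))^[j] Φ) (z.1, z.2 + (θ * z.1) • l)) :=
      (differentiable_of_smooth hs).comp (by fun_prop)
    rw [dd_const_mul _ hd]
    beta_reduce
    rw [dd_segment (differentiable_of_smooth hs), iterate_dd_dd_comm _ _ _ hΦ,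
      Function.iterate_succ_apply']
    ring
  simp only [h3]
  unfold JZ
  rw [← intervalIntegral.integral_add]
  · exact ((contDiff_JZ_integrand hw (contDiff_dd hΦ) l j).continuous.comp
      (Continuous.prodMk_right z)).intervalIntegrable _ _
  · exact ((contDiff_JZ_integrand (contDiff_id.mul hw) hΦ l (j + 1)).continuous.comp
      (Continuous.prodMk_right z)).intervalIntegrable _ _

theorem iterate_dd_JZ (hw : ContDiff ℝ ∞ w) (hΦ : ContDiff ℝ ∞ Φ) (l : E d) (j k : ℕ) :
    (dd (es d))^[k] (JZ w l j Φ) = fun z => ∑ i ∈ Finset.HasAntidiagonal.antidiagonal k, (k.choose i.1 : ℝ) *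
      JZ (fun θ => θ ^ i.1 * w θ) l (j + i.1) ((dd (es d))^[i.2] Φ) z := by
  induction k with
  | zero => funext z; simp
  | succ k ih =>
    have hJ : ∀ i k, ContDiff ℝ ∞ (JZ (fun θ => θ ^ i * w θ) l (j + i) ((dd (es d))^[k] Φ)) :=
      fun i k => contDiff_JZ ((contDiff_id.pow i).mul hw) (contDiff_iterate_dd _ k hΦ) l (j + i)
    rw [Function.iterate_succ_apply', ih, dd_sum _ fun i _ =>
      (differentiable_of_smooth (hJ i.1 i.2)).const_mul _]
    funext z
    have h1 := Finset.sum_antidiagonal_choose_succ_nsmul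
      (fun i k => JZ (fun θ => θ ^ i * w θ) l (j + i) ((dd (es d))^[k] Φ) z) k
    simp only [nsmul_eq_mul] at h1
    rw [h1, ← Finset.sum_add_distrib]
    refine Finset.sum_congr rfl fun i hi => ?_
    have hw' : ContDiff ℝ ∞ (fun θ : ℝ => θ ^ i.1 * w θ) := (contDiff_id.pow i.1).mul hw
    rw [dd_const_mul _ (differentiable_of_smooth (hJ i.1 i.2)),
      dd_JZ hw' (contDiff_iterate_dd _ i.2 hΦ)]
    have h2 : k.choose i.2 = k.choose i.1 := by
      rw [← Finset.HasAntidiagonal.mem_antidiagonal.1 hi, Nat.choose_symm_add]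
    have h3 : (fun θ => θ * (θ ^ i.1 * w θ)) = fun θ => θ ^ (i.1 + 1) * w θ := by
      funext θ; ring
    rw [h2, Function.iterate_succ_apply', h3, add_assoc]
    beta_reduce
    rw [mul_add]

end Mesh

end FDScheme

/-! ### The schemes of all mesh sizes as one equation on `ℝ × ℝ^d`. -/

namespace FDScheme

namespace Scheme

variable {d : ℕ} (S : Scheme d) (ρ : ℝ → ℝ)

/-- The shifts of the scheme with mesh size `ρ(s)`. -/
def meshMap : Option S.Λ₁ → ℝ × E d → ℝ × E d
  | none => id
  | some l => fun z => (z.1, z.2 + ρ z.1 • (l : E d))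

/-- The coefficients at the shifts of the scheme with mesh size `ρ(s)`. -/
def meshCoef (q p : S.Λ₁ → ℝ → E d → ℝ) (c : ℝ → E d → ℝ) : Option S.Λ₁ → ℝ → ℝ × E d → ℝ
  | none => fun t z => -1 * (∑ l, ((ρ z.1)⁻¹ * (ρ z.1)⁻¹ * q l t z.2 + (ρ z.1)⁻¹ * p l t z.2)) -
      c t z.2
  | some l => fun t z => (ρ z.1)⁻¹ * (ρ z.1)⁻¹ * q l t z.2 + (ρ z.1)⁻¹ * p l t z.2

/-- The initial value and the time integral of the free term. -/
def meshFree (f : ℝ → E d → ℝ) (g : E d → ℝ) : ℝ → ℝ × E d → ℝ :=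
  fun t z => g z.2 + ∫ s in (0 : ℝ)..cl S.T t, f s z.2

/-- The first coordinate is never moved, so the equation on `ℝ × ℝ^d` decouples into the schemes
with mesh sizes `ρ(s)`. -/
theorem shiftOp_mesh (q p : S.Λ₁ → ℝ → E d → ℝ) (c : ℝ → E d → ℝ) (U : ℝ → ℝ × E d → ℝ) (t : ℝ)
    (z : ℝ × E d) :
    shiftOp (S.meshCoef ρ q p c) (S.meshMap ρ) U t z =
      S.Lop (ρ z.1) (fun l => q l t) (fun l => p l t) (c t) (fun x => U t (z.1, x)) z.2 := by
  obtain ⟨s, x⟩ := z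
  simp only [shiftOp, Fintype.sum_option, meshCoef, meshMap, Lop, Qop, Pop, del, id, Finset.mul_sum]
  rw [sub_mul, Finset.sum_mul, sub_add_eq_add_sub, ← Finset.sum_add_distrib,
    ← Finset.sum_add_distrib]
  congr 1
  exact Finset.sum_congr rfl fun l _ => by ring

theorem meshFree_cl (f : ℝ → E d → ℝ) (g : E d → ℝ) (t : ℝ) (z : ℝ × E d) :
    S.meshFree f g (cl S.T t) z = S.meshFree f g t z := by
  simp only [meshFree, cl_cl S.T_pos.le]

variable {ρ}

/-- The Jacobian of a shift is the identity plus a rank one term with factor `ρ'`, and `ρ'` is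
smooth with compact support. -/
theorem meshMap_compBound (hρ : ContDiff ℝ ∞ ρ) {h₀ : ℝ}
    (hc : HasCompactSupport fun s => ρ s - h₀) (n : ℕ) :
    ∃ κ, 0 ≤ κ ∧ CompBound (eZ d) S.T n (S.meshMap ρ) κ := by
  have hd : Differentiable ℝ ρ := hρ.differentiable (by simp)
  have hfd : ∀ (l : S.Λ₁) z, HasFDerivAt (S.meshMap ρ (some l))
      ((ContinuousLinearMap.fst ℝ ℝ (E d)).prod (ContinuousLinearMap.snd ℝ ℝ (E d) +
        (deriv ρ z.1 • ContinuousLinearMap.fst ℝ ℝ (E d)).smulRight (l : E d))) z := by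
    intro l z
    have h1 : HasFDerivAt (fun z : ℝ × E d => ρ z.1)
        (deriv ρ z.1 • ContinuousLinearMap.fst ℝ ℝ (E d)) z :=
      (hd z.1).hasDerivAt.comp_hasFDerivAt z hasFDerivAt_fst
    exact hasFDerivAt_fst.prodMk (hasFDerivAt_snd.add (h1.smul_const (l : E d)))
  have hdiff : ∀ i, Differentiable ℝ (S.meshMap ρ i) := by
    rintro (_ | l)
    · exact differentiable_id
    · exact fun z => (hfd l z).differentiableAt
  refine exists_compBound (a := fun i j k z => (eZ d).repr (fderiv ℝ (S.meshMap ρ i) z (eZ d j)) k)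
    hdiff (fun i j z => ((eZ d).sum_repr _).symm) ?_ n
  rintro (_ | l) j k
  · have h1 : ∀ z, fderiv ℝ (S.meshMap ρ none) z = ContinuousLinearMap.id ℝ _ := fun z =>
      fderiv_id
    simp only [h1]
    exact SM.const _
  · have h1 : ∀ z v, fderiv ℝ (S.meshMap ρ (some l)) z v =
        v + (deriv ρ z.1 * v.1) • ((0 : ℝ), (l : E d)) := by
      intro z v
      rw [(hfd l z).fderiv]
      ext <;> simp
    simp only [h1, map_add, map_smul, Finsupp.add_apply, Finsupp.smul_apply, smul_eq_mul]
    refine (SM.const _).add (SM.mul (SM.mul ?_ (SM.const _)) (SM.const _))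
    refine sm_of_compactSupport (c := 0) (contDiff_infty_iff_deriv.1 hρ).2 ?_
    have h2 : (fun s => deriv ρ s - 0) = deriv (fun s => ρ s - h₀) := by funext s; simp
    rw [h2]
    exact hc.deriv

/-- Off a compact set `1 / ρ` equals the constant `1 / h₀`. -/
theorem sm_inv_mesh (hρ : ContDiff ℝ ∞ ρ) {h₀ : ℝ} (hc : HasCompactSupport fun s => ρ s - h₀)
    (hpos : ∀ s, 0 < ρ s) : SM (eZ d) S.T (fun _ z => (ρ z.1)⁻¹) := by
  refine sm_of_compactSupport (c := h₀⁻¹) (hρ.inv fun s => (hpos s).ne') (hc.mono' ?_)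
  intro s hs
  refine subset_tsupport _ ?_
  rw [Function.mem_support] at hs ⊢
  contrapose! hs
  rw [Pi.inv_apply, sub_eq_zero.1 hs, sub_self]

/-- Bounds for the coefficients in terms of those of the scheme. -/
theorem exists_meshCoef_bound (hρ : ContDiff ℝ ∞ ρ) {h₀ : ℝ}
    (hc : HasCompactSupport fun s => ρ s - h₀) (hpos : ∀ s, 0 < ρ s) (n : ℕ) :
    ∃ N, 0 ≤ N ∧ ∀ (q p : S.Λ₁ → ℝ → E d → ℝ) (c : ℝ → E d → ℝ) (B : ℝ),
      (∀ l, NN (eE d) S.T 0 n B (q l)) → (∀ l, NN (eE d) S.T 0 n B (p l)) →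
      NN (eE d) S.T 0 n B c → ∀ i, NN (eZ d) S.T 0 n (N * B) (S.meshCoef ρ q p c i) := by
  have h1 := S.sm_inv_mesh hρ hc hpos
  obtain ⟨C₁, hC₁⟩ := (h1.mul h1) n
  obtain ⟨C₂, hC₂⟩ := h1 n
  have hC₁0 := hC₁.nonneg
  have hC₂0 := hC₂.nonneg
  set A := 2 ^ n * C₁ + 2 ^ n * C₂ with hA
  have hA0 : 0 ≤ A := by positivity
  refine ⟨Fintype.card S.Λ₁ * A + A + 1, by positivity, fun q p c B hq hp hc => ?_⟩
  have hB := hc.nonneg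
  have h2 : ∀ l, NN (eZ d) S.T 0 n (A * B) (fun t z =>
      (ρ z.1)⁻¹ * (ρ z.1)⁻¹ * q l t z.2 + (ρ z.1)⁻¹ * p l t z.2) := fun l =>
    ((hC₁.mul (hq l).lift).add (hC₂.mul (hp l).lift)).mono (le_of_eq (by rw [hA]; ring))
  have hcA : 0 ≤ (Fintype.card S.Λ₁ : ℝ) * A := by positivity
  rintro (_ | l)
  · refine (((NN.sum Finset.univ fun l _ => h2 l).const_mul (-1)).sub hc.lift).mono ?_
    rw [Finset.sum_const, Finset.card_univ, nsmul_eq_mul, abs_neg, abs_one]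
    nlinarith
  · exact (h2 l).mono (by nlinarith)

theorem meshCoef_sub (q p q' p' : S.Λ₁ → ℝ → E d → ℝ) (c c' : ℝ → E d → ℝ) (i : Option S.Λ₁) :
    (fun t z => S.meshCoef ρ q' p' c' i t z - S.meshCoef ρ q p c i t z) =
      S.meshCoef ρ (fun l t x => q' l t x - q l t x) (fun l t x => p' l t x - p l t x)
        (fun t x => c' t x - c t x) i := by
  funext t z
  rcases i with _ | l
  · simp only [meshCoef]
    rw [sub_sub_sub_comm, ← mul_sub, ← Finset.sum_sub_distrib]
    congr 2
    exact Finset.sum_congr rfl fun l _ => by ring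
  · simp only [meshCoef]; ring

theorem sm_meshCoef (hρ : ContDiff ℝ ∞ ρ) {h₀ : ℝ}
    (hc : HasCompactSupport fun s => ρ s - h₀) (hpos : ∀ s, 0 < ρ s) {q p : S.Λ₁ → ℝ → E d → ℝ}
    {c : ℝ → E d → ℝ} (hq : ∀ l, SM (eE d) S.T (q l)) (hp : ∀ l, SM (eE d) S.T (p l))
    (hcS : SM (eE d) S.T c) (i : Option S.Λ₁) : SM (eZ d) S.T (S.meshCoef ρ q p c i) := by
  have h1 := S.sm_inv_mesh hρ hc hpos
  have h2 : ∀ l, SM (eZ d) S.T (fun t z =>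
      (ρ z.1)⁻¹ * (ρ z.1)⁻¹ * q l t z.2 + (ρ z.1)⁻¹ * p l t z.2) := fun l =>
    ((h1.mul h1).mul (hq l).lift).add (h1.mul (hp l).lift)
  rcases i with _ | l
  · exact ((SM.sum Finset.univ h2).const_mul (-1)).sub hcS.lift
  · exact h2 l

theorem meshFree_nn {n : ℕ} {C : ℝ} {f : ℝ → E d → ℝ} {g : E d → ℝ}
    (hf : NN (eE d) S.T 0 n C f) (hg : NN (eE d) S.T 0 n C (fun _ => g)) :
    NN (eZ d) S.T 0 n ((1 + Real.exp S.T) * C) (S.meshFree f g) :=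
  (hg.lift.add (hf.lift.integral_of_nonneg S.T_pos.le)).mono (le_of_eq (by ring))

theorem meshFree_sub {n : ℕ} {C C' : ℝ} {f f' : ℝ → E d → ℝ} {g g' : E d → ℝ}
    (hf : NN (eE d) S.T 0 n C f) (hf' : NN (eE d) S.T 0 n C' f') :
    (fun t z => S.meshFree f' g' t z - S.meshFree f g t z) =
      S.meshFree (fun t x => f' t x - f t x) (fun x => g' x - g x) := by
  funext t z
  simp only [meshFree]
  rw [intervalIntegral.integral_sub (hf'.nn0.intervalIntegrable _ _ _)
    (hf.nn0.intervalIntegrable _ _ _)]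
  ring

/-- A smooth solution of the scheme, as a function of the mesh size and of the point. -/
structure MeshSol (ρ : ℝ → ℝ) (q p : S.Λ₁ → ℝ → E d → ℝ) (c f : ℝ → E d → ℝ) (g : E d → ℝ)
    (U : ℝ → ℝ × E d → ℝ) : Prop where
  q_sm : ∀ l, SM (eE d) S.T (q l)
  p_sm : ∀ l, SM (eE d) S.T (p l)
  c_sm : SM (eE d) S.T c
  f_sm : SM (eE d) S.T f
  g_sm : SM (eE d) S.T (fun _ => g)
  b_sm : ∀ i, SM (eZ d) S.T (S.meshCoef ρ q p c i)
  comp : ∀ n, ∃ κ, 0 ≤ κ ∧ CompBound (eZ d) S.T n (S.meshMap ρ) κ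
  U_sm : SM (eZ d) S.T U
  eqn : ∀ t z, U t z = S.meshFree f g t z +
    ∫ s in (0 : ℝ)..cl S.T t, shiftOp (S.meshCoef ρ q p c) (S.meshMap ρ) U s z

theorem exists_meshSol (hρ : ContDiff ℝ ∞ ρ) {h₀ : ℝ}
    (hρc : HasCompactSupport fun s => ρ s - h₀) (hpos : ∀ s, 0 < ρ s)
    {q p : S.Λ₁ → ℝ → E d → ℝ} {c f : ℝ → E d → ℝ} {g : E d → ℝ}
    (hq : ∀ l, SM (eE d) S.T (q l)) (hp : ∀ l, SM (eE d) S.T (p l)) (hc : SM (eE d) S.T c)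
    (hf : SM (eE d) S.T f) (hg : SM (eE d) S.T (fun _ => g)) :
    ∃ U, S.MeshSol ρ q p c f g U := by
  have hb := S.sm_meshCoef hρ hρc hpos hq hp hc
  have hH : SM (eZ d) S.T (S.meshFree f g) := hg.lift.add (hf.lift.integral S.T_pos.le)
  obtain ⟨U, hU, hE⟩ := exists_smooth_solution S.T_pos.le (S.meshMap_compBound hρ hρc)
    hb hH (S.meshFree_cl f g)
  exact ⟨U, hq, hp, hc, hf, hg, hb, S.meshMap_compBound hρ hρc, hU, hE⟩

variable {S} {q p : S.Λ₁ → ℝ → E d → ℝ} {c f : ℝ → E d → ℝ} {g : E d → ℝ} {U : ℝ → ℝ × E d → ℝ}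

/-- The `k`-th derivative of the solution in the mesh size. -/
def hD (U : ℝ → ℝ × E d → ℝ) (k : ℕ) (s t : ℝ) (x : E d) : ℝ := (dd (es d))^[k] (U t) (s, x)

variable (S) in
/-- The right-hand side of the equation, as a function of the mesh size and of the point. -/
def meshRhs (ρ : ℝ → ℝ) (q p : S.Λ₁ → ℝ → E d → ℝ) (c f : ℝ → E d → ℝ) (U : ℝ → ℝ × E d → ℝ)
    (t : ℝ) (z : ℝ × E d) : ℝ :=
  shiftOp (S.meshCoef ρ q p c) (S.meshMap ρ) U t z + f t z.2

variable (S) in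
/-- The free term in the equation for the `k`-th derivative in the mesh size. -/
def hFree (ρ : ℝ → ℝ) (q p : S.Λ₁ → ℝ → E d → ℝ) (c f : ℝ → E d → ℝ) (U : ℝ → ℝ × E d → ℝ)
    (k : ℕ) (s t : ℝ) (x : E d) : ℝ :=
  (dd (es d))^[k] (S.meshRhs ρ q p c f U t) (s, x) -
    S.Lop (ρ s) (fun l => q l t) (fun l => p l t) (c t) (hD U k s t) x

theorem MeshSol.rhs_sm (hU : S.MeshSol ρ q p c f g U) : SM (eZ d) S.T (S.meshRhs ρ q p c f U) := by
  refine SM.add (fun n => ?_) hU.f_sm.lift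
  obtain ⟨κ, _, hc⟩ := hU.comp n
  choose B hB using fun i => hU.b_sm i n
  obtain ⟨C, hC⟩ := hU.U_sm n
  exact ⟨_, hC.shiftOp hc fun i => (hB i).mono
    (Finset.single_le_sum (fun i _ => (hB i).nonneg) (Finset.mem_univ i))⟩

theorem sm_iterate_es {F : ℝ → ℝ × E d → ℝ} {T : ℝ} (hF : SM (eZ d) T F) (k : ℕ) :
    SM (eZ d) T (fun t => (dd (es d))^[k] (F t)) := by
  have := hF.iterate_dd (Sum.inl ()) k
  rwa [eZ_inl] at this

theorem iterate_dd_integral {F : ℝ → ℝ × E d → ℝ} {T : ℝ} (hF : SM (eZ d) T F) (k : ℕ) (t : ℝ) :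
    (dd (es d))^[k] (fun z => ∫ s in (0 : ℝ)..cl T t, F s z) =
      fun z => ∫ s in (0 : ℝ)..cl T t, (dd (es d))^[k] (F s) z := by
  induction k generalizing F with
  | zero => rfl
  | succ k ih =>
    obtain ⟨C, hC⟩ := hF 1
    have h1 := (dd_integral hC (Sum.inl ()) t).2
    rw [eZ_inl] at h1
    rw [Function.iterate_succ_apply, h1]
    exact ih (sm_iterate_es hF 1)

/-- The derivatives in the mesh size solve the scheme. -/
theorem MeshSol.deriv (hU : S.MeshSol ρ q p c f g U) (τ₀ : ℝ) (k : ℕ) (s : ℝ) :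
    S.SmoothSol τ₀ (ρ s) q p c (S.hFree ρ q p c f U k s) (if k = 0 then g else fun _ => 0)
      (hD U k s) := by
  have hT := S.T_pos.le
  have hR := hU.rhs_sm
  have hv : SM (eE d) S.T (hD U k s) := (sm_iterate_es hU.U_sm k).slice s
  refine smoothSol_of_SM hU.q_sm hU.p_sm hU.c_sm
    (((sm_iterate_es hR k).slice s).sub (sm_Lop hU.q_sm hU.p_sm hU.c_sm hv)) ?_ hv ?_
  · split_ifs
    · exact hU.g_sm.contDiff 0
    · exact contDiff_const
  · intro t ht x
    -- In this form the equation can be differentiated in the mesh size under the integral. The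
    -- lifted `g` does not depend on the mesh size, so the initial value of every derivative of
    -- order `k ≥ 1` vanishes.
    have h1 : U t = fun z => g z.2 + ∫ s in (0 : ℝ)..cl S.T t, S.meshRhs ρ q p c f U s z := by
      funext z
      rw [hU.eqn t z, meshFree, add_assoc]
      congr 1
      obtain ⟨κ, _, hc⟩ := hU.comp 0
      choose B hB using fun i => hU.b_sm i 0
      obtain ⟨C, hC⟩ := hU.U_sm 0
      obtain ⟨C', hC'⟩ := hU.f_sm.lift 0
      have h2 := (hC.shiftOp hc fun i => (hB i).mono
        (Finset.single_le_sum (fun i _ => (hB i).nonneg) (Finset.mem_univ i))).nn0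
      rw [← intervalIntegral.integral_add (hC'.nn0.intervalIntegrable z _ _)
        (h2.intervalIntegrable z _ _)]
      exact intervalIntegral.integral_congr fun s _ => add_comm _ _
    simp only [hFree, add_sub_cancel]
    rw [hD, h1, iterate_dd_add _ _ (hU.g_sm.lift.contDiff 0) ((hR.integral hT).contDiff t),
      iterate_dd_integral hR, cl_of_mem ht]
    rcases k with _ | k
    · rfl
    · rw [iterate_dd_lift (hU.g_sm.contDiff 0)]
      simp

/-- One of the terms of the free term in the equation for the derivatives in the mesh size. -/
def hTerm (q p : S.Λ₁ → E d → ℝ) (i : ℕ) (s : ℝ) (φ : E d → ℝ) (x : E d) : ℝ :=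
  ∑ l, q l x * Jop (fun θ => θ ^ i * (1 - θ)) (l : E d) (2 + i) s φ x +
    ∑ l, p l x * Jop (fun θ => θ ^ i * 1) (l : E d) (1 + i) s φ x

theorem hFree_zero (s : ℝ) :
    S.hFree ρ q p c f U 0 s = f := by
  funext t x
  simp only [hFree, meshRhs, Function.iterate_zero, id, shiftOp_mesh]
  change _ - S.Lop (ρ s) _ _ _ (fun x => U t (s, x)) x = _
  ring

/-- Near `s` the scheme is rewritten without negative powers of the mesh size, by averages along
segments. Leibniz' rule then gives the operator applied to the top derivative plus terms in strictly
lower mesh derivatives. -/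
theorem MeshSol.hFree_succ (hU : S.MeshSol ρ q p c f g U) {s t : ℝ} (hs : s ≠ 0)
    (hρs : ∀ᶠ s' in nhds s, ρ s' = s') (hcen : ∀ x, ∑ l, q l t x • (l : E d) = 0) (k : ℕ) :
    S.hFree ρ q p c f U (k + 1) s t = fun x => ∑ i ∈ Finset.HasAntidiagonal.antidiagonal k,
      ((k + 1).choose (i.1 + 1) : ℝ) *
        hTerm (fun l => q l t) (fun l => p l t) (i.1 + 1) s (hD U i.2 s t) x := by
  have hUt := hU.U_sm.contDiff t
  have hw : ContDiff ℝ ∞ (fun θ : ℝ => 1 - θ) := contDiff_const.sub contDiff_id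
  have hw1 : ContDiff ℝ ∞ (fun _ : ℝ => (1 : ℝ)) := contDiff_const
  -- Centering removes the singular factor: second order averages stand with `q`, first order
  -- averages with `p`.
  have hlop : ∀ {s : ℝ} (_ : s ≠ 0) {Φ : ℝ × E d → ℝ} (_ : ContDiff ℝ ∞ Φ) (x : E d),
      S.Lop s (fun l => q l t) (fun l => p l t) (c t) (fun x => Φ (s, x)) x =
      (∑ l, q l t x * JZ (fun θ => 1 - θ) (l : E d) 2 Φ (s, x) +
        ∑ l, p l t x * JZ (fun _ => 1) (l : E d) 1 Φ (s, x)) - c t x * Φ (s, x) := by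
    intro s hs Φ hΦ x
    have hΦs : ContDiff ℝ ∞ (fun x => Φ (s, x)) := hΦ.comp (contDiff_const.prodMk contDiff_id)
    simp only [Lop, Qop, Pop]
    rw [S.centered_eq_Jop hs (hcen x) hΦs]
    simp only [S.del_eq_Jop hs _ hΦs, JZ_eq_Jop hΦ]
  funext x
  have hev : S.meshRhs ρ q p c f U t =ᶠ[nhds (s, x)] fun z =>
      (((∑ l, q l t z.2 * JZ (fun θ => 1 - θ) (l : E d) 2 (U t) z) +
        ∑ l, p l t z.2 * JZ (fun _ => 1) (l : E d) 1 (U t) z) +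
        (-c t z.2) * U t z) + f t z.2 := by
    have h1 : ∀ᶠ z : ℝ × E d in nhds (s, x), ρ z.1 = z.1 :=
      (continuous_fst.tendsto (s, x)).eventually hρs
    have h2 : ∀ᶠ z : ℝ × E d in nhds (s, x), z.1 ≠ 0 :=
      (continuous_fst.tendsto (s, x)).eventually (isOpen_ne.mem_nhds hs)
    filter_upwards [h1, h2] with z hz hz2
    rw [meshRhs, shiftOp_mesh, hz, hlop hz2 hUt]
    ring
  have hq := fun l => (hU.q_sm l).contDiff t
  have hp := fun l => (hU.p_sm l).contDiff t
  have hJ1 : ∀ l : S.Λ₁, ContDiff ℝ ∞ (JZ (fun θ => 1 - θ) (l : E d) 2 (U t)) := fun l =>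
    contDiff_JZ hw hUt _ _
  have hJ2 : ∀ l : S.Λ₁, ContDiff ℝ ∞ (JZ (fun _ => 1) (l : E d) 1 (U t)) := fun l =>
    contDiff_JZ hw1 hUt _ _
  have hqJ : ∀ l : S.Λ₁, ContDiff ℝ ∞
      (fun z : ℝ × E d => q l t z.2 * JZ (fun θ => 1 - θ) (l : E d) 2 (U t) z) := fun l =>
    ((hq l).comp contDiff_snd).mul (hJ1 l)
  have hpJ : ∀ l : S.Λ₁, ContDiff ℝ ∞
      (fun z : ℝ × E d => p l t z.2 * JZ (fun _ => 1) (l : E d) 1 (U t) z) := fun l =>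
    ((hp l).comp contDiff_snd).mul (hJ2 l)
  have hcn : ContDiff ℝ ∞ (fun x => -c t x) := (hU.c_sm.contDiff t).neg
  have hcU : ContDiff ℝ ∞ (fun z : ℝ × E d => (-c t z.2) * U t z) :=
    (hcn.comp contDiff_snd).mul hUt
  have hsum1 := ContDiff.sum (s := Finset.univ) fun l _ => hqJ l
  have hsum2 := ContDiff.sum (s := Finset.univ) fun l _ => hpJ l
  rw [hFree, (iterate_dd_eventuallyEq (es d) (k + 1) hev).eq_of_nhds,
    iterate_dd_add _ _ ((hsum1.add hsum2).add hcU) (hU.f_sm.lift.contDiff t),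
    iterate_dd_add _ _ (hsum1.add hsum2) hcU, iterate_dd_add _ _ hsum1 hsum2,
    iterate_dd_lift (hU.f_sm.contDiff t), iterate_dd_sum _ _ _ hqJ, iterate_dd_sum _ _ _ hpJ,
    iterate_dd_lift_mul hcn hUt]
  simp only [iterate_dd_lift_mul (hq _) (hJ1 _), iterate_dd_lift_mul (hp _) (hJ2 _)]
  rw [hρs.self_of_nhds]
  have hD' : ∀ k, ContDiff ℝ ∞ ((dd (es d))^[k] (U t)) := fun k => contDiff_iterate_dd _ k hUt
  change _ - S.Lop s (fun l => q l t) (fun l => p l t) (c t)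
    (fun x => (dd (es d))^[k + 1] (U t) (s, x)) x = _
  rw [hlop hs (hD' (k + 1))]
  -- The terms in which every mesh derivative falls on `U` are split off; they cancel the subtracted
  -- operator.
  simp only [iterate_dd_JZ hw hUt, iterate_dd_JZ hw1 hUt, Finset.Nat.sum_antidiagonal_succ]
  simp only [Nat.choose_zero_right, Nat.cast_one, one_mul, pow_zero, add_zero, mul_add,
    Finset.sum_add_distrib, hTerm]
  have hsw : ∀ (b : S.Λ₁ → ℝ) (w : ℝ → ℝ) (j : ℕ),
      ∑ l, b l * ∑ i ∈ Finset.HasAntidiagonal.antidiagonal k, ((k + 1).choose (i.1 + 1) : ℝ) *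
        JZ (fun θ => θ ^ (i.1 + 1) * w θ) (l : E d) (j + (i.1 + 1)) ((dd (es d))^[i.2] (U t)) (s, x) =
      ∑ i ∈ Finset.HasAntidiagonal.antidiagonal k, ((k + 1).choose (i.1 + 1) : ℝ) *
        ∑ l, b l * Jop (fun θ => θ ^ (i.1 + 1) * w θ) (l : E d) (j + (i.1 + 1)) s (hD U i.2 s t) x := by
    intro b w j
    simp only [Finset.mul_sum]
    rw [Finset.sum_comm]
    refine Finset.sum_congr rfl fun i _ => Finset.sum_congr rfl fun l _ => ?_
    rw [JZ_eq_Jop (hD' i.2)]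
    change _ = _ * (_ * Jop _ _ _ _ (fun x => (dd (es d))^[i.2] (U t) (s, x)) x)
    ring
  rw [hsw (fun l => q l t x) (fun θ => 1 - θ) 2, hsw (fun l => p l t x) (fun _ => 1) 1]
  ring

end Scheme

end FDScheme

/-! ### Bounds for the derivatives in the mesh size. -/

namespace FDScheme

namespace Scheme

variable {d : ℕ} (S : Scheme d) (τ₀ h : ℝ)

theorem dl_const_mul (lam : List S.Idx) (a : ℝ) {φ : E d → ℝ} (hφ : ContDiff ℝ ∞ φ) :
    S.dl τ₀ h lam (fun x => a * φ x) = fun x => a * S.dl τ₀ h lam φ x := by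
  induction lam generalizing φ with
  | nil => rfl
  | cons μ lam ih =>
    rw [dl_cons, S.dbar_const_mul τ₀ h μ a (differentiable_of_smooth hφ),
      ih (contDiff_dbar τ₀ h μ hφ)]
    rfl

theorem dl_zero (lam : List S.Idx) : S.dl τ₀ h lam (fun _ => 0) = fun _ => 0 := by
  induction lam with
  | nil => rfl
  | cons μ lam ih => rw [dl_cons, dbar_zero, ih]

theorem dl_sum (lam : List S.Idx) {ι : Type*} (s : Finset ι) {φ : ι → E d → ℝ}
    (hφ : ∀ i, ContDiff ℝ ∞ (φ i)) :
    S.dl τ₀ h lam (fun x => ∑ i ∈ s, φ i x) = fun x => ∑ i ∈ s, S.dl τ₀ h lam (φ i) x := by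
  induction lam generalizing φ with
  | nil => rfl
  | cons μ lam ih =>
    rw [dl_cons, S.dbar_sum τ₀ h μ s fun i _ => differentiable_of_smooth (hφ i),
      ih fun i => contDiff_dbar τ₀ h μ (hφ i)]
    rfl

theorem W_const_mul (n : ℕ) (a : ℝ) {φ : E d → ℝ} (hφ : ContDiff ℝ ∞ φ) (x : E d) :
    S.W τ₀ h n (fun x => a * φ x) x = a ^ 2 * S.W τ₀ h n φ x := by
  simp only [W, S.dl_const_mul τ₀ h _ a hφ, mul_pow, lsum_mul_left]

theorem W_const_zero (n : ℕ) (x : E d) : S.W τ₀ h n (fun _ => 0) x = 0 := by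
  simp [W, dl_zero, lsum]

theorem W_sum_le (n : ℕ) {ι : Type*} (s : Finset ι) {φ : ι → E d → ℝ}
    (hφ : ∀ i, ContDiff ℝ ∞ (φ i)) (x : E d) :
    S.W τ₀ h n (fun x => ∑ i ∈ s, φ i x) x ≤ s.card * ∑ i ∈ s, S.W τ₀ h n (φ i) x := by
  simp only [W, S.dl_sum τ₀ h _ s hφ, ← lsum_comm, ← lsum_mul_left]
  exact lsum_mono n fun lam => sq_sum_le_card_mul_sum_sq

theorem W_weighted_sum_le (n : ℕ) {ι : Type*} (s : Finset ι) (a : ι → ℝ) {φ : ι → E d → ℝ}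
    (hφ : ∀ i, ContDiff ℝ ∞ (φ i)) (x : E d) :
    S.W τ₀ h n (fun x => ∑ i ∈ s, a i * φ i x) x ≤ s.card * ∑ i ∈ s, a i ^ 2 * S.W τ₀ h n (φ i) x := by
  refine (S.W_sum_le τ₀ h n s (fun i => contDiff_const.mul (hφ i)) x).trans (le_of_eq ?_)
  congr 1
  exact Finset.sum_congr rfl fun i _ => S.W_const_mul τ₀ h n (a i) (hφ i) x

variable {S τ₀ h}

theorem contDiff_hTerm {q p : S.Λ₁ → E d → ℝ} {φ : E d → ℝ} (hq : ∀ l, ContDiff ℝ ∞ (q l))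
    (hp : ∀ l, ContDiff ℝ ∞ (p l)) (hφ : ContDiff ℝ ∞ φ) (i : ℕ) (s : ℝ) :
    ContDiff ℝ ∞ (hTerm q p i s φ) := by
  refine ContDiff.add (ContDiff.sum fun l _ => (hq l).mul (contDiff_Jop _ _ _ ?_ hφ))
    (ContDiff.sum fun l _ => (hp l).mul (contDiff_Jop _ _ _ ?_ hφ))
  · exact (contDiff_id.pow i).mul (contDiff_const.sub contDiff_id)
  · exact (contDiff_id.pow i).mul contDiff_const

/-- The averages in this term contain `2 + i` derivatives next to `q` and `1 + i` next to `p`, all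
with weights bounded by one on `[0,1]`. -/
theorem W_hTerm_le (hτ₀ : 0 < τ₀) {q p : S.Λ₁ → E d → ℝ} {φ : E d → ℝ}
    (hq : ∀ l, ContDiff ℝ ∞ (q l)) (hp : ∀ l, ContDiff ℝ ∞ (p l)) (hφ : ContDiff ℝ ∞ φ)
    (n i : ℕ) (s : ℝ) {B X : ℝ} (hqB : ∀ j ≤ n, ∀ x, ∑ l, S.W τ₀ h j (q l) x ≤ B)
    (hpB : ∀ j ≤ n, ∀ x, ∑ l, S.W τ₀ h j (p l) x ≤ B)
    (hX : ∀ j ≤ n + (2 + i), ∀ x, S.W τ₀ h j φ x ≤ X) (x : E d) :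
    S.W τ₀ h n (hTerm q p i s φ) x ≤
      2 * (4 ^ n * B * ((S.size / τ₀) ^ (2 * (2 + i)) * X)) +
      2 * (4 ^ n * B * ((S.size / τ₀) ^ (2 * (1 + i)) * X)) := by
  have key : ∀ {b : S.Λ₁ → E d → ℝ} (_ : ∀ l, ContDiff ℝ ∞ (b l)) (w : ℝ → ℝ)
      (_ : ContDiff ℝ ∞ w) (_ : ∀ θ ∈ Icc (0 : ℝ) 1, |w θ| ≤ 1) (e : ℕ) (_ : 1 ≤ e)
      (_ : e ≤ 2 + i) (_ : ∀ j ≤ n, ∀ x, ∑ l, S.W τ₀ h j (b l) x ≤ B),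
      ContDiff ℝ ∞ (fun x => ∑ l, b l x * Jop w (l : E d) e s φ x) ∧
      S.W τ₀ h n (fun x => ∑ l, b l x * Jop w (l : E d) e s φ x) x ≤
        4 ^ n * B * ((S.size / τ₀) ^ (2 * e) * X) := by
    intro b hb w hw hw1 e he1 he2 hB
    refine ⟨ContDiff.sum fun l _ => (hb l).mul (contDiff_Jop _ _ _ hw hφ), ?_⟩
    have h1 := S.W_prod_le τ₀ h (K₁ := Unit) (K₂ := Unit) n (b := fun _ => b)
      (φ := fun _ (l : S.Λ₁) => Jop w (l : E d) e s φ) (fun _ => 0) (fun _ => hb)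
      (fun _ l => contDiff_Jop _ _ _ hw hφ) (B := B) (Φ := (S.size / τ₀) ^ (2 * e) * X)
      (by simpa using hB) (fun j hj x => ?_) x
    · simpa using h1
    · exact S.sum_W_Jop_le τ₀ h hτ₀ hw hw1 e he1 s (κ := Unit) (φ := fun _ => φ) (fun _ => hφ) j
        (by simpa using hX (j + e) (by omega)) x
  have hpow : ∀ θ ∈ Icc (0 : ℝ) 1, |θ ^ i| ≤ 1 := fun θ hθ => by
    rw [abs_of_nonneg (pow_nonneg hθ.1 _)]
    exact pow_le_one₀ hθ.1 hθ.2
  obtain ⟨h1, h2⟩ := key hq (fun θ => θ ^ i * (1 - θ))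
    ((contDiff_id.pow i).mul (contDiff_const.sub contDiff_id)) (fun θ hθ => by
      rw [abs_mul]
      exact mul_le_one₀ (hpow θ hθ) (abs_nonneg _) (by
        rw [abs_of_nonneg (by linarith [hθ.2])]; linarith [hθ.1]))
    (2 + i) (by omega) le_rfl hqB
  obtain ⟨h3, h4⟩ := key hp (fun θ => θ ^ i * 1) ((contDiff_id.pow i).mul contDiff_const)
    (fun θ hθ => by rw [mul_one]; exact hpow θ hθ) (1 + i) (by omega) (by omega) hpB
  exact (S.W_add_le τ₀ h n h1 h3 x).trans (by linarith)

/-- The derivatives in the mesh size are bounded in terms of the data. -/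
theorem hD_bound (m : ℕ) {δ K c₀ τ₀ B : ℝ} (α : ℝ) (hδ : 0 < δ) (hδ1 : δ ≤ 1) (hK : 0 ≤ K)
    (hc₀ : 0 < c₀) (hτ₀ : 0 < τ₀) (k : ℕ) : ∃ N : ℝ, 0 ≤ N ∧
    ∀ (d : ℕ) (S : Scheme d) (ρ : ℝ → ℝ) (q p : S.Λ₁ → ℝ → E d → ℝ) (c f : ℝ → E d → ℝ)
      (g : E d → ℝ) (U : ℝ → ℝ × E d → ℝ) (s D : ℝ), S.size / τ₀ = α → s ≠ 0 →
      (∀ᶠ s' in nhds s, ρ s' = s') → 0 ≤ D → S.MeshSol ρ q p c f g U →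
      (∀ t ∈ Icc 0 S.T, S.SmoothCoef τ₀ s m δ K c₀ B (fun l => q l t) (fun l => p l t) (c t)) →
      (∀ j ≤ m, ∀ t ∈ Icc 0 S.T, ∀ x, S.W τ₀ s j (f t) x ≤ D) →
      (∀ j ≤ m, ∀ x, S.W τ₀ s j g x ≤ D) →
      ∀ k' ≤ k, ∀ j, 3 * k' + j ≤ m → ∀ t ∈ Icc 0 S.T, ∀ x,
        S.W τ₀ s j (hD U k' s t) x ≤ N * D := by
  induction k with
  | zero =>
    obtain ⟨N, _, _, hN, -, -, H⟩ := apriori_aux m (B := B) α hδ hδ1 hK hc₀ hτ₀ m le_rfl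
    refine ⟨N, hN, fun d S ρ q p c f g U s D hα hs hρ hD0 hU hco hf hg k' hk' j hj => ?_⟩
    obtain rfl : k' = 0 := by omega
    have h1 := hU.deriv τ₀ 0 s
    rw [hρ.self_of_nhds, hFree_zero, if_pos rfl] at h1
    exact (H d S s q p c f g _ D hα hs hD0 hco h1 hf hg).1 j (by omega)
  | succ k ih =>
    obtain ⟨N, hN, H⟩ := ih
    -- If `3(k + 1)` exceeds `m`, no new derivative is claimed and the previous constant serves.
    rcases lt_or_ge m (3 * (k + 1)) with hm | hm
    · refine ⟨N, hN, fun d S ρ q p c f g U s D hα hs hρ hD0 hU hco hf hg k' hk' j hj => ?_⟩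
      exact H d S ρ q p c f g U s D hα hs hρ hD0 hU hco hf hg k' (by omega) j hj
    obtain ⟨N', _, _, hN', -, -, H'⟩ := apriori_aux m (B := B) α hδ hδ1 hK hc₀ hτ₀ (m - 3 * (k + 1))
      (by omega)
    -- The absolute values make the constant nonnegative before a scheme is given; only a scheme
    -- shows that `B ≥ 0`.
    set A : ℕ → ℝ := fun i => 2 * (4 ^ m * |B| * |α ^ (2 * (2 + (i + 1)))|) +
      2 * (4 ^ m * |B| * |α ^ (2 * (1 + (i + 1)))|) with hA
    have hA0 : ∀ i, 0 ≤ A i := fun i => by positivity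
    set C : ℝ := (Finset.HasAntidiagonal.antidiagonal k).card *
      ∑ i ∈ Finset.HasAntidiagonal.antidiagonal k, ((k + 1).choose (i.1 + 1) : ℝ) ^ 2 * A i.1
      with hC
    have hC0 : 0 ≤ C := mul_nonneg (by positivity) (Finset.sum_nonneg fun i _ =>
      mul_nonneg (by positivity) (hA0 _))
    refine ⟨max N (N' * (C * N)), le_max_of_le_left hN,
      fun d S ρ q p c f g U s D hα hs hρ hD0 hU hco hf hg k' hk' j hj t ht x => ?_⟩
    have hprev := H d S ρ q p c f g U s D hα hs hρ hD0 hU hco hf hg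
    rcases Nat.lt_or_ge k' (k + 1) with hk | hk
    · exact (hprev k' (by omega) j hj t ht x).trans
        (mul_le_mul_of_nonneg_right (le_max_left _ _) hD0)
    obtain rfl : k' = k + 1 := by omega
    have h1 := hU.deriv τ₀ (k + 1) s
    rw [hρ.self_of_nhds, if_neg (by omega)] at h1
    have hB0 : 0 ≤ B := (S.W_nonneg τ₀ s 0 _ _).trans ((hco t ht).c_le 0 (by omega) x)
    have hfree : ∀ j ≤ m - 3 * (k + 1), ∀ t ∈ Icc 0 S.T, ∀ x,
        S.W τ₀ s j (S.hFree ρ q p c f U (k + 1) s t) x ≤ C * N * D := by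
      intro j hj t ht x
      rw [hU.hFree_succ hs hρ (hco t ht).centered]
      have hv : ∀ i : ℕ, ContDiff ℝ ∞ (hD U i s t) := fun i =>
        (contDiff_iterate_dd _ i (hU.U_sm.contDiff t)).comp (contDiff_const.prodMk contDiff_id)
      have hqs := (hco t ht).q_smooth
      have hps := (hco t ht).p_smooth
      refine (S.W_weighted_sum_le τ₀ s j (Finset.HasAntidiagonal.antidiagonal k)
        (fun i => ((k + 1).choose (i.1 + 1) : ℝ))
        (φ := fun i => hTerm (fun l => q l t) (fun l => p l t) (i.1 + 1) s (hD U i.2 s t))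
        (fun i => contDiff_hTerm hqs hps (hv i.2) (i.1 + 1) s) x).trans ?_
      rw [hC, mul_assoc, mul_assoc]
      refine mul_le_mul_of_nonneg_left ?_ (by positivity)
      rw [Finset.sum_mul]
      refine Finset.sum_le_sum fun i hi => ?_
      have hik := Finset.HasAntidiagonal.mem_antidiagonal.1 hi
      rw [mul_assoc]
      refine mul_le_mul_of_nonneg_left ?_ (by positivity)
      have hT := W_hTerm_le (h := s) hτ₀ hqs hps (hv i.2) j (i.1 + 1) s (B := B) (X := N * D)
        (fun j' hj' => (hco t ht).q_le j' (by omega))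
        (fun j' hj' => (hco t ht).p_le j' (by omega))
        -- With `i.1 + i.2 = k` the orders satisfy `3 i.2 + j + 3 + i.1 ≤ 3(k + 1) + j ≤ m`. The
        -- case `i.1 = 0` is extremal: one mesh derivative costs three spatial ones.
        (fun j' hj' => hprev i.2 (by omega) j' (by omega) t ht) x
      refine hT.trans ?_
      simp only [hα, hA, abs_of_nonneg hB0]
      have hND : 0 ≤ N * D := mul_nonneg hN hD0
      have h4 : (4 : ℝ) ^ j ≤ 4 ^ m := pow_le_pow_right₀ (by norm_num) (by omega)
      have h5 : ∀ e : ℕ, 4 ^ j * B * (α ^ e * (N * D)) ≤ 4 ^ m * B * |α ^ e| * (N * D) := by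
        intro e
        have : α ^ e * (N * D) ≤ |α ^ e| * (N * D) :=
          mul_le_mul_of_nonneg_right (le_abs_self _) hND
        rw [mul_assoc (4 ^ m * B)]
        exact (mul_le_mul_of_nonneg_left this (by positivity)).trans
          (mul_le_mul_of_nonneg_right (by gcongr) (by positivity))
      linarith [h5 (2 * (2 + (i.1 + 1))), h5 (2 * (1 + (i.1 + 1)))]
    -- The derivative of order `k + 1` starts from zero, so its bound comes from the free term
    -- alone.
    have h2 := (H' d S s q p c _ _ _ (C * N * D) hα hs (by positivity) hco h1 hfree
      (fun j _ x => by rw [W_const_zero]; positivity)).1 j (by omega) t ht x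
    refine h2.trans ?_
    rw [← mul_assoc]
    exact mul_le_mul_of_nonneg_right (le_max_right _ _) hD0

end Scheme

end FDScheme

namespace FDScheme

/-! ### Multi-indices and iterated partial derivatives -/

section Multi

variable {d : ℕ}

theorem contDiff_partialDeriv (i : Fin d) {φ : E d → ℝ} (hφ : ContDiff ℝ ∞ φ) :
    ContDiff ℝ ∞ (partialDeriv i φ) := contDiff_dd hφ

theorem contDiff_iterate_partialDeriv (i : Fin d) (k : ℕ) {φ : E d → ℝ} (hφ : ContDiff ℝ ∞ φ) :
    ContDiff ℝ ∞ ((partialDeriv i)^[k] φ) := contDiff_iterate_dd _ k hφ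

/-- Partial derivatives in the directions of a list, with given multiplicities. -/
def foldDeriv (L : List (Fin d)) (α : Fin d → ℕ) (φ : E d → ℝ) : E d → ℝ :=
  L.foldr (fun i ψ => (partialDeriv i)^[α i] ψ) φ

theorem contDiff_foldDeriv (L : List (Fin d)) (α : Fin d → ℕ) {φ : E d → ℝ}
    (hφ : ContDiff ℝ ∞ φ) : ContDiff ℝ ∞ (foldDeriv L α φ) := by
  induction L with
  | nil => exact hφ
  | cons i L ih => exact contDiff_iterate_partialDeriv i _ ih

theorem foldDeriv_partialDeriv (L : List (Fin d)) (α : Fin d → ℕ) (j : Fin d) {φ : E d → ℝ}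
    (hφ : ContDiff ℝ ∞ φ) : foldDeriv L α (partialDeriv j φ) = partialDeriv j (foldDeriv L α φ) := by
  induction L with
  | nil => rfl
  | cons i L ih =>
    change (partialDeriv i)^[α i] (foldDeriv L α (partialDeriv j φ)) =
      partialDeriv j ((partialDeriv i)^[α i] (foldDeriv L α φ))
    rw [ih]
    exact iterate_dd_dd_comm _ _ _ (contDiff_foldDeriv L α hφ)

theorem foldDeriv_add_single (L : List (Fin d)) (hL : L.Nodup) (α : Fin d → ℕ) (j : Fin d)
    {φ : E d → ℝ} (hφ : ContDiff ℝ ∞ φ) : foldDeriv L (α + Pi.single j 1) φ =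
      if j ∈ L then partialDeriv j (foldDeriv L α φ) else foldDeriv L α φ := by
  induction L with
  | nil => rfl
  | cons i L ih =>
    obtain ⟨hi, hL'⟩ := List.nodup_cons.1 hL
    change (partialDeriv i)^[(α + Pi.single j 1 : Fin d → ℕ) i] (foldDeriv L (α + Pi.single j 1) φ) = _
    rw [ih hL']
    by_cases hij : j = i
    · subst hij
      rw [if_neg hi, if_pos List.mem_cons_self]
      simp only [Pi.add_apply, Pi.single_eq_same, Function.iterate_succ_apply']
      rfl
    · have h1 : (α + Pi.single j 1 : Fin d → ℕ) i = α i := by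
        simp [Pi.single_eq_of_ne (Ne.symm hij)]
      rw [h1]
      by_cases hjL : j ∈ L
      · rw [if_pos hjL, if_pos (List.mem_cons_of_mem _ hjL)]
        exact iterate_dd_dd_comm _ _ _ (contDiff_foldDeriv L α hφ)
      · rw [if_neg hjL, if_neg (by simp [hij, hjL])]
        rfl

theorem contDiff_multiDeriv (α : Fin d → ℕ) {φ : E d → ℝ} (hφ : ContDiff ℝ ∞ φ) :
    ContDiff ℝ ∞ (multiDeriv α φ) := contDiff_foldDeriv _ α hφ

theorem multiDeriv_add_single (α : Fin d → ℕ) (j : Fin d) {φ : E d → ℝ} (hφ : ContDiff ℝ ∞ φ) :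
    multiDeriv (α + Pi.single j 1) φ = partialDeriv j (multiDeriv α φ) := by
  have := foldDeriv_add_single (List.finRange d) (List.nodup_finRange d) α j hφ
  rwa [if_pos (List.mem_finRange j)] at this

theorem multiDeriv_partialDeriv (α : Fin d → ℕ) (j : Fin d) {φ : E d → ℝ} (hφ : ContDiff ℝ ∞ φ) :
    multiDeriv α (partialDeriv j φ) = multiDeriv (α + Pi.single j 1) φ := by
  rw [multiDeriv_add_single α j hφ]
  exact foldDeriv_partialDeriv _ α j hφ

theorem multiDeriv_zero (φ : E d → ℝ) : multiDeriv 0 φ = φ := by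
  change foldDeriv _ 0 φ = φ
  generalize List.finRange d = L
  induction L with
  | nil => rfl
  | cons i L ih => exact ih

theorem multiDeriv_single (j : Fin d) {φ : E d → ℝ} (hφ : ContDiff ℝ ∞ φ) :
    multiDeriv (Pi.single j 1) φ = partialDeriv j φ := by
  have := multiDeriv_add_single 0 j hφ
  rwa [zero_add, multiDeriv_zero] at this

/-- Every multi-index other than zero is obtained by adding a unit multi-index. -/
theorem exists_eq_add_single {α : Fin d → ℕ} {n : ℕ} (hα : ∑ i, α i = n + 1) :
    ∃ (β : Fin d → ℕ) (j : Fin d), α = β + Pi.single j 1 ∧ ∑ i, β i = n := by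
  obtain ⟨j, hj⟩ : ∃ j, α j ≠ 0 := by
    by_contra hcon
    push Not at hcon
    simp [hcon] at hα
  have h1 : α = (α - Pi.single j 1) + Pi.single j 1 := by
    funext i
    by_cases hij : i = j
    · subst hij; simp; omega
    · simp [Pi.single_eq_of_ne hij]
  refine ⟨α - Pi.single j 1, j, h1, ?_⟩
  rw [h1] at hα
  simp only [Pi.add_apply, Finset.sum_add_distrib, Finset.sum_pi_single', Finset.mem_univ,
    if_true] at hα
  simpa using hα

theorem sum_add_single (β : Fin d → ℕ) (j : Fin d) :
    ∑ i, (β + Pi.single j 1 : Fin d → ℕ) i = (∑ i, β i) + 1 := by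
  simp [Finset.sum_add_distrib]

theorem mem_multiIndices {n : ℕ} {α : Fin d → ℕ} : α ∈ multiIndices d n ↔ ∑ i, α i = n := by
  simp [multiIndices, Finset.mem_piAntidiag]

/-- The multiplicities of the directions in a list. -/
def cnt (β : List (Fin d)) : Fin d → ℕ := fun i => β.count i

theorem cnt_cons (i : Fin d) (β : List (Fin d)) : cnt (i :: β) = cnt β + Pi.single i 1 := by
  funext j
  by_cases hij : i = j
  · subst hij; simp [cnt]
  · simp [cnt, hij]

theorem sum_cnt (β : List (Fin d)) : ∑ i, cnt β i = β.length := by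
  induction β with
  | nil => simp [cnt]
  | cons i β ih => rw [cnt_cons, sum_add_single, ih, List.length_cons]

/-- Iterated partial derivatives in the directions of a list. -/
def wd : List (Fin d) → (E d → ℝ) → (E d → ℝ)
  | [], φ => φ
  | i :: β, φ => wd β (partialDeriv i φ)

theorem contDiff_wd (β : List (Fin d)) {φ : E d → ℝ} (hφ : ContDiff ℝ ∞ φ) :
    ContDiff ℝ ∞ (wd β φ) := by
  induction β generalizing φ with
  | nil => exact hφ
  | cons i β ih => exact ih (contDiff_partialDeriv i hφ)

theorem wd_eq_multiDeriv (β : List (Fin d)) {φ : E d → ℝ} (hφ : ContDiff ℝ ∞ φ) :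
    wd β φ = multiDeriv (cnt β) φ := by
  induction β generalizing φ with
  | nil => exact (multiDeriv_zero φ).symm
  | cons i β ih =>
    rw [wd, ih (contDiff_partialDeriv i hφ), multiDeriv_partialDeriv _ _ hφ, cnt_cons]

theorem sum_multiIndices_add_single (n : ℕ) (g : (Fin d → ℕ) → ℝ) (i : Fin d) :
    ∑ α ∈ multiIndices d n, g (α + Pi.single i 1) =
      ∑ β ∈ multiIndices d (n + 1), if β i = 0 then 0 else g β := by
  have hite : ∀ β : Fin d → ℕ, (if β i = 0 then 0 else g β) = if β i ≠ 0 then g β else 0 := by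
    intro β; by_cases h : β i = 0 <;> simp [h]
  simp only [hite]
  rw [← Finset.sum_filter]
  refine Finset.sum_bij' (fun α _ => α + Pi.single i 1) (fun β _ => β - Pi.single i 1)
    ?_ ?_ ?_ ?_ ?_
  · intro α hα
    rw [Finset.mem_filter, mem_multiIndices, sum_add_single, mem_multiIndices.1 hα]
    simp
  · intro β hβ
    rw [Finset.mem_filter, mem_multiIndices] at hβ
    rw [mem_multiIndices]
    have h1 : β = (β - Pi.single i 1) + Pi.single i 1 := by
      funext j
      by_cases hij : j = i
      · subst hij; simp; omega
      · simp [Pi.single_eq_of_ne hij]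
    have h2 := hβ.1
    rw [h1, sum_add_single] at h2
    omega
  · intro α _
    simp
  · intro β hβ
    rw [Finset.mem_filter] at hβ
    funext j
    by_cases hij : j = i
    · subst hij; have := hβ.2; simp; omega
    · simp [Pi.single_eq_of_ne hij]
  · intro α _
    rfl

/-- A multi-index `β` of order `n + 1` is reached once for each `i` with `β i ≠ 0`, hence at least
once and at most `n + 1` times, whatever `d` is. -/
theorem sum_multiIndices_succ (n : ℕ) {g : (Fin d → ℕ) → ℝ} (hg : ∀ α, 0 ≤ g α) :
    ∑ β ∈ multiIndices d (n + 1), g β ≤ ∑ i, ∑ α ∈ multiIndices d n, g (α + Pi.single i 1) ∧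
    ∑ i, ∑ α ∈ multiIndices d n, g (α + Pi.single i 1) ≤
      (n + 1) * ∑ β ∈ multiIndices d (n + 1), g β := by
  simp only [sum_multiIndices_add_single]
  rw [Finset.sum_comm, Finset.mul_sum]
  refine ⟨Finset.sum_le_sum fun β hβ => ?_, Finset.sum_le_sum fun β hβ => ?_⟩
  · obtain ⟨j, hj⟩ : ∃ j, β j ≠ 0 := by
      by_contra hcon
      push Not at hcon
      have := mem_multiIndices.1 hβ
      simp [hcon] at this
    refine le_trans ?_ (Finset.single_le_sum (f := fun i => if β i = 0 then 0 else g β)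
      (fun i _ => ?_) (Finset.mem_univ j))
    · simp [hj]
    · split_ifs
      · exact le_rfl
      · exact hg β
  · have h1 : ∀ i, (if β i = 0 then 0 else g β) ≤ (β i : ℝ) * g β := by
      intro i
      split_ifs with h
      · rw [h]; simp
      · refine le_mul_of_one_le_left (hg β) ?_
        exact_mod_cast Nat.one_le_iff_ne_zero.2 h
    refine (Finset.sum_le_sum fun i _ => h1 i).trans (le_of_eq ?_)
    rw [← Finset.sum_mul, ← Nat.cast_sum, mem_multiIndices.1 hβ]
    push_cast
    ring

theorem multiIndices_zero : multiIndices d 0 = {0} := by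
  ext α
  rw [mem_multiIndices, Finset.mem_singleton, Finset.sum_eq_zero_iff]
  constructor
  · intro h; funext i; exact h i (Finset.mem_univ i)
  · rintro rfl i _; rfl

/-- Sums over lists of directions and over multi-indices. -/
theorem lsum_cnt (n : ℕ) {g : (Fin d → ℕ) → ℝ} (hg : ∀ α, 0 ≤ g α) :
    ∑ α ∈ multiIndices d n, g α ≤ Scheme.lsum n (fun β : List (Fin d) => g (cnt β)) ∧
    Scheme.lsum n (fun β : List (Fin d) => g (cnt β)) ≤ n.factorial * ∑ α ∈ multiIndices d n, g α := by
  induction n generalizing g with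
  | zero =>
    have h0 : cnt ([] : List (Fin d)) = 0 := by funext i; simp [cnt]
    rw [Scheme.lsum_zero, multiIndices_zero, Finset.sum_singleton, h0]
    simp
  | succ n ih =>
    obtain ⟨h1, h2⟩ := sum_multiIndices_succ n hg
    rw [Scheme.lsum_succ]
    simp only [cnt_cons]
    have h3 := fun i : Fin d => ih (g := fun α => g (α + Pi.single i 1)) fun α => hg _
    refine ⟨h1.trans (Finset.sum_le_sum fun i _ => (h3 i).1), ?_⟩
    refine (Finset.sum_le_sum fun i _ => (h3 i).2).trans ?_
    rw [← Finset.mul_sum, Nat.factorial_succ]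
    push_cast
    rw [mul_comm ((n : ℝ) + 1), mul_assoc]
    exact mul_le_mul_of_nonneg_left h2 (by positivity)

end Multi

/-! ### Comparison of the functionals `W_n` with partial derivatives. -/

namespace Scheme

variable {d : ℕ} (S : Scheme d) (τ₀ h : ℝ)

theorem dd_sq_le_sum (l : E d) (φ : E d → ℝ) (x : E d) :
    (dd l φ x) ^ 2 ≤ ‖l‖ ^ 2 * ∑ i, (partialDeriv i φ x) ^ 2 := by
  rw [dd_eq_sum]
  refine (Finset.sum_mul_sq_le_sq_mul_sq _ _ _).trans (le_of_eq ?_)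
  rw [EuclideanSpace.norm_sq_eq]
  simp

theorem partialDeriv_dbar (i : Fin d) (μ : S.Idx) {φ : E d → ℝ} (hφ : ContDiff ℝ ∞ φ) :
    partialDeriv i (S.dbar τ₀ h μ φ) = S.dbar τ₀ h μ (partialDeriv i φ) :=
  S.dd_dbar τ₀ h _ μ hφ

theorem wd_dbar (β : List (Fin d)) (μ : S.Idx) {φ : E d → ℝ} (hφ : ContDiff ℝ ∞ φ) :
    wd β (S.dbar τ₀ h μ φ) = S.dbar τ₀ h μ (wd β φ) := by
  induction β generalizing φ with
  | nil => rfl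
  | cons i β ih =>
    rw [wd, S.partialDeriv_dbar τ₀ h i μ hφ, ih (contDiff_partialDeriv i hφ)]
    rfl

-- The difference quotients are averages of derivatives along `λ`, each at most `‖λ‖` times the
-- gradient. With the factors `τ_λ` they sum to `‖Λ₁‖²`; the operators `τ₀ D_i` contribute `τ₀²`.
variable {h} in
theorem sum_dbar_sq_le (hh : h ≠ 0) {κ : Type*} [Fintype κ] {φ : κ → E d → ℝ}
    (hφ : ∀ k, ContDiff ℝ ∞ (φ k)) {X : ℝ}
    (hX : ∀ x, ∑ k, ∑ i, (partialDeriv i (φ k) x) ^ 2 ≤ X) (x : E d) :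
    ∑ k, ∑ μ, (S.dbar τ₀ h μ (φ k) x) ^ 2 ≤ (τ₀ ^ 2 + S.weightedSize ^ 2) * X := by
  have hX0 : 0 ≤ X := le_trans (Finset.sum_nonneg fun _ _ => Finset.sum_nonneg fun _ _ =>
    sq_nonneg _) (hX x)
  simp only [Fintype.sum_sum_type, Finset.sum_add_distrib]
  have h1 : ∑ k, ∑ i : Fin d, (S.dbar τ₀ h (Sum.inr i) (φ k) x) ^ 2 ≤ τ₀ ^ 2 * X := by
    simp only [dbar, mul_pow, ← Finset.mul_sum]
    exact mul_le_mul_of_nonneg_left (hX x) (sq_nonneg _)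
  have h2 : ∑ k, ∑ l : S.Λ₁, (S.dbar τ₀ h (Sum.inl l) (φ k) x) ^ 2 ≤ S.weightedSize ^ 2 * X := by
    rw [Finset.sum_comm, weightedSize, Real.sq_sqrt (Finset.sum_nonneg fun _ _ => sq_nonneg _),
      Finset.sum_mul]
    refine Finset.sum_le_sum fun l _ => ?_
    have h3 : ∀ k, (S.dbar τ₀ h (Sum.inl l) (φ k) x) ^ 2 = S.τ l ^ 2 * (∫ θ in (0 : ℝ)..1,
        (fun _ => (1 : ℝ)) θ * (dd (l : E d) (φ k)) (x + (θ * h) • (l : E d))) ^ 2 := by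
      intro k
      have := S.del_eq_Jop hh l (hφ k) x
      rw [del] at this
      change (S.τ l * h⁻¹ * _) ^ 2 = _
      rw [mul_assoc, this, mul_pow]
      rfl
    simp only [h3, ← Finset.mul_sum, norm_smul, mul_pow, Real.norm_eq_abs, sq_abs]
    rw [mul_assoc]
    refine mul_le_mul_of_nonneg_left ?_ (sq_nonneg _)
    refine sum_sq_integral_le continuous_const
      (fun k => (contDiff_dd (hφ k)).continuous.comp (by fun_prop)) (fun _ _ => by simp)
      fun θ _ => ?_
    refine (Finset.sum_le_sum fun k _ => dd_sq_le_sum (l : E d) (φ k) _).trans ?_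
    rw [← Finset.mul_sum]
    exact mul_le_mul_of_nonneg_left (hX _) (sq_nonneg _)
  linarith

variable {h} in
/-- The norms `W` are controlled by the partial derivatives. -/
theorem sum_W_le_wd (hh : h ≠ 0) (n : ℕ) {κ : Type} [Fintype κ] {φ : κ → E d → ℝ}
    (hφ : ∀ k, ContDiff ℝ ∞ (φ k)) {X : ℝ}
    (hX : ∀ x, ∑ k, lsum n (fun β : List (Fin d) => (wd β (φ k) x) ^ 2) ≤ X) (x : E d) :
    ∑ k, S.W τ₀ h n (φ k) x ≤ (τ₀ ^ 2 + S.weightedSize ^ 2) ^ n * X := by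
  induction n generalizing κ X with
  | zero =>
    have := hX x
    simpa [W_zero, lsum_zero, wd] using this
  | succ n ih =>
    simp only [W_succ]
    rw [← Fintype.sum_prod_type' (f := fun k μ => S.W τ₀ h n (S.dbar τ₀ h μ (φ k)) x)]
    refine (ih (φ := fun z : κ × S.Idx => S.dbar τ₀ h z.2 (φ z.1))
      (fun z => contDiff_dbar τ₀ h z.2 (hφ z.1))
      (X := (τ₀ ^ 2 + S.weightedSize ^ 2) * X) fun x => ?_).trans (le_of_eq (by ring))
    -- One `δ̄` is traded for one partial derivative, on the family of all words in the remaining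
    -- partial derivatives, with which it commutes.
    have h1 := S.sum_dbar_sq_le τ₀ hh (κ := κ × (Fin n → Fin d))
      (φ := fun z => wd (List.ofFn z.2) (φ z.1)) (fun z => contDiff_wd _ (hφ z.1)) (X := X)
      (fun x => ?_) x
    · refine le_trans (le_of_eq ?_) h1
      rw [Fintype.sum_prod_type, Fintype.sum_prod_type]
      refine Finset.sum_congr rfl fun k _ => ?_
      simp only [lsum, S.wd_dbar τ₀ h _ _ (hφ k)]
      exact Finset.sum_comm
    · refine le_trans (le_of_eq ?_) (hX x)
      rw [Fintype.sum_prod_type]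
      refine Finset.sum_congr rfl fun k _ => ?_
      rw [lsum_succ, Finset.sum_comm]
      refine Finset.sum_congr rfl fun i _ => ?_
      rw [lsum]
      refine Finset.sum_congr rfl fun β _ => ?_
      rw [wd, wd_eq_multiDeriv _ (contDiff_partialDeriv i (hφ k)), wd_eq_multiDeriv _ (hφ k),
        multiDeriv_partialDeriv _ _ (hφ k), multiDeriv_add_single _ _ (hφ k)]

variable {τ₀} in
/-- The partial derivatives are controlled by the norms `W`. -/
theorem sum_multiDeriv_le_W (hτ₀ : 0 < τ₀) (n : ℕ) {φ : E d → ℝ} (hφ : ContDiff ℝ ∞ φ) (x : E d) :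
    ∑ α ∈ multiIndices d n, (multiDeriv α φ x) ^ 2 ≤ (τ₀⁻¹ ^ 2) ^ n * S.W τ₀ h n φ x := by
  refine (lsum_cnt n (g := fun α => (multiDeriv α φ x) ^ 2) fun _ => sq_nonneg _).1.trans ?_
  simp only [← wd_eq_multiDeriv _ hφ]
  induction n generalizing φ with
  | zero => simp [lsum_zero, W_zero, wd]
  | succ n ih =>
    rw [lsum_succ, W_succ, Fintype.sum_sum_type, mul_add]
    have h1 : ∀ i : Fin d, lsum n (fun β => (wd (i :: β) φ x) ^ 2) ≤
        (τ₀⁻¹ ^ 2) ^ (n + 1) * S.W τ₀ h n (S.dbar τ₀ h (Sum.inr i) φ) x := by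
      intro i
      have hi := contDiff_partialDeriv i hφ
      have h3 : S.W τ₀ h n (S.dbar τ₀ h (Sum.inr i) φ) x = τ₀ ^ 2 * S.W τ₀ h n (partialDeriv i φ) x :=
        S.W_const_mul τ₀ h n τ₀ hi x
      rw [h3, pow_succ, mul_assoc, ← mul_assoc (τ₀⁻¹ ^ 2), ← mul_pow, inv_mul_cancel₀ hτ₀.ne',
        one_pow, one_mul]
      exact ih hi
    -- The part of `W` coming from difference quotients is discarded.
    have h2 : 0 ≤ (τ₀⁻¹ ^ 2) ^ (n + 1) *
        ∑ l : S.Λ₁, S.W τ₀ h n (S.dbar τ₀ h (Sum.inl l) φ) x :=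
      mul_nonneg (by positivity) (Finset.sum_nonneg fun _ _ => S.W_nonneg _ _ _ _ _)
    rw [Finset.mul_sum (s := (Finset.univ : Finset (Fin d)))]
    linarith [Finset.sum_le_sum fun i (_ : i ∈ Finset.univ) => h1 i]

end Scheme

end FDScheme

namespace FDScheme

/-! ### Mollification -/

section Mol

variable {d : ℕ}

/-- Mollification with the kernel `η`. -/
def mol (η ψ : E d → ℝ) (x : E d) : ℝ := ∫ y, ψ y * η (x - y)

/-- Mollifying kernels supported in the ball of radius `ε`. -/
structure IsKernel (ε : ℝ) (η : E d → ℝ) : Prop where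
  smooth : ContDiff ℝ ∞ η
  supp : HasCompactSupport η
  nonneg : ∀ x, 0 ≤ η x
  integral : ∫ x, η x = 1
  small : ∀ x, η x ≠ 0 → ‖x‖ ≤ ε

/-- Essentially bounded functions. -/
structure EB (C : ℝ) (v : E d → ℝ) : Prop where
  meas : AEStronglyMeasurable v volume
  bound : ∀ᵐ x, |v x| ≤ C

variable {η η' ψ v w : E d → ℝ} {ε ε' C : ℝ}

theorem EB.locallyIntegrable (hv : EB C v) : LocallyIntegrable v volume := by
  intro x
  refine ⟨Metric.ball x 1, Metric.ball_mem_nhds x one_pos, ?_⟩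
  refine Measure.integrableOn_of_bounded (M := C) measure_ball_lt_top.ne hv.meas ?_
  exact ae_restrict_of_ae hv.bound

theorem integrable_reflect (hc : Continuous η) (hs : HasCompactSupport η) (x : E d) :
    Integrable (fun y => η (x - y)) volume :=
  (hc.integrable_of_hasCompactSupport hs).comp_sub_left x

theorem integrable_mul_reflect (hv : LocallyIntegrable v volume) (hc : Continuous η)
    (hs : HasCompactSupport η) (x : E d) : Integrable (fun y => v y * η (x - y)) volume := by
  have h1 := hs.convolutionExists_right (ContinuousLinearMap.mul ℝ ℝ) hv hc x
  exact h1

theorem mol_eq_convolution (η ψ : E d → ℝ) :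
    mol η ψ = convolution ψ η (ContinuousLinearMap.mul ℝ ℝ) volume := rfl

theorem contDiff_mol (hη : ContDiff ℝ ∞ η) (hs : HasCompactSupport η)
    (hψ : LocallyIntegrable ψ volume) : ContDiff ℝ ∞ (mol η ψ) := by
  rw [mol_eq_convolution]
  exact hs.contDiff_convolution_right _ hψ hη

theorem hasCompactSupport_dd (hs : HasCompactSupport η) (u : E d) : HasCompactSupport (dd u η) :=
  hs.fderiv_apply ℝ u

theorem dd_mol (hη : ContDiff ℝ ∞ η) (hs : HasCompactSupport η)
    (hψ : LocallyIntegrable ψ volume) (u : E d) : dd u (mol η ψ) = mol (dd u η) ψ := by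
  funext x
  have h1 : ContDiff ℝ 1 η := mod_cast contDiff_infty.1 hη 1
  have h := hs.hasFDerivAt_convolution_right (ContinuousLinearMap.mul ℝ ℝ) hψ h1 x
  unfold dd
  rw [mol_eq_convolution, h.fderiv, convolution_precompR_apply _ hψ (hs.fderiv ℝ)
    (h1.continuous_fderiv (by simp))]
  rfl

theorem hasCompactSupport_multiDeriv {α : Fin d → ℕ} (hη : ContDiff ℝ ∞ η)
    (hs : HasCompactSupport η) : HasCompactSupport (multiDeriv α η) := by
  obtain ⟨n, hn⟩ : ∃ n, ∑ i, α i = n := ⟨_, rfl⟩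
  induction n generalizing α with
  | zero =>
    have : α = 0 := by
      rw [← mem_multiIndices, multiIndices_zero, Finset.mem_singleton] at hn
      exact hn
    rwa [this, multiDeriv_zero]
  | succ n ih =>
    obtain ⟨β, j, rfl, hβ⟩ := exists_eq_add_single hn
    rw [multiDeriv_add_single _ _ hη]
    exact hasCompactSupport_dd (ih hβ) _

theorem multiDeriv_mol {α : Fin d → ℕ} (hη : ContDiff ℝ ∞ η) (hs : HasCompactSupport η)
    (hψ : LocallyIntegrable ψ volume) : multiDeriv α (mol η ψ) = mol (multiDeriv α η) ψ := by
  obtain ⟨n, hn⟩ : ∃ n, ∑ i, α i = n := ⟨_, rfl⟩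
  induction n generalizing α with
  | zero =>
    have : α = 0 := by
      rw [← mem_multiIndices, multiIndices_zero, Finset.mem_singleton] at hn
      exact hn
    rw [this, multiDeriv_zero, multiDeriv_zero]
  | succ n ih =>
    obtain ⟨β, j, rfl, hβ⟩ := exists_eq_add_single hn
    rw [multiDeriv_add_single _ _ hη, multiDeriv_add_single _ _ (contDiff_mol hη hs hψ), ih hβ]
    exact dd_mol (contDiff_multiDeriv β hη) (hasCompactSupport_multiDeriv hη hs) hψ _

theorem dd_reflect (hη : Differentiable ℝ η) (u x : E d) :
    dd u (fun y => η (x - y)) = fun y => -1 * dd u η (x - y) := by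
  funext y
  have h1 : HasFDerivAt (fun y : E d => x - y) (-ContinuousLinearMap.id ℝ (E d)) y :=
    (hasFDerivAt_id y).const_sub x
  have h := (hη (x - y)).hasFDerivAt.comp y h1
  have h2 : (η ∘ fun y => x - y) = fun y => η (x - y) := rfl
  rw [h2] at h
  simp [dd, h.fderiv]

theorem contDiff_reflect (hη : ContDiff ℝ ∞ η) (x : E d) : ContDiff ℝ ∞ (fun y => η (x - y)) :=
  hη.comp (contDiff_const.sub contDiff_id)

theorem multiDeriv_reflect {α : Fin d → ℕ} (hη : ContDiff ℝ ∞ η) (x : E d) :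
    multiDeriv α (fun y => η (x - y)) = fun y => (-1) ^ (∑ i, α i) * multiDeriv α η (x - y) := by
  obtain ⟨n, hn⟩ : ∃ n, ∑ i, α i = n := ⟨_, rfl⟩
  induction n generalizing α with
  | zero =>
    have : α = 0 := by
      rw [← mem_multiIndices, multiIndices_zero, Finset.mem_singleton] at hn
      exact hn
    rw [this, multiDeriv_zero, multiDeriv_zero]
    simp
  | succ n ih =>
    obtain ⟨β, j, rfl, hβ⟩ := exists_eq_add_single hn
    have h1 := contDiff_multiDeriv β hη
    rw [multiDeriv_add_single _ _ hη, multiDeriv_add_single _ _ (contDiff_reflect hη x), ih hβ,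
      partialDeriv_eq_dd, dd_const_mul _ (differentiable_of_smooth (contDiff_reflect h1 x)),
      dd_reflect (differentiable_of_smooth h1), sum_add_single, hβ]
    funext y
    change _ * (-1 * partialDeriv j (multiDeriv β η) (x - y)) = _
    rw [pow_succ]
    ring

theorem hasCompactSupport_reflect (hs : HasCompactSupport η) (x : E d) :
    HasCompactSupport (fun y => η (x - y)) :=
  hs.comp_homeomorph (Homeomorph.subLeft x)

/-- The reflected kernel is an admissible test function, and the sign of the reflection cancels the
sign of the integration by parts. -/
theorem mol_weakDeriv {α : Fin d → ℕ} (hη : ContDiff ℝ ∞ η) (hs : HasCompactSupport η)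
    (hv : IsWeakDeriv α ψ v) : mol (multiDeriv α η) ψ = mol η v := by
  funext x
  have h1 := hv.2.2 _ (contDiff_reflect hη x) (hasCompactSupport_reflect hs x)
  rw [multiDeriv_reflect hη] at h1
  have h2 : ∀ y, ψ y * ((-1) ^ (∑ i, α i) * multiDeriv α η (x - y)) =
      (-1) ^ (∑ i, α i) * (ψ y * multiDeriv α η (x - y)) := fun y => by ring
  simp only [h2] at h1
  rw [integral_const_mul] at h1
  exact mul_left_cancel₀ (pow_ne_zero _ (by norm_num)) h1

theorem multiDeriv_mol_eq {α : Fin d → ℕ} (hη : ContDiff ℝ ∞ η) (hs : HasCompactSupport η)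
    (hv : IsWeakDeriv α ψ v) : multiDeriv α (mol η ψ) = mol η v := by
  rw [multiDeriv_mol hη hs hv.1, mol_weakDeriv hη hs hv]

theorem mol_shift (η ψ : E d → ℝ) (a x : E d) :
    mol η (fun y => ψ (y + a)) x = mol η ψ (x + a) := by
  unfold mol
  rw [← integral_add_right_eq_self (fun y => ψ y * η (x + a - y)) a]
  simp only [add_sub_add_right_eq_sub]

theorem integral_reflect (hη : IsKernel ε η) (x : E d) : ∫ y, η (x - y) = 1 := by
  rw [integral_sub_left_eq_self]; exact hη.integral

theorem mol_congr (h : ψ =ᵐ[volume] w) : mol η ψ = mol η w := by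
  funext x
  exact integral_congr_ae (h.mono fun y hy => by simp only [hy])

/-- Mollification as an average. -/
structure Avg (η : E d → ℝ) (x : E d) (a : E d → ℝ) (r : ℝ) : Prop where
  int : Integrable (fun y => a y * η (x - y)) volume
  eq : ∫ y, a y * η (x - y) = r

namespace Avg

variable {x : E d} {a b : E d → ℝ} {r s : ℝ}

theorem add (ha : Avg η x a r) (hb : Avg η x b s) : Avg η x (fun y => a y + b y) (r + s) := by
  have h1 : (fun y => (a y + b y) * η (x - y)) = fun y => a y * η (x - y) + b y * η (x - y) := by
    funext y; ring
  refine ⟨?_, ?_⟩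
  · rw [h1]; exact ha.int.add hb.int
  · rw [h1, integral_add ha.int hb.int, ha.eq, hb.eq]

theorem const_mul (ha : Avg η x a r) (k : ℝ) : Avg η x (fun y => k * a y) (k * r) := by
  have h1 : (fun y => k * a y * η (x - y)) = fun y => k * (a y * η (x - y)) := by
    funext y; ring
  refine ⟨?_, ?_⟩
  · rw [h1]; exact ha.int.const_mul k
  · rw [h1, integral_const_mul, ha.eq]

theorem mul_const (ha : Avg η x a r) (k : ℝ) : Avg η x (fun y => a y * k) (r * k) := by
  simpa only [mul_comm k] using ha.const_mul k

theorem sum {ι : Type*} {u : Finset ι} {a : ι → E d → ℝ} {r : ι → ℝ}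
    (ha : ∀ i ∈ u, Avg η x (a i) (r i)) : Avg η x (fun y => ∑ i ∈ u, a i y) (∑ i ∈ u, r i) := by
  have h1 : (fun y => (∑ i ∈ u, a i y) * η (x - y)) = fun y => ∑ i ∈ u, a i y * η (x - y) := by
    funext y; rw [Finset.sum_mul]
  refine ⟨?_, ?_⟩
  · rw [h1]; exact integrable_finsetSum u fun i hi => (ha i hi).int
  · rw [h1, integral_finsetSum u fun i hi => (ha i hi).int]
    exact Finset.sum_congr rfl fun i hi => (ha i hi).eq

theorem const (hη : IsKernel ε η) (k : ℝ) : Avg η x (fun _ => k) k :=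
  ⟨(integrable_reflect hη.smooth.continuous hη.supp x).const_mul k, by
    rw [integral_const_mul, integral_reflect hη, mul_one]⟩

/-- The device that carries inequalities over to mollified coefficients: both sides are linear in
the coefficients, so an inequality almost everywhere may be averaged. -/
theorem mono (hη : IsKernel ε η) (ha : Avg η x a r) (hb : Avg η x b s)
    (hab : ∀ᵐ y, a y ≤ b y) : r ≤ s := by
  rw [← ha.eq, ← hb.eq]
  exact integral_mono_ae ha.int hb.int (hab.mono fun y hy =>
    mul_le_mul_of_nonneg_right hy (hη.nonneg _))

theorem of_locallyIntegrable (hη : IsKernel ε η) (ha : LocallyIntegrable a volume) :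
    Avg η x a (mol η a x) :=
  ⟨integrable_mul_reflect ha hη.smooth.continuous hη.supp x, rfl⟩

end Avg

theorem abs_mol_le (hη : IsKernel ε η) (hv : EB C v) (x : E d) : |mol η v x| ≤ C := by
  have h := Avg.of_locallyIntegrable (x := x) hη hv.locallyIntegrable
  rw [abs_le]
  exact ⟨Avg.mono hη (Avg.const hη (-C)) h (hv.bound.mono fun y hy => neg_le_of_abs_le hy),
    Avg.mono hη h (Avg.const hη C) (hv.bound.mono fun y hy => le_of_abs_le hy)⟩

/-- Mollification does not increase the Euclidean norm of a finite family. -/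
theorem sum_mol_sq_le (hη : IsKernel ε η) {κ : Type*} (s : Finset κ) {v : κ → E d → ℝ}
    (hv : ∀ k, LocallyIntegrable (v k) volume) (hC : ∀ᵐ x, ∑ k ∈ s, (v k x) ^ 2 ≤ C) (x : E d) :
    ∑ k ∈ s, (mol η (v k) x) ^ 2 ≤ C := by
  set A := ∑ k ∈ s, (mol η (v k) x) ^ 2 with hA
  have hA0 : 0 ≤ A := Finset.sum_nonneg fun _ _ => sq_nonneg _
  -- As for weighted means, the vector of averages is tested against itself.
  have h1 : Avg η x (fun y => ∑ k ∈ s, mol η (v k) x * v k y) A := by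
    have := Avg.sum (u := s) fun k _ =>
      (Avg.of_locallyIntegrable (x := x) hη (hv k)).const_mul (mol η (v k) x)
    simpa only [hA, sq] using this
  have hC0 : 0 ≤ C := by
    obtain ⟨y, hy⟩ := hC.exists
    exact (Finset.sum_nonneg fun _ _ => sq_nonneg _).trans hy
  have h2 : A ≤ Real.sqrt (A * C) := by
    refine Avg.mono hη h1 (Avg.const hη _) (hC.mono fun y hy => ?_)
    refine Real.le_sqrt_of_sq_le ((Finset.sum_mul_sq_le_sq_mul_sq _ _ _).trans ?_)
    exact mul_le_mul_of_nonneg_left hy hA0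
  have h3 : A ^ 2 ≤ A * C := by
    have := pow_le_pow_left₀ hA0 h2 2
    rwa [Real.sq_sqrt (mul_nonneg hA0 hC0)] at this
  by_contra hlt
  push Not at hlt
  nlinarith

theorem mol_eq_integral_sub (η ψ : E d → ℝ) (x : E d) : mol η ψ x = ∫ y, ψ (x - y) * η y := by
  unfold mol
  rw [← integral_sub_left_eq_self (fun y => ψ y * η (x - y)) volume x]
  simp only [sub_sub_cancel]

/-- Fubini's theorem for the double convolution. -/
theorem mol_comm (hη : IsKernel ε η) (hη' : IsKernel ε' η') (hv : EB C v) :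
    mol η (mol η' v) = mol η' (mol η v) := by
  funext x
  -- A measurable representative makes the integrand jointly measurable.
  obtain ⟨w, hw, hvw⟩ := hv.meas
  rw [mol_congr hvw, mol_congr hvw]
  have hi : Integrable (Function.uncurry fun y y' => w (x - y - y') * η' y' * η y)
      ((volume : Measure (E d)).prod volume) := by
    have h1 : Integrable (fun z : E d × E d => η z.1 * η' z.2)
        ((volume : Measure (E d)).prod volume) :=
      (hη.smooth.continuous.integrable_of_hasCompactSupport hη.supp).mul_prod
        (hη'.smooth.continuous.integrable_of_hasCompactSupport hη'.supp)
    have hm : Measurable fun z : E d × E d => w (x - z.1 - z.2) :=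
      hw.measurable.comp (by fun_prop)
    have hb : ∀ᵐ z : E d × E d ∂((volume : Measure (E d)).prod volume), ‖w (x - z.1 - z.2)‖ ≤ C := by
      refine (Measure.ae_prod_iff_ae_ae ?_).2 (Filter.Eventually.of_forall fun y => ?_)
      · exact measurableSet_le hm.norm measurable_const
      · have h2 : ∀ᵐ x, ‖w x‖ ≤ C := by
          filter_upwards [hv.bound, hvw] with x h3 h4
          rwa [← h4]
        exact (quasiMeasurePreserving_sub_left_of_right_invariant volume (x - y)).ae h2
    have h3 := h1.bdd_mul hm.aestronglyMeasurable hb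
    refine h3.congr (Filter.Eventually.of_forall fun z => ?_)
    simp only [Function.uncurry]
    ring
  have h1 := integral_integral_swap hi
  have e1 : ∀ (η η' : E d → ℝ), mol η (mol η' w) x = ∫ y, ∫ y', w (x - y - y') * η' y' * η y := by
    intro η η'
    rw [mol_eq_integral_sub]
    refine integral_congr_ae (Filter.Eventually.of_forall fun y => ?_)
    simp only [mol_eq_integral_sub]
    rw [integral_mul_const]
  rw [e1, e1, h1]
  refine integral_congr_ae (Filter.Eventually.of_forall fun y => ?_)
  refine integral_congr_ae (Filter.Eventually.of_forall fun y' => ?_)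
  simp only [sub_right_comm x y y', mul_right_comm]

theorem abs_mol_sub_le (hη : IsKernel ε η) {φ : E d → ℝ} (hφ : Continuous φ) (hC : 0 ≤ C)
    (hl : ∀ x y, |φ x - φ y| ≤ C * ‖x - y‖) (x : E d) : |mol η φ x - φ x| ≤ C * ε := by
  have h1 : Avg η x (fun y => φ y - φ x) (mol η φ x - φ x) := by
    have := (Avg.of_locallyIntegrable (x := x) hη hφ.locallyIntegrable).add (Avg.const hη (-φ x))
    simpa only [← sub_eq_add_neg] using this
  rw [← h1.eq]
  have h2 : ∀ y, ‖(φ y - φ x) * η (x - y)‖ ≤ C * ε * η (x - y) := by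
    intro y
    rw [norm_mul, Real.norm_eq_abs, Real.norm_eq_abs, abs_of_nonneg (hη.nonneg _)]
    by_cases h : η (x - y) = 0
    · simp [h]
    · refine mul_le_mul_of_nonneg_right ((hl y x).trans ?_) (hη.nonneg _)
      rw [norm_sub_rev]
      exact mul_le_mul_of_nonneg_left (hη.small _ h) hC
  refine (norm_integral_le_of_norm_le ((integrable_reflect hη.smooth.continuous hη.supp x).const_mul
    (C * ε)) (Filter.Eventually.of_forall h2)).trans (le_of_eq ?_)
  rw [integral_const_mul, integral_reflect hη, mul_one]

/-- Mollifications with different kernels of a function with bounded gradient. -/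
theorem abs_mol_sub_mol_le (hη : IsKernel ε η) (hη' : IsKernel ε' η') (hv : EB C v) {C' : ℝ}
    (hC' : 0 ≤ C') (hl : ∀ x y, |mol η v x - mol η v y| ≤ C' * ‖x - y‖)
    (hl' : ∀ x y, |mol η' v x - mol η' v y| ≤ C' * ‖x - y‖) (x : E d) :
    |mol η v x - mol η' v x| ≤ C' * (ε + ε') := by
  have h1 := abs_mol_sub_le hη' (contDiff_mol hη.smooth hη.supp hv.locallyIntegrable).continuous
    hC' hl x
  have h2 := abs_mol_sub_le hη (contDiff_mol hη'.smooth hη'.supp hv.locallyIntegrable).continuous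
    hC' hl' x
  -- Both mollifications are close to the common double mollification.
  rw [mol_comm hη hη' hv] at h2
  rw [abs_le] at *
  constructor <;> linarith [h1.1, h1.2, h2.1, h2.2]

/-- A sequence of kernels which shrinks to the origin. -/
theorem exists_kernels (d : ℕ) : ∃ (ε : ℕ → ℝ) (η : ℕ → E d → ℝ), (∀ i, IsKernel (ε i) (η i)) ∧
    (∀ i, 0 < ε i) ∧ Antitone ε ∧ Filter.Tendsto ε Filter.atTop (nhds 0) ∧
    ∀ v : E d → ℝ, LocallyIntegrable v volume →
      ∀ᵐ x, Filter.Tendsto (fun i => mol (η i) v x) Filter.atTop (nhds (v x)) := by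
  let φ : ℕ → ContDiffBump (0 : E d) := fun i =>
    ⟨(1 / ((i : ℝ) + 1)) / 2, 1 / ((i : ℝ) + 1), by positivity, half_lt_self (by positivity)⟩
  have ht : Filter.Tendsto (fun i : ℕ => 1 / ((i : ℝ) + 1)) Filter.atTop (nhds 0) :=
    tendsto_one_div_add_atTop_nhds_zero_nat
  refine ⟨fun i => 1 / ((i : ℝ) + 1), fun i => (φ i).normed volume, fun i => ?_,
    fun i => by positivity, fun i j hij => ?_, ht, fun v hv => ?_⟩
  · refine ⟨(φ i).contDiff_normed, (φ i).hasCompactSupport_normed, (φ i).nonneg_normed,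
      (φ i).integral_normed, fun x hx => ?_⟩
    have h1 : x ∈ Function.support ((φ i).normed volume) := hx
    rw [(φ i).support_normed_eq, mem_ball_zero_iff] at h1
    exact h1.le
  · have : (i : ℝ) ≤ j := by exact_mod_cast hij
    exact one_div_le_one_div_of_le (by positivity) (by linarith)
  · have h1 := ContDiffBump.ae_convolution_tendsto_right_of_locallyIntegrable (φ := φ)
      (l := Filter.atTop) (K := 2) (g := v) (μ := volume) ht
      (Filter.Eventually.of_forall fun i => by
        change 1 / ((i : ℝ) + 1) ≤ 2 * (1 / ((i : ℝ) + 1) / 2); linarith) hv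
    filter_upwards [h1] with x hx
    refine hx.congr fun i => ?_
    rw [mol_eq_integral_sub, convolution]
    simp only [ContinuousLinearMap.lsmul_apply, smul_eq_mul, mul_comm]

end Mol

end FDScheme

namespace FDScheme

/-! ### Generalized derivatives -/

section Weak

variable {d : ℕ} {ψ χ v w : E d → ℝ} {α : Fin d → ℕ}

theorem weakDeriv_spec (h : ∃ v, IsWeakDeriv α ψ v) : IsWeakDeriv α ψ (weakDeriv α ψ) := by
  rw [weakDeriv, dif_pos h]
  exact h.choose_spec

theorem IsWeakDeriv.ae_unique (hv : IsWeakDeriv α ψ v) (hw : IsWeakDeriv α ψ w) :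
    v =ᵐ[volume] w := by
  refine ae_eq_of_integral_contDiff_smul_eq hv.2.1 hw.2.1 fun φ hφ hs => ?_
  have h1 := hv.2.2 φ hφ hs
  rw [hw.2.2 φ hφ hs] at h1
  have h2 := mul_left_cancel₀ (pow_ne_zero _ (by norm_num : (-1 : ℝ) ≠ 0)) h1
  simpa only [smul_eq_mul, mul_comm] using h2.symm

theorem IsWeakDeriv.weakDeriv_ae (hv : IsWeakDeriv α ψ v) : weakDeriv α ψ =ᵐ[volume] v :=
  (weakDeriv_spec ⟨v, hv⟩).ae_unique hv

theorem isWeakDeriv_zero (hψ : LocallyIntegrable ψ volume) : IsWeakDeriv 0 ψ ψ :=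
  ⟨hψ, hψ, fun φ _ _ => by simp [multiDeriv_zero]⟩

theorem isWeakDeriv_single_iff {i : Fin d} : IsWeakDeriv (Pi.single i 1) ψ v ↔
    LocallyIntegrable ψ volume ∧ LocallyIntegrable v volume ∧
    ∀ φ : E d → ℝ, ContDiff ℝ ∞ φ → HasCompactSupport φ →
      ∫ x, ψ x * partialDeriv i φ x = -1 * ∫ x, v x * φ x := by
  have h0 : ∑ j, (Pi.single i 1 : Fin d → ℕ) j = 1 := by simp
  unfold IsWeakDeriv
  rw [h0, pow_one]
  refine and_congr_right fun _ => and_congr_right fun _ => forall_congr' fun φ =>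
    forall_congr' fun hφ => forall_congr' fun _ => ?_
  rw [multiDeriv_single i hφ]

theorem integrable_mul_test (hψ : LocallyIntegrable ψ volume) {φ : E d → ℝ} (hφ : Continuous φ)
    (hs : HasCompactSupport φ) : Integrable (fun x => ψ x * φ x) volume := by
  have := hψ.integrable_smul_right_of_hasCompactSupport hφ hs
  simpa only [smul_eq_mul] using this

theorem continuous_partialDeriv {φ : E d → ℝ} (hφ : ContDiff ℝ ∞ φ) (i : Fin d) :
    Continuous (partialDeriv i φ) := (contDiff_partialDeriv i hφ).continuous

theorem locallyIntegrable_shift (hψ : LocallyIntegrable ψ volume) (a : E d) :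
    LocallyIntegrable (fun x => ψ (x + a)) volume := by
  intro x
  obtain ⟨U, hU, hi⟩ := hψ (x + a)
  refine ⟨(fun x => x + a) ⁻¹' U, (continuous_add_const a).continuousAt hU, ?_⟩
  exact ((measurePreserving_add_right volume a).integrableOn_comp_preimage
    (MeasurableEquiv.addRight a).measurableEmbedding).2 hi

theorem weak_shift {i : Fin d} (hv : IsWeakDeriv (Pi.single i 1) ψ v) (a : E d) :
    IsWeakDeriv (Pi.single i 1) (fun x => ψ (x + a)) (fun x => v (x + a)) := by
  rw [isWeakDeriv_single_iff] at hv ⊢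
  refine ⟨locallyIntegrable_shift hv.1 a, locallyIntegrable_shift hv.2.1 a, fun φ hφ hs => ?_⟩
  have hφ' : ContDiff ℝ ∞ (fun x => φ (x + -a)) := hφ.comp (contDiff_id.add contDiff_const)
  have h1 := hv.2.2 (fun x => φ (x + -a)) hφ' (hs.comp_homeomorph (Homeomorph.addRight (-a)))
  rw [partialDeriv_eq_dd, dd_shift] at h1
  rw [← integral_add_right_eq_self _ a, ← integral_add_right_eq_self (fun x => v x * _) a] at h1
  simp only [add_neg_cancel_right] at h1
  exact h1

theorem weak_sub {i : Fin d} (hv : IsWeakDeriv (Pi.single i 1) ψ v)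
    (hw : IsWeakDeriv (Pi.single i 1) χ w) :
    IsWeakDeriv (Pi.single i 1) (fun x => ψ x - χ x) (fun x => v x - w x) := by
  rw [isWeakDeriv_single_iff] at hv hw ⊢
  refine ⟨hv.1.sub hw.1, hv.2.1.sub hw.2.1, fun φ hφ hs => ?_⟩
  have hc := hφ.continuous
  have hc' := continuous_partialDeriv hφ i
  have hs' : HasCompactSupport (partialDeriv i φ) := hasCompactSupport_dd hs _
  simp only [sub_mul]
  rw [integral_sub (integrable_mul_test hv.1 hc' hs') (integrable_mul_test hw.1 hc' hs'),
    integral_sub (integrable_mul_test hv.2.1 hc hs) (integrable_mul_test hw.2.1 hc hs),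
    hv.2.2 φ hφ hs, hw.2.2 φ hφ hs]
  ring

theorem weak_const_mul {i : Fin d} (hv : IsWeakDeriv (Pi.single i 1) ψ v) (a : ℝ) :
    IsWeakDeriv (Pi.single i 1) (fun x => a * ψ x) (fun x => a * v x) := by
  rw [isWeakDeriv_single_iff] at hv ⊢
  refine ⟨hv.1.smul a, hv.2.1.smul a, fun φ hφ hs => ?_⟩
  simp only [mul_assoc]
  rw [integral_const_mul, integral_const_mul, hv.2.2 φ hφ hs]
  ring

/-- In the definition of the first derivative the test function is taken to be `D_i φ`; mixed
classical derivatives of `φ` commute. -/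
theorem weak_weak {i j : Fin d} (hv : IsWeakDeriv (Pi.single j 1) ψ v)
    (hw : IsWeakDeriv (Pi.single j 1 + Pi.single i 1) ψ w) : IsWeakDeriv (Pi.single i 1) v w := by
  rw [isWeakDeriv_single_iff] at hv ⊢
  refine ⟨hv.2.1, hw.2.1, fun φ hφ hs => ?_⟩
  have h1 := hw.2.2 φ hφ hs
  have h2 := hv.2.2 (partialDeriv i φ) (contDiff_partialDeriv i hφ) (hasCompactSupport_dd hs _)
  rw [multiDeriv_add_single _ _ hφ, multiDeriv_single j hφ, sum_add_single] at h1
  have h0 : ∑ k, (Pi.single j 1 : Fin d → ℕ) k = 1 := by simp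
  have h3 : partialDeriv i (partialDeriv j φ) = partialDeriv j (partialDeriv i φ) :=
    dd_comm _ _ (mod_cast contDiff_infty.1 hφ 2)
  have h4 : (-1 : ℝ) ^ (1 + 1) = 1 := by norm_num
  rw [h0, h3, h2, h4] at h1
  linarith

end Weak

/-! ### The operators `δ̄` on functions with generalized derivatives. -/

namespace Scheme

variable {d : ℕ} (S : Scheme d) (τ₀ h : ℝ)

section DbarW

variable {S τ₀ h} {η ψ : E d → ℝ} {ε : ℝ}

theorem locallyIntegrable_dbarW (hψ : LocallyIntegrable ψ volume)
    (hw : ∀ i, ∃ v, IsWeakDeriv (Pi.single i 1) ψ v) (μ : S.Idx) :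
    LocallyIntegrable (S.dbarW τ₀ h μ ψ) volume := by
  rcases μ with l | i
  · exact ((locallyIntegrable_shift hψ _).sub hψ).smul (S.τ l * h⁻¹)
  · exact (weakDeriv_spec (hw i)).2.1.smul τ₀

/-- Mollification commutes with `δ̄`, generalized derivatives becoming classical ones. The
commutator coefficients of the mollified scheme are therefore averages of those of the given scheme.
-/
theorem dbar_mol (hη : IsKernel ε η) (hψ : LocallyIntegrable ψ volume)
    (hw : ∀ i, ∃ v, IsWeakDeriv (Pi.single i 1) ψ v) (μ : S.Idx) :
    S.dbar τ₀ h μ (mol η ψ) = mol η (S.dbarW τ₀ h μ ψ) := by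
  funext x
  rcases μ with l | i
  · have h1 := (((Avg.of_locallyIntegrable (x := x) hη (locallyIntegrable_shift hψ (h • (l : E d)))).add
      ((Avg.of_locallyIntegrable (x := x) hη hψ).const_mul (-1))).const_mul (S.τ l * h⁻¹)).eq
    rw [mol_shift] at h1
    simp only [dbar, dbarW]
    unfold mol at h1 ⊢
    rw [sub_eq_add_neg, ← neg_one_mul, ← h1]
    simp only [neg_one_mul, sub_eq_add_neg]
  · have h1 := multiDeriv_mol_eq hη.smooth hη.supp (weakDeriv_spec (hw i))
    rw [multiDeriv_single i (contDiff_mol hη.smooth hη.supp hψ)] at h1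
    simp only [dbar, dbarW]
    rw [h1]
    exact ((Avg.of_locallyIntegrable (x := x) hη (weakDeriv_spec (hw i)).2.1).const_mul τ₀).eq.symm

theorem exists_weak_dbarW (hw : ∀ i, ∃ v, IsWeakDeriv (Pi.single i 1) ψ v)
    (hw2 : ∀ i j, ∃ v, IsWeakDeriv (Pi.single j 1 + Pi.single i 1) ψ v) (μ : S.Idx) (i : Fin d) :
    ∃ v, IsWeakDeriv (Pi.single i 1) (S.dbarW τ₀ h μ ψ) v := by
  rcases μ with l | j
  · obtain ⟨v, hv⟩ := hw i
    exact ⟨_, weak_const_mul (weak_sub (weak_shift hv _) hv) _⟩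
  · obtain ⟨w, hw'⟩ := hw2 i j
    exact ⟨_, weak_const_mul (weak_weak (weakDeriv_spec (hw j)) hw') _⟩

end DbarW

/-! ### The quadratic forms with constant coefficients -/

/-- `A_h` with the values of the coefficients at another point. -/
def Afro (a b : S.Idx → S.Λ₁ → ℝ) (φ : E d → ℝ) (z : E d) : ℝ :=
  2 * ∑ μ, S.dbar τ₀ h μ φ z * (h⁻¹ * ∑ l, a μ l * S.del h l (S.shift h μ φ) z +
    ∑ l, b μ l * S.del h l (S.shift h μ φ) z)

/-- `∑_{λ ∈ Λ²} (δ̄_{h,λ} φ) Q_{h,λ} T_{h,λ} φ` with the values of the coefficients at another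
point. -/
def Bfro (a : S.Idx → S.Idx → S.Λ₁ → ℝ) (φ : E d → ℝ) (z : E d) : ℝ :=
  ∑ l : S.Idx × S.Idx, S.dbar2 τ₀ h l φ z *
    (h⁻¹ * ∑ k, a l.1 l.2 k * S.del h k (S.shift2 h l φ) z)

/-- `𝒬_h` with the values of the coefficients at another point. -/
def Qfro (a b : S.Λ₁ → ℝ) (φ : E d → ℝ) (z : E d) : ℝ :=
  ∑ l, (a l + h * b l) * (S.del h l φ z) ^ 2

variable {S τ₀ h}

theorem shift_shift (μ : S.Idx) (φ : E d → ℝ) (y : E d) :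
    S.shift h μ (fun x => φ (x + y)) = fun x => S.shift h μ φ (x + y) := by
  simp only [shift_eq, add_right_comm]

theorem Afro_shift (a b : S.Idx → S.Λ₁ → ℝ) (φ : E d → ℝ) (y x : E d) :
    S.Afro τ₀ h a b (fun x => φ (x + y)) x = S.Afro τ₀ h a b φ (x + y) := by
  simp only [Afro, dbar_shift, shift_shift, del_shift]

theorem Bfro_shift (a : S.Idx → S.Idx → S.Λ₁ → ℝ) (φ : E d → ℝ) (y x : E d) :
    S.Bfro τ₀ h a (fun x => φ (x + y)) x = S.Bfro τ₀ h a φ (x + y) := by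
  simp only [Bfro, dbar2, shift2, dbar_shift, shift_shift, del_shift]

theorem Qfro_shift (a b : S.Λ₁ → ℝ) (φ : E d → ℝ) (y x : E d) :
    S.Qfro h a b (fun x => φ (x + y)) x = S.Qfro h a b φ (x + y) := by
  simp only [Qfro, del_shift]

theorem continuous_del {φ : E d → ℝ} (hφ : Continuous φ) (l : S.Λ₁) : Continuous (S.del h l φ) := by
  unfold del; fun_prop

theorem continuous_shift {φ : E d → ℝ} (hφ : Continuous φ) (μ : S.Idx) :
    Continuous (S.shift h μ φ) := by
  rw [shift_eq]; fun_prop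

theorem continuous_Afro (a b : S.Idx → S.Λ₁ → ℝ) {φ : E d → ℝ} (hφ : ContDiff ℝ ∞ φ) :
    Continuous (S.Afro τ₀ h a b φ) := by
  have h1 : ∀ (μ : S.Idx) (l : S.Λ₁), Continuous (S.del h l (S.shift h μ φ)) := fun μ l =>
    continuous_del (continuous_shift hφ.continuous μ) l
  have h2 : ∀ μ : S.Idx, Continuous (S.dbar τ₀ h μ φ) := fun μ =>
    (contDiff_dbar τ₀ h μ hφ).continuous
  unfold Afro
  fun_prop

theorem continuous_Bfro (a : S.Idx → S.Idx → S.Λ₁ → ℝ) {φ : E d → ℝ} (hφ : ContDiff ℝ ∞ φ) :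
    Continuous (S.Bfro τ₀ h a φ) := by
  have h1 : ∀ (μ : S.Idx × S.Idx) (l : S.Λ₁), Continuous (S.del h l (S.shift2 h μ φ)) := fun μ l =>
    continuous_del (continuous_shift (continuous_shift hφ.continuous μ.2) μ.1) l
  have h2 : ∀ μ : S.Idx × S.Idx, Continuous (S.dbar2 τ₀ h μ φ) := fun μ =>
    (contDiff_dbar τ₀ h μ.1 (contDiff_dbar τ₀ h μ.2 hφ)).continuous
  unfold Bfro
  fun_prop

theorem continuous_Qfro (a b : S.Λ₁ → ℝ) {φ : E d → ℝ} (hφ : ContDiff ℝ ∞ φ) :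
    Continuous (S.Qfro h a b φ) := by
  have h1 : ∀ l : S.Λ₁, Continuous (S.del h l φ) := fun l => continuous_del hφ.continuous l
  unfold Qfro
  fun_prop

section Avg

variable {η : E d → ℝ} {x : E d}

theorem avg_Afro {a b : E d → S.Idx → S.Λ₁ → ℝ} {a' b' : S.Idx → S.Λ₁ → ℝ}
    (ha : ∀ μ l, Avg η x (fun y => a y μ l) (a' μ l))
    (hb : ∀ μ l, Avg η x (fun y => b y μ l) (b' μ l)) (φ : E d → ℝ) (z : E d) :
    Avg η x (fun y => S.Afro τ₀ h (a y) (b y) φ z) (S.Afro τ₀ h a' b' φ z) :=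
  (Avg.sum fun μ _ => ((((Avg.sum fun l _ => (ha μ l).mul_const _).const_mul _).add
    (Avg.sum fun l _ => (hb μ l).mul_const _)).const_mul _)).const_mul _

theorem avg_Bfro {a : E d → S.Idx → S.Idx → S.Λ₁ → ℝ} {a' : S.Idx → S.Idx → S.Λ₁ → ℝ}
    (ha : ∀ μ ν l, Avg η x (fun y => a y μ ν l) (a' μ ν l)) (φ : E d → ℝ) (z : E d) :
    Avg η x (fun y => S.Bfro τ₀ h (a y) φ z) (S.Bfro τ₀ h a' φ z) :=
  Avg.sum fun μ _ => (((Avg.sum fun l _ => (ha μ.1 μ.2 l).mul_const _).const_mul _).const_mul _)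

theorem avg_Qfro {a b : E d → S.Λ₁ → ℝ} {a' b' : S.Λ₁ → ℝ}
    (ha : ∀ l, Avg η x (fun y => a y l) (a' l)) (hb : ∀ l, Avg η x (fun y => b y l) (b' l))
    (φ : E d → ℝ) (z : E d) :
    Avg η x (fun y => S.Qfro h (a y) (b y) φ z) (S.Qfro h a' b' φ z) :=
  Avg.sum fun l _ => ((ha l).add ((hb l).const_mul h)).mul_const _

end Avg

/-! ### Positive contractions and suprema -/

theorem _root_.FDScheme.ClassK.sum {𝒦 : (E d → ℝ) → (E d → ℝ)} (hK : ClassK 𝒦) {ι : Type*}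
    (s : Finset ι) {ψ : ι → E d → ℝ} (hψ : ∀ i, BddBorel (ψ i)) :
    BddBorel (fun x => ∑ i ∈ s, ψ i x) ∧
      ∀ x, 𝒦 (fun x => ∑ i ∈ s, ψ i x) x = ∑ i ∈ s, 𝒦 (ψ i) x := by
  classical
  induction s using Finset.induction_on with
  | empty =>
    refine ⟨⟨by simp, 0, by simp⟩, fun x => ?_⟩
    have h0 : BddBorel (fun _ : E d => (0 : ℝ)) := ⟨measurable_const, 0, by simp⟩
    have h1 := congrFun (hK.smul 0 _ h0) x
    have h2 : (0 : ℝ) • (fun _ : E d => (0 : ℝ)) = fun _ => 0 := by funext; simp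
    rw [h2] at h1
    simpa using h1
  | insert i s hi ih =>
    have h1 : (fun x => ∑ j ∈ insert i s, ψ j x) = ψ i + fun x => ∑ j ∈ s, ψ j x := by
      funext x; rw [Finset.sum_insert hi]; rfl
    obtain ⟨⟨hm, C, hC⟩, h3⟩ := ih
    obtain ⟨hm', C', hC'⟩ := hψ i
    refine ⟨?_, fun x => ?_⟩
    · rw [h1]
      exact ⟨hm'.add hm, C' + C, fun x => (abs_add_le _ _).trans (add_le_add (hC' x) (hC x))⟩
    · rw [h1, hK.add _ _ (hψ i) ⟨hm, C, hC⟩, Pi.add_apply, h3, Finset.sum_insert hi]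

/-- Positivity is applied to `G - ψ`, and then `𝒦 1 ≤ 1`. This is how positive contractions give way
to suprema. -/
theorem _root_.FDScheme.ClassK.le_of_le {𝒦 : (E d → ℝ) → (E d → ℝ)} (hK : ClassK 𝒦)
    {ψ : E d → ℝ} (hψ : BddBorel ψ) {G : ℝ} (hG : 0 ≤ G) (hle : ∀ x, ψ x ≤ G) (x : E d) :
    𝒦 ψ x ≤ G := by
  have h1 : BddBorel (fun _ : E d => (1 : ℝ)) := ⟨measurable_const, 1, by simp⟩
  obtain ⟨hm, C, hC⟩ := hψ
  have hn : BddBorel ((-1 : ℝ) • ψ) := ⟨hm.const_smul _, C, fun x => by simpa using hC x⟩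
  have hG1 : BddBorel (G • fun _ : E d => (1 : ℝ)) := ⟨measurable_const, G, fun x => by
    simp [abs_of_nonneg hG]⟩
  have h2 := hK.nonneg ((G • fun _ : E d => (1 : ℝ)) + (-1 : ℝ) • ψ) ⟨hG1.1.add hn.1, G + C,
    fun x => by
      refine (abs_add_le _ _).trans (add_le_add ?_ ?_)
      · simp [abs_of_nonneg hG]
      · simpa using hC x⟩ (fun x => by simpa using hle x) x
  rw [hK.add _ _ hG1 hn, hK.smul _ _ h1, hK.smul _ _ ⟨hm, C, hC⟩] at h2
  simp only [Pi.add_apply, Pi.smul_apply, smul_eq_mul] at h2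
  have h3 := mul_le_mul_of_nonneg_left (hK.one_le x) hG
  linarith

theorem bddBorel_gradSq {φ : E d → ℝ} (hφ : SmoothBdd φ) : BddBorel (S.gradSq τ₀ h φ) := by
  have h1 := fun μ : S.Idx => S.smoothBdd_dbar τ₀ h μ hφ
  choose C hC using fun μ => (h1 μ).bounded
  refine ⟨?_, ∑ μ, C μ ^ 2, fun x => ?_⟩
  · have : Continuous (S.gradSq τ₀ h φ) :=
      continuous_finsetSum _ fun μ _ => (h1 μ).1.continuous.pow 2
    exact this.measurable
  · rw [gradSq, abs_of_nonneg (Finset.sum_nonneg fun _ _ => sq_nonneg _)]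
    exact Finset.sum_le_sum fun μ _ => sq_le_sq' (neg_le_of_abs_le (hC μ x)) (le_of_abs_le (hC μ x))

theorem bddBorel_hessSq {φ : E d → ℝ} (hφ : SmoothBdd φ) : BddBorel (S.hessSq τ₀ h φ) := by
  have h1 := fun μ : S.Idx × S.Idx => S.smoothBdd_dbar τ₀ h μ.1 (S.smoothBdd_dbar τ₀ h μ.2 hφ)
  choose C hC using fun μ => (h1 μ).bounded
  refine ⟨?_, ∑ μ, C μ ^ 2, fun x => ?_⟩
  · have : Continuous (S.hessSq τ₀ h φ) :=
      continuous_finsetSum _ fun μ _ => (h1 μ).1.continuous.pow 2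
    exact this.measurable
  · rw [hessSq, abs_of_nonneg (Finset.sum_nonneg fun _ _ => sq_nonneg _)]
    exact Finset.sum_le_sum fun μ _ => sq_le_sq' (neg_le_of_abs_le (hC μ x)) (le_of_abs_le (hC μ x))

/-- A pointwise inequality for all translates of a function. -/
theorem ae_forall_of_translates {P Q : E d → E d → ℝ} (hP : ∀ x, Continuous (P x))
    (hQ : ∀ x, Continuous (Q x)) (hPQ : ∀ y, ∀ᵐ x, P x (x + y) ≤ Q x (x + y)) :
    ∀ᵐ x, ∀ z, P x z ≤ Q x z := by
  -- The exceptional null set may depend on the translation; countably many translations share one,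
  -- and continuity in `z` supplies the rest.
  have h1 : ∀ᵐ x, ∀ n, P x (x + TopologicalSpace.denseSeq (E d) n) ≤
      Q x (x + TopologicalSpace.denseSeq (E d) n) := ae_all_iff.2 fun n => hPQ _
  filter_upwards [h1] with x hx z
  have hc : IsClosed {y | P x (x + y) ≤ Q x (x + y)} := isClosed_le
    ((hP x).comp (continuous_const.add continuous_id))
    ((hQ x).comp (continuous_const.add continuous_id))
  have h2 : z - x ∈ closure (range (TopologicalSpace.denseSeq (E d))) :=
    TopologicalSpace.denseRange_denseSeq (E d) _
  have h3 := closure_minimal (s := range (TopologicalSpace.denseSeq (E d))) (by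
    rintro _ ⟨n, rfl⟩; exact hx n) hc h2
  simpa using h3

end Scheme

end FDScheme

/-! ### The structural conditions for mollified coefficients. -/

namespace FDScheme

/-- Local integrability together with the existence of generalized derivatives up to order two. -/
structure Weak2 {d : ℕ} (ψ : E d → ℝ) : Prop where
  loc : LocallyIntegrable ψ volume
  first : ∀ i, ∃ v, IsWeakDeriv (Pi.single i 1) ψ v
  second : ∀ i j, ∃ v, IsWeakDeriv (Pi.single j 1 + Pi.single i 1) ψ v

theorem MemB.exists_weak {d m : ℕ} {T : ℝ} {ψ : ℝ → E d → ℝ} (hψ : MemB T m ψ) {t : ℝ}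
    (ht : t ∈ Icc 0 T) {α : Fin d → ℕ} (hα : ∑ i, α i ≤ m) : ∃ v, IsWeakDeriv α (ψ t) v := by
  obtain ⟨C, hC⟩ := hψ.derivs
  obtain ⟨v, hv, -⟩ := hC t ht α hα
  exact ⟨v, hv⟩

theorem MemB.weak2 {d m : ℕ} {T : ℝ} {ψ : ℝ → E d → ℝ} (hψ : MemB T m ψ) (hm : 2 ≤ m) {t : ℝ}
    (ht : t ∈ Icc 0 T) : Weak2 (ψ t) := by
  refine ⟨(hψ.continuous t ht).locallyIntegrable, fun i => hψ.exists_weak ht ?_,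
    fun i j => hψ.exists_weak ht ?_⟩
  · simp; omega
  · rw [sum_add_single]; simp; omega

namespace Scheme

variable {d : ℕ} {S : Scheme d} {τ₀ h : ℝ}

theorem W_one (φ : E d → ℝ) : S.W τ₀ h 1 φ = S.gradSq τ₀ h φ := by
  funext x
  simp only [W_succ, W_zero, gradSq]

theorem W_two (φ : E d → ℝ) : S.W τ₀ h 2 φ = S.hessSq τ₀ h φ := by
  funext x
  simp only [W_succ, W_zero, hessSq, dbar2, Fintype.sum_prod_type_right]

theorem lsum_one {I : Type*} [Fintype I] (F : List I → ℝ) : lsum 1 F = ∑ μ, F [μ] := by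
  simp only [lsum_succ, lsum_zero]

theorem lsum_two_dl (X : (E d → ℝ) → ℝ) (φ : E d → ℝ) :
    lsum 2 (fun lam => X (S.dl τ₀ h lam φ)) = ∑ l : S.Idx × S.Idx, X (S.dbar2 τ₀ h l φ) := by
  simp only [lsum_succ, lsum_zero, Fintype.sum_prod_type_right]
  rfl

theorem shift2_eq (l : S.Idx × S.Idx) (φ : E d → ℝ) :
    S.shift2 h l φ = fun x => φ (x + (S.sv h l.2 + S.sv h l.1)) := by
  funext x
  simp only [shift2, shift_eq]
  rw [add_assoc, add_comm (S.sv h l.1)]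

theorem gradSq_shift (φ : E d → ℝ) (y x : E d) :
    S.gradSq τ₀ h (fun x => φ (x + y)) x = S.gradSq τ₀ h φ (x + y) := by
  simp only [gradSq, dbar_shift]

theorem hessSq_shift (φ : E d → ℝ) (y x : E d) :
    S.hessSq τ₀ h (fun x => φ (x + y)) x = S.hessSq τ₀ h φ (x + y) := by
  simp only [hessSq, dbar2, dbar_shift]

section Mollified

variable {η : E d → ℝ} {ε t : ℝ}

theorem weak2_dbarW {ψ : E d → ℝ} (hψ : Weak2 ψ) (μ : S.Idx) :
    LocallyIntegrable (S.dbarW τ₀ h μ ψ) volume ∧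
      ∀ i, ∃ v, IsWeakDeriv (Pi.single i 1) (S.dbarW τ₀ h μ ψ) v :=
  ⟨locallyIntegrable_dbarW hψ.loc hψ.first μ, exists_weak_dbarW hψ.first hψ.second μ⟩

theorem cf_mol (hη : IsKernel ε η) {q : S.Λ₁ → E d → ℝ} (hq : ∀ l, Weak2 (q l)) (μ : S.Idx) :
    S.cf τ₀ h μ (fun l => mol η (q l)) = fun l => mol η (S.dbarW τ₀ h μ (q l)) := by
  funext l
  exact dbar_mol hη (hq l).loc (hq l).first μ

theorem cf_cf_mol (hη : IsKernel ε η) {q : S.Λ₁ → E d → ℝ} (hq : ∀ l, Weak2 (q l))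
    (μ ν : S.Idx) : S.cf τ₀ h ν (S.cf τ₀ h μ (fun l => mol η (q l))) =
      fun l => mol η (S.dbarW τ₀ h ν (S.dbarW τ₀ h μ (q l))) := by
  rw [cf_mol hη hq]
  funext l
  exact dbar_mol hη (weak2_dbarW (hq l) μ).1 (weak2_dbarW (hq l) μ).2 ν

theorem Aop_mol (hη : IsKernel ε η) {q p : S.Λ₁ → E d → ℝ} (hq : ∀ l, Weak2 (q l))
    (hp : ∀ l, Weak2 (p l)) (φ : E d → ℝ) (x : E d) :
    S.Aop τ₀ h (fun l => mol η (q l)) (fun l => mol η (p l)) φ x =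
      S.Afro τ₀ h (fun μ l => mol η (S.dbarW τ₀ h μ (q l)) x)
        (fun μ l => mol η (S.dbarW τ₀ h μ (p l)) x) φ x := by
  simp only [Aop, Afro, Dop, cf_mol hη hq, cf_mol hη hp, shift_eq]
  rfl

theorem Bop_mol (hη : IsKernel ε η) {q : S.Λ₁ → E d → ℝ} (hq : ∀ l, Weak2 (q l))
    (φ : E d → ℝ) (x : E d) :
    S.Bop τ₀ h (fun l => mol η (q l)) φ x =
      S.Bfro τ₀ h (fun ν μ l => mol η (S.dbarW τ₀ h ν (S.dbarW τ₀ h μ (q l))) x) φ x := by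
  simp only [Bop, Bfro, cf_cf_mol hη hq, shift2_eq, Fintype.sum_prod_type_right]
  rfl

variable {m : ℕ} {δ K c₀ : ℝ}

/-- Applied to all translates of `φ`, the condition holds with the coefficients at `y` and `φ` at an
independent point. With `φ` held at `x` both sides are linear in the coefficients and can be
averaged over `y`. The operator `𝒦` must first be replaced by the supremum `G`, which a translation
does not change. -/
theorem supI_mol (hη : IsKernel ε η) (ht : t ∈ Icc 0 S.T) (hh : h ∈ Ioc 0 S.h₀)
    (hq : ∀ l, Weak2 (S.q l t)) (hp : ∀ l, Weak2 (S.p l t)) (hc : LocallyIntegrable (S.c t) volume)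
    (hδ1 : δ ≤ 1) (hc₀ : 0 < c₀) (hkill : S.Killing c₀) (hS : S.StructI m δ τ₀ K) :
    S.SupI τ₀ h (fun l => mol η (S.q l t)) (fun l => mol η (S.p l t)) (mol η (S.c t)) m δ K := by
  intro φ hφ G hG x
  rw [W_one] at hG
  have hG0 : 0 ≤ G := (Finset.sum_nonneg fun _ _ => sq_nonneg _).trans (hG 0)
  obtain ⟨𝒦, hK, hS⟩ := hS h hh
  have key := ae_forall_of_translates
    (P := fun x z => (m : ℝ) * S.Afro τ₀ h (fun μ l => S.dbarW τ₀ h μ (S.q l t) x)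
        (fun μ l => S.dbarW τ₀ h μ (S.p l t) x) φ z)
    (Q := fun x z => (1 - δ) * ∑ μ, S.Qfro h (fun l => S.q l t x) (fun l => S.p l t x)
        (S.dbar τ₀ h μ φ) z + K * S.Qfro h (fun l => S.q l t x) (fun l => S.p l t x) φ z +
        2 * (1 - δ) * S.c t x * G)
    (fun x => continuous_const.mul (continuous_Afro _ _ hφ.1))
    (fun x => ((continuous_const.mul (continuous_finsetSum _ fun μ _ =>
      continuous_Qfro _ _ (contDiff_dbar τ₀ h μ hφ.1))).add
        (continuous_const.mul (continuous_Qfro _ _ hφ.1))).add continuous_const)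
    (fun y => by
      filter_upwards [hS _ (hφ.shift y) t ht] with x hx
      have h1 := (hK t ht).le_of_le (bddBorel_gradSq (S := S) (τ₀ := τ₀) (h := h) (hφ.shift y))
        hG0 (fun x => by rw [gradSq_shift]; exact hG _) x
      have h2 := mul_le_mul_of_nonneg_left h1 (mul_nonneg (mul_nonneg two_pos.le
        (sub_nonneg.2 hδ1)) (hc₀.le.trans (hkill t ht x)))
      refine le_trans (le_of_eq ?_) (hx.trans (le_trans (add_le_add le_rfl h2) (le_of_eq ?_)))
      · beta_reduce
        rw [← Afro_shift]; rfl
      · beta_reduce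
        simp only [← Qfro_shift, ← dbar_shift]; rfl)
  have hA : ∀ {ψ : E d → ℝ}, LocallyIntegrable ψ volume → Avg η x ψ (mol η ψ x) := fun hψ =>
    Avg.of_locallyIntegrable hη hψ
  have := Avg.mono hη
    ((avg_Afro (τ₀ := τ₀) (h := h) (fun μ l => hA (weak2_dbarW (hq l) μ).1)
      (fun μ l => hA (weak2_dbarW (hp l) μ).1) φ x).const_mul (m : ℝ))
    ((((Avg.sum (u := Finset.univ) fun μ _ => avg_Qfro (h := h) (fun l => hA (hq l).loc)
      (fun l => hA (hp l).loc) (S.dbar τ₀ h μ φ) x).const_mul (1 - δ)).add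
      ((avg_Qfro (h := h) (fun l => hA (hq l).loc) (fun l => hA (hp l).loc) φ x).const_mul K)).add
      (((hA hc).const_mul (2 * (1 - δ))).mul_const G)) (key.mono fun y hy => hy x)
  rw [Aop_mol hη hq hp, lsum_one]
  exact this

/-- The argument of `supI_mol`, for a family. Additivity of the operators allows summation over the
family before the supremum is taken, so the supremum of the sum appears and not the larger sum of
suprema. -/
theorem supII_mol (hη : IsKernel ε η) (ht : t ∈ Icc 0 S.T) (hh : h ∈ Ioc 0 S.h₀)
    (hq : ∀ l, Weak2 (S.q l t)) (hp : ∀ l, Weak2 (S.p l t)) (hc : LocallyIntegrable (S.c t) volume)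
    (hδ1 : δ ≤ 1) (hK0 : 0 ≤ K) (hc₀ : 0 < c₀) (hkill : S.Killing c₀)
    (hS : S.StructII m δ τ₀ K) (n : ℕ) (hn : n ∈ Finset.Icc 1 m) :
    S.SupII τ₀ h (fun l => mol η (S.q l t)) (fun l => mol η (S.p l t)) (mol η (S.c t)) n δ K := by
  intro κ _ φ hφ G₁ G₂ hG₁ hG₂ x
  simp only [W_one, W_two] at hG₁ hG₂
  have hG₁0 : 0 ≤ G₁ := (Finset.sum_nonneg fun _ _ => Finset.sum_nonneg fun _ _ =>
    sq_nonneg _).trans (hG₁ 0)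
  have hG₂0 : 0 ≤ G₂ := (Finset.sum_nonneg fun _ _ => Finset.sum_nonneg fun _ _ =>
    sq_nonneg _).trans (hG₂ 0)
  obtain ⟨𝒦, 𝒦', hK, hK', hS⟩ := hS h hh n hn
  have hφd := fun k (ν : S.Idx) => contDiff_dbar τ₀ h ν (hφ k).1
  have hφdd := fun k (l : S.Idx × S.Idx) => contDiff_dbar τ₀ h l.1 (hφd k l.2)
  have key := ae_forall_of_translates
    (P := fun x z => ∑ k, ((n : ℝ) * ∑ ν, S.Afro τ₀ h (fun μ l => S.dbarW τ₀ h μ (S.q l t) x)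
        (fun μ l => S.dbarW τ₀ h μ (S.p l t) x) (S.dbar τ₀ h ν (φ k)) z + (n : ℝ) * ((n : ℝ) - 1) *
        S.Bfro τ₀ h (fun ν μ l => S.dbarW τ₀ h ν (S.dbarW τ₀ h μ (S.q l t)) x) (φ k) z))
    (Q := fun x z => ∑ k, ((1 - δ) * ∑ l, S.Qfro h (fun l => S.q l t x) (fun l => S.p l t x)
        (S.dbar2 τ₀ h l (φ k)) z + K * ∑ μ, S.Qfro h (fun l => S.q l t x) (fun l => S.p l t x)
        (S.dbar τ₀ h μ (φ k)) z) + 2 * (1 - δ) * S.c t x * G₂ + K * G₁)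
    (fun x => continuous_finsetSum _ fun k _ => (continuous_const.mul
      (continuous_finsetSum _ fun ν _ => continuous_Afro _ _ (hφd k ν))).add
      (continuous_const.mul (continuous_Bfro _ (hφ k).1)))
    (fun x => ((continuous_finsetSum _ fun k _ => (continuous_const.mul
      (continuous_finsetSum _ fun l _ => continuous_Qfro _ _ (hφdd k l))).add
      (continuous_const.mul (continuous_finsetSum _ fun μ _ =>
        continuous_Qfro _ _ (hφd k μ)))).add continuous_const).add continuous_const)
    (fun y => by
      have hall : ∀ᵐ x, ∀ k, _ := ae_all_iff.2 fun k => hS _ ((hφ k).shift y) t ht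
      filter_upwards [hall] with x hx
      obtain ⟨b1, e1⟩ := (hK' t ht).sum Finset.univ fun k =>
        bddBorel_gradSq (S := S) (τ₀ := τ₀) (h := h) ((hφ k).shift y)
      obtain ⟨b2, e2⟩ := (hK t ht).sum Finset.univ fun k =>
        bddBorel_hessSq (S := S) (τ₀ := τ₀) (h := h) ((hφ k).shift y)
      have h1 := (hK' t ht).le_of_le b1 hG₁0 (fun x => by
        simp only [gradSq_shift]; exact hG₁ _) x
      have h2 := (hK t ht).le_of_le b2 hG₂0 (fun x => by
        simp only [hessSq_shift]; exact hG₂ _) x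
      rw [e1] at h1
      rw [e2] at h2
      have h3 := mul_le_mul_of_nonneg_left h2 (mul_nonneg (mul_nonneg two_pos.le
        (sub_nonneg.2 hδ1)) (hc₀.le.trans (hkill t ht x)))
      have h4 := mul_le_mul_of_nonneg_left h1 hK0
      have h5 := Finset.sum_le_sum fun k (_ : k ∈ Finset.univ) => hx k
      simp only [Finset.sum_add_distrib (ι := κ), ← Finset.mul_sum (ι := κ)] at h5
      refine le_trans (le_of_eq ?_) (h5.trans (le_trans (add_le_add (add_le_add le_rfl h3) h4)
        (le_of_eq ?_)))
      · simp only [Finset.sum_add_distrib (ι := κ), ← Finset.mul_sum (ι := κ)]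
        simp only [← Afro_shift, ← Bfro_shift, ← dbar_shift]; rfl
      · simp only [Finset.sum_add_distrib (ι := κ), ← Finset.mul_sum (ι := κ)]
        simp only [← Qfro_shift, dbar2, ← dbar_shift]; rfl)
  have hA : ∀ {ψ : E d → ℝ}, LocallyIntegrable ψ volume → Avg η x ψ (mol η ψ x) := fun hψ =>
    Avg.of_locallyIntegrable hη hψ
  have hqW := fun (l : S.Λ₁) (μ ν : S.Idx) => locallyIntegrable_dbarW (τ₀ := τ₀) (h := h)
    (weak2_dbarW (τ₀ := τ₀) (h := h) (hq l) μ).1 (weak2_dbarW (hq l) μ).2 ν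
  have := Avg.mono hη
    (Avg.sum (u := Finset.univ) fun k _ =>
      ((Avg.sum (u := Finset.univ) fun ν _ => avg_Afro (τ₀ := τ₀) (h := h)
        (fun μ l => hA (weak2_dbarW (hq l) μ).1)
        (fun μ l => hA (weak2_dbarW (hp l) μ).1) (S.dbar τ₀ h ν (φ k)) x).const_mul (n : ℝ)).add
      ((avg_Bfro (τ₀ := τ₀) (h := h) (fun ν μ l => hA (hqW l μ ν)) (φ k) x).const_mul
        ((n : ℝ) * ((n : ℝ) - 1))))
    (((Avg.sum (u := Finset.univ) fun k _ =>
      ((Avg.sum (u := Finset.univ) fun l _ => avg_Qfro (h := h) (fun l => hA (hq l).loc)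
        (fun l => hA (hp l).loc) (S.dbar2 τ₀ h l (φ k)) x).const_mul (1 - δ)).add
      ((Avg.sum (u := Finset.univ) fun μ _ => avg_Qfro (h := h) (fun l => hA (hq l).loc)
        (fun l => hA (hp l).loc) (S.dbar τ₀ h μ (φ k)) x).const_mul K)).add
      (((hA hc).const_mul (2 * (1 - δ))).mul_const G₂)).add (Avg.const hη (K * G₁)))
      (key.mono fun y hy => hy x)
  simp only [Aop_mol hη hq hp, Bop_mol hη hq, lsum_one,
    fun k => lsum_two_dl (S := S) (τ₀ := τ₀) (h := h)
      (fun ψ => S.QQop h (fun l => mol η (S.q l t)) (fun l => mol η (S.p l t)) ψ x) (φ k)]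
  exact this

end Mollified

end Scheme

end FDScheme

/-! ### Bounds for the mollified coefficients. -/

namespace FDScheme

theorem locallyIntegrable_weakDeriv {d : ℕ} (α : Fin d → ℕ) (ψ : E d → ℝ) :
    LocallyIntegrable (weakDeriv α ψ) volume := by
  by_cases h : ∃ v, IsWeakDeriv α ψ v
  · exact (weakDeriv_spec h).2.1
  · rw [weakDeriv, dif_neg h]
    exact continuous_const.locallyIntegrable

theorem derivSq_nonneg {d : ℕ} (k : ℕ) (ψ : E d → ℝ) (x : E d) : 0 ≤ derivSq k ψ x :=
  Finset.sum_nonneg fun _ _ => sq_nonneg _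

namespace Scheme

variable {d : ℕ} {S : Scheme d} {τ₀ h : ℝ} {η : E d → ℝ} {ε : ℝ}

/-- Words in partial derivatives outnumber multi-indices by a factor at most `n!` (`lsum_cnt`), and
mollification does not increase Euclidean norms. -/
theorem sum_W_mol_le (hη : IsKernel ε η) (hh : h ≠ 0) (n : ℕ) {κ : Type} [Fintype κ]
    {ψ : κ → E d → ℝ} (hψ : ∀ k, LocallyIntegrable (ψ k) volume)
    (hw : ∀ k (α : Fin d → ℕ), ∑ i, α i = n → ∃ v, IsWeakDeriv α (ψ k) v) {X : ℝ}
    (hX : ∀ᵐ x, ∑ k, derivSq n (ψ k) x ≤ X) (x : E d) :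
    ∑ k, S.W τ₀ h n (mol η (ψ k)) x ≤
      (τ₀ ^ 2 + S.weightedSize ^ 2) ^ n * (n.factorial * X) := by
  have hs := fun k => contDiff_mol hη.smooth hη.supp (hψ k)
  refine S.sum_W_le_wd τ₀ hh n hs (fun x => ?_) x
  have h1 : ∀ k, lsum n (fun β : List (Fin d) => (wd β (mol η (ψ k)) x) ^ 2) ≤
      n.factorial * ∑ α ∈ multiIndices d n, (mol η (weakDeriv α (ψ k)) x) ^ 2 := by
    intro k
    have h2 := (lsum_cnt n (g := fun α => (multiDeriv α (mol η (ψ k)) x) ^ 2)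
      fun _ => sq_nonneg _).2
    simp only [← wd_eq_multiDeriv _ (hs k)] at h2
    refine h2.trans (le_of_eq (congrArg _ (Finset.sum_congr rfl fun α hα => ?_)))
    rw [multiDeriv_mol_eq hη.smooth hη.supp (weakDeriv_spec (hw k α (mem_multiIndices.1 hα)))]
  refine (Finset.sum_le_sum fun k _ => h1 k).trans ?_
  rw [← Finset.mul_sum, ← Finset.sum_product']
  refine mul_le_mul_of_nonneg_left ?_ (Nat.cast_nonneg _)
  refine sum_mol_sq_le hη (Finset.univ ×ˢ multiIndices d n)
    (v := fun k : κ × (Fin d → ℕ) => weakDeriv k.2 (ψ k.1))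
    (fun k => locallyIntegrable_weakDeriv _ _) (hX.mono fun y hy => ?_) x
  rwa [Finset.sum_product]

/-- The bound on the `W` seminorms of mollified coefficients. -/
def coefBound (m : ℕ) (M : Fin (m + 1) → ℝ) (τ₀ b : ℝ) : ℝ :=
  ∑ s : Fin (m + 1), (τ₀ ^ 2 + b ^ 2) ^ (s : ℕ) * ((s : ℕ).factorial * M s ^ 2)

theorem le_coefBound {m : ℕ} (M : Fin (m + 1) → ℝ) (τ₀ b : ℝ) {s : ℕ} (hs : s ≤ m) :
    (τ₀ ^ 2 + b ^ 2) ^ s * (s.factorial * M ⟨s, Nat.lt_succ_of_le hs⟩ ^ 2) ≤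
      coefBound m M τ₀ b :=
  Finset.single_le_sum (f := fun s : Fin (m + 1) =>
    (τ₀ ^ 2 + b ^ 2) ^ (s : ℕ) * ((s : ℕ).factorial * M s ^ 2)) (fun s _ => by positivity)
    (Finset.mem_univ (⟨s, Nat.lt_succ_of_le hs⟩ : Fin (m + 1)))

/-- Each requirement is linear in the coefficients or a bound on a Euclidean norm, so it survives
averaging with constants that depend neither on the kernel nor on `h`. -/
theorem smoothCoef_mol {m : ℕ} {M : Fin (m + 1) → ℝ} {δ K c₀ t : ℝ} (hη : IsKernel ε η)
    (hm : 2 ≤ m) (ht : t ∈ Icc 0 S.T) (hh : h ∈ Ioc 0 S.h₀) (hδ1 : δ ≤ 1) (hK : 0 ≤ K)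
    (hc₀ : 0 < c₀) (hD : S.SmoothData m M) (hchi : S.ChiNonneg) (hcen : S.Centered)
    (hkill : S.Killing c₀) (hI : S.StructI m δ τ₀ K) (hII : S.StructII m δ τ₀ K) :
    S.SmoothCoef τ₀ h m δ K c₀ (coefBound m M τ₀ S.weightedSize) (fun l => mol η (S.q l t))
      (fun l => mol η (S.p l t)) (mol η (S.c t)) := by
  have hq := fun l => (hD.q l).weak2 hm ht
  have hp := fun l => (hD.p l).weak2 hm ht
  have hc := hD.c.weak2 hm ht
  have hA : ∀ {ψ : E d → ℝ} (x : E d), LocallyIntegrable ψ volume → Avg η x ψ (mol η ψ x) :=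
    fun _ hψ => Avg.of_locallyIntegrable hη hψ
  have hb := fun (s : ℕ) (hs : s ≤ m) => hD.bound ⟨s, Nat.lt_succ_of_le hs⟩ t ht
  refine ⟨fun l => contDiff_mol hη.smooth hη.supp (hq l).loc,
    fun l => contDiff_mol hη.smooth hη.supp (hp l).loc, contDiff_mol hη.smooth hη.supp hc.loc,
    fun l x => ?_, fun x => ?_, fun x => ?_, fun s hs x => ?_, fun s hs x => ?_, fun s hs x => ?_,
    supI_mol hη ht hh hq hp hc.loc hδ1 hc₀ hkill hI,
    fun n hn => supII_mol hη ht hh hq hp hc.loc hδ1 hK hc₀ hkill hII n hn⟩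
  · exact Avg.mono hη (Avg.const hη 0) ((hA x (hq l).loc).add ((hA x (hp l).loc).const_mul h))
      (Filter.Eventually.of_forall fun y => hchi h hh l t ht y)
  · exact Avg.mono hη (Avg.const hη c₀) (hA x hc.loc)
      (Filter.Eventually.of_forall fun y => hkill t ht y)
  · ext i
    have h1 := Avg.sum (u := Finset.univ) fun (l : S.Λ₁) _ => (hA x (hq l).loc).mul_const ((l : E d) i)
    have h2 : (fun y => ∑ l : S.Λ₁, S.q l t y * (l : E d) i) = fun _ => 0 := by
      funext y
      have := congrArg (fun v : E d => v i) (hcen t ht y)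
      simpa using this
    rw [h2] at h1
    have h3 := h1.eq
    simp only [zero_mul, integral_zero] at h3
    simpa using h3.symm
  · refine (sum_W_mol_le hη hh.1.ne' s (fun l => (hq l).loc) (fun l α hα =>
      (hD.q l).exists_weak ht (hα.trans_le hs)) ((hb s hs).mono fun x hx => ?_) x).trans
      (le_coefBound M τ₀ _ hs)
    refine le_trans (Finset.sum_le_sum fun l _ => le_add_of_nonneg_right (derivSq_nonneg _ _ _))
      ((le_add_of_nonneg_right (derivSq_nonneg _ _ _)).trans hx)
  · refine (sum_W_mol_le hη hh.1.ne' s (fun l => (hp l).loc) (fun l α hα =>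
      (hD.p l).exists_weak ht (hα.trans_le hs)) ((hb s hs).mono fun x hx => ?_) x).trans
      (le_coefBound M τ₀ _ hs)
    refine le_trans (Finset.sum_le_sum fun l _ => le_add_of_nonneg_left (derivSq_nonneg _ _ _))
      ((le_add_of_nonneg_right (derivSq_nonneg _ _ _)).trans hx)
  · have h1 := sum_W_mol_le (S := S) (τ₀ := τ₀) hη hh.1.ne' s (κ := Unit) (ψ := fun _ => S.c t)
      (fun _ => hc.loc) (fun _ α hα => hD.c.exists_weak ht (hα.trans_le hs))
      (X := M ⟨s, Nat.lt_succ_of_le hs⟩ ^ 2) ((hb s hs).mono fun x hx => by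
        simp only [Finset.univ_unique, Finset.sum_const, Finset.card_singleton, one_smul]
        exact (le_add_of_nonneg_left (Finset.sum_nonneg fun l _ =>
          add_nonneg (derivSq_nonneg _ _ _) (derivSq_nonneg _ _ _))).trans hx) x
    simp only [Finset.univ_unique, Finset.sum_const, Finset.card_singleton, one_smul] at h1
    exact h1.trans (le_coefBound M τ₀ _ hs)

end Scheme

/-! ### Mollified data as functions of time -/

section Time

variable {d : ℕ} {T : ℝ}

theorem wd_sub (β : List (Fin d)) {φ χ : E d → ℝ} (hφ : ContDiff ℝ ∞ φ) (hχ : ContDiff ℝ ∞ χ) :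
    wd β (fun x => φ x - χ x) = fun x => wd β φ x - wd β χ x := by
  induction β generalizing φ χ with
  | nil => rfl
  | cons i β ih =>
    have h1 : partialDeriv i (fun x => φ x - χ x) =
        fun x => partialDeriv i φ x - partialDeriv i χ x :=
      dd_sub (differentiable_of_smooth hφ) (differentiable_of_smooth hχ)
    simp only [wd]
    rw [h1, ih (contDiff_partialDeriv i hφ) (contDiff_partialDeriv i hχ)]

theorem NN.of_words {F : ℝ → E d → ℝ} {n : ℕ} {C : ℝ} (hF : ∀ t, ContDiff ℝ ∞ (F t))
    (hm : ∀ β : List (Fin d), β.length ≤ n → Measurable (Function.uncurry fun t => wd β (F t)))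
    (hC : ∀ β : List (Fin d), β.length ≤ n → ∀ t x, |wd β (F t) x| ≤ C) :
    NN (eE d) T 0 n C F := by
  have h0 : NN0 T 0 C F := ⟨hm [] (Nat.zero_le _), fun t => (hF t).continuous, fun t x => by
    simpa [wd] using hC [] (Nat.zero_le _) t x⟩
  induction n generalizing F with
  | zero => exact h0
  | succ n ih =>
    refine ⟨h0, fun t => differentiable_of_smooth (hF t), fun j => ?_⟩
    simp only [eE_apply]
    have h1 : ∀ β : List (Fin d), β.length ≤ n → (j :: β).length ≤ n + 1 := fun β hβ => by
      simpa using hβ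
    refine ih (fun t => contDiff_dd (hF t)) (fun β hβ => hm _ (h1 β hβ))
      (fun β hβ => hC _ (h1 β hβ)) ⟨hm [j] (by simp), fun t => (contDiff_dd (hF t)).continuous,
        fun t x => ?_⟩
    have := hC [j] (by simp) t x
    simpa [wd, partialDeriv_eq_dd] using this

theorem SM.of_words {F : ℝ → E d → ℝ} (hF : ∀ t, ContDiff ℝ ∞ (F t))
    (hm : ∀ β : List (Fin d), Measurable (Function.uncurry fun t => wd β (F t)))
    (hC : ∀ β : List (Fin d), ∃ C, ∀ t x, |wd β (F t) x| ≤ C) : SM (eE d) T F := by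
  intro n
  choose C hC using hC
  have hfin := List.finite_length_le (Fin d) n
  refine ⟨∑ β ∈ hfin.toFinset, C β, NN.of_words hF (fun β _ => hm β) fun β hβ t x =>
    (hC β t x).trans (Finset.single_le_sum (f := C) (fun β _ => (abs_nonneg _).trans (hC β 0 0))
      (hfin.mem_toFinset.2 hβ))⟩

/-- The crude factor `d` is harmless: this bound serves only for convergence and for Lipschitz
representatives, never in the final constant. -/
theorem lipschitz_of_partialDeriv {φ : E d → ℝ} (hφ : Differentiable ℝ φ) {C : ℝ} (hC0 : 0 ≤ C)
    (hC : ∀ i x, |partialDeriv i φ x| ≤ C) (x y : E d) : |φ x - φ y| ≤ d * C * ‖x - y‖ := by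
  have h1 : ∀ z, ‖fderiv ℝ φ z‖ ≤ d * C := by
    intro z
    refine ContinuousLinearMap.opNorm_le_bound _ (by positivity) fun v => ?_
    have h2 : fderiv ℝ φ z v = ∑ i, v i * partialDeriv i φ z := dd_eq_sum v φ z
    rw [h2]
    refine (norm_sum_le _ _).trans ?_
    have h3 : ∀ i ∈ (Finset.univ : Finset (Fin d)), ‖v i * partialDeriv i φ z‖ ≤ C * ‖v‖ := by
      intro i _
      rw [norm_mul, mul_comm]
      exact mul_le_mul (hC i z) (PiLp.norm_apply_le v i) (norm_nonneg _) hC0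
    refine (Finset.sum_le_sum h3).trans (le_of_eq ?_)
    simp [mul_assoc]
  exact convex_univ.norm_image_sub_le_of_norm_fderiv_le (fun z _ => hφ z) (fun z _ => h1 z)
    (mem_univ y) (mem_univ x)

variable {ψ : ℝ → E d → ℝ} {η ζ : E d → ℝ} {ε : ℝ} {m : ℕ}

theorem BorelOn.measurable_clamp (hT : 0 ≤ T) (hψ : BorelOn T ψ) :
    Measurable (Function.uncurry fun t x => ψ (cl T t) x) := by
  have h1 : Measurable fun z : ℝ × E d => ((⟨cl T z.1, cl_mem hT z.1⟩ : Icc (0 : ℝ) T), z.2) :=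
    (((measurable_cl T).comp measurable_fst).subtype_mk).prodMk measurable_snd
  exact hψ.comp h1

theorem measurable_mol (hT : 0 ≤ T) (hψ : BorelOn T ψ) (hζ : Continuous ζ) :
    Measurable (Function.uncurry fun t => mol ζ (ψ (cl T t))) := by
  have h1 : StronglyMeasurable (Function.uncurry fun (z : ℝ × E d) (y : E d) =>
      ψ (cl T z.1) y * ζ (z.2 - y)) := by
    refine Measurable.stronglyMeasurable (Measurable.mul ?_ ?_)
    · exact (hψ.measurable_clamp hT).comp
        (f := fun z : (ℝ × E d) × E d => (z.1.1, z.2)) (by fun_prop)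
    · exact hζ.measurable.comp (f := fun z : (ℝ × E d) × E d => z.1.2 - z.2) (by fun_prop)
  exact (h1.integral_prod_right (ν := volume)).measurable

theorem wd_mol (hη : ContDiff ℝ ∞ η) (hs : HasCompactSupport η) {χ : E d → ℝ}
    (hχ : LocallyIntegrable χ volume) (β : List (Fin d)) :
    wd β (mol η χ) = mol (multiDeriv (cnt β) η) χ := by
  rw [wd_eq_multiDeriv _ (contDiff_mol hη hs hχ), multiDeriv_mol hη hs hχ]

theorem MemB.loc (hψ : MemB T m ψ) {t : ℝ} (ht : t ∈ Icc 0 T) : LocallyIntegrable (ψ t) volume :=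
  (hψ.continuous t ht).locallyIntegrable

theorem MemB.measurable_wd_mol (hT : 0 ≤ T) (hψ : MemB T m ψ) (hη : IsKernel ε η)
    (β : List (Fin d)) :
    Measurable (Function.uncurry fun t => wd β (mol η (ψ (cl T t)))) := by
  simp only [fun t => wd_mol hη.smooth hη.supp (hψ.loc (cl_mem hT t)) β]
  exact measurable_mol hT hψ.borel (contDiff_multiDeriv _ hη.smooth).continuous

theorem MemB.sm_mol (hT : 0 ≤ T) (hψ : MemB T m ψ) (hη : IsKernel ε η) :
    SM (eE d) T (fun t => mol η (ψ (cl T t))) := by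
  refine SM.of_words (fun t => contDiff_mol hη.smooth hη.supp (hψ.loc (cl_mem hT t)))
    (hψ.measurable_wd_mol hT hη) fun β => ?_
  obtain ⟨C, hC⟩ := hψ.bounded
  have hc := (contDiff_multiDeriv (cnt β) hη.smooth).continuous
  have hs := hasCompactSupport_multiDeriv (α := cnt β) hη.smooth hη.supp
  refine ⟨∫ y, C * |multiDeriv (cnt β) η y|, fun t x => ?_⟩
  rw [wd_mol hη.smooth hη.supp (hψ.loc (cl_mem hT t)), mol_eq_integral_sub, ← Real.norm_eq_abs]
  have hi : Integrable (fun y => C * |multiDeriv (cnt β) η y|) (volume : Measure (E d)) :=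
    (hc.integrable_of_hasCompactSupport hs).abs.const_mul C
  refine norm_integral_le_of_norm_le hi (Filter.Eventually.of_forall fun y => ?_)
  rw [norm_mul, Real.norm_eq_abs, Real.norm_eq_abs]
  exact mul_le_mul_of_nonneg_right (hC _ (cl_mem hT t) _) (abs_nonneg _)

/-- A common bound for the generalized derivatives. -/
def DerivBound (T : ℝ) (m : ℕ) (ψ : ℝ → E d → ℝ) (C : ℝ) : Prop :=
  0 ≤ C ∧ ∀ t ∈ Icc 0 T, ∀ α : Fin d → ℕ, ∑ i, α i ≤ m →
    ∃ v : E d → ℝ, IsWeakDeriv α (ψ t) v ∧ EB C v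

theorem MemB.exists_derivBound (hψ : MemB T m ψ) : ∃ C, DerivBound T m ψ C := by
  obtain ⟨C, hC⟩ := hψ.derivs
  refine ⟨max C 0, le_max_right _ _, fun t ht α hα => ?_⟩
  obtain ⟨v, hv, hb⟩ := hC t ht α hα
  exact ⟨v, hv, hv.2.1.aestronglyMeasurable, hb.mono fun x hx => hx.trans (le_max_left _ _)⟩

theorem DerivBound.abs_wd_mol_le {C : ℝ} (hC : DerivBound T m ψ C) (hη : IsKernel ε η) {t : ℝ}
    (ht : t ∈ Icc 0 T) {β : List (Fin d)} (hβ : β.length ≤ m) (x : E d) :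
    |wd β (mol η (ψ t)) x| ≤ C := by
  obtain ⟨v, hv, hb⟩ := hC.2 t ht (cnt β) (by rwa [sum_cnt])
  rw [wd_eq_multiDeriv _ (contDiff_mol hη.smooth hη.supp hv.1),
    multiDeriv_mol_eq hη.smooth hη.supp hv]
  exact abs_mol_le hη hb x

theorem DerivBound.lipschitz_wd_mol {C : ℝ} (hC : DerivBound T (m + 1) ψ C) (hη : IsKernel ε η)
    {t : ℝ} (ht : t ∈ Icc 0 T) {β : List (Fin d)} (hβ : β.length ≤ m) (x y : E d) :
    |wd β (mol η (ψ t)) x - wd β (mol η (ψ t)) y| ≤ d * C * ‖x - y‖ := by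
  obtain ⟨v, hv, hb⟩ := hC.2 t ht (cnt β) (by rw [sum_cnt]; omega)
  have hs := contDiff_mol hη.smooth hη.supp hv.1
  refine lipschitz_of_partialDeriv (differentiable_of_smooth (contDiff_wd β hs)) hC.1
    (fun i x => ?_) x y
  have h1 := hC.abs_wd_mol_le hη ht (β := i :: β) (by simpa using hβ) x
  rwa [wd_eq_multiDeriv _ hs, cnt_cons, multiDeriv_add_single _ _ hs, ← wd_eq_multiDeriv _ hs] at h1

theorem DerivBound.abs_wd_mol_sub_le {C ε' : ℝ} {η' : E d → ℝ} (hC : DerivBound T (m + 1) ψ C)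
    (hη : IsKernel ε η) (hη' : IsKernel ε' η') {t : ℝ} (ht : t ∈ Icc 0 T) {β : List (Fin d)}
    (hβ : β.length ≤ m) (x : E d) :
    |wd β (fun x => mol η (ψ t) x - mol η' (ψ t) x) x| ≤ d * C * (ε + ε') := by
  obtain ⟨v, hv, hb⟩ := hC.2 t ht (cnt β) (by rw [sum_cnt]; omega)
  have hs := contDiff_mol hη.smooth hη.supp hv.1
  have hs' := contDiff_mol hη'.smooth hη'.supp hv.1
  have h1 := hC.lipschitz_wd_mol hη ht hβ
  have h2 := hC.lipschitz_wd_mol hη' ht hβ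
  rw [wd_sub β hs hs']
  rw [wd_eq_multiDeriv _ hs, multiDeriv_mol_eq hη.smooth hη.supp hv] at h1 ⊢
  rw [wd_eq_multiDeriv _ hs', multiDeriv_mol_eq hη'.smooth hη'.supp hv] at h2 ⊢
  exact abs_mol_sub_mol_le hη hη' hb (by have := hC.1; positivity) h1 h2 x

/-- Mollifications of a function in `𝔅^{m+1}` converge together with `m` derivatives. -/
theorem MemB.approx (hT : 0 ≤ T) (hψ : MemB T (m + 1) ψ) {ε : ℕ → ℝ} {η : ℕ → E d → ℝ}
    (hη : ∀ i, IsKernel (ε i) (η i)) (hanti : Antitone ε)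
    (hε : Filter.Tendsto ε Filter.atTop (nhds 0))
    (hlim : ∀ v : E d → ℝ, LocallyIntegrable v volume →
      ∀ᵐ x, Filter.Tendsto (fun i => mol (η i) v x) Filter.atTop (nhds (v x))) :
    ∃ C A, 0 ≤ C ∧ 0 ≤ A ∧ (∀ i, NN (eE d) T 0 m C (fun t => mol (η i) (ψ (cl T t)))) ∧
      NN (eE d) T 0 m C (fun t => ψ (cl T t)) ∧
      ∀ i, NN (eE d) T 0 m (A * ε i) (fun t x => mol (η i) (ψ (cl T t)) x - ψ (cl T t) x) := by
  obtain ⟨C, hC⟩ := hψ.exists_derivBound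
  have hs := fun i t => contDiff_mol (hη i).smooth (hη i).supp (hψ.loc (cl_mem hT t))
  have h1 : ∀ i, NN (eE d) T 0 m C (fun t => mol (η i) (ψ (cl T t))) := fun i =>
    NN.of_words (hs i) (fun β _ => hψ.measurable_wd_mol hT (hη i) β) fun β hβ t x =>
      hC.abs_wd_mol_le (hη i) (cl_mem hT t) (by omega) x
  -- The derivative of order `m + 1` is spent on the rate: functions with bounded gradient are
  -- approximated to order `ε i`.
  have h2 : ∀ i k, i ≤ k → NN (eE d) T 0 m (2 * (d * C) * ε i)
      (fun t x => mol (η i) (ψ (cl T t)) x - mol (η k) (ψ (cl T t)) x) := fun i k hik =>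
    NN.of_words (fun t => (hs i t).sub (hs k t)) (fun β _ => by
      simp only [fun t => wd_sub β (hs i t) (hs k t)]
      exact (hψ.measurable_wd_mol hT (hη i) β).sub (hψ.measurable_wd_mol hT (hη k) β))
      fun β hβ t x => by
        refine (hC.abs_wd_mol_sub_le (hη i) (hη k) (cl_mem hT t) hβ x).trans ?_
        have h3 := hanti hik
        have h4 : 0 ≤ (d : ℝ) * C := mul_nonneg (Nat.cast_nonneg _) hC.1
        nlinarith [mul_le_mul_of_nonneg_left h3 h4]
  obtain ⟨G, g1, g2, g3⟩ := NN.limit h1 (by simpa using hε.const_mul (2 * (d * C))) h2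
  -- The uniform limit agrees with `ψ` almost everywhere, hence everywhere, both being continuous in
  -- `x`.
  have hG : G = fun t => ψ (cl T t) := by
    funext t
    refine Continuous.ae_eq_iff_eq volume (g2.nn0.2.1 t) (hψ.continuous _ (cl_mem hT t)) |>.1 ?_
    filter_upwards [hlim _ (hψ.loc (cl_mem hT t))] with x hx
    exact tendsto_nhds_unique (g1 t x) hx
  rw [hG] at g2 g3
  exact ⟨C, 2 * (d * C), hC.1, by have := hC.1; positivity, h1, g2, g3⟩

end Time

end FDScheme

namespace FDScheme

/-! ### Generalized derivatives of limits -/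

section Limit

variable {d : ℕ} {ψ v w w' : E d → ℝ} {α β : Fin d → ℕ}

theorem IsWeakDeriv.congr_right (h : IsWeakDeriv α ψ w) (hw' : LocallyIntegrable w' volume)
    (hww' : w =ᵐ[volume] w') : IsWeakDeriv α ψ w' := by
  refine ⟨h.1, hw', fun φ hφ hs => ?_⟩
  rw [h.2.2 φ hφ hs]
  congr 1
  refine integral_congr_ae (hww'.mono fun x hx => ?_)
  simp only [hx]

theorem IsWeakDeriv.add_single {i : Fin d} (h : IsWeakDeriv β ψ w)
    (h' : IsWeakDeriv (Pi.single i 1) w v) : IsWeakDeriv (β + Pi.single i 1) ψ v := by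
  rw [isWeakDeriv_single_iff] at h'
  refine ⟨h.1, h'.2.1, fun φ hφ hs => ?_⟩
  rw [sum_add_single, ← multiDeriv_partialDeriv β i hφ,
    h.2.2 _ (contDiff_partialDeriv i hφ) (hasCompactSupport_dd hs _), h'.2.2 φ hφ hs]
  ring

/-- Integration by parts for Lipschitz functions. -/
theorem isWeakDeriv_lineDeriv {L : NNReal} (hw : LipschitzWith L w) (i : Fin d) :
    IsWeakDeriv (Pi.single i 1) w (fun x => lineDeriv ℝ w x (EuclideanSpace.single i 1)) := by
  rw [isWeakDeriv_single_iff]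
  refine ⟨hw.continuous.locallyIntegrable, hw.locallyIntegrable_lineDeriv _, fun φ hφ hs => ?_⟩
  obtain ⟨D, hD⟩ := (hφ.of_le (by simp : (1 : WithTop ℕ∞) ≤ ∞)).lipschitzWith_of_hasCompactSupport
    hs one_ne_zero
  rw [hw.integral_lineDeriv_mul_eq hD hs, ← integral_const_mul]
  refine integral_congr_ae (Filter.Eventually.of_forall fun x => ?_)
  beta_reduce
  rw [(differentiable_of_smooth hφ x).lineDeriv_eq_fderiv, map_neg, partialDeriv]
  ring

theorem LipschitzWith.of_abs_le {L : ℝ} (h : ∀ x y, |w x - w y| ≤ L * ‖x - y‖) :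
    LipschitzWith L.toNNReal w :=
  _root_.LipschitzWith.of_dist_le' fun x y => by rw [Real.dist_eq, dist_eq_norm]; exact h x y

theorem SmoothBdd.isWeakDeriv_single {φ : E d → ℝ} (hφ : SmoothBdd φ) (i : Fin d) :
    IsWeakDeriv (Pi.single i 1) φ (partialDeriv i φ) := by
  choose C hC using fun j : Fin d => (hφ.dd (EuclideanSpace.single j 1)).bounded
  have h1 := lipschitz_of_partialDeriv (C := ∑ j, |C j|) (differentiable_of_smooth hφ.1)
    (Finset.sum_nonneg fun _ _ => abs_nonneg _) fun j x => (hC j x).trans ((le_abs_self _).trans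
      (Finset.single_le_sum (f := fun j => |C j|) (fun _ _ => abs_nonneg _) (Finset.mem_univ j)))
  have h2 := isWeakDeriv_lineDeriv (LipschitzWith.of_abs_le h1) i
  simp only [(differentiable_of_smooth hφ.1 _).lineDeriv_eq_fderiv] at h2
  exact h2

theorem SmoothBdd.multiDeriv {φ : E d → ℝ} (hφ : SmoothBdd φ) (α : Fin d → ℕ) :
    SmoothBdd (multiDeriv α φ) ∧ IsWeakDeriv α φ (FDScheme.multiDeriv α φ) := by
  obtain ⟨n, hn⟩ : ∃ n, ∑ i, α i = n := ⟨_, rfl⟩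
  induction n generalizing α with
  | zero =>
    have : α = 0 := by
      rw [← mem_multiIndices, multiIndices_zero, Finset.mem_singleton] at hn
      exact hn
    rw [this, multiDeriv_zero]
    exact ⟨hφ, isWeakDeriv_zero hφ.1.continuous.locallyIntegrable⟩
  | succ n ih =>
    obtain ⟨β, j, rfl, hβ⟩ := exists_eq_add_single hn
    rw [multiDeriv_add_single _ _ hφ.1]
    exact ⟨(ih β hβ).1.dd _, (ih β hβ).2.add_single ((ih β hβ).1.isWeakDeriv_single j)⟩

/-- A sequence of kernels which shrinks to the origin. -/
structure Kernels (ε : ℕ → ℝ) (η : ℕ → E d → ℝ) : Prop where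
  kernel : ∀ i, IsKernel (ε i) (η i)
  anti : Antitone ε
  tendsto : Filter.Tendsto ε Filter.atTop (nhds 0)
  ae_tendsto : ∀ v : E d → ℝ, LocallyIntegrable v volume →
    ∀ᵐ x, Filter.Tendsto (fun i => mol (η i) v x) Filter.atTop (nhds (v x))

variable {ε : ℕ → ℝ} {η : ℕ → E d → ℝ} {A C : ℝ}

/-- Mollifications with a common Lipschitz constant form a Cauchy sequence at every point; the limit
is Lipschitz and equals `w` almost everywhere. -/
theorem Kernels.exists_lipschitz (hK : Kernels ε η) (hw : EB C w) {L : ℝ} (hL : 0 ≤ L)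
    (hl : ∀ i x y, |mol (η i) w x - mol (η i) w y| ≤ L * ‖x - y‖) :
    ∃ w', LipschitzWith L.toNNReal w' ∧ w =ᵐ[volume] w' := by
  have hcau : ∀ x, CauchySeq fun i => mol (η i) w x := by
    intro x
    refine cauchySeq_of_le_tendsto_0' (fun i => L * (2 * ε i)) (fun i k hik => ?_) ?_
    · rw [Real.dist_eq]
      refine (abs_mol_sub_mol_le (hK.kernel i) (hK.kernel k) hw hL (hl i) (hl k) x).trans ?_
      exact mul_le_mul_of_nonneg_left (by linarith [hK.anti hik]) hL
    · simpa using (hK.tendsto.const_mul 2).const_mul L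
  choose w' hw' using fun x => cauchySeq_tendsto_of_complete (hcau x)
  refine ⟨w', LipschitzWith.of_abs_le fun x y => ?_, ?_⟩
  · exact le_of_tendsto' ((hw' x).sub (hw' y)).abs fun i => hl i x y
  · filter_upwards [hK.ae_tendsto w hw.locallyIntegrable] with x hx
    exact tendsto_nhds_unique hx (hw' x)

theorem Kernels.eb_of_mol_le (hK : Kernels ε η) (hw : LocallyIntegrable w volume)
    (h : ∀ i x, |mol (η i) w x| ≤ C) : EB C w := by
  refine ⟨hw.aestronglyMeasurable, ?_⟩
  filter_upwards [hK.ae_tendsto w hw] with x hx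
  exact le_of_tendsto' hx.abs fun i => h i x

/-- Induction on the order. The derivative already found has mollifications with bounded gradients,
so it has a Lipschitz representative, and that function has a further generalized derivative. -/
theorem Kernels.exists_weakDeriv (hK : Kernels ε η) (hv : LocallyIntegrable v volume) {r : ℕ}
    (hC : ∀ α : Fin d → ℕ, ∑ i, α i ≤ r → ∀ i x, |multiDeriv α (mol (η i) v) x| ≤ C)
    (α : Fin d → ℕ) (hα : ∑ i, α i ≤ r) : ∃ w, IsWeakDeriv α v w ∧ EB C w := by
  obtain ⟨n, hn⟩ : ∃ n, ∑ i, α i = n := ⟨_, rfl⟩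
  induction n generalizing α with
  | zero =>
    have h0 : α = 0 := by
      rw [← mem_multiIndices, multiIndices_zero, Finset.mem_singleton] at hn
      exact hn
    subst h0
    refine ⟨v, isWeakDeriv_zero hv, hK.eb_of_mol_le hv fun i x => ?_⟩
    have := hC 0 (by simp) i x
    rwa [multiDeriv_zero] at this
  | succ n ih =>
    obtain ⟨β, j, rfl, hβ⟩ := exists_eq_add_single hn
    obtain ⟨w, hw, hwC⟩ := ih β (by omega) hβ
    have hC0 : 0 ≤ C := (abs_nonneg _).trans (hC β (by omega) 0 0)
    have hmol : ∀ i, multiDeriv β (mol (η i) v) = mol (η i) w := fun i =>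
      multiDeriv_mol_eq (hK.kernel i).smooth (hK.kernel i).supp hw
    have hs := fun i => contDiff_mol (hK.kernel i).smooth (hK.kernel i).supp hv
    obtain ⟨w', hL, hww'⟩ := hK.exists_lipschitz hwC (L := d * C) (by positivity) fun i =>
      lipschitz_of_partialDeriv (differentiable_of_smooth (contDiff_mol (hK.kernel i).smooth
        (hK.kernel i).supp hw.2.1)) hC0 fun k x => by
        rw [← hmol, ← multiDeriv_add_single β k (hs i)]
        exact hC _ (by rw [sum_add_single]; omega) i x
    have hu := (hw.congr_right hL.continuous.locallyIntegrable hww').add_single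
      (isWeakDeriv_lineDeriv hL j)
    refine ⟨_, hu, hK.eb_of_mol_le hu.2.1 fun i x => ?_⟩
    rw [← multiDeriv_mol_eq (hK.kernel i).smooth (hK.kernel i).supp hu]
    exact hC _ hα i x

theorem tendsto_mol {V : ℕ → E d → ℝ} {ζ : E d → ℝ} (hζ : Continuous ζ) (hs : HasCompactSupport ζ)
    (hV : ∀ i, Continuous (V i)) (hA : ∀ i x, |V i x| ≤ A)
    (hlim : ∀ x, Filter.Tendsto (fun i => V i x) Filter.atTop (nhds (v x))) (x : E d) :
    Filter.Tendsto (fun i => mol ζ (V i) x) Filter.atTop (nhds (mol ζ v x)) := by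
  have hi : Integrable (fun y => A * |ζ (x - y)|) (volume : Measure (E d)) :=
    (integrable_reflect hζ hs x).abs.const_mul A
  refine tendsto_integral_of_dominated_convergence _ (fun i => ?_) hi (fun i => ?_) ?_
  · exact ((hV i).mul (hζ.comp (continuous_const.sub continuous_id))).aestronglyMeasurable
  · refine Filter.Eventually.of_forall fun y => ?_
    rw [norm_mul, Real.norm_eq_abs, Real.norm_eq_abs]
    exact mul_le_mul_of_nonneg_right (hA i y) (abs_nonneg _)
  · exact Filter.Eventually.of_forall fun y => (hlim y).mul_const _

/-- Bounds on the derivatives of smooth functions carry over to the generalized derivatives of a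
pointwise limit. -/
theorem weakDeriv_limit {V : ℕ → E d → ℝ} (hV : ∀ i, SmoothBdd (V i)) (hA : ∀ i x, |V i x| ≤ A)
    (hlim : ∀ x, Filter.Tendsto (fun i => V i x) Filter.atTop (nhds (v x))) (hv : Continuous v)
    {r : ℕ} {C : ℕ → ℝ}
    (hC : ∀ j ≤ r, ∀ i x, ∑ α ∈ multiIndices d j, (multiDeriv α (V i) x) ^ 2 ≤ C j) :
    (∀ α : Fin d → ℕ, ∑ i, α i ≤ r → ∃ w, IsWeakDeriv α v w ∧
      ∀ᵐ x, |w x| ≤ Real.sqrt (∑ j ∈ Finset.range (r + 1), |C j|)) ∧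
    ∀ j ≤ r, ∀ᵐ x, derivSq j v x ≤ C j := by
  obtain ⟨ε, η, h1, -, h2, h3, h4⟩ := exists_kernels d
  have hK : Kernels ε η := ⟨h1, h2, h3, h4⟩
  have hvl := hv.locallyIntegrable (μ := (volume : Measure (E d)))
  -- The derivatives are placed on the kernel, where bounded pointwise convergence suffices, and
  -- moved back to the smooth functions, where the bound is available.
  have key : ∀ j ≤ r, ∀ i x, ∑ α ∈ multiIndices d j, (multiDeriv α (mol (η i) v) x) ^ 2 ≤ C j := by
    intro j hj i x
    have hη := hK.kernel i
    have hl : Filter.Tendsto (fun n => ∑ α ∈ multiIndices d j,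
        (mol (multiDeriv α (η i)) (V n) x) ^ 2) Filter.atTop
        (nhds (∑ α ∈ multiIndices d j, (mol (multiDeriv α (η i)) v x) ^ 2)) :=
      tendsto_finsetSum _ fun α _ => (tendsto_mol (contDiff_multiDeriv α hη.smooth).continuous
        (hasCompactSupport_multiDeriv hη.smooth hη.supp) (fun n => (hV n).1.continuous) hA hlim
        x).pow 2
    simp only [multiDeriv_mol hη.smooth hη.supp hvl]
    refine le_of_tendsto' hl fun n => ?_
    simp only [fun α => mol_weakDeriv hη.smooth hη.supp ((hV n).multiDeriv α).2]
    exact sum_mol_sq_le hη _ (fun α => ((hV n).multiDeriv α).2.2.1)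
      (Filter.Eventually.of_forall (hC j hj n)) x
  have hex := hK.exists_weakDeriv (C := Real.sqrt (∑ j ∈ Finset.range (r + 1), |C j|)) hvl
    (r := r) fun α hα i x => by
      refine Real.abs_le_sqrt ?_
      refine (Finset.single_le_sum (f := fun α => (multiDeriv α (mol (η i) v) x) ^ 2)
        (fun _ _ => sq_nonneg _) (mem_multiIndices.2 (rfl : ∑ i, α i = ∑ i, α i))).trans ?_
      refine (key _ hα i x).trans ((le_abs_self _).trans ?_)
      exact Finset.single_le_sum (f := fun j => |C j|) (fun _ _ => abs_nonneg _)
        (Finset.mem_range.2 (Nat.lt_succ_of_le hα))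
  refine ⟨fun α hα => ?_, fun j hj => ?_⟩
  · obtain ⟨w, hw, hb⟩ := hex α hα
    exact ⟨w, hw, hb.bound⟩
  -- The bound on the mollified derivatives tends to a bound on the derivatives at almost every
  -- point, with the same constant.
  · have hae : ∀ᵐ x, ∀ α ∈ multiIndices d j,
        Filter.Tendsto (fun i => mol (η i) (weakDeriv α v) x) Filter.atTop
          (nhds (weakDeriv α v x)) :=
      (Finset.eventually_all _).2 fun α _ => hK.ae_tendsto _ (locallyIntegrable_weakDeriv _ _)
    filter_upwards [hae] with x hx
    refine le_of_tendsto' (tendsto_finsetSum _ fun α hα => (hx α hα).pow 2) fun i => ?_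
    refine le_trans (le_of_eq (Finset.sum_congr rfl fun α hα => ?_)) (key j hj i x)
    obtain ⟨w, hw, -⟩ := hex α ((mem_multiIndices.1 hα).trans_le hj)
    rw [multiDeriv_mol_eq (hK.kernel i).smooth (hK.kernel i).supp (weakDeriv_spec ⟨w, hw⟩)]

end Limit

end FDScheme

namespace FDScheme

/-! ### The norm of `𝔅^m` -/

section Norm

variable {d m : ℕ} {T : ℝ} {ψ : ℝ → E d → ℝ}

theorem normB_nonneg (T : ℝ) (m : ℕ) (ψ : ℝ → E d → ℝ) : 0 ≤ normB T m ψ :=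
  Real.sInf_nonneg fun _ hC => hC.1

theorem normB_le {C : ℝ} (hC : 0 ≤ C) (h : ∀ t ∈ Icc 0 T, ∀ᵐ x,
    ∑ k ∈ Finset.range (m + 1), derivSq k (ψ t) x ≤ C ^ 2) : normB T m ψ ≤ C :=
  csInf_le ⟨0, fun _ hC => hC.1⟩ ⟨hC, h⟩

theorem MemB.exists_derivSq_le (hψ : MemB T m ψ) : ∃ C, 0 ≤ C ∧ ∀ t ∈ Icc 0 T, ∀ᵐ x,
    ∑ k ∈ Finset.range (m + 1), derivSq k (ψ t) x ≤ C ^ 2 := by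
  obtain ⟨C, hC0, hC⟩ := hψ.exists_derivBound
  set X : ℝ := ∑ k ∈ Finset.range (m + 1), ∑ _α ∈ multiIndices d k, C ^ 2 with hX
  have hX0 : 0 ≤ X := Finset.sum_nonneg fun _ _ => Finset.sum_nonneg fun _ _ => sq_nonneg _
  refine ⟨Real.sqrt X, Real.sqrt_nonneg _, fun t ht => ?_⟩
  have h1 : ∀ᵐ x, ∀ k ∈ Finset.range (m + 1), ∀ α ∈ multiIndices d k,
      |weakDeriv α (ψ t) x| ≤ C := by
    refine (Finset.eventually_all _).2 fun k hk => (Finset.eventually_all _).2 fun α hα => ?_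
    obtain ⟨v, hv, hb⟩ := hC t ht α
      ((mem_multiIndices.1 hα).trans_le (Nat.lt_succ_iff.1 (Finset.mem_range.1 hk)))
    filter_upwards [hv.weakDeriv_ae, hb.bound] with x hx hx'
    rwa [hx]
  filter_upwards [h1] with x hx
  rw [Real.sq_sqrt hX0]
  exact Finset.sum_le_sum fun k hk => Finset.sum_le_sum fun α hα =>
    sq_le_sq' (neg_le_of_abs_le (hx k hk α hα)) (le_of_abs_le (hx k hk α hα))

/-- The infimum in the definition of the norm is attained. -/
theorem MemB.derivSq_le_normB (hψ : MemB T m ψ) {t : ℝ} (ht : t ∈ Icc 0 T) : ∀ᵐ x,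
    ∑ k ∈ Finset.range (m + 1), derivSq k (ψ t) x ≤ normB T m ψ ^ 2 := by
  -- Countably many admissible constants approach the infimum, so their null sets can be united.
  have h1 : ∀ i : ℕ, ∀ᵐ x, ∑ k ∈ Finset.range (m + 1), derivSq k (ψ t) x ≤
      (normB T m ψ + 1 / ((i : ℝ) + 1)) ^ 2 := by
    intro i
    obtain ⟨C, hC⟩ := hψ.exists_derivSq_le
    obtain ⟨C', hC', hlt⟩ := exists_lt_of_csInf_lt (s := {C : ℝ | 0 ≤ C ∧ ∀ t ∈ Icc 0 T, ∀ᵐ x,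
      ∑ k ∈ Finset.range (m + 1), derivSq k (ψ t) x ≤ C ^ 2}) ⟨C, hC⟩
      (lt_add_of_pos_right (normB T m ψ) (Nat.one_div_pos_of_nat (n := i)))
    exact (hC'.2 t ht).mono fun x hx => hx.trans (pow_le_pow_left₀ hC'.1 hlt.le 2)
  filter_upwards [ae_all_iff.2 h1] with x hx
  have h2 : Filter.Tendsto (fun i : ℕ => (normB T m ψ + 1 / ((i : ℝ) + 1)) ^ 2) Filter.atTop
      (nhds (normB T m ψ ^ 2)) := by
    simpa using (tendsto_one_div_add_atTop_nhds_zero_nat.const_add (normB T m ψ)).pow 2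
  exact ge_of_tendsto' h2 hx

end Norm

/-! ### Iterated derivatives in one direction and in the mesh size. -/

section Iterate

variable {Z : Type} [NormedAddCommGroup Z] [NormedSpace ℝ Z] [FiniteDimensional ℝ Z]
  [MeasurableSpace Z] [BorelSpace Z] {J : Type} [Fintype J] {e : Module.Basis J ℝ Z} {T : ℝ}
  {F G : ℝ → Z → ℝ}

theorem NN.iterate_dd {n : ℕ} {r C : ℝ} (hF : NN e T r n C F) (j : J) {k : ℕ} (hk : k ≤ n) :
    NN e T r (n - k) C (fun t => (FDScheme.dd (e j))^[k] (F t)) := by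
  induction k generalizing n F with
  | zero => exact hF
  | succ k ih =>
    obtain ⟨n, rfl⟩ : ∃ n', n = n' + 1 := ⟨n - 1, by omega⟩
    rw [Nat.add_sub_add_right]
    exact ih (hF.2.2 j) (by omega)

theorem NN.abs_iterate_dd_sub_le {n : ℕ} {r C C' ε : ℝ} (hF : NN e T r n C F)
    (hG : NN e T r n C' G) (hFG : NN e T r n ε (fun t z => F t z - G t z)) (j : J) {k : ℕ}
    (hk : k ≤ n) (t : ℝ) (z : Z) :
    |(FDScheme.dd (e j))^[k] (F t) z - (FDScheme.dd (e j))^[k] (G t) z| ≤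
      ε * Real.exp (r * cl T t) := by
  induction k generalizing n F G with
  | zero => exact hFG.nn0.2.2 t z
  | succ k ih =>
    obtain ⟨n, rfl⟩ : ∃ n', n = n' + 1 := ⟨n - 1, by omega⟩
    refine ih (hF.2.2 j) (hG.2.2 j) ?_ (by omega)
    have h1 := hFG.2.2 j
    have h2 : (fun t => FDScheme.dd (e j) fun z => F t z - G t z) =
        fun t z => FDScheme.dd (e j) (F t) z - FDScheme.dd (e j) (G t) z :=
      funext fun t => dd_sub (hF.2.1 t) (hG.2.1 t)
    rwa [h2] at h1

end Iterate

theorem iteratedDeriv_slice {d n : ℕ} {T r C : ℝ} {U : ℝ → ℝ × E d → ℝ}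
    (hU : NN (eZ d) T r n C U) {k : ℕ} (hk : k ≤ n) (t s : ℝ) (x : E d) :
    iteratedDeriv k (fun η => U t (η, x)) s = Scheme.hD U k s t x := by
  unfold Scheme.hD
  induction k generalizing n U with
  | zero => simp
  | succ k ih =>
    obtain ⟨n, rfl⟩ : ∃ n', n = n' + 1 := ⟨n - 1, by omega⟩
    have h1 : deriv (fun η => U t (η, x)) = fun η => dd (es d) (U t) (η, x) := by
      funext η
      have h2 : HasDerivAt (fun η : ℝ => (η, x)) (es d) η :=
        (hasDerivAt_id η).prodMk (hasDerivAt_const η x)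
      exact ((hU.2.1 t (η, x)).hasFDerivAt.comp_hasDerivAt η h2).deriv
    rw [iteratedDeriv_succ', h1, Function.iterate_succ_apply]
    have h3 := hU.2.2 (Sum.inl ())
    rw [eZ_inl] at h3
    exact ih h3 (by omega)

/-! ### Approximation by solutions with mollified data. -/

namespace Scheme

variable {d : ℕ} (S : Scheme d)

/-- A solution of the scheme with a variable mesh size, and smooth approximations of it. -/
structure MeshApprox (n : ℕ) (ρ : ℝ → ℝ) (η : ℕ → E d → ℝ) (C : ℝ) (κ : ℕ → ℝ)
    (U : ℝ → ℝ × E d → ℝ) (V : ℕ → ℝ → ℝ × E d → ℝ) : Prop where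
  f_nn : NN (eE d) S.T 0 n C (fun t => S.f (cl S.T t))
  b_nn : ∀ i, NN (eZ d) S.T 0 n C (S.meshCoef ρ (fun l t => S.q l (cl S.T t))
    (fun l t => S.p l (cl S.T t)) (fun t => S.c (cl S.T t)) i)
  comp : ∃ κ, 0 ≤ κ ∧ CompBound (eZ d) S.T n (S.meshMap ρ) κ
  U_nn : NN (eZ d) S.T 0 n C U
  eqn : ∀ t z, U t z = S.meshFree (fun t => S.f (cl S.T t)) S.g t z +
    ∫ s in (0 : ℝ)..cl S.T t, shiftOp (S.meshCoef ρ (fun l t => S.q l (cl S.T t))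
      (fun l t => S.p l (cl S.T t)) (fun t => S.c (cl S.T t))) (S.meshMap ρ) U s z
  V_sol : ∀ i, S.MeshSol ρ (fun l t => mol (η i) (S.q l (cl S.T t)))
    (fun l t => mol (η i) (S.p l (cl S.T t))) (fun t => mol (η i) (S.c (cl S.T t)))
    (fun t => mol (η i) (S.f (cl S.T t))) (mol (η i) S.g) (V i)
  V_nn : ∀ i, NN (eZ d) S.T 0 n C (V i)
  tendsto : Filter.Tendsto κ Filter.atTop (nhds 0)
  diff : ∀ i, NN (eZ d) S.T 0 n (κ i) (fun t z => V i t z - U t z)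

variable {S}

/-- All data are mollified in `x` with the same kernels. They converge at rate `ε i` together with
`n` derivatives, and `solution_stability` transfers the rate to the solutions as functions of mesh
size and point. -/
theorem exists_meshApprox {n : ℕ} {M : Fin (n + 1 + 1) → ℝ} (hD : S.SmoothData (n + 1) M)
    {ρ : ℝ → ℝ} (hρ : ContDiff ℝ ∞ ρ) {h₀ : ℝ} (hc : HasCompactSupport fun s => ρ s - h₀)
    (hpos : ∀ s, 0 < ρ s) {ε : ℕ → ℝ} {η : ℕ → E d → ℝ} (hK : Kernels ε η)
    (hεpos : ∀ i, 0 < ε i) :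
    ∃ C κ U V, S.MeshApprox n ρ η C κ U V := by
  have hT := S.T_pos.le
  choose Cq Aq hCq hAq hq1 hq2 hq3 using fun l =>
    (hD.q l).approx hT hK.kernel hK.anti hK.tendsto hK.ae_tendsto
  choose Cp Ap hCp hAp hp1 hp2 hp3 using fun l =>
    (hD.p l).approx hT hK.kernel hK.anti hK.tendsto hK.ae_tendsto
  obtain ⟨Cc, Ac, hCc, hAc, hc1, hc2, hc3⟩ :=
    hD.c.approx hT hK.kernel hK.anti hK.tendsto hK.ae_tendsto
  obtain ⟨Cf, Af, hCf, hAf, hf1, hf2, hf3⟩ :=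
    hD.f.approx hT hK.kernel hK.anti hK.tendsto hK.ae_tendsto
  obtain ⟨Cg, Ag, hCg, hAg, hg1, hg2, hg3⟩ :=
    hD.g.approx hT hK.kernel hK.anti hK.tendsto hK.ae_tendsto
  set B := ∑ l, Cq l + ∑ l, Cp l + Cc + Cf + Cg with hB
  set A := ∑ l, Aq l + ∑ l, Ap l + Ac + Af + Ag with hA
  have sq := Finset.sum_nonneg fun l (_ : l ∈ Finset.univ) => hCq l
  have sp := Finset.sum_nonneg fun l (_ : l ∈ Finset.univ) => hCp l
  have sq' := Finset.sum_nonneg fun l (_ : l ∈ Finset.univ) => hAq l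
  have sp' := Finset.sum_nonneg fun l (_ : l ∈ Finset.univ) => hAp l
  have bq : ∀ l, Cq l ≤ B := fun l => by
    have := Finset.single_le_sum (fun l _ => hCq l) (Finset.mem_univ l); linarith
  have bp : ∀ l, Cp l ≤ B := fun l => by
    have := Finset.single_le_sum (fun l _ => hCp l) (Finset.mem_univ l); linarith
  have aq : ∀ l, Aq l ≤ A := fun l => by
    have := Finset.single_le_sum (fun l _ => hAq l) (Finset.mem_univ l); linarith
  have ap : ∀ l, Ap l ≤ A := fun l => by
    have := Finset.single_le_sum (fun l _ => hAp l) (Finset.mem_univ l); linarith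
  have bc : Cc ≤ B := by linarith
  have bf : Cf ≤ B := by linarith
  have bg : Cg ≤ B := by linarith
  have ac : Ac ≤ A := by linarith
  have af : Af ≤ A := by linarith
  have ag : Ag ≤ A := by linarith
  have hA0 : 0 ≤ A := by linarith
  have hB0 : 0 ≤ B := by linarith
  have hAε : ∀ i {a : ℝ}, a ≤ A → a * ε i ≤ A * ε i := fun i a ha =>
    mul_le_mul_of_nonneg_right ha (hεpos i).le
  obtain ⟨κ, hκ0, hκ⟩ := S.meshMap_compBound hρ hc n
  obtain ⟨N₁, hN₁, hcoef⟩ := S.exists_meshCoef_bound hρ hc hpos n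
  set e : ℝ := 1 + Real.exp S.T with he
  have he0 : 0 ≤ e := by positivity
  obtain ⟨N₂, hsol⟩ := exists_solution_unweighted hT hκ (N₁ * B)
  obtain ⟨N₃, hstab⟩ := solution_stability hT hκ (N₁ * B) (N₂ * (e * B))
  have hb : ∀ i, NN (eZ d) S.T 0 n (N₁ * B) (S.meshCoef ρ (fun l t => S.q l (cl S.T t))
      (fun l t => S.p l (cl S.T t)) (fun t => S.c (cl S.T t)) i) :=
    hcoef _ _ _ B (fun l => (hq2 l).mono (bq l)) (fun l => (hp2 l).mono (bp l)) (hc2.mono bc)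
  have hH : NN (eZ d) S.T 0 n (e * B) (S.meshFree (fun t => S.f (cl S.T t)) S.g) :=
    S.meshFree_nn (hf2.mono bf) (hg2.mono bg)
  obtain ⟨U, hU, hUe⟩ := hsol _ _ _ hb hH
  choose V hV using fun i => S.exists_meshSol hρ hc hpos (fun l => (hD.q l).sm_mol hT (hK.kernel i))
    (fun l => (hD.p l).sm_mol hT (hK.kernel i)) (hD.c.sm_mol hT (hK.kernel i))
    (hD.f.sm_mol hT (hK.kernel i)) (hD.g.sm_mol hT (hK.kernel i))
  have hb' : ∀ i j, NN (eZ d) S.T 0 n (N₁ * B)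
      (S.meshCoef ρ (fun l t => mol (η i) (S.q l (cl S.T t)))
        (fun l t => mol (η i) (S.p l (cl S.T t))) (fun t => mol (η i) (S.c (cl S.T t))) j) :=
    fun i => hcoef _ _ _ B (fun l => (hq1 l i).mono (bq l)) (fun l => (hp1 l i).mono (bp l))
      ((hc1 i).mono bc)
  have hH' : ∀ i, NN (eZ d) S.T 0 n (e * B)
      (S.meshFree (fun t => mol (η i) (S.f (cl S.T t))) (mol (η i) S.g)) := fun i =>
    S.meshFree_nn ((hf1 i).mono bf) ((hg1 i).mono bg)
  -- The smooth solutions come without bounds uniform in `i`. Uniqueness identifies each with the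
  -- solution of order `n`, whose bound depends only on the common bound of the data.
  have hV' : ∀ i, NN (eZ d) S.T 0 n (N₂ * (e * B)) (V i) := by
    intro i
    obtain ⟨V', hV', hVe'⟩ := hsol _ _ _ (hb' i) (hH' i)
    obtain ⟨C', hC'⟩ := (hV i).U_sm 0
    have : V i = V' := by
      funext t z
      exact solution_unique hT (fun j => (hb' i j).nn0) (S.meshFree_cl _ _) hC'.nn0 hV'.nn0
        (hV i).eqn hVe' t z
    rwa [this]
  have hmax : N₁ * B ≤ N₁ * B + |N₂ * (e * B)| + B := by
    have := abs_nonneg (N₂ * (e * B)); linarith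
  have hmax' : N₂ * (e * B) ≤ N₁ * B + |N₂ * (e * B)| + B := by
    have := le_abs_self (N₂ * (e * B)); have := mul_nonneg hN₁ hB0; linarith
  have hmax'' : Cf ≤ N₁ * B + |N₂ * (e * B)| + B := by
    have := abs_nonneg (N₂ * (e * B)); have := mul_nonneg hN₁ hB0; linarith
  refine ⟨N₁ * B + |N₂ * (e * B)| + B, fun i => N₃ * ((N₁ + e) * (A * ε i)), U, V,
    hf2.mono hmax'', fun i => (hb i).mono hmax, ⟨κ, hκ0, hκ⟩, hU.mono hmax', hUe, hV,
    fun i => (hV' i).mono hmax', ?_, fun i => ?_⟩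
  · simpa using ((hK.tendsto.const_mul A).const_mul (N₁ + e)).const_mul N₃
  · have hAi : 0 ≤ A * ε i := mul_nonneg hA0 (hεpos i).le
    refine hstab _ _ _ _ _ _ _ hb (hb' i) (fun j => ?_) ?_ (S.meshFree_cl _ _)
      (S.meshFree_cl _ _) hU (hV' i) hUe (hV i).eqn
    · rw [meshCoef_sub]
      refine (hcoef _ _ _ (A * ε i) (fun l => (hq3 l i).mono (hAε i (aq l)))
        (fun l => (hp3 l i).mono (hAε i (ap l))) ((hc3 i).mono (hAε i ac)) j).mono ?_
      nlinarith
    · rw [S.meshFree_sub (hf2) (hf1 i)]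
      refine (S.meshFree_nn ((hf3 i).mono (hAε i af)) ((hg3 i).mono (hAε i ag))).mono ?_
      nlinarith

end Scheme

end FDScheme

namespace FDScheme

namespace Scheme

variable {d : ℕ} {S : Scheme d} {τ₀ h : ℝ}

/-! ### Bounded solutions -/

theorem L_eq_shiftOp (q p : S.Λ₁ → ℝ → E d → ℝ) (c : ℝ → E d → ℝ) {t : ℝ}
    (hq : ∀ l, q l t = S.q l t) (hp : ∀ l, p l t = S.p l t) (hc : c t = S.c t) (ρ : ℝ → ℝ) {s : ℝ}
    (hρ : ρ s = h) (U : ℝ → ℝ × E d → ℝ) (x : E d) :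
    S.L h t (fun x => U t (s, x)) x = shiftOp (S.meshCoef ρ q p c) (S.meshMap ρ) U t (s, x) := by
  rw [shiftOp_mesh]
  simp only [Lop, Qop, Pop, L, hq, hp, hc, hρ]

/-- For fixed `h` the operator is a bounded combination of shifts, so the difference of two bounded
solutions is dominated by its own time integral. -/
theorem SmoothData.solution_unique {m : ℕ} {M : Fin (m + 1) → ℝ} (hD : S.SmoothData m M)
    {w w' : ℝ → E d → ℝ} (hw : S.IsBoundedSolution h w) (hw' : S.IsBoundedSolution h w') :
    ∀ t ∈ Icc 0 S.T, ∀ x, w t x = w' t x := by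
  obtain ⟨⟨C, hC⟩, hw⟩ := hw
  obtain ⟨⟨C', hC'⟩, hw'⟩ := hw'
  choose Cq hCq using fun l => (hD.q l).bounded
  choose Cp hCp using fun l => (hD.p l).bounded
  obtain ⟨Cc, hCc⟩ := hD.c.bounded
  -- The shift form of the scheme is reused with the constant mesh function `h` and a dummy first
  -- coordinate.
  have hb : ∀ i : Option S.Λ₁, ∃ A, ∀ t ∈ Icc 0 S.T, ∀ x : E d,
      |S.meshCoef (fun _ => h) S.q S.p S.c i t (0, x)| ≤ A := by
    have h1 : ∀ l, ∀ t ∈ Icc 0 S.T, ∀ x : E d, |h⁻¹ * h⁻¹ * S.q l t x + h⁻¹ * S.p l t x| ≤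
        |h⁻¹ * h⁻¹| * Cq l + |h⁻¹| * Cp l := fun l t ht x => by
      refine (abs_add_le _ _).trans (add_le_add ?_ ?_)
      · rw [abs_mul]; exact mul_le_mul_of_nonneg_left (hCq l t ht x) (abs_nonneg _)
      · rw [abs_mul]; exact mul_le_mul_of_nonneg_left (hCp l t ht x) (abs_nonneg _)
    rintro (_ | l)
    · refine ⟨(∑ l, (|h⁻¹ * h⁻¹| * Cq l + |h⁻¹| * Cp l)) + Cc, fun t ht x => ?_⟩
      refine (abs_sub _ _).trans (add_le_add ?_ (hCc t ht x))
      rw [abs_mul, abs_neg, abs_one, one_mul]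
      exact (Finset.abs_sum_le_sum_abs _ _).trans (Finset.sum_le_sum fun l _ => h1 l t ht x)
    · exact ⟨_, h1 l⟩
  choose A hA using hb
  have hL : ∀ (w : ℝ → E d → ℝ) (s : ℝ) (x : E d), S.L h s (w s) x =
      ∑ i, S.meshCoef (fun _ => h) S.q S.p S.c i s (0, x) *
        w s (S.meshMap (fun _ => h) i (0, x)).2 := fun w s x =>
    L_eq_shiftOp S.q S.p S.c (fun _ => rfl) (fun _ => rfl) rfl (fun _ => h) (s := 0) rfl
      (fun t z => w t z.2) x
  have hz := eq_zero_of_integral_eq (T := S.T) (A := ∑ i, |A i|) (C := C + C')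
    (w := fun t x => w t x - w' t x)
    (b := fun i t x => S.meshCoef (fun _ => h) S.q S.p S.c i t (0, x))
    (σ := fun i x => (S.meshMap (fun _ => h) i (0, x)).2)
    (Finset.sum_nonneg fun _ _ => abs_nonneg _)
    (fun t ht x => (abs_sub _ _).trans (add_le_add (hC t ht x) (hC' t ht x)))
    (fun i t ht x => (hA i t ht x).trans ((le_abs_self _).trans
      (Finset.single_le_sum (f := fun i => |A i|) (fun _ _ => abs_nonneg _) (Finset.mem_univ i))))
    (fun t ht x => by
      rw [(hw t ht x).2, (hw' t ht x).2, add_sub_add_left_eq_sub,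
        ← intervalIntegral.integral_sub (hw t ht x).1 (hw' t ht x).1]
      refine intervalIntegral.integral_congr fun s _ => ?_
      simp only [hL, mul_sub, Finset.sum_sub_distrib]
      ring)
  exact fun t ht x => sub_eq_zero.1 (hz t ht x)

variable {n : ℕ} {ρ : ℝ → ℝ} {ε κ : ℕ → ℝ} {η : ℕ → E d → ℝ} {C s P : ℝ} {U : ℝ → ℝ × E d → ℝ}
  {V : ℕ → ℝ → ℝ × E d → ℝ}

theorem MeshApprox.isBoundedSolution (hA : S.MeshApprox n ρ η C κ U V) (hρ : ρ h = h) :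
    S.IsBoundedSolution h (fun t x => U t (h, x)) := by
  obtain ⟨κ', -, hκ'⟩ := hA.comp
  have h1 := (NN.shiftOp hκ' hA.b_nn hA.U_nn).nn0
  have h2 := hA.f_nn.nn0
  refine ⟨⟨C, fun t _ x => ?_⟩, fun t ht x => ?_⟩
  · simpa using hA.U_nn.nn0.2.2 t (h, x)
  · have hcongr : ∀ r ∈ Icc 0 S.T, S.L h r (fun x => U r (h, x)) x + S.f r x =
        shiftOp (S.meshCoef ρ (fun l t => S.q l (cl S.T t)) (fun l t => S.p l (cl S.T t))
          (fun t => S.c (cl S.T t))) (S.meshMap ρ) U r (h, x) + S.f (cl S.T r) x := by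
      intro r hr
      rw [L_eq_shiftOp (fun l t => S.q l (cl S.T t)) (fun l t => S.p l (cl S.T t))
        (fun t => S.c (cl S.T t)) (fun l => by simp only [cl_of_mem hr])
        (fun l => by simp only [cl_of_mem hr]) (by simp only [cl_of_mem hr]) ρ hρ U x,
        cl_of_mem hr]
    have hsub : uIcc 0 t ⊆ Icc 0 S.T := by
      rw [uIcc_of_le ht.1]; exact Icc_subset_Icc_right ht.2
    have i1 := h1.intervalIntegrable (h, x) 0 t
    have i2 := h2.intervalIntegrable x 0 t
    refine ⟨(i1.add i2).congr fun r hr => (hcongr r (hsub (uIoc_subset_uIcc hr))).symm, ?_⟩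
    rw [intervalIntegral.integral_congr fun r hr => hcongr r (hsub hr),
      intervalIntegral.integral_add i1 i2]
    beta_reduce
    rw [hA.eqn, meshFree, cl_of_mem ht]
    ring

/-- The function `U` is smooth enough in a full neighbourhood of `h`, so the derivative within
`(0,h₀]`, one-sided at `h₀`, coincides with the ordinary one. -/
theorem Dh_eq {u : ℝ → ℝ → E d → ℝ} {T r : ℝ} (hU : NN (eZ d) T r n C U) {k : ℕ} (hk : k ≤ n)
    (hh : h ∈ Ioc 0 S.h₀) {t : ℝ} {x : E d}
    (hu : ∀ᶠ s in nhdsWithin h (Ioc 0 S.h₀), u s t x = U t (s, x)) :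
    S.Dh k u h t x = hD U k h t x := by
  have h1 : ContDiff ℝ k (fun s => U t (s, x)) :=
    ((hU.contDiff t).of_le (by exact_mod_cast hk)).comp (contDiff_id.prodMk contDiff_const)
  rw [← iteratedDeriv_slice hU hk, Dh, Filter.EventuallyEq.iteratedDerivWithin_eq hu
    (hu.self_of_nhdsWithin hh), iteratedDerivWithin_eq_iteratedDeriv (uniqueDiffOn_Ioc _ _)
    h1.contDiffAt hh]

theorem _root_.FDScheme.NN.hD {T : ℝ} (hU : NN (eZ d) T 0 n C U) {k : ℕ} (hk : k ≤ n) (s : ℝ) :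
    NN (eE d) T 0 (n - k) C (hD U k s) := by
  have := hU.iterate_dd (Sum.inl ()) hk
  rw [eZ_inl] at this
  exact this.slice s

/-- Only convergence of the mesh derivative itself is needed, hence only `k ≤ n`. The `r` spatial
derivatives come from the uniform bounds, which recovers the order lost in mollification. -/
theorem MeshApprox.weakDeriv_hD (hA : S.MeshApprox n ρ η C κ U V) (hτ₀ : 0 < τ₀) {k r : ℕ}
    (hk : k ≤ n) {t : ℝ}
    (hP : ∀ i, ∀ j ≤ r, ∀ x, S.W τ₀ s j (hD (V i) k s t) x ≤ P) :
    (∀ α : Fin d → ℕ, ∑ i, α i ≤ r → ∃ w, IsWeakDeriv α (hD U k s t) w ∧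
      ∀ᵐ x, |w x| ≤ Real.sqrt (∑ j ∈ Finset.range (r + 1), |(τ₀⁻¹ ^ 2) ^ j * P|)) ∧
    ∀ j ≤ r, ∀ᵐ x, derivSq j (hD U k s t) x ≤ (τ₀⁻¹ ^ 2) ^ j * P := by
  have hs : ∀ i, SmoothBdd (hD (V i) k s t) := fun i =>
    ((sm_iterate_es (hA.V_sol i).U_sm k).slice s).smoothBdd t
  refine weakDeriv_limit hs (A := C) (fun i x => ?_) (fun x => ?_) ((hA.U_nn.hD hk s).nn0.2.1 t)
    fun j hj i x => ?_
  · simpa using ((hA.V_nn i).hD hk s).nn0.2.2 t x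
  · rw [tendsto_iff_norm_sub_tendsto_zero]
    refine squeeze_zero (fun _ => norm_nonneg _) (fun i => ?_) hA.tendsto
    have := (hA.V_nn i).abs_iterate_dd_sub_le hA.U_nn (hA.diff i) (Sum.inl ()) hk t (s, x)
    rw [eZ_inl] at this
    simpa [hD] using this
  · exact (S.sum_multiDeriv_le_W s hτ₀ j (hs i).1 x).trans
      (mul_le_mul_of_nonneg_left (hP i j hj x) (by positivity))

theorem W_mol_le {m : ℕ} {ψ : ℝ → E d → ℝ} {T t ε : ℝ} {η : E d → ℝ} (hη : IsKernel ε η) (hh : h ≠ 0)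
    (hψ : MemB T m ψ) (ht : t ∈ Icc 0 T) {j : ℕ} (hj : j ≤ m) (x : E d) :
    S.W τ₀ h j (mol η (ψ t)) x ≤
      (τ₀ ^ 2 + S.weightedSize ^ 2) ^ j * (j.factorial * normB T m ψ ^ 2) := by
  have h1 := sum_W_mol_le (S := S) (τ₀ := τ₀) hη hh j (κ := Unit) (ψ := fun _ => ψ t)
    (fun _ => hψ.loc ht) (fun _ α hα => hψ.exists_weak ht (hα.trans_le hj))
    (X := normB T m ψ ^ 2) ((hψ.derivSq_le_normB ht).mono fun x hx => by
      simp only [Finset.univ_unique, Finset.sum_const, Finset.card_singleton, one_smul]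
      exact (Finset.single_le_sum (f := fun k => derivSq k (ψ t) x)
        (fun _ _ => derivSq_nonneg _ _ _) (Finset.mem_range.2 (Nat.lt_succ_of_le hj))).trans hx) x
  simpa only [Finset.univ_unique, Finset.sum_const, Finset.card_singleton, one_smul] using h1

/-- The factor between the norms of the free terms and their `W` seminorms. -/
def freeBound (m : ℕ) (τ₀ b : ℝ) : ℝ :=
  ∑ s ∈ Finset.range (m + 1), (τ₀ ^ 2 + b ^ 2) ^ s * (s.factorial : ℝ)

theorem freeBound_nonneg (m : ℕ) (τ₀ b : ℝ) : 0 ≤ freeBound m τ₀ b :=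
  Finset.sum_nonneg fun s _ => by positivity

theorem W_mol_le_freeBound {m : ℕ} {ψ : ℝ → E d → ℝ} {T t ε X : ℝ} {η : E d → ℝ}
    (hη : IsKernel ε η) (hh : h ≠ 0) (hψ : MemB T m ψ) (hX : normB T m ψ ≤ X) (ht : t ∈ Icc 0 T)
    {j : ℕ} (hj : j ≤ m) (x : E d) :
    S.W τ₀ h j (mol η (ψ t)) x ≤ freeBound m τ₀ S.weightedSize * X ^ 2 := by
  refine (W_mol_le hη hh hψ ht hj x).trans ?_
  rw [← mul_assoc]
  refine mul_le_mul (Finset.single_le_sum (f := fun s : ℕ =>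
    (τ₀ ^ 2 + S.weightedSize ^ 2) ^ s * (s.factorial : ℝ)) (fun s _ => by positivity)
    (Finset.mem_range.2 (Nat.lt_succ_of_le hj)))
    (pow_le_pow_left₀ (normB_nonneg _ _ _) hX 2) (by positivity) (freeBound_nonneg _ _ _)

/-- Near every mesh size there is a smooth family of solutions obeying the estimates. -/
theorem exists_local_family {M : Fin (n + 1 + 1) → ℝ} {δ K c₀ N : ℝ} (hn : 1 ≤ n)
    (hδ1 : δ ≤ 1) (hK : 0 ≤ K) (hc₀ : 0 < c₀) (hτ₀ : 0 < τ₀)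
    (hN : ∀ (ρ : ℝ → ℝ) (q p : S.Λ₁ → ℝ → E d → ℝ) (c f : ℝ → E d → ℝ)
      (g : E d → ℝ) (U : ℝ → ℝ × E d → ℝ) (s D : ℝ), s ≠ 0 →
      (∀ᶠ s' in nhds s, ρ s' = s') → 0 ≤ D → S.MeshSol ρ q p c f g U →
      (∀ t ∈ Icc 0 S.T, S.SmoothCoef τ₀ s (n + 1) δ K c₀ (coefBound (n + 1) M τ₀ S.weightedSize)
        (fun l => q l t) (fun l => p l t) (c t)) →
      (∀ j ≤ n + 1, ∀ t ∈ Icc 0 S.T, ∀ x, S.W τ₀ s j (f t) x ≤ D) →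
      (∀ j ≤ n + 1, ∀ x, S.W τ₀ s j g x ≤ D) →
      ∀ k ≤ n + 1, ∀ j, 3 * k + j ≤ n + 1 → ∀ t ∈ Icc 0 S.T, ∀ x,
        S.W τ₀ s j (hD U k s t) x ≤ N * D)
    (hD : S.SmoothData (n + 1) M) (hchi : S.ChiNonneg) (hcen : S.Centered)
    (hkill : S.Killing c₀) (hI : S.StructI (n + 1) δ τ₀ K) (hII : S.StructII (n + 1) δ τ₀ K)
    {P : ℝ} (hP : P = N * (freeBound (n + 1) τ₀ S.weightedSize *
      (normB S.T (n + 1) S.f + normB S.T (n + 1) (fun _ => S.g)) ^ 2)) (hh : h ∈ Ioc 0 S.h₀) :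
    ∃ C U, NN (eZ d) S.T 0 n C U ∧
      (∀ᶠ s in nhds h, S.IsBoundedSolution s (fun t x => U t (s, x))) ∧
      ∀ k r, 3 * k + r ≤ n + 1 → ∀ t ∈ Icc 0 S.T,
        (∀ α : Fin d → ℕ, ∑ i, α i ≤ r → ∃ w, IsWeakDeriv α (Scheme.hD U k h t) w ∧
          ∀ᵐ x, |w x| ≤ Real.sqrt (∑ j ∈ Finset.range (r + 1), |(τ₀⁻¹ ^ 2) ^ j * P|)) ∧
        ∀ j ≤ r, ∀ᵐ x, derivSq j (Scheme.hD U k h t) x ≤ (τ₀⁻¹ ^ 2) ^ j * P := by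
  obtain ⟨ε, η, h1, hεpos, h2, h3, h4⟩ := exists_kernels d
  have hKer : Kernels ε η := ⟨h1, h2, h3, h4⟩
  -- With `h / 2` as lower threshold `ρ` is the identity on a neighbourhood of `h`, including the
  -- case `h = h₀`.
  obtain ⟨ρ, hρ, hρc, hρpos, hρid⟩ := exists_mesh (half_pos hh.1)
    ((half_lt_self hh.1).trans_le hh.2)
  have hnear : ∀ᶠ s in nhds h, ρ s = s := by
    filter_upwards [Ioo_mem_nhds (half_lt_self hh.1)
      (by linarith [hh.1, hh.2] : h < 2 * S.h₀ - h / 2)] with s hs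
    exact hρid s hs
  obtain ⟨C, κ, U, V, hA⟩ := exists_meshApprox hD hρ hρc hρpos hKer hεpos
  refine ⟨C, U, hA.U_nn, hnear.mono fun s hs => hA.isBoundedSolution hs, fun k r hkr t ht => ?_⟩
  have hf0 := normB_nonneg S.T (n + 1) S.f
  have hg0 := normB_nonneg S.T (n + 1) (fun _ => S.g)
  have hm : 2 ≤ n + 1 := by omega
  have h0 : (0 : ℝ) ∈ Icc 0 S.T := ⟨le_rfl, S.T_pos.le⟩
  refine hA.weakDeriv_hD hτ₀ (by omega) fun i j hj x => ?_
  rw [hP]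
  refine hN ρ _ _ _ _ _ (V i) h _ hh.1.ne' hnear
    (mul_nonneg (freeBound_nonneg _ _ _) (sq_nonneg _)) (hA.V_sol i) (fun t ht => ?_)
    (fun j hj t ht x => ?_) (fun j hj x => ?_) k (by omega) j (by omega) t ht x
  · simp only [cl_of_mem ht]
    exact smoothCoef_mol (h1 i) hm ht hh hδ1 hK hc₀ hD hchi hcen hkill hI hII
  · rw [cl_of_mem ht]
    exact W_mol_le_freeBound (h1 i) hh.1.ne' hD.f (by linarith) ht hj x
  · exact W_mol_le_freeBound (h1 i) hh.1.ne' hD.g (by linarith) h0 hj x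

end Scheme

end FDScheme

end

/-! ### The theorem. -/

theorem theorem17p25p06p07 (m : ℕ) (hm : 2 ≤ m) (δ c₀ τ₀ K : ℝ)
    (hδ : 0 < δ ∧ δ ≤ 1) (hc₀ : 0 < c₀) (hτ₀ : 0 < τ₀) (hK : 1 ≤ K)
    (M : Fin (m + 1) → ℝ) (a b : ℝ) :
    ∃ N : ℝ, ∀ (d : ℕ) (S : FDScheme.Scheme d),
      S.size = a → S.weightedSize = b →
      S.SmoothData m M → S.ChiNonneg → S.Centered → S.Killing c₀ →
      S.StructI m δ τ₀ K → S.StructII m δ τ₀ K →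
      -- for each mesh size the scheme has exactly one bounded solution on `H_T`
      (∀ h ∈ Set.Ioc 0 S.h₀, (∃ w, S.IsBoundedSolution h w) ∧
        ∀ w w', S.IsBoundedSolution h w → S.IsBoundedSolution h w' →
          ∀ t ∈ Set.Icc 0 S.T, ∀ x, w t x = w' t x) ∧
      -- the family of these solutions has the claimed derivatives and bounds
      ∀ u : ℝ → ℝ → FDScheme.E d → ℝ,
        (∀ h ∈ Set.Ioc 0 S.h₀, S.IsBoundedSolution h (u h)) →
        (∀ k r : ℕ, 3 * k + r ≤ m →
          (∀ t ∈ Set.Icc 0 S.T, ∀ x, ContDiffOn ℝ k (fun h => u h t x) (Set.Ioc 0 S.h₀)) ∧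
          ∀ h ∈ Set.Ioc 0 S.h₀,
            FDScheme.MemB S.T r (S.Dh k u h) ∧
            ∀ t ∈ Set.Icc 0 S.T, ∀ᵐ x,
              Real.sqrt (FDScheme.derivSq r (S.Dh k u h t) x) ≤
                N * (FDScheme.normB S.T m S.f + FDScheme.normB S.T m (fun _ => S.g))) ∧
        ∀ h ∈ Set.Ioc 0 S.h₀,
          FDScheme.MemB S.T m (u h) ∧
          FDScheme.normB S.T m (u h) ≤
            N * (FDScheme.normB S.T m S.f + FDScheme.normB S.T m (fun _ => S.g)) := by
  -- Approximation holds with `n = m - 1` derivatives. This suffices for the mesh derivatives,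
  -- because `3k ≤ m` and `m ≥ 2` give `k ≤ n`.
  obtain ⟨n, rfl⟩ : ∃ n, m = n + 1 := ⟨m - 1, by omega⟩
  obtain ⟨N₁, hN₁, hN⟩ := FDScheme.Scheme.hD_bound (B := FDScheme.Scheme.coefBound (n + 1) M τ₀ b)
    (n + 1) (a / τ₀) hδ.1 hδ.2 (zero_le_one.trans hK) hc₀ hτ₀ (n + 1)
  -- The sum of the factors lost in passing from `W_j` to derivatives of order `j`, so that one
  -- constant serves every single order and the full norm.
  set G : ℝ := ∑ j ∈ Finset.range (n + 1 + 1), (τ₀⁻¹ ^ 2) ^ j with hG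
  have hGpos : ∀ j : ℕ, 0 ≤ (τ₀⁻¹ ^ 2) ^ j := fun j => by positivity
  have hG0 : 0 ≤ G := Finset.sum_nonneg fun j _ => hGpos j
  have hA0 : 0 ≤ G * (N₁ * FDScheme.Scheme.freeBound (n + 1) τ₀ b) :=
    mul_nonneg hG0 (mul_nonneg hN₁ (FDScheme.Scheme.freeBound_nonneg _ _ _))
  -- The functionals `W` are quadratic, hence the square root. The constant is fixed before the
  -- dimension and the scheme are introduced.
  refine ⟨Real.sqrt (G * (N₁ * FDScheme.Scheme.freeBound (n + 1) τ₀ b)),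
    fun d S ha hb hD hchi hcen hkill hI hII => ?_⟩
  subst ha hb
  set X : ℝ := FDScheme.normB S.T (n + 1) S.f + FDScheme.normB S.T (n + 1) (fun _ => S.g) with hX
  have hX0 : 0 ≤ X := add_nonneg (FDScheme.normB_nonneg _ _ _) (FDScheme.normB_nonneg _ _ _)
  set P : ℝ := N₁ * (FDScheme.Scheme.freeBound (n + 1) τ₀ S.weightedSize * X ^ 2) with hP
  have hP0 : 0 ≤ P := mul_nonneg hN₁ (mul_nonneg (FDScheme.Scheme.freeBound_nonneg _ _ _)
    (sq_nonneg _))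
  have hGP : (Real.sqrt (G * (N₁ * FDScheme.Scheme.freeBound (n + 1) τ₀ S.weightedSize)) * X) ^ 2 =
      G * P := by
    rw [mul_pow, Real.sq_sqrt hA0, hP]
    ring
  have loc := fun h hh => FDScheme.Scheme.exists_local_family (S := S) (h := h) (P := P)
    (by omega) hδ.2 (zero_le_one.trans hK) hc₀ hτ₀
    (fun ρ q p c f g U s D => hN d S ρ q p c f g U s D rfl) hD hchi hcen hkill hI hII rfl hh
  refine ⟨fun h hh => ⟨?_, fun w w' hw hw' => hD.solution_unique hw hw'⟩, fun u hu => ?_⟩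
  · obtain ⟨C, U, -, hsol, -⟩ := loc h hh
    exact ⟨_, hsol.self_of_nhds⟩
  have core : ∀ k r : ℕ, 3 * k + r ≤ n + 1 →
      (∀ t ∈ Set.Icc 0 S.T, ∀ x, ContDiffOn ℝ k (fun h => u h t x) (Set.Ioc 0 S.h₀)) ∧
      ∀ h ∈ Set.Ioc 0 S.h₀, FDScheme.MemB S.T r (S.Dh k u h) ∧
        ∀ t ∈ Set.Icc 0 S.T, ∀ j ≤ r, ∀ᵐ x,
          FDScheme.derivSq j (S.Dh k u h t) x ≤ (τ₀⁻¹ ^ 2) ^ j * P := by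
    intro k r hkr
    have hk : k ≤ n := by omega
    -- By uniqueness the given family agrees near `h`, within `(0,h₀]`, with the smooth local
    -- family, and differentiability in `h` is a local property.
    have hev : ∀ h, ∀ U : ℝ → ℝ × FDScheme.E d → ℝ,
        (∀ᶠ s in nhds h, S.IsBoundedSolution s (fun t x => U t (s, x))) →
        ∀ t ∈ Set.Icc 0 S.T, ∀ x,
          ∀ᶠ s in nhdsWithin h (Set.Ioc 0 S.h₀), u s t x = U t (s, x) := by
      intro h U hsol t ht x
      filter_upwards [self_mem_nhdsWithin, nhdsWithin_le_nhds hsol] with s hs hs'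
      exact hD.solution_unique (hu s hs) hs' t ht x
    refine ⟨fun t ht x h hh => ?_, fun h hh => ?_⟩
    · obtain ⟨C, U, hU, hsol, -⟩ := loc h hh
      have h1 : ContDiff ℝ k (fun s => U t (s, x)) :=
        ((hU.contDiff t).of_le (by exact_mod_cast hk)).comp (contDiff_id.prodMk contDiff_const)
      have h2 := hev h U hsol t ht x
      exact h1.contDiffAt.contDiffWithinAt.congr_of_eventuallyEq h2 (h2.self_of_nhdsWithin hh)
    · obtain ⟨C, U, hU, hsol, hest⟩ := loc h hh
      have heq : ∀ t ∈ Set.Icc 0 S.T, S.Dh k u h t = FDScheme.Scheme.hD U k h t := fun t ht =>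
        funext fun x => FDScheme.Scheme.Dh_eq hU hk hh (hev h U hsol t ht x)
      have hH := (hU.hD hk h).nn0
      refine ⟨⟨?_, ⟨C, fun t ht x => ?_⟩, fun t ht => ?_, ⟨Real.sqrt
        (∑ j ∈ Finset.range (r + 1), |(τ₀⁻¹ ^ 2) ^ j * P|), fun t ht α hα => ?_⟩⟩,
        fun t ht j hj => ?_⟩
      · have h1 : (fun z : Set.Icc (0 : ℝ) S.T × FDScheme.E d => S.Dh k u h (z.1 : ℝ) z.2) =
            fun z => FDScheme.Scheme.hD U k h (z.1 : ℝ) z.2 :=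
          funext fun z => congrFun (heq _ z.1.2) z.2
        rw [FDScheme.BorelOn, h1]
        exact hH.1.comp
          ((measurable_subtype_coe.comp measurable_fst).prodMk measurable_snd)
      · rw [heq t ht]
        simpa using hH.2.2 t x
      · rw [heq t ht]
        exact hH.2.1 t
      · rw [heq t ht]
        exact (hest k r hkr t ht).1 α hα
      · rw [heq t ht]
        exact (hest k r hkr t ht).2 j hj
  refine ⟨fun k r hkr => ⟨(core k r hkr).1, fun h hh => ⟨((core k r hkr).2 h hh).1,
    fun t ht => ?_⟩⟩, fun h hh => ?_⟩
  · filter_upwards [((core k r hkr).2 h hh).2 t ht r le_rfl] with x hx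
    refine Real.sqrt_le_iff.2 ⟨mul_nonneg (Real.sqrt_nonneg _) hX0, hx.trans ?_⟩
    rw [hGP]
    exact mul_le_mul_of_nonneg_right (Finset.single_le_sum (f := fun j : ℕ => (τ₀⁻¹ ^ 2) ^ j)
      (fun j _ => hGpos j) (Finset.mem_range.2 (by omega))) hP0
  -- The case `k = 0`, `r = m`; the bounds of all orders up to `m` are now summed.
  · have h0 : S.Dh 0 u h = u h := by
      funext t x
      simp [FDScheme.Scheme.Dh]
    obtain ⟨hmem, hest⟩ := (core 0 (n + 1) (by omega)).2 h hh
    rw [h0] at hmem hest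
    refine ⟨hmem, FDScheme.normB_le (mul_nonneg (Real.sqrt_nonneg _) hX0) fun t ht => ?_⟩
    have hall : ∀ᵐ x, ∀ j ∈ Finset.range (n + 1 + 1),
        FDScheme.derivSq j (u h t) x ≤ (τ₀⁻¹ ^ 2) ^ j * P :=
      (Finset.eventually_all _).2 fun j hj =>
        hest t ht j (Nat.lt_succ_iff.1 (Finset.mem_range.1 hj))
    filter_upwards [hall] with x hx
    rw [hGP, hG, Finset.sum_mul]
    exact Finset.sum_le_sum hx
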